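/- Let $\Sigma$ be a compact connected oriented surface with exactly one boundary component, let $*\in\partial\Sigma$, and let $\pi=\pi_1(\Sigma,*)$, where products of loops are read from left to right. Let $\Gamma_1\pi=\pi\supset\Gamma_2\pi\supset\cdots$ be the lower central series of $\pi$. *Definitions.* Let $I\subset\mathbb{Q}\pi$ be the augmentation ideal, $\widehat{\mathbb{Q}\pi}=\varprojlim_m \mathbb{Q}\pi/I^m$ with its filtration $\widehat{I^m}=\ker(\widehat{\mathbb{Q}\pi}\to\mathbb{Q}\pi/I^m)$, let $\widehat\pi\subset\widehat{\mathbb{Q}\pi}$ be the group of group-like elements (the Malcev completion), and $\widehat\pi_m=\widehat\pi\cap(1+\widehat{I^m})$. The inclusion $\pi\to\widehat\pi$ induces an (injective) homomorphism $\pi/\Gamma_m\pi\to\widehat\pi/\widehat\pi_m$. For a free loop $\alpha$ in $\mathrm{Int}(\Sigma)$ and a based loop $\beta$ in general position, put $$\sigma(\alpha)(\beta)=\sum_{p\in\alpha\cap\beta}\varepsilon_p\,\beta_{*p}\,\alpha_p\,\beta_{p*}\in\mathbb{Q}\pi ,$$ where $\varepsilon_p\in\{\pm1\}$ is the sign of the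 intersection of $\beta$ and $\alpha$ (in this order) at $p$, $\alpha_p$ is $\alpha$ based at $p$, and $\beta_{*p}$, $\beta_{p*}$ are the subpaths of $\beta$ from $*$ to $p$ and from $p$ to $*$; $\sigma(\alpha)(\beta)$ depends only on the homotopy classes, and $\sigma$ is extended linearly in both arguments. For a closed curve $\gamma$ in $\mathrm{Int}(\Sigma)$, oriented arbitrarily, and $L(x)=\frac12(\log x)^2=\sum_m a_m(x-1)^m$, let $\sigma(L(\gamma))$ be the continuous endomorphism $\sum_m a_m\,\sigma((\gamma-1)^m)$ of $\widehat{\mathbb{Q}\pi}$, where $(\gamma-1)^m$ is expanded as a combination of the powers $\gamma^j$. The generalized Dehn twist along $\gamma$ is $t_\gamma=\exp(\sigma(L(\gamma)))$. The curve $\gamma$ is of nilpotency class $\ge k$ if its class in $\pi$, for some choice of an arc joining it to $*$, lies in $\Gamma_k\pi$. **Proposition.** Let $k\ge1$ and let $\gamma\subset\mathrm{Int}(\Sigma)$ be an oriented closed curve of nilpotency class $\ge k$. Then $t_\gamma$ is a well-defined algebra automorphism of $\widehat{\mathbb{Q}\pi}$ (the series defining it converge), it restricts to an automorphism of $\widehat\pi$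 and induces an automorphism of $\widehat\pi/\widehat\pi_{2k}$, and the latter restricts to an automorphism of $\pi/\Gamma_{2k}\pi$, again denoted by $t_\gamma$. Let $\ell\colon[0,1]\to\Sigma$ be any based loop which intersects $\gamma$ in general position (finitely many intersections, all transverse), and let $p_1,\dots,p_n$ be the intersections, ordered such that their parameters on $\ell$ satisfy $\ell^{-1}(p_1)<\cdots<\ell^{-1}(p_n)$. Let $\varepsilon_i\in\{\pm1\}$ be the sign of the intersection of $\ell$ and $\gamma$ (in this order) at $p_i$. Then $t_\gamma$ maps the class $\{\ell\}$ of $\ell$ in $\pi/\Gamma_{2k}\pi$ to $$t_\gamma(\{\ell\})=\ell_{*p_1}(\gamma_{p_1})^{\varepsilon_1}\ell_{p_1p_2}(\gamma_{p_2})^{\varepsilon_2}\cdots\ell_{p_{n-1}p_n}(\gamma_{p_n})^{\varepsilon_n}\ell_{p_n*}\in\frac{\pi}{\Gamma_{2k}\pi},$$ where $\ell_{p_ip_{i+1}}$ is the subpath of $\ell$ from $p_i$ to $p_{i+1}$. -/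

import Mathlib

open scoped Manifold ContDiff unitInterval

noncomputable section

namespace GenDehn

/-! ### The completed group algebra and the Malcev completion of a group -/

section Algebra

variable (G : Type*) [Group G]

/-- The augmentation `ℚ[G] → ℚ`, sending every group element to `1`. -/
def augmentation : MonoidAlgebra ℚ G →ₐ[ℚ] ℚ := MonoidAlgebra.lift ℚ ℚ G 1

/-- The augmentation ideal `I` of the group algebra `ℚ[G]`. -/
abbrev augIdeal : Ideal (MonoidAlgebra ℚ G) := RingHom.ker (augmentation G)

/-- The quotient algebra `ℚ[G] / I ^ m`. -/
abbrev QuotPow (m : ℕ) : Type _ := MonoidAlgebra ℚ G ⧸ (augIdeal G ^ m)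

/-- The transition map `ℚ[G] / I ^ n → ℚ[G] / I ^ m` for `m ≤ n`. -/
def transition {m n : ℕ} (h : m ≤ n) : QuotPow G n →ₐ[ℚ] QuotPow G m :=
  Ideal.Quotient.factorₐ ℚ (Ideal.pow_le_pow_right h)

/-- The `I`-adic completion of `ℚ[G]`: the projective limit of the algebras `ℚ[G] / I ^ m`. -/
def completion : Subalgebra ℚ (∀ m : ℕ, QuotPow G m) where
  carrier := {x | ∀ (m n : ℕ) (h : m ≤ n), transition G h (x n) = x m}
  mul_mem' := by
    intro a b ha hb m n h
    simp only [Pi.mul_apply, map_mul, ha m n h, hb m n h]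
  add_mem' := by
    intro a b ha hb m n h
    simp only [Pi.add_apply, map_add, ha m n h, hb m n h]
  algebraMap_mem' := by
    intro r m n h
    simp only [Pi.algebraMap_apply, AlgHom.commutes]

/-- The completed group algebra, as a type. -/
abbrev CompletedAlgebra : Type _ := completion G

variable {G}

/-- The projection of the completed group algebra to `ℚ[G] / I ^ m`. -/
def level (m : ℕ) : CompletedAlgebra G →ₐ[ℚ] QuotPow G m :=
  (Pi.evalAlgHom ℚ (QuotPow G) m).comp (completion G).val

/-- The filtration of the completed group algebra induced by the powers of `I`: its `m`-th term
is the kernel of the projection to `ℚ[G] / I ^ m`. -/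
def filtration (m : ℕ) : Ideal (CompletedAlgebra G) := RingHom.ker (level (G := G) m)

/-- The canonical map from the group algebra to its completion. -/
def toCompletion : MonoidAlgebra ℚ G →ₐ[ℚ] CompletedAlgebra G :=
  (AlgHom.pi fun m => Ideal.Quotient.mkₐ ℚ (augIdeal G ^ m)).codRestrict
    (completion G) (fun _ _ _ _ => rfl)

/-- Convergence of a sequence in the completed group algebra, for the topology defined by
the filtration. -/
def ConvergesTo (u : ℕ → CompletedAlgebra G) (v : CompletedAlgebra G) : Prop :=
  ∀ m : ℕ, ∃ N₀ : ℕ, ∀ N ≥ N₀, u N - v ∈ filtration (G := G) m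

theorem augIdeal_pow_le_comap {H : Type*} [Group H] (f : G →* H) (m : ℕ) :
    augIdeal G ^ m ≤
      (augIdeal H ^ m).comap (MonoidAlgebra.mapDomainAlgHom ℚ ℚ f).toRingHom := by
  have h1 : ∀ x, augmentation H (MonoidAlgebra.mapDomainAlgHom ℚ ℚ f x) = augmentation G x := by
    intro x
    have : (augmentation H).comp (MonoidAlgebra.mapDomainAlgHom ℚ ℚ f) = augmentation G := by
      ext g
      simp [augmentation]
    exact DFunLike.congr_fun this x
  induction m with
  | zero =>
    intro x _
    rw [Ideal.mem_comap, Submodule.pow_zero, Ideal.one_eq_top]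
    exact Submodule.mem_top
  | succ m ih =>
    rw [Submodule.pow_succ, Ideal.mul_le]
    intro a ha b hb
    rw [Ideal.mem_comap, map_mul, Submodule.pow_succ]
    refine Ideal.mul_mem_mul (ih ha) ?_
    rw [RingHom.mem_ker] at hb ⊢
    exact (h1 b).trans hb

/-- The map `ℚ[G] / I ^ m → ℚ[H] / I ^ m` induced by a group homomorphism `G → H`. -/
def levelMap {H : Type*} [Group H] (f : G →* H) (m : ℕ) : QuotPow G m →ₐ[ℚ] QuotPow H m :=
  Ideal.Quotient.liftₐ (augIdeal G ^ m)
    ((Ideal.Quotient.mkₐ ℚ (augIdeal H ^ m)).comp (MonoidAlgebra.mapDomainAlgHom ℚ ℚ f))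
    (fun _ ha => Ideal.Quotient.eq_zero_iff_mem.2 (augIdeal_pow_le_comap f m ha))

/-- The algebra map between completed group algebras induced by a group homomorphism. -/
def completionMap {H : Type*} [Group H] (f : G →* H) :
    CompletedAlgebra G →ₐ[ℚ] CompletedAlgebra H :=
  (AlgHom.pi fun m => (levelMap f m).comp (level m)).codRestrict (completion H) (by
    intro x m n h
    change transition H h (levelMap f n (x.1 n)) = levelMap f m (x.1 m)
    rw [← x.2 m n h]
    obtain ⟨y, hy⟩ := Ideal.Quotient.mk_surjective (x.1 n)
    rw [← hy]
    rfl)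

/-- The coproduct `x ↦ Δ(x)` of the completed group algebra. The algebra `ℚ[G] ⊗ ℚ[G]` is
identified with `ℚ[G × G]` through `g ⊗ h ↦ (g, h)`; its filtration by the ideals
`∑ I ^ i ⊗ I ^ j` (`i + j = m`) is then the filtration by the powers of the augmentation ideal
of `ℚ[G × G]`, so that the completed tensor square is the completed group algebra of `G × G`.
The coproduct is induced by the diagonal `g ↦ (g, g)`. -/
def comul : CompletedAlgebra G →ₐ[ℚ] CompletedAlgebra (G × G) :=
  completionMap ((MonoidHom.id G).prod (MonoidHom.id G))

/-- The completed tensor product `x ⊗ y = (x ⊗ 1) (1 ⊗ y)` of two elements of the completed group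
algebra (for the same identification as in `comul`). -/
def tmul (x y : CompletedAlgebra G) : CompletedAlgebra (G × G) :=
  completionMap (MonoidHom.inl G G) x * completionMap (MonoidHom.inr G G) y

/-- The nonzero elements `x` with `Δ(x) = x ⊗ x`. -/
def IsGroupLike (x : CompletedAlgebra G) : Prop := x ≠ 0 ∧ comul x = tmul x x

theorem completion_ext {x y : CompletedAlgebra G} (h : ∀ m, level m x = level m y) : x = y :=
  Subtype.ext (funext h)

theorem level_completionMap {H : Type*} [Group H] (f : G →* H) (x : CompletedAlgebra G) (m : ℕ) :
    level m (completionMap f x) = levelMap f m (level m x) := rfl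

theorem commute_inl_inr (x y : CompletedAlgebra G) :
    completionMap (MonoidHom.inl G G) x * completionMap (MonoidHom.inr G G) y =
      completionMap (MonoidHom.inr G G) y * completionMap (MonoidHom.inl G G) x := by
  refine completion_ext fun m => ?_
  rw [map_mul, map_mul, level_completionMap, level_completionMap]
  obtain ⟨a, ha⟩ := Ideal.Quotient.mk_surjective (level m x)
  obtain ⟨b, hb⟩ := Ideal.Quotient.mk_surjective (level m y)
  rw [← ha, ← hb]
  change Ideal.Quotient.mk _ (MonoidAlgebra.mapDomainAlgHom ℚ ℚ (MonoidHom.inl G G) a) *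
      Ideal.Quotient.mk _ (MonoidAlgebra.mapDomainAlgHom ℚ ℚ (MonoidHom.inr G G) b) =
    Ideal.Quotient.mk _ (MonoidAlgebra.mapDomainAlgHom ℚ ℚ (MonoidHom.inr G G) b) *
      Ideal.Quotient.mk _ (MonoidAlgebra.mapDomainAlgHom ℚ ℚ (MonoidHom.inl G G) a)
  rw [← map_mul, ← map_mul]
  congr 1
  clear ha hb
  induction a using MonoidAlgebra.induction_linear with
  | zero => simp
  | add p q hp hq => rw [map_add, add_mul, mul_add, hp, hq]
  | single g r =>
    induction b using MonoidAlgebra.induction_linear with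
    | zero => simp
    | add p q hp hq => rw [map_add, add_mul, mul_add, hp, hq]
    | single h s => simp [MonoidAlgebra.single_mul_single, mul_comm]

theorem tmul_mul (x y x' y' : CompletedAlgebra G) :
    tmul x y * tmul x' y' = tmul (x * x') (y * y') := by
  simp only [tmul, map_mul]
  rw [mul_assoc, ← mul_assoc (completionMap (MonoidHom.inr G G) y),
    ← commute_inl_inr x' y, mul_assoc, mul_assoc]

instance : Nontrivial (CompletedAlgebra G) := by
  have h1 : (1 : MonoidAlgebra ℚ G) ∉ augIdeal G ^ 1 := by
    rw [Submodule.pow_one, RingHom.mem_ker, map_one]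
    exact one_ne_zero
  refine ⟨⟨1, 0, fun h => h1 ?_⟩⟩
  have h2 := congrArg (level (G := G) 1) h
  rw [map_one, map_zero] at h2
  exact Ideal.Quotient.eq_zero_iff_mem.1 h2

variable (G) in
/-- The Malcev completion of `G`: the group of group-like elements of the completed group algebra.
(A group-like element has augmentation `1`, hence is invertible.) -/
def Malcev : Subgroup (CompletedAlgebra G)ˣ where
  carrier := {u | IsGroupLike (u : CompletedAlgebra G)}
  mul_mem' := by
    rintro a b ⟨-, ha⟩ ⟨-, hb⟩
    refine ⟨Units.ne_zero _, ?_⟩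
    rw [Units.val_mul, map_mul, ha, hb, tmul_mul]
  one_mem' := ⟨Units.ne_zero _, by simp [tmul]⟩
  inv_mem' := by
    rintro a ⟨-, ha⟩
    refine ⟨Units.ne_zero _, ?_⟩
    have h1 : comul (a : CompletedAlgebra G) * comul ((a⁻¹ : (CompletedAlgebra G)ˣ) : _) = 1 := by
      rw [← map_mul, Units.mul_inv, map_one]
    have h2 : tmul ((a⁻¹ : (CompletedAlgebra G)ˣ) : CompletedAlgebra G) ((a⁻¹ : (CompletedAlgebra G)ˣ) : _)
        * comul (a : CompletedAlgebra G) = 1 := by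
      rw [ha, tmul_mul, Units.inv_mul]
      simp [tmul]
    exact (left_inv_eq_right_inv h2 h1).symm

variable (G) in
/-- The `m`-th term of the filtration of the Malcev completion: the elements that are congruent
to `1` modulo the `m`-th term of the filtration of the completed group algebra. -/
def malcevFiltration (m : ℕ) : Subgroup (Malcev G) :=
  ((Units.map (level (G := G) m : CompletedAlgebra G →* QuotPow G m)).comp
    (Malcev G).subtype).ker

theorem mem_malcevFiltration {m : ℕ} {u : Malcev G} :
    u ∈ malcevFiltration G m ↔
      ((u : (CompletedAlgebra G)ˣ) : CompletedAlgebra G) - 1 ∈ filtration (G := G) m := by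
  rw [malcevFiltration, MonoidHom.mem_ker, Units.ext_iff, filtration, RingHom.mem_ker,
    map_sub (level (G := G) m), map_one (level (G := G) m), sub_eq_zero]
  rfl

instance (m : ℕ) : (malcevFiltration G m).Normal := by
  unfold malcevFiltration
  infer_instance

variable (G) in
/-- The canonical homomorphism from `G` to its Malcev completion. -/
def toMalcev : G →* Malcev G :=
  (MonoidHom.toHomUnits
    ((toCompletion (G := G) : MonoidAlgebra ℚ G →* CompletedAlgebra G).comp
      (MonoidAlgebra.of ℚ G))).codRestrict (Malcev G) (by
    intro g
    refine ⟨Units.ne_zero _, ?_⟩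
    refine completion_ext fun m => ?_
    change Ideal.Quotient.mk (augIdeal (G × G) ^ m) (MonoidAlgebra.mapDomainAlgHom ℚ ℚ
        ((MonoidHom.id G).prod (MonoidHom.id G)) (MonoidAlgebra.single g 1)) =
      Ideal.Quotient.mk (augIdeal (G × G) ^ m) (MonoidAlgebra.mapDomainAlgHom ℚ ℚ
        (MonoidHom.inl G G) (MonoidAlgebra.single g 1)) *
      Ideal.Quotient.mk (augIdeal (G × G) ^ m) (MonoidAlgebra.mapDomainAlgHom ℚ ℚ
        (MonoidHom.inr G G) (MonoidAlgebra.single g 1))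
    rw [← map_mul]
    congr 1
    simp [MonoidAlgebra.single_mul_single])

variable (G) in
/-- The term `Γ_m` of the lower central series of `G`, with `Γ_1 = G` and
`Γ_{m+1} = [Γ_m, G]` (and `Γ_0 = G`). -/
def Gam (m : ℕ) : Subgroup G := (⊤ : Subgroup G).lowerCentralSeries (m - 1)

instance (m : ℕ) : (Gam G m).Normal := by
  unfold Gam
  infer_instance

theorem toMalcev_mem_malcevFiltration (m : ℕ) (g : G) :
    toMalcev G g ∈ malcevFiltration G m ↔ MonoidAlgebra.of ℚ G g - 1 ∈ augIdeal G ^ m := by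
  rw [mem_malcevFiltration, ← Ideal.Quotient.eq_zero_iff_mem, filtration, RingHom.mem_ker]
  rfl

open scoped commutatorElement in
theorem Gam_le (m : ℕ) : Gam G m ≤ (malcevFiltration G m).comap (toMalcev G) := by
  have hone : ∀ b : G, MonoidAlgebra.of ℚ G b - 1 ∈ augIdeal G := by
    intro b
    rw [RingHom.mem_ker, map_sub, map_one]
    simp [augmentation]
  rcases m with _ | m
  · intro g _
    rw [Subgroup.mem_comap, toMalcev_mem_malcevFiltration, Submodule.pow_zero, Ideal.one_eq_top]
    exact Submodule.mem_top
  change (⊤ : Subgroup G).lowerCentralSeries m ≤ _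
  induction m with
  | zero =>
    intro a _
    rw [Subgroup.mem_comap, toMalcev_mem_malcevFiltration, zero_add, Submodule.pow_one]
    exact hone a
  | succ n ih =>
    rw [Subgroup.lowerCentralSeries_succ, Subgroup.commutator_le]
    intro a ha b _
    have ha1 := (toMalcev_mem_malcevFiltration _ a).1 (ih ha)
    have hb1 := hone b
    rw [Subgroup.mem_comap, toMalcev_mem_malcevFiltration]
    have e1 : (1 : MonoidAlgebra ℚ G) =
        MonoidAlgebra.of ℚ G b * MonoidAlgebra.of ℚ G a * MonoidAlgebra.of ℚ G (a⁻¹ * b⁻¹) := by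
      rw [← map_mul, ← map_mul, ← map_one (MonoidAlgebra.of ℚ G)]
      congr 1
      group
    have e2 : MonoidAlgebra.of ℚ G ⁅a, b⁆ =
        MonoidAlgebra.of ℚ G a * MonoidAlgebra.of ℚ G b * MonoidAlgebra.of ℚ G (a⁻¹ * b⁻¹) := by
      rw [← map_mul, ← map_mul]
      congr 1
      rw [commutatorElement_def]
      group
    have e : MonoidAlgebra.of ℚ G ⁅a, b⁆ - 1 =
        ((MonoidAlgebra.of ℚ G a - 1) * (MonoidAlgebra.of ℚ G b - 1) -
          (MonoidAlgebra.of ℚ G b - 1) * (MonoidAlgebra.of ℚ G a - 1)) *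
          MonoidAlgebra.of ℚ G (a⁻¹ * b⁻¹) := by
      rw [e2]
      nth_rewrite 1 [e1]
      rw [← sub_mul]
      congr 1
      noncomm_ring
    rw [e]
    refine Ideal.mul_mem_right _ _ (Ideal.sub_mem _ ?_ ?_)
    · rw [Submodule.pow_succ]
      exact Ideal.mul_mem_mul ha1 hb1
    · rw [Ideal.IsTwoSided.pow_succ]
      exact Ideal.mul_mem_mul hb1 ha1

variable (G) in
/-- The homomorphism from `G / Γ_m` to the quotient of the Malcev completion by the `m`-th term of
its filtration, induced by the canonical map from `G` to its Malcev completion. -/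
def nilpotentToMalcev (m : ℕ) : G ⧸ Gam G m →* Malcev G ⧸ malcevFiltration G m :=
  QuotientGroup.map (Gam G m) (malcevFiltration G m) (toMalcev G) (Gam_le m)

/-- The automorphism `T` of the completed group algebra restricts to an automorphism of the Malcev
completion, which passes to an automorphism of the `m`-th quotient of the Malcev completion, and
the latter restricts along `G / Γ_m → Malcev G / (Malcev G)_m` to the automorphism `τ`. -/
def ActsOnNilpotentQuotient (T : CompletedAlgebra G ≃ₐ[ℚ] CompletedAlgebra G) (m : ℕ)
    (τ : MulAut (G ⧸ Gam G m)) : Prop :=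
  ∃ T₁ : MulAut (Malcev G),
    (∀ u : Malcev G, (((T₁ u : Malcev G) : (CompletedAlgebra G)ˣ) : CompletedAlgebra G) =
      T ((u : (CompletedAlgebra G)ˣ) : CompletedAlgebra G)) ∧
    ∃ T₂ : MulAut (Malcev G ⧸ malcevFiltration G m),
      (∀ u : Malcev G, T₂ (QuotientGroup.mk u) = QuotientGroup.mk (T₁ u)) ∧
      ∀ x : G ⧸ Gam G m, nilpotentToMalcev G m (τ x) = T₂ (nilpotentToMalcev G m x)

end Algebra

/-- The power series `log x = ∑ (-1)^(n-1) / n * (x - 1)^n`, in the variable `x - 1`. -/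
def logSeries : PowerSeries ℚ :=
  PowerSeries.mk fun n => if n = 0 then 0 else (-1 : ℚ) ^ (n - 1) / n

/-- The power series `L(x) = (1/2) (log x)^2`, in the variable `x - 1`. -/
def halfLogSq : PowerSeries ℚ := (1 / 2 : ℚ) • logSeries ^ 2

/-! ### Curves on an oriented surface -/

section Surface

variable {M : Type*} [TopologicalSpace M]

/-- The fundamental group, with the convention that a product of (classes of) loops is their
concatenation read from left to right. (Mathlib multiplies in the opposite order.) -/
abbrev LoopGroup (x₀ : M) : Type _ := (FundamentalGroup M x₀)ᵐᵒᵖ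

/-- The element of the fundamental group given by a homotopy class of loops. -/
def loopClass {x₀ : M} (p : Path.Homotopic.Quotient x₀ x₀) : LoopGroup x₀ :=
  MulOpposite.op (FundamentalGroup.fromPath p)

/-- The closed curve `γ`, viewed as a loop based at the point `γ s`. -/
def basedAt (γ : C(UnitAddCircle, M)) (s : UnitAddCircle) : Path (γ s) (γ s) where
  toFun u := γ (s + ((u : ℝ) : UnitAddCircle))
  continuous_toFun := by
    refine γ.continuous.comp (continuous_const.add ?_)
    exact (AddCircle.continuous_mk' (1 : ℝ)).comp continuous_subtype_val
  source' := by simp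
  target' := by
    have : ((1 : ℝ) : UnitAddCircle) = 0 := AddCircle.coe_period 1
    simp [this]

/-- The `m`-th power of the free loop `γ`, which runs `m` times along `γ`. -/
def curvePow (γ : C(UnitAddCircle, M)) (m : ℕ) : C(UnitAddCircle, M) :=
  ⟨fun s => γ (m • s), γ.continuous.comp (continuous_nsmul m)⟩

/-- The closed curve `γ` is of nilpotency class `≥ k`: once connected to the basepoint
by an arc, its homotopy class lies in `Γ_k` of the fundamental group. -/
def NilpotencyClassGE (x₀ : M) (γ : C(UnitAddCircle, M)) (k : ℕ) : Prop :=
  ∃ c : Path x₀ (γ 0),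
    loopClass (Path.Homotopic.Quotient.mk ((c.trans (basedAt γ 0)).trans c.symm)) ∈
      Gam (LoopGroup x₀) k

/-- An intersection of the based loop `ℓ` and the closed curve `γ`, given by its parameters on
both curves. -/
structure Crossing {x₀ : M} (ℓ : Path x₀ x₀) (γ : C(UnitAddCircle, M)) where
  /-- the parameter of the intersection on the based loop -/
  time : I
  /-- the parameter of the intersection on the closed curve -/
  param : UnitAddCircle
  /-- both parameters give the same point -/
  eq : γ param = ℓ time

namespace Crossing

variable {x₀ : M} {ℓ : Path x₀ x₀} {γ : C(UnitAddCircle, M)}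

/-- The closed curve `γ` based at the intersection point. -/
def loop (c : Crossing ℓ γ) : Path (ℓ c.time) (ℓ c.time) :=
  (basedAt γ c.param).cast c.eq.symm c.eq.symm

/-- The class of the loop obtained from `ℓ` by inserting a copy of `γ` at the intersection point:
`ℓ` from the basepoint to the point, then `γ`, then `ℓ` from the point to the basepoint. -/
def insertOnce (c : Crossing ℓ γ) : LoopGroup x₀ :=
  loopClass
    ((((Path.Homotopic.Quotient.mk (ℓ.subpath 0 c.time)).trans
      (Path.Homotopic.Quotient.mk c.loop)).trans
        (Path.Homotopic.Quotient.mk (ℓ.subpath c.time 1))).cast ℓ.source.symm ℓ.target.symm)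

variable [ChartedSpace (EuclideanHalfSpace 2) M]

/-- The based loop near the intersection, read in the chart at the intersection point. -/
def loopInChart (c : Crossing ℓ γ) (t : ℝ) : EuclideanSpace ℝ (Fin 2) :=
  extChartAt (𝓡∂ 2) (ℓ c.time) (ℓ.extend t)

/-- The closed curve near the intersection, read in the chart at the intersection point. -/
def curveInChart (c : Crossing ℓ γ) (s : ℝ) : EuclideanSpace ℝ (Fin 2) :=
  extChartAt (𝓡∂ 2) (ℓ c.time) (γ (c.param + (s : UnitAddCircle)))

/-- The determinant of the pair (velocity of `ℓ`, velocity of `γ`) at the intersection, read in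
the chart at the intersection point. -/
def det (c : Crossing ℓ γ) : ℝ :=
  deriv c.loopInChart (c.time : ℝ) 0 * deriv c.curveInChart 0 1 -
    deriv c.loopInChart (c.time : ℝ) 1 * deriv c.curveInChart 0 0

/-- The two curves intersect transversally: both have a velocity vector, and these are linearly
independent. -/
def Transverse (c : Crossing ℓ γ) : Prop :=
  DifferentiableAt ℝ c.loopInChart (c.time : ℝ) ∧ DifferentiableAt ℝ c.curveInChart 0 ∧ c.det ≠ 0

/-- The sign of the intersection of `ℓ` and `γ` (in this order): `1` if (velocity of `ℓ`,
velocity of `γ`) is a positive frame, `-1` if it is a negative frame. -/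
def sign (c : Crossing ℓ γ) : SignType := SignType.sign c.det

/-- The class of `γ ^ ε`, based at the intersection point, where `ε = ±1` is the sign of the
intersection. -/
def signedLoop (c : Crossing ℓ γ) : Path.Homotopic.Quotient (ℓ c.time) (ℓ c.time) :=
  if c.sign = 1 then Path.Homotopic.Quotient.mk c.loop
  else Path.Homotopic.Quotient.mk c.loop.symm

end Crossing

/-- For intersections `p₁, …, pₙ`, the class of the path
`ℓ_{t p₁} γ_{p₁}^{ε₁} ℓ_{p₁ p₂} ⋯ γ_{pₙ}^{εₙ} ℓ_{pₙ *}` starting from the point `ℓ t`. -/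
def insertFrom [ChartedSpace (EuclideanHalfSpace 2) M] {x₀ : M} {ℓ : Path x₀ x₀}
    {γ : C(UnitAddCircle, M)} : (t : I) → List (Crossing ℓ γ) → Path.Homotopic.Quotient (ℓ t) x₀
  | t, [] => (Path.Homotopic.Quotient.mk (ℓ.subpath t 1)).cast rfl ℓ.target.symm
  | t, c :: cs =>
    (Path.Homotopic.Quotient.mk (ℓ.subpath t c.time)).trans
      (c.signedLoop.trans (insertFrom c.time cs))

/-- The class of the based loop
`ℓ_{* p₁} γ_{p₁}^{ε₁} ℓ_{p₁ p₂} γ_{p₂}^{ε₂} ⋯ γ_{pₙ}^{εₙ} ℓ_{pₙ *}`. -/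
def insertAll [ChartedSpace (EuclideanHalfSpace 2) M] {x₀ : M} {ℓ : Path x₀ x₀}
    {γ : C(UnitAddCircle, M)} (cs : List (Crossing ℓ γ)) : LoopGroup x₀ :=
  loopClass ((insertFrom 0 cs).cast ℓ.source.symm rfl)

variable [ChartedSpace (EuclideanHalfSpace 2) M]

variable (M) in
/-- The given atlas of the surface is oriented: all changes of charts have positive Jacobian
determinant. -/
def OrientedAtlas : Prop :=
  ∀ e ∈ atlas (EuclideanHalfSpace 2) M, ∀ e' ∈ atlas (EuclideanHalfSpace 2) M,
    ∀ z ∈ ((e.extend (𝓡∂ 2)).symm ≫ e'.extend (𝓡∂ 2)).source,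
      0 < (fderivWithin ℝ (e'.extend (𝓡∂ 2) ∘ (e.extend (𝓡∂ 2)).symm)
        (Set.range (𝓡∂ 2)) z).det

/-- The based loop `ℓ` and the closed curve `γ`, which lies in the interior of the surface, are in
general position: they have finitely many intersections, all of which are transverse. -/
def GeneralPosition {x₀ : M} (ℓ : Path x₀ x₀) (γ : C(UnitAddCircle, M)) : Prop :=
  (∀ s, γ s ∈ (𝓡∂ 2).interior M) ∧ Finite (Crossing ℓ γ) ∧ ∀ c : Crossing ℓ γ, c.Transverse

/-- The sum `∑ ε_p ℓ_{*p} γ_p ℓ_{p*}` over all intersections of `ℓ` and `γ`. -/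
def intersectionSum {x₀ : M} (ℓ : Path x₀ x₀) (γ : C(UnitAddCircle, M)) :
    MonoidAlgebra ℚ (LoopGroup x₀) :=
  ∑ᶠ c : Crossing ℓ γ, MonoidAlgebra.single c.insertOnce ((c.sign : ℤ) : ℚ)

/-- A free loop `γ` and a based loop `ℓ` in general position representing the free homotopy class of
`α` and the element `x` of the fundamental group. -/
def Represents {x₀ : M} (α : C(UnitAddCircle, M)) (x : LoopGroup x₀)
    (r : Path x₀ x₀ × C(UnitAddCircle, M)) : Prop :=
  loopClass (Path.Homotopic.Quotient.mk r.1) = x ∧ ContinuousMap.Homotopic r.2 α ∧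
    GeneralPosition r.1 r.2

open Classical in
/-- The action `σ(α)(x)` of the free loop `α` on the element `x` of the fundamental group: the sum
`∑ ε_p ℓ_{*p} γ_p ℓ_{p*}` for representatives `ℓ` of `x` and `γ` of `α` in general position. -/
def loopAction {x₀ : M} (α : C(UnitAddCircle, M)) (x : LoopGroup x₀) :
    MonoidAlgebra ℚ (LoopGroup x₀) :=
  if h : ∃ r, Represents α x r then intersectionSum h.choose.1 h.choose.2 else 0

/-- The `ℚ`-linear extension of `σ(α)` to the group algebra. -/
def sigma (x₀ : M) (α : C(UnitAddCircle, M)) :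
    MonoidAlgebra ℚ (LoopGroup x₀) →ₗ[ℚ] MonoidAlgebra ℚ (LoopGroup x₀) :=
  (Finsupp.linearCombination ℚ (loopAction α)).comp
    (MonoidAlgebra.coeffLinearEquiv ℚ).toLinearMap

/-- The endomorphism `σ((γ - 1)^m)` of the group algebra, where `(γ - 1)^m` is expanded as a linear
combination of the free loops `γ^j`. -/
def sigmaSubOnePow (x₀ : M) (γ : C(UnitAddCircle, M)) (m : ℕ) :
    MonoidAlgebra ℚ (LoopGroup x₀) →ₗ[ℚ] MonoidAlgebra ℚ (LoopGroup x₀) :=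
  ∑ j ∈ Finset.range (m + 1), ((-1 : ℚ) ^ (m - j) * (m.choose j : ℚ)) • sigma x₀ (curvePow γ j)

/-- `D` is the endomorphism `σ(f(γ))` of the completed group algebra, for a power series
`f = ∑ a_m (x - 1)^m`: it is continuous, and on the group algebra it is the sum of the convergent
series `∑ a_m σ((γ - 1)^m)`. -/
def IsSigmaSeries (x₀ : M) (f : PowerSeries ℚ) (γ : C(UnitAddCircle, M))
    (D : CompletedAlgebra (LoopGroup x₀) →ₗ[ℚ] CompletedAlgebra (LoopGroup x₀)) : Prop :=
  (∀ m : ℕ, ∃ n : ℕ, ∀ v ∈ filtration (G := LoopGroup x₀) n, D v ∈ filtration m) ∧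
  ∀ a : MonoidAlgebra ℚ (LoopGroup x₀),
    ConvergesTo (fun N => ∑ m ∈ Finset.range N,
      PowerSeries.coeff m f • toCompletion (sigmaSubOnePow x₀ γ m a)) (D (toCompletion a))

/-- `T` is the generalized Dehn twist `exp (σ(L(γ)))` along `γ`, where `L(x) = (1/2) (log x)^2`; the
exponential series converges pointwise. -/
def IsGeneralizedDehnTwist (x₀ : M) (γ : C(UnitAddCircle, M))
    (T : CompletedAlgebra (LoopGroup x₀) ≃ₐ[ℚ] CompletedAlgebra (LoopGroup x₀)) : Prop :=
  ∃ D, IsSigmaSeries x₀ halfLogSq γ D ∧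
    ∀ v, ConvergesTo (fun N => ∑ n ∈ Finset.range N, ((n.factorial : ℚ)⁻¹) • (D ^ n) v) (T v)

end Surface

end GenDehn

end

open GenDehn

open scoped Manifold ContDiff unitInterval

noncomputable section

namespace GenDehn

/-! ### Variation of the logarithm along a path, and winding numbers of boxes -/

section Winding

open Set Complex

/-! Write `G` for the fundamental group, `I` for the augmentation ideal of `ℚ[G]`, and `y ∈ Γ_k` for
the class of `γ` joined to the basepoint. If `ℓ` has class `x` and is in general position with `γ`,
each crossing `p` gives a lasso (along `ℓ` to `p`, around `γ`, back along `ℓ`), which is a conjugate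
of `y`, and `σ(γ)(x) = b(x, y) x` with `b(x, y) = ∑ ε_p lasso_p`. The topological half of the proof
defines `b` (here `brk`) on classes and establishes three facts. (1) `b(x x', y) = b(x, y) + x b(x',
y) x⁻¹`. (2) For fixed `x` there is a Fox derivation `Θ`, with `Θ(y y') = Θ(y) + y Θ(y')`, such that
`b(x, y)` arises from `Θ(y)` by replacing each group element `u` by `u⁻¹ y u`. (3) `b(y, y)` has
augmentation zero, by antisymmetry of intersection numbers.

The algebraic half uses only these. By (2), `Θ(y^j) = (1 + y + ⋯ + y^(j-1)) Θ(y)`, and conjugation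
by powers of `y` fixes `y^j`; so with `θ = Θ(y)` one gets `b(x, y^j) = j ∑ θ_u u⁻¹ y^j u`. Hence
`σ(f(γ))` sends `x` to `(∑ θ_u u⁻¹ g(y) u) x` with `g(z) = z f'(z)`. For `f = L` this is `g = log`,
so `D = σ(L(γ))` is the map `x ↦ (∑ θ_u u⁻¹ (log y) u) x`. By (1) it is a derivation. On `I / I²` it
is a transvection in the direction of `y`, of square zero by (3); therefore `D` is nilpotent on
every `ℚ[G] / I^N`, and `exp D` converges to an algebra automorphism. As `log y` is primitive, `D`
is compatible with the coproduct, so `exp D` preserves the group-like elements.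

If `y ∈ Γ_k`, then `θ ∈ I^(k-1)`, `y - 1 ∈ I^k` and `log y ≡ y - 1` modulo `I^(2k)`. So `D² ≡ 0`
modulo `I^(2k)` and `exp(D) x ≡ (1 + ∑ ε_p (lasso_p - 1)) x ≡ (∏ lasso_p^{ε_p}) x`, the class of `ℓ`
with the signed copies of `γ` inserted. That this formula defines an automorphism of `G / Γ_{2k}` is
checked inside that group, not through its map to the Malcev quotient: the image of `Γ_k` is
commutative, so the product depends only on `b(x, y)`; (1) gives multiplicativity; bijectivity
follows from a finite filtration on whose successive quotients the map is the identity.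

For the topology, curves are merely continuous and are cut into short pieces. The crossing number of
pieces `f` and `h` is the winding number of `f(s) - h(t)`, read in a chart, around the boundary of
the parameter box; oriented changes of charts do not affect it. Replacing a piece of `f` by another
one with the same ends changes its crossing numbers with `h` by differences of winding numbers
around the division points of `h`. These telescope in a sum weighted by locally constant labels,
provided that `h` closes up or has its ends on the boundary of the surface, around which nothing
winds (`sum_cr_eq`). The contribution of a short piece is thus a local cocycle, and products of
local cocycles along a curve depend only on its homotopy class (`LocalCocycle.chainProd_eq`,
`isum_eq_of_hol`). At a transverse crossing the winding number is the sign (`boxVar_diffIn`), which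
identifies these sums with the geometric ones (`intersectionSum_eq_brk`). Representatives in general
position are polygons whose corners avoid a null set of bad positions. -/

/-- The variation of a continuous logarithm of `z` along `[a, b]`. -/
def logVar (z : ℝ → ℂ) (a b : ℝ) : ℂ :=
  open Classical in
  if h : ∃ g : ℝ → ℂ, ContinuousOn g (Icc a b) ∧ ∀ x ∈ Icc a b, exp (g x) = z x then
    h.choose b - h.choose a else 0

/-- Clamping to the box extends `F` to a nowhere vanishing continuous function on the whole plane,
which is simply connected. Paths are treated as degenerate boxes. -/
theorem exists_log_box {F : ℝ × ℝ → ℂ} {a b c d : ℝ} (hab : a ≤ b) (hcd : c ≤ d)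
    (hF : ContinuousOn F (Icc a b ×ˢ Icc c d)) (h0 : ∀ x ∈ Icc a b ×ˢ Icc c d, F x ≠ 0) :
    ∃ G : ℝ × ℝ → ℂ, ContinuousOn G (Icc a b ×ˢ Icc c d) ∧
      ∀ x ∈ Icc a b ×ˢ Icc c d, exp (G x) = F x := by
  let P : ℝ × ℝ → ℝ × ℝ := fun x => (projIcc a b hab x.1, projIcc c d hcd x.2)
  have hP : Continuous P :=
    (continuous_subtype_val.comp ((continuous_projIcc).comp continuous_fst)).prodMk
      (continuous_subtype_val.comp ((continuous_projIcc).comp continuous_snd))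
  have hPm : ∀ x, P x ∈ Icc a b ×ˢ Icc c d := fun x =>
    ⟨(projIcc a b hab x.1).2, (projIcc c d hcd x.2).2⟩
  have hPid : ∀ x ∈ Icc a b ×ˢ Icc c d, P x = x := by
    rintro ⟨x, y⟩ ⟨hx, hy⟩
    simp only [P]
    rw [projIcc_of_mem hab hx, projIcc_of_mem hcd hy]
  have hc : ContinuousOn (F ∘ P) univ := (hF.comp_continuous hP hPm).continuousOn
  obtain ⟨G, hG, hGe⟩ := Complex.exists_continuousOn_eqOn_exp_comp
    (U := (univ : Set (ℝ × ℝ))) (by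
      have := (convex_univ : Convex ℝ (univ : Set (ℝ × ℝ))).contractibleSpace univ_nonempty
      exact inferInstanceAs (SimplyConnectedSpace (univ : Set (ℝ × ℝ)))) isOpen_univ hc (by
      rintro ⟨x, -, hx⟩
      exact h0 _ (hPm x) hx)
  refine ⟨G, hG.mono (subset_univ _), fun x hx => ?_⟩
  have := hGe (mem_univ x)
  simp only [Function.comp] at this
  rw [this, hPid x hx]

theorem exists_log_path {z : ℝ → ℂ} {a b : ℝ} (hab : a ≤ b)
    (hz : ContinuousOn z (Icc a b)) (h0 : ∀ x ∈ Icc a b, z x ≠ 0) :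
    ∃ g : ℝ → ℂ, ContinuousOn g (Icc a b) ∧ ∀ x ∈ Icc a b, exp (g x) = z x := by
  obtain ⟨G, hG, hGe⟩ := exists_log_box (F := fun x => z x.1) hab (le_refl (0 : ℝ))
    (hz.comp continuousOn_fst fun x hx => hx.1) (fun x hx => h0 _ hx.1)
  refine ⟨fun x => G (x, 0), hG.comp (by fun_prop) fun x hx => ⟨hx, by simp⟩,
    fun x hx => hGe (x, 0) ⟨hx, by simp⟩⟩

/-- The difference of two logarithms of one function, divided by `2πi`, is continuous and integer
valued, hence constant on an interval. This makes `logVar` independent of the chosen logarithm. -/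
theorem log_sub_eq_of_exp_eq {g g' : ℝ → ℂ} {a b : ℝ} (hab : a ≤ b)
    (hg : ContinuousOn g (Icc a b)) (hg' : ContinuousOn g' (Icc a b))
    (h : ∀ x ∈ Icc a b, exp (g x) = exp (g' x)) : g b - g a = g' b - g' a := by
  have hc : ContinuousOn (fun x => (g x - g' x) / (2 * Real.pi * Complex.I)) (Icc a b) :=
    (hg.sub hg').div_const _
  have hpi : (2 * Real.pi * Complex.I : ℂ) ≠ 0 := two_pi_I_ne_zero
  have hint : ∀ x ∈ Icc a b, ∃ n : ℤ, (g x - g' x) / (2 * Real.pi * Complex.I) = n := by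
    intro x hx
    obtain ⟨n, hn⟩ := exp_eq_exp_iff_exists_int.1 (h x hx)
    exact ⟨n, by rw [hn]; field_simp; ring⟩
  have hre : ContinuousOn (fun x => ((g x - g' x) / (2 * Real.pi * Complex.I)).re) (Icc a b) :=
    continuous_re.comp_continuousOn hc
  have hconst : (fun x => ((g x - g' x) / (2 * Real.pi * Complex.I)).re) b =
      (fun x => ((g x - g' x) / (2 * Real.pi * Complex.I)).re) a := by
    refine isPreconnected_Icc.constant_of_mapsTo (T := range ((↑) : ℤ → ℝ)) ?_ hre ?_
      (right_mem_Icc.2 hab) (left_mem_Icc.2 hab)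
    · exact Int.isClosedEmbedding_coe_real.isInducing.isDiscrete_range
    · intro x hx
      obtain ⟨n, hn⟩ := hint x hx
      exact ⟨n, by simp only [hn, intCast_re]⟩
  obtain ⟨n, hn⟩ := hint b (right_mem_Icc.2 hab)
  obtain ⟨m, hm⟩ := hint a (left_mem_Icc.2 hab)
  simp only [hn, hm, intCast_re, Int.cast_inj] at hconst
  rw [hconst, ← hm, div_left_inj' hpi] at hn
  linear_combination hn

theorem logVar_eq {z g : ℝ → ℂ} {a b : ℝ} (hab : a ≤ b) (hg : ContinuousOn g (Icc a b))
    (h : ∀ x ∈ Icc a b, exp (g x) = z x) : logVar z a b = g b - g a := by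
  have hex : ∃ g : ℝ → ℂ, ContinuousOn g (Icc a b) ∧ ∀ x ∈ Icc a b, exp (g x) = z x := ⟨g, hg, h⟩
  rw [logVar, dif_pos hex]
  exact log_sub_eq_of_exp_eq hab hex.choose_spec.1 hg fun x hx =>
    (hex.choose_spec.2 x hx).trans (h x hx).symm

/-- Functions that agree on the interval give the same predicate for the choice in `logVar`, hence
the same chosen logarithm; neither continuity nor nonvanishing is needed. -/
theorem logVar_congr {z w : ℝ → ℂ} {a b : ℝ} (h : ∀ x ∈ Icc a b, z x = w x) :
    logVar z a b = logVar w a b := by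
  have : (fun g : ℝ → ℂ => ContinuousOn g (Icc a b) ∧ ∀ x ∈ Icc a b, exp (g x) = z x) =
      fun g : ℝ → ℂ => ContinuousOn g (Icc a b) ∧ ∀ x ∈ Icc a b, exp (g x) = w x := by
    funext g
    refine propext (and_congr_right fun _ => forall₂_congr fun x hx => ?_)
    rw [h x hx]
  have h1 : ∀ p q : (ℝ → ℂ) → Prop, p = q → (open Classical in
      if h : ∃ g, p g then h.choose b - h.choose a else (0 : ℂ)) = (open Classical in
      if h : ∃ g, q g then h.choose b - h.choose a else (0 : ℂ)) := by
    rintro p _ rfl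
    rfl
  exact h1 _ _ this

/-- `z` is continuous and nowhere zero on `[a, b]`. -/
def NonzeroOn (z : ℝ → ℂ) (a b : ℝ) : Prop :=
  ContinuousOn z (Icc a b) ∧ ∀ x ∈ Icc a b, z x ≠ 0

theorem logVar_add {z : ℝ → ℂ} {a b c : ℝ} (hab : a ≤ b) (hbc : b ≤ c) (h : NonzeroOn z a c) :
    logVar z a c = logVar z a b + logVar z b c := by
  obtain ⟨g, hg, hge⟩ := exists_log_path (hab.trans hbc) h.1 h.2
  rw [logVar_eq (hab.trans hbc) hg hge,
    logVar_eq hab (hg.mono (Icc_subset_Icc_right hbc)) fun x hx =>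
      hge x (Icc_subset_Icc_right hbc hx),
    logVar_eq hbc (hg.mono (Icc_subset_Icc_left hab)) fun x hx =>
      hge x (Icc_subset_Icc_left hab hx)]
  ring

theorem exp_logVar {z : ℝ → ℂ} {a b : ℝ} (hab : a ≤ b) (h : NonzeroOn z a b) :
    exp (logVar z a b) = z b / z a := by
  obtain ⟨g, hg, hge⟩ := exists_log_path hab h.1 h.2
  rw [logVar_eq hab hg hge, exp_sub, hge b (right_mem_Icc.2 hab), hge a (left_mem_Icc.2 hab)]

theorem logVar_mul {z w : ℝ → ℂ} {a b : ℝ} (hab : a ≤ b) (hz : NonzeroOn z a b)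
    (hw : NonzeroOn w a b) :
    logVar (fun x => z x * w x) a b = logVar z a b + logVar w a b := by
  obtain ⟨g, hg, hge⟩ := exists_log_path hab hz.1 hz.2
  obtain ⟨k, hk, hke⟩ := exists_log_path hab hw.1 hw.2
  rw [logVar_eq hab hg hge, logVar_eq hab hk hke,
    logVar_eq (g := fun x => g x + k x) hab (hg.add hk) fun x hx => by
      rw [exp_add, hge x hx, hke x hx]]
  ring

theorem logVar_of_re_pos {w : ℝ → ℂ} {a b : ℝ} (hab : a ≤ b) (hc : ContinuousOn w (Icc a b))
    (hw : ∀ x ∈ Icc a b, 0 < (w x).re) : logVar w a b = log (w b) - log (w a) :=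
  logVar_eq (g := fun x => log (w x)) hab (hc.clog fun x hx => Or.inl (hw x hx)) fun x hx =>
    exp_log fun h => by have := hw x hx; rw [h] at this; simp at this

theorem logVar_const_mul {w : ℝ → ℂ} {a b : ℝ} {α : ℂ} (hα : α ≠ 0) (hab : a ≤ b)
    (hw : NonzeroOn w a b) : logVar (fun x => α * w x) a b = logVar w a b := by
  obtain ⟨g, hg, hge⟩ := exists_log_path hab hw.1 hw.2
  rw [logVar_eq hab hg hge, logVar_eq (g := fun x => log α + g x) hab
    (continuousOn_const.add hg) fun x hx => by rw [exp_add, exp_log hα, hge x hx]]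
  ring

/-- If `w / (α z)` has positive real part, then the variations of the logarithms of `w` and `z`
differ by the variation of the principal logarithm of `w / (α z)`. -/
theorem logVar_of_ratio {z w : ℝ → ℂ} {a b : ℝ} {α : ℂ} (hα : α ≠ 0) (hab : a ≤ b)
    (hz : NonzeroOn z a b) (hw : ContinuousOn w (Icc a b))
    (h : ∀ x ∈ Icc a b, 0 < (w x / (α * z x)).re) :
    logVar w a b = logVar z a b + (log (w b / (α * z b)) - log (w a / (α * z a))) := by
  have hq : ContinuousOn (fun x => w x / (α * z x)) (Icc a b) :=
    hw.div (continuousOn_const.mul hz.1) fun x hx => mul_ne_zero hα (hz.2 x hx)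
  have hq0 : NonzeroOn (fun x => w x / (α * z x)) a b :=
    ⟨hq, fun x hx h0 => by
      have := h x hx
      simp only at h0
      rw [h0] at this
      simp at this⟩
  have h1 : logVar w a b = logVar (fun x => (α * z x) * (w x / (α * z x))) a b :=
    logVar_congr fun x hx => by rw [mul_div_cancel₀ _ (mul_ne_zero hα (hz.2 x hx))]
  have hz' : NonzeroOn (fun x => α * z x) a b :=
    ⟨continuousOn_const.mul hz.1, fun x hx => mul_ne_zero hα (hz.2 x hx)⟩
  rw [h1, logVar_mul hab hz' hq0,
    logVar_const_mul hα hab hz, logVar_of_re_pos hab hq h]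

/-- The variation of the logarithm of `F` around the boundary of the box `[a, b] × [c, d]`, which is
run through clockwise. -/
def boxVar (F : ℝ → ℝ → ℂ) (a b c d : ℝ) : ℂ :=
  logVar (F a) c d + logVar (fun s => F s d) a b - logVar (F b) c d - logVar (fun s => F s c) a b

/-- `F` is continuous on the box and has no zero on its boundary. -/
structure BoxOK (F : ℝ → ℝ → ℂ) (a b c d : ℝ) : Prop where
  hab : a ≤ b
  hcd : c ≤ d
  cont : ContinuousOn (Function.uncurry F) (Icc a b ×ˢ Icc c d)
  left : ∀ t ∈ Icc c d, F a t ≠ 0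
  right : ∀ t ∈ Icc c d, F b t ≠ 0
  bot : ∀ s ∈ Icc a b, F s c ≠ 0
  top : ∀ s ∈ Icc a b, F s d ≠ 0

namespace BoxOK

variable {F : ℝ → ℝ → ℂ} {a b c d : ℝ}

theorem contS (h : BoxOK F a b c d) {t : ℝ} (ht : t ∈ Icc c d) :
    ContinuousOn (fun s => F s t) (Icc a b) :=
  h.cont.comp (f := fun s => (s, t)) (by fun_prop) fun _ hs => ⟨hs, ht⟩

theorem contT (h : BoxOK F a b c d) {s : ℝ} (hs : s ∈ Icc a b) :
    ContinuousOn (F s) (Icc c d) :=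
  h.cont.comp (f := fun t => (s, t)) (by fun_prop) fun _ ht => ⟨hs, ht⟩

theorem nzL (h : BoxOK F a b c d) : NonzeroOn (F a) c d :=
  ⟨h.contT (left_mem_Icc.2 h.hab), h.left⟩
theorem nzR (h : BoxOK F a b c d) : NonzeroOn (F b) c d :=
  ⟨h.contT (right_mem_Icc.2 h.hab), h.right⟩
theorem nzB (h : BoxOK F a b c d) : NonzeroOn (fun s => F s c) a b :=
  ⟨h.contS (left_mem_Icc.2 h.hcd), h.bot⟩
theorem nzT (h : BoxOK F a b c d) : NonzeroOn (fun s => F s d) a b :=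
  ⟨h.contS (right_mem_Icc.2 h.hcd), h.top⟩

end BoxOK

/-- A single logarithm of `F` on the whole box computes all four sides, and its corner values
cancel. -/
theorem boxVar_eq_zero {F : ℝ → ℝ → ℂ} {a b c d : ℝ} (hab : a ≤ b) (hcd : c ≤ d)
    (hF : ContinuousOn (Function.uncurry F) (Icc a b ×ˢ Icc c d))
    (h0 : ∀ s ∈ Icc a b, ∀ t ∈ Icc c d, F s t ≠ 0) : boxVar F a b c d = 0 := by
  obtain ⟨G, hG, hGe⟩ := exists_log_box hab hcd hF fun x hx => h0 _ hx.1 _ hx.2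
  have hs : ∀ t ∈ Icc c d, logVar (fun s => F s t) a b = G (b, t) - G (a, t) := fun t ht =>
    logVar_eq (g := fun s => G (s, t)) hab
      (hG.comp (f := fun s => (s, t)) (by fun_prop) fun _ hs => ⟨hs, ht⟩) fun s hs =>
      hGe (s, t) ⟨hs, ht⟩
  have ht : ∀ s ∈ Icc a b, logVar (F s) c d = G (s, d) - G (s, c) := fun s hs =>
    logVar_eq (g := fun t => G (s, t)) hcd
      (hG.comp (f := fun t => (s, t)) (by fun_prop) fun _ ht => ⟨hs, ht⟩) fun t ht =>
      hGe (s, t) ⟨hs, ht⟩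
  rw [boxVar, hs c (left_mem_Icc.2 hcd), hs d (right_mem_Icc.2 hcd), ht a (left_mem_Icc.2 hab),
    ht b (right_mem_Icc.2 hab)]
  ring

/-- A multiplicative form of Rouché's theorem: along the boundary the quotient `F' / (α F)` stays in
the right half-plane, so its principal logarithm only contributes corner terms, and these cancel.
The constant `α` absorbs the rotation caused by a change of charts. -/
theorem boxVar_ratio {F F' : ℝ → ℝ → ℂ} {a b c d : ℝ} {α : ℂ} (hα : α ≠ 0)
    (h : BoxOK F a b c d) (h' : BoxOK F' a b c d)
    (hr : ∀ s ∈ Icc a b, ∀ t ∈ Icc c d, F s t ≠ 0 → 0 < (F' s t / (α * F s t)).re) :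
    boxVar F' a b c d = boxVar F a b c d := by
  have hl := left_mem_Icc.2 h.hab
  have hr' := right_mem_Icc.2 h.hab
  have hb := left_mem_Icc.2 h.hcd
  have ht := right_mem_Icc.2 h.hcd
  rw [boxVar, boxVar,
    logVar_of_ratio hα h.hcd h.nzL h'.nzL.1 fun x hx => hr _ hl _ hx (h.left x hx),
    logVar_of_ratio hα h.hcd h.nzR h'.nzR.1 fun x hx => hr _ hr' _ hx (h.right x hx),
    logVar_of_ratio hα h.hab h.nzB h'.nzB.1 fun x hx => hr _ hx _ hb (h.bot x hx),
    logVar_of_ratio hα h.hab h.nzT h'.nzT.1 fun x hx => hr _ hx _ ht (h.top x hx)]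
  ring

theorem boxVar_splitS {F : ℝ → ℝ → ℂ} {a b m c d : ℝ} (h1 : BoxOK F a m c d)
    (h2 : BoxOK F m b c d) : boxVar F a b c d = boxVar F a m c d + boxVar F m b c d := by
  have key : ∀ t ∈ Icc c d, (∀ s ∈ Icc a m, F s t ≠ 0) → (∀ s ∈ Icc m b, F s t ≠ 0) →
      logVar (fun s => F s t) a b = logVar (fun s => F s t) a m + logVar (fun s => F s t) m b := by
    intro t ht hn1 hn2
    refine logVar_add h1.hab h2.hab ⟨?_, ?_⟩
    · rw [← Icc_union_Icc_eq_Icc h1.hab h2.hab]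
      exact (h1.contS ht).union_of_isClosed (h2.contS ht) isClosed_Icc isClosed_Icc
    · intro s hs
      rw [← Icc_union_Icc_eq_Icc h1.hab h2.hab] at hs
      exact hs.elim (hn1 s) (hn2 s)
  rw [boxVar, boxVar, boxVar, key c (left_mem_Icc.2 h1.hcd) h1.bot h2.bot,
    key d (right_mem_Icc.2 h1.hcd) h1.top h2.top]
  ring

theorem boxVar_splitT {F : ℝ → ℝ → ℂ} {a b m c d : ℝ} (h1 : BoxOK F a b c m)
    (h2 : BoxOK F a b m d) : boxVar F a b c d = boxVar F a b c m + boxVar F a b m d := by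
  have key : ∀ s ∈ Icc a b, (∀ t ∈ Icc c m, F s t ≠ 0) → (∀ t ∈ Icc m d, F s t ≠ 0) →
      logVar (F s) c d = logVar (F s) c m + logVar (F s) m d := by
    intro s hs hn1 hn2
    refine logVar_add h1.hcd h2.hcd ⟨?_, ?_⟩
    · rw [← Icc_union_Icc_eq_Icc h1.hcd h2.hcd]
      exact (h1.contT hs).union_of_isClosed (h2.contT hs) isClosed_Icc isClosed_Icc
    · intro t ht
      rw [← Icc_union_Icc_eq_Icc h1.hcd h2.hcd] at ht
      exact ht.elim (hn1 t) (hn2 t)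
  rw [boxVar, boxVar, boxVar, key a (left_mem_Icc.2 h1.hab) h1.left h2.left,
    key b (right_mem_Icc.2 h1.hab) h1.right h2.right]
  ring

/-! ### Local computation at a transverse zero -/

theorem log_one_add_I_sub : log (1 + Complex.I) - log (1 - Complex.I) = Real.pi / 2 * Complex.I := by
  have harg : arg (1 + Complex.I) = Real.pi / 4 := by
    have h := Complex.arg_mul_cos_add_sin_mul_I (r := Real.sqrt 2) (θ := Real.pi / 4) (by positivity)
      ⟨by linarith [Real.pi_pos], by linarith [Real.pi_pos]⟩
    rw [← h]
    congr 1
    rw [← ofReal_cos, ← ofReal_sin, Real.cos_pi_div_four, Real.sin_pi_div_four]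
    have h2 : (Real.sqrt 2 : ℂ) * Real.sqrt 2 = 2 := by
      rw [← ofReal_mul, Real.mul_self_sqrt (by norm_num)]; norm_num
    push_cast
    linear_combination (-(1 / 2 : ℂ) - 1 / 2 * Complex.I) * h2
  have hconj : (1 - Complex.I : ℂ) = (starRingEnd ℂ) (1 + Complex.I) := by
    simp [sub_eq_add_neg]
  rw [hconj, log_conj _ (by rw [harg]; intro h; linarith [Real.pi_pos])]
  rw [Complex.sub_conj, log_im, harg]
  push_cast
  ring

/-- Seen from the centre, a side of a square is a quarter turn: up to constant factors it is the
segment from `1 - i` to `1 + i`. -/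
theorem logVar_side {r : ℝ} (hr : 0 < r) (m : ℝ) (u : ℂ) (hu : u ≠ 0) (z : ℝ → ℂ)
    (hz : ∀ t, z t = u * (r + Complex.I * (t - m))) :
    logVar z (m - r) (m + r) = Real.pi / 2 * Complex.I := by
  have hle : m - r ≤ m + r := by linarith
  have hc : ContinuousOn (fun t : ℝ => (r + Complex.I * (t - m) : ℂ)) (Icc (m - r) (m + r)) := by
    fun_prop
  have hre : ∀ t : ℝ, 0 < (r + Complex.I * (t - m) : ℂ).re := by
    intro t; simp [hr]
  rw [funext hz, logVar_const_mul hu hle ⟨hc, fun t _ h => by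
    have := hre t; rw [h] at this; simp at this⟩, logVar_of_re_pos hle hc fun t _ => hre t,
    ← log_one_add_I_sub]
  have e1 : (r + Complex.I * (((m + r : ℝ) : ℂ) - m) : ℂ) = (r : ℂ) * (1 + Complex.I) := by
    push_cast; ring
  have e2 : (r + Complex.I * (((m - r : ℝ) : ℂ) - m) : ℂ) = (r : ℂ) * (1 - Complex.I) := by
    push_cast; ring
  have n1 : (1 + Complex.I : ℂ) ≠ 0 := fun h => by simpa using congrArg re h
  have n2 : (1 - Complex.I : ℂ) ≠ 0 := fun h => by simpa using congrArg re h
  rw [e1, e2, log_ofReal_mul hr n1, log_ofReal_mul hr n2]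
  ring

theorem logVar_side' {r : ℝ} (hr : 0 < r) (m : ℝ) (u : ℂ) (hu : u ≠ 0) (z : ℝ → ℂ)
    (hz : ∀ t, z t = u * (r - Complex.I * (t - m))) :
    logVar z (m - r) (m + r) = -(Real.pi / 2 * Complex.I) := by
  have hle : m - r ≤ m + r := by linarith
  have hc : ContinuousOn (fun t : ℝ => (r - Complex.I * (t - m) : ℂ)) (Icc (m - r) (m + r)) := by
    fun_prop
  have hre : ∀ t : ℝ, 0 < (r - Complex.I * (t - m) : ℂ).re := by
    intro t; simp [hr]
  rw [funext hz, logVar_const_mul hu hle ⟨hc, fun t _ h => by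
    have := hre t; rw [h] at this; simp at this⟩, logVar_of_re_pos hle hc fun t _ => hre t,
    ← log_one_add_I_sub]
  have e1 : (r - Complex.I * (((m + r : ℝ) : ℂ) - m) : ℂ) = (r : ℂ) * (1 - Complex.I) := by
    push_cast; ring
  have e2 : (r - Complex.I * (((m - r : ℝ) : ℂ) - m) : ℂ) = (r : ℂ) * (1 + Complex.I) := by
    push_cast; ring
  have n1 : (1 + Complex.I : ℂ) ≠ 0 := fun h => by simpa using congrArg re h
  have n2 : (1 - Complex.I : ℂ) ≠ 0 := fun h => by simpa using congrArg re h
  rw [e1, e2, log_ofReal_mul hr n1, log_ofReal_mul hr n2]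
  ring

/-- Since `boxVar` runs clockwise, the zero of `w` counts `-1` and the zero of its conjugate counts
`+1`. -/
theorem boxVar_id {r : ℝ} (hr : 0 < r) (s₀ t₀ : ℝ) :
    boxVar (fun s t => ((s - s₀ : ℝ) : ℂ) + Complex.I * ((t - t₀ : ℝ) : ℂ))
      (s₀ - r) (s₀ + r) (t₀ - r) (t₀ + r) = -(2 * Real.pi * Complex.I) := by
  rw [boxVar, logVar_side' hr t₀ (-1) (by simp) _ fun t => by push_cast; ring,
    logVar_side' hr s₀ Complex.I (by simp) _ fun s => by
      push_cast; linear_combination ((s : ℂ) - s₀) * Complex.I_sq,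
    logVar_side hr t₀ 1 (by simp) _ fun t => by push_cast; ring,
    logVar_side hr s₀ (-Complex.I) (by simp) _ fun s => by
      push_cast; linear_combination ((s : ℂ) - s₀) * Complex.I_sq]
  ring

theorem boxVar_conj {r : ℝ} (hr : 0 < r) (s₀ t₀ : ℝ) :
    boxVar (fun s t => ((s - s₀ : ℝ) : ℂ) - Complex.I * ((t - t₀ : ℝ) : ℂ))
      (s₀ - r) (s₀ + r) (t₀ - r) (t₀ + r) = 2 * Real.pi * Complex.I := by
  rw [boxVar, logVar_side hr t₀ (-1) (by simp) _ fun t => by push_cast; ring,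
    logVar_side hr s₀ (-Complex.I) (by simp) _ fun s => by
      push_cast; linear_combination ((s : ℂ) - s₀) * Complex.I_sq,
    logVar_side' hr t₀ 1 (by simp) _ fun t => by push_cast; ring,
    logVar_side' hr s₀ Complex.I (by simp) _ fun s => by
      push_cast; linear_combination ((s : ℂ) - s₀) * Complex.I_sq]
  ring

theorem re_div_pos_of_norm_sub_lt {w z : ℂ} (h : ‖w - z‖ < ‖z‖) : 0 < (w / z).re := by
  have hz : z ≠ 0 := by rintro rfl; simp at h; linarith [norm_nonneg w]
  have h1 : ‖(w - z) / z‖ < 1 := by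
    rw [norm_div]; exact (div_lt_one (norm_pos_iff.2 hz)).2 h
  have h2 : w / z = 1 + (w - z) / z := by field_simp; ring
  rw [h2, add_re, one_re]
  have := (abs_le.1 (abs_re_le_norm ((w - z) / z))).1
  linarith

/-- Pairing `p x - q y` with `q` isolates `x`, pairing it with `p` isolates `y`. This is a
quantitative form of the injectivity of `(x, y) ↦ p x - q y`. -/
theorem det_mul_le {p q : ℂ} (x y : ℝ) :
    |p.re * q.im - p.im * q.re| * (|x| + |y|) ≤ (‖p‖ + ‖q‖) * ‖p * x - q * y‖ := by
  have key : ∀ u v : ℂ, |u.re * v.im - u.im * v.re| ≤ ‖u‖ * ‖v‖ := by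
    intro u v
    have h1 : u.re * v.im - u.im * v.re = ((starRingEnd ℂ) u * v).im := by
      simp [mul_im]; ring
    rw [h1, ← norm_conj u, ← norm_mul]
    exact abs_im_le_norm _
  have h1 := key (p * x - q * y) q
  have h2 := key (p * x - q * y) p
  have e1 : (p * x - q * y).re * q.im - (p * x - q * y).im * q.re =
      (p.re * q.im - p.im * q.re) * x := by simp; ring
  have e2 : (p * x - q * y).re * p.im - (p * x - q * y).im * p.re =
      (p.re * q.im - p.im * q.re) * y := by simp; ring
  rw [e1, abs_mul] at h1
  rw [e2, abs_mul] at h2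
  nlinarith

/-- The hypothesis makes `F` comparable to its linear part `L`. With `w = (s - s₀) + i (t - t₀)` one
has `L = α w + β w̄` and `|β|² - |α|²` equal to the determinant, so its sign decides which of the
two terms dominates, and the winding number is that of `w` or of `w̄`. -/
theorem boxVar_transverse_square {F : ℝ → ℝ → ℂ} {r s₀ t₀ : ℝ} {p q : ℂ} (hr : 0 < r)
    (hF : BoxOK F (s₀ - r) (s₀ + r) (t₀ - r) (t₀ + r))
    (hdet : p.re * q.im - p.im * q.re ≠ 0)
    (happ : ∀ s ∈ Icc (s₀ - r) (s₀ + r), ∀ t ∈ Icc (t₀ - r) (t₀ + r),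
      (‖p‖ + ‖q‖) * ‖F s t - (p * ((s - s₀ : ℝ) : ℂ) - q * ((t - t₀ : ℝ) : ℂ))‖ ≤
        |p.re * q.im - p.im * q.re| / 2 * (|s - s₀| + |t - t₀|)) :
    boxVar F (s₀ - r) (s₀ + r) (t₀ - r) (t₀ + r) =
      2 * Real.pi * Complex.I * (SignType.sign (p.re * q.im - p.im * q.re) : ℤ) := by
  set D := p.re * q.im - p.im * q.re with hD
  set L : ℝ → ℝ → ℂ := fun s t => p * ((s - s₀ : ℝ) : ℂ) - q * ((t - t₀ : ℝ) : ℂ) with hL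
  have hpq : 0 < ‖p‖ + ‖q‖ := by
    rcases eq_or_ne p 0 with rfl | hp
    · simp [hD] at hdet
    · have := norm_pos_iff.2 hp
      positivity
  have hLz : ∀ s t, L s t = 0 → s = s₀ ∧ t = t₀ := by
    intro s t h
    have := det_mul_le (p := p) (q := q) (s - s₀) (t - t₀)
    rw [show p * ((s - s₀ : ℝ) : ℂ) - q * ((t - t₀ : ℝ) : ℂ) = L s t from rfl, h] at this
    simp only [norm_zero, mul_zero] at this
    have h0 : |s - s₀| + |t - t₀| ≤ 0 := by
      by_contra hc
      have := mul_pos (abs_pos.2 hdet) (not_le.1 hc)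
      linarith
    constructor
    · have : |s - s₀| = 0 := le_antisymm (by linarith [abs_nonneg (t - t₀)]) (abs_nonneg _)
      linarith [abs_eq_zero.1 this]
    · have : |t - t₀| = 0 := le_antisymm (by linarith [abs_nonneg (s - s₀)]) (abs_nonneg _)
      linarith [abs_eq_zero.1 this]
  have mk : ∀ G : ℝ → ℝ → ℂ, Continuous (Function.uncurry G) →
      (∀ s t, G s t = 0 → s = s₀ ∧ t = t₀) →
      BoxOK G (s₀ - r) (s₀ + r) (t₀ - r) (t₀ + r) := by
    intro G hG hz
    refine ⟨by linarith, by linarith, hG.continuousOn, ?_, ?_, ?_, ?_⟩ <;> intro x _ h0 <;>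
    have := hz _ _ h0 <;> linarith [this.1, this.2]
  have hLc : Continuous (Function.uncurry L) := by
    simp only [hL, Function.uncurry_def]; fun_prop
  have hLok := mk L hLc hLz
  have h1 : boxVar F (s₀ - r) (s₀ + r) (t₀ - r) (t₀ + r) =
      boxVar L (s₀ - r) (s₀ + r) (t₀ - r) (t₀ + r) := by
    refine boxVar_ratio one_ne_zero hLok hF fun s hs t ht hn => ?_
    rw [one_mul]
    refine re_div_pos_of_norm_sub_lt ?_
    have h1 := happ s hs t ht
    have h2 := det_mul_le (p := p) (q := q) (s - s₀) (t - t₀)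
    change (‖p‖ + ‖q‖) * ‖F s t - L s t‖ ≤ _ at h1
    change _ ≤ (‖p‖ + ‖q‖) * ‖L s t‖ at h2
    have h3 := norm_pos_iff.2 hn
    have h4 : (‖p‖ + ‖q‖) * ‖F s t - L s t‖ < (‖p‖ + ‖q‖) * ‖L s t‖ := by
      have := mul_pos hpq h3
      linarith
    exact lt_of_mul_lt_mul_left h4 hpq.le
  rw [h1]
  set α : ℂ := (p + Complex.I * q) / 2 with hα
  set β : ℂ := (p - Complex.I * q) / 2 with hβ
  have hdiff : ‖β‖ ^ 2 - ‖α‖ ^ 2 = D := by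
    rw [← normSq_eq_norm_sq, ← normSq_eq_norm_sq, normSq_apply, normSq_apply, hD]
    simp [hα, hβ]
    ring
  rcases lt_or_gt_of_ne hdet with hneg | hpos
  · have hlt : ‖β‖ < ‖α‖ := by
      by_contra hc
      have := pow_le_pow_left₀ (norm_nonneg α) (not_lt.1 hc) 2
      linarith
    have hα0 : α ≠ 0 := by
      intro h; rw [h, norm_zero] at hlt; linarith [norm_nonneg β]
    rw [boxVar_ratio hα0 (mk (fun s t => ((s - s₀ : ℝ) : ℂ) + Complex.I * ((t - t₀ : ℝ) : ℂ))
      (by simp only [Function.uncurry_def]; fun_prop) ?_) hLok ?_, boxVar_id hr, sign_neg hneg]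
    · simp
    · intro s t h
      have h1 := congrArg re h
      have h2 := congrArg im h
      simp at h1 h2
      constructor <;> linarith
    · intro s _ t _ hn
      refine re_div_pos_of_norm_sub_lt ?_
      have e : L s t - α * (((s - s₀ : ℝ) : ℂ) + Complex.I * ((t - t₀ : ℝ) : ℂ)) =
          β * (starRingEnd ℂ) (((s - s₀ : ℝ) : ℂ) + Complex.I * ((t - t₀ : ℝ) : ℂ)) := by
        simp only [hL, hα, hβ, map_add, map_mul, conj_ofReal, conj_I]
        linear_combination (-q * ((t - t₀ : ℝ) : ℂ)) * Complex.I_sq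
      rw [e, norm_mul, norm_mul, norm_conj]
      exact mul_lt_mul_of_pos_right hlt (norm_pos_iff.2 hn)
  · have hlt : ‖α‖ < ‖β‖ := by
      by_contra hc
      have := pow_le_pow_left₀ (norm_nonneg β) (not_lt.1 hc) 2
      linarith
    have hβ0 : β ≠ 0 := by
      intro h; rw [h, norm_zero] at hlt; linarith [norm_nonneg α]
    rw [boxVar_ratio hβ0 (mk (fun s t => ((s - s₀ : ℝ) : ℂ) - Complex.I * ((t - t₀ : ℝ) : ℂ))
      (by simp only [Function.uncurry_def]; fun_prop) ?_) hLok ?_, boxVar_conj hr, sign_pos hpos]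
    · simp
    · intro s t h
      have h1 := congrArg re h
      have h2 := congrArg im h
      simp at h1 h2
      constructor <;> linarith
    · intro s _ t _ hn
      refine re_div_pos_of_norm_sub_lt ?_
      have e : L s t - β * (((s - s₀ : ℝ) : ℂ) - Complex.I * ((t - t₀ : ℝ) : ℂ)) =
          α * (starRingEnd ℂ) (((s - s₀ : ℝ) : ℂ) - Complex.I * ((t - t₀ : ℝ) : ℂ)) := by
        simp only [hL, hα, hβ, map_sub, map_mul, conj_ofReal, conj_I]
        linear_combination (-q * ((t - t₀ : ℝ) : ℂ)) * Complex.I_sq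
      rw [e, norm_mul, norm_mul, norm_conj]
      exact mul_lt_mul_of_pos_right hlt (norm_pos_iff.2 hn)

/-- The winding number around a box of a function with a single zero is the winding number around
any small square centered at the zero. -/
theorem boxVar_localize {F : ℝ → ℝ → ℂ} {a b c d s₀ t₀ : ℝ}
    (hs₀ : s₀ ∈ Ioo a b) (ht₀ : t₀ ∈ Ioo c d)
    (hF : ContinuousOn (Function.uncurry F) (Icc a b ×ˢ Icc c d))
    (hz : ∀ s ∈ Icc a b, ∀ t ∈ Icc c d, F s t = 0 → s = s₀ ∧ t = t₀) :
    ∃ R > 0, ∀ r, 0 < r → r ≤ R → (a ≤ s₀ - r ∧ s₀ + r ≤ b ∧ c ≤ t₀ - r ∧ t₀ + r ≤ d) ∧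
      BoxOK F (s₀ - r) (s₀ + r) (t₀ - r) (t₀ + r) ∧
      boxVar F a b c d = boxVar F (s₀ - r) (s₀ + r) (t₀ - r) (t₀ + r) := by
  obtain ⟨ha, hb⟩ := hs₀
  obtain ⟨hc, hd⟩ := ht₀
  refine ⟨min (min (s₀ - a) (b - s₀)) (min (t₀ - c) (d - t₀)),
    lt_min (lt_min (by linarith) (by linarith)) (lt_min (by linarith) (by linarith)), ?_⟩
  intro r hr hrR
  have hra : a ≤ s₀ - r := by
    linarith [hrR.trans ((min_le_left _ _).trans (min_le_left _ _))]
  have hrb : s₀ + r ≤ b := by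
    linarith [hrR.trans ((min_le_left _ _).trans (min_le_right _ _))]
  have hrc : c ≤ t₀ - r := by
    linarith [hrR.trans ((min_le_right _ _).trans (min_le_left _ _))]
  have hrd : t₀ + r ≤ d := by
    linarith [hrR.trans ((min_le_right _ _).trans (min_le_right _ _))]
  refine ⟨⟨hra, hrb, hrc, hrd⟩, ?_⟩
  have sub : ∀ {a' b' c' d' : ℝ}, a ≤ a' → a' ≤ b' → b' ≤ b → c ≤ c' → c' ≤ d' → d' ≤ d →
      (a' ≠ s₀) → (b' ≠ s₀) → (c' ≠ t₀) → (d' ≠ t₀) → BoxOK F a' b' c' d' := by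
    intro a' b' c' d' h1 h2 h3 h4 h5 h6 n1 n2 n3 n4
    refine ⟨h2, h5, hF.mono (prod_mono (Icc_subset_Icc h1 h3) (Icc_subset_Icc h4 h6)), ?_, ?_,
      ?_, ?_⟩
    · intro t ht h0
      exact n1 (hz _ ⟨h1, h2.trans h3⟩ _ ⟨h4.trans ht.1, ht.2.trans h6⟩ h0).1
    · intro t ht h0
      exact n2 (hz _ ⟨h1.trans h2, h3⟩ _ ⟨h4.trans ht.1, ht.2.trans h6⟩ h0).1
    · intro s hs h0
      exact n3 (hz _ ⟨h1.trans hs.1, hs.2.trans h3⟩ _ ⟨h4, h5.trans h6⟩ h0).2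
    · intro s hs h0
      exact n4 (hz _ ⟨h1.trans hs.1, hs.2.trans h3⟩ _ ⟨h4.trans h5, h6⟩ h0).2
  have zero : ∀ {a' b' c' d' : ℝ}, a ≤ a' → a' ≤ b' → b' ≤ b → c ≤ c' → c' ≤ d' → d' ≤ d →
      (b' < s₀ ∨ s₀ < a' ∨ d' < t₀ ∨ t₀ < c') → boxVar F a' b' c' d' = 0 := by
    intro a' b' c' d' h1 h2 h3 h4 h5 h6 hor
    refine boxVar_eq_zero h2 h5
      (hF.mono (prod_mono (Icc_subset_Icc h1 h3) (Icc_subset_Icc h4 h6))) ?_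
    intro s hs t ht h0
    obtain ⟨e1, e2⟩ := hz s ⟨h1.trans hs.1, hs.2.trans h3⟩ t ⟨h4.trans ht.1, ht.2.trans h6⟩ h0
    rcases hor with h | h | h | h <;> linarith [hs.1, hs.2, ht.1, ht.2]
  have s1 : BoxOK F a (s₀ - r) c d := sub le_rfl hra (by linarith) le_rfl (by linarith) le_rfl
    ha.ne (by linarith) hc.ne hd.ne'
  have s2 : BoxOK F (s₀ - r) (s₀ + r) c d := sub hra (by linarith) hrb le_rfl (by linarith) le_rfl
    (by linarith) (by linarith) hc.ne hd.ne'
  have s3 : BoxOK F (s₀ + r) b c d := sub (by linarith) hrb le_rfl le_rfl (by linarith) le_rfl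
    (by linarith) hb.ne' hc.ne hd.ne'
  have s23 : BoxOK F (s₀ - r) b c d := sub hra (by linarith) le_rfl le_rfl (by linarith) le_rfl
    (by linarith) hb.ne' hc.ne hd.ne'
  have t1 : BoxOK F (s₀ - r) (s₀ + r) c (t₀ - r) := sub hra (by linarith) hrb le_rfl hrc
    (by linarith) (by linarith) (by linarith) hc.ne (by linarith)
  have t2 : BoxOK F (s₀ - r) (s₀ + r) (t₀ - r) (t₀ + r) := sub hra (by linarith) hrb hrc
    (by linarith) hrd (by linarith) (by linarith) (by linarith) (by linarith)
  have t3 : BoxOK F (s₀ - r) (s₀ + r) (t₀ + r) d := sub hra (by linarith) hrb (by linarith) hrd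
    le_rfl (by linarith) (by linarith) (by linarith) hd.ne'
  have t23 : BoxOK F (s₀ - r) (s₀ + r) (t₀ - r) d := sub hra (by linarith) hrb hrc (by linarith)
    le_rfl (by linarith) (by linarith) (by linarith) hd.ne'
  refine ⟨t2, ?_⟩
  -- Cut off the left and right strips, then the parts of the middle strip below and above the
  -- square: these four boxes contain no zero.
  rw [boxVar_splitS s1 s23, boxVar_splitS s2 s3, boxVar_splitT t1 t23, boxVar_splitT t2 t3,
    zero le_rfl hra (by linarith) le_rfl (by linarith) le_rfl (Or.inl (by linarith)),
    zero (by linarith) hrb le_rfl le_rfl (by linarith) le_rfl (Or.inr (Or.inl (by linarith))),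
    zero hra (by linarith) hrb le_rfl hrc (by linarith) (Or.inr (Or.inr (Or.inl (by linarith)))),
    zero hra (by linarith) hrb (by linarith) hrd le_rfl (Or.inr (Or.inr (Or.inr (by linarith))))]
  ring

/-- The winding number around a small square of a function that is approximated
by `p (s - s₀) - q (t - t₀)` with linearly independent `p` and `q`. -/
theorem boxVar_of_approx {F : ℝ → ℝ → ℂ} {s₀ t₀ : ℝ} {p q : ℂ}
    (hdet : p.re * q.im - p.im * q.re ≠ 0)
    (happ : ∀ ε > 0, ∃ δ > 0, ∀ s t, |s - s₀| ≤ δ → |t - t₀| ≤ δ →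
      ‖F s t - (p * ((s - s₀ : ℝ) : ℂ) - q * ((t - t₀ : ℝ) : ℂ))‖ ≤ ε * (|s - s₀| + |t - t₀|)) :
    ∃ R > 0, ∀ r, 0 < r → r ≤ R → BoxOK F (s₀ - r) (s₀ + r) (t₀ - r) (t₀ + r) →
      boxVar F (s₀ - r) (s₀ + r) (t₀ - r) (t₀ + r) =
        2 * Real.pi * Complex.I * (SignType.sign (p.re * q.im - p.im * q.re) : ℤ) := by
  have hpq : 0 < ‖p‖ + ‖q‖ := by
    rcases eq_or_ne p 0 with rfl | hp
    · simp at hdet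
    · have := norm_pos_iff.2 hp
      positivity
  obtain ⟨δ, hδ, happ⟩ := happ (|p.re * q.im - p.im * q.re| / 2 / (‖p‖ + ‖q‖))
    (div_pos (half_pos (abs_pos.2 hdet)) hpq)
  refine ⟨δ, hδ, fun r hr hrδ hF => boxVar_transverse_square hr hF hdet fun s hs t ht => ?_⟩
  have := happ s t ((abs_le.2 ⟨by linarith [hs.1], by linarith [hs.2]⟩).trans hrδ)
    ((abs_le.2 ⟨by linarith [ht.1], by linarith [ht.2]⟩).trans hrδ)
  calc _ ≤ (‖p‖ + ‖q‖) * (|p.re * q.im - p.im * q.re| / 2 / (‖p‖ + ‖q‖) *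
        (|s - s₀| + |t - t₀|)) := mul_le_mul_of_nonneg_left this hpq.le
    _ = _ := by field_simp

end Winding

/-! ### Complex coordinates on an oriented surface -/

section Charts

open Set Filter Topology

/-- The identification of the model plane with the complex plane. -/
def planeEquiv : EuclideanSpace ℝ (Fin 2) ≃ₗᵢ[ℝ] ℂ := Complex.orthonormalBasisOneI.repr.symm

theorem planeEquiv_apply (v : EuclideanSpace ℝ (Fin 2)) :
    planeEquiv v = (v 0 : ℂ) + v 1 * Complex.I := by
  simp [planeEquiv, Complex.orthonormalBasisOneI, Complex.basisOneI]

theorem planeEquiv_re (v : EuclideanSpace ℝ (Fin 2)) : (planeEquiv v).re = v 0 := by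
  simp [planeEquiv_apply]

theorem planeEquiv_im (v : EuclideanSpace ℝ (Fin 2)) : (planeEquiv v).im = v 1 := by
  simp [planeEquiv_apply]

theorem det_eq_fin_two (A : EuclideanSpace ℝ (Fin 2) →L[ℝ] EuclideanSpace ℝ (Fin 2)) :
    A.det = A (EuclideanSpace.single 0 1) 0 * A (EuclideanSpace.single 1 1) 1 -
      A (EuclideanSpace.single 1 1) 0 * A (EuclideanSpace.single 0 1) 1 := by
  rw [ContinuousLinearMap.det, ← LinearMap.det_toMatrix (EuclideanSpace.basisFun (Fin 2) ℝ).toBasis,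
    Matrix.det_fin_two]
  simp [LinearMap.toMatrix_apply]

/-- A linear map of positive determinant is `z ↦ α z + β z̄` with `|β| < |α|`. -/
theorem exists_conformal_part (A : EuclideanSpace ℝ (Fin 2) →L[ℝ] EuclideanSpace ℝ (Fin 2))
    (hA : 0 < A.det) : ∃ α β : ℂ, ‖β‖ < ‖α‖ ∧
      ∀ v, planeEquiv (A v) = α * planeEquiv v + β * (starRingEnd ℂ) (planeEquiv v) := by
  rw [det_eq_fin_two] at hA
  set a := A (EuclideanSpace.single 0 1) 0
  set b := A (EuclideanSpace.single 1 1) 0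
  set c := A (EuclideanSpace.single 0 1) 1
  set d := A (EuclideanSpace.single 1 1) 1
  refine ⟨⟨(a + d) / 2, (c - b) / 2⟩, ⟨(a - d) / 2, (c + b) / 2⟩, ?_, fun v => ?_⟩
  · refine lt_of_pow_lt_pow_left₀ 2 (norm_nonneg _) ?_
    rw [← Complex.normSq_eq_norm_sq, ← Complex.normSq_eq_norm_sq, Complex.normSq_mk,
      Complex.normSq_mk]
    nlinarith
  · have hv : v = v 0 • EuclideanSpace.single 0 (1 : ℝ) + v 1 • EuclideanSpace.single 1 (1 : ℝ) := by
      ext i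
      fin_cases i <;> simp
    have h0 : A v 0 = v 0 * a + v 1 * b := by
      conv_lhs => rw [hv]
      simp [a, b]
    have h1 : A v 1 = v 0 * c + v 1 * d := by
      conv_lhs => rw [hv]
      simp [c, d]
    apply Complex.ext <;>
    simp only [planeEquiv_re, planeEquiv_im, h0, h1, Complex.add_re, Complex.mul_re,
      Complex.add_im, Complex.mul_im, Complex.conj_re, Complex.conj_im] <;> ring

variable {M : Type*} [TopologicalSpace M] [ChartedSpace (EuclideanHalfSpace 2) M]

/-- The domain of the chart at `b`. -/
abbrev dom (b : M) : Set M := (chartAt (EuclideanHalfSpace 2) b).source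

/-- The chart at `b`, as a map to the complex plane. -/
def coord (b x : M) : ℂ := planeEquiv (extChartAt (𝓡∂ 2) b x)

theorem dom_open (b : M) : IsOpen (dom b) := (chartAt (EuclideanHalfSpace 2) b).open_source

theorem mem_dom (b : M) : b ∈ dom b := mem_chart_source _ b

theorem coord_continuousOn (b : M) : ContinuousOn (coord b) (dom b) := by
  refine planeEquiv.continuous.comp_continuousOn ?_
  rw [dom, ← extChartAt_source (𝓡∂ 2)]
  exact continuousOn_extChartAt b

theorem coord_injOn (b : M) : InjOn (coord b) (dom b) := by
  intro x hx y hy h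
  rw [dom, ← extChartAt_source (𝓡∂ 2)] at hx hy
  exact (extChartAt (𝓡∂ 2) b).injOn hx hy (planeEquiv.injective h)

theorem coord_re (b x : M) : (coord b x).re = extChartAt (𝓡∂ 2) b x 0 := planeEquiv_re _

theorem coord_re_nonneg (b x : M) : 0 ≤ (coord b x).re := by
  rw [coord_re]
  have : extChartAt (𝓡∂ 2) b x ∈ range (𝓡∂ 2) := by
    rw [extChartAt_coe]; exact mem_range_self _
  rw [range_modelWithCornersEuclideanHalfSpace] at this
  exact this

variable [IsManifold (𝓡∂ 2) ∞ M]

/-- Being an interior point can be tested in any chart of the smooth atlas, and there it means that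
the first coordinate is positive. -/
theorem mem_interior_iff {b x : M} (hx : x ∈ dom b) :
    x ∈ (𝓡∂ 2).interior M ↔ 0 < (coord b x).re := by
  rw [coord_re, ModelWithCorners.interior, mem_ofPred_eq,
    ModelWithCorners.isInteriorPoint_iff_of_mem_atlas (n := ∞) (by simp)
      (chart_mem_atlas _ b) hx]
  have h1 := interior_range_modelWithCornersEuclideanHalfSpace 2
  constructor
  · intro h
    have : (chartAt (EuclideanHalfSpace 2) b).extend (𝓡∂ 2) x ∈ interior (range (𝓡∂ 2)) :=
      interior_mono ((chartAt (EuclideanHalfSpace 2) b).extend_target_subset_range) h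
    rw [h1] at this
    exact this
  · intro h
    have h2 : (chartAt (EuclideanHalfSpace 2) b).extend (𝓡∂ 2) x ∈ interior (range (𝓡∂ 2)) := by
      rw [h1]; exact h
    exact (chartAt (EuclideanHalfSpace 2) b).mem_interior_extend_target
      (OpenPartialHomeomorph.map_source _ hx) h2

/-- Differences of points read in two charts agree, up to a constant factor and a factor of
positive real part, near every point. -/
theorem exists_coord_ratio (hor : OrientedAtlas M) {b b' p : M} (hb : p ∈ dom b) (hb' : p ∈ dom b') :
    ∃ α : ℂ, α ≠ 0 ∧ ∃ U : Set M, IsOpen U ∧ p ∈ U ∧ U ⊆ dom b ∩ dom b' ∧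
      ∀ x ∈ U, ∀ y ∈ U, x ≠ y →
        0 < ((coord b' x - coord b' y) / (α * (coord b x - coord b y))).re := by
  set S := range (𝓡∂ 2) with hS
  set Φ := extChartAt (𝓡∂ 2) b' ∘ (extChartAt (𝓡∂ 2) b).symm with hΦ
  set z₀ := extChartAt (𝓡∂ 2) b p with hz₀
  have hbs : p ∈ (extChartAt (𝓡∂ 2) b).source := by rwa [extChartAt_source]
  have hbs' : p ∈ (extChartAt (𝓡∂ 2) b').source := by rwa [extChartAt_source]
  have hsrc : z₀ ∈ ((extChartAt (𝓡∂ 2) b).symm.trans (extChartAt (𝓡∂ 2) b')).source := by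
    rw [PartialEquiv.trans_source, PartialEquiv.symm_source]
    refine ⟨(extChartAt (𝓡∂ 2) b).map_source hbs, ?_⟩
    rw [mem_preimage, hz₀, (extChartAt (𝓡∂ 2) b).left_inv hbs]
    exact hbs'
  have hdet := hor (chartAt _ b) (chart_mem_atlas _ b) (chartAt _ b') (chart_mem_atlas _ b') z₀ hsrc
  have hz₀S : z₀ ∈ S := by rw [hz₀, extChartAt_coe]; exact mem_range_self _
  have hcd : ContDiffWithinAt ℝ ∞ Φ S z₀ := contDiffWithinAt_ext_coord_change b' b hsrc
  have hconv : Convex ℝ S := (𝓡∂ 2).convex_range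
  set A := fderivWithin ℝ Φ S z₀ with hA
  obtain ⟨α, β, hβα, hAv⟩ := exists_conformal_part A hdet
  have hα : α ≠ 0 := by rintro rfl; simp at hβα; linarith [norm_nonneg β]
  have hcont : ContinuousWithinAt (fderivWithin ℝ Φ S) S z₀ :=
    (hcd.fderivWithin_right (m := 0) (𝓡∂ 2).uniqueDiffOn (by simp) hz₀S).continuousWithinAt
  -- The derivative of the coordinate change is continuous up to the edge of the half-plane.
  -- Deviating from `A` by less than `(|α| - |β|) / 2`, together with the conjugate-linear part `β`,
  -- it stays dominated by `α`.
  have hev1 : ∀ᶠ y in 𝓝[S] z₀, ‖fderivWithin ℝ Φ S y - A‖ < (‖α‖ - ‖β‖) / 2 := by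
    have := Metric.tendsto_nhds.1 hcont ((‖α‖ - ‖β‖) / 2) (by linarith)
    simpa [dist_eq_norm] using this
  have hev2 : ∀ᶠ y in 𝓝[S] z₀, ContDiffWithinAt ℝ 1 Φ S y := by
    have := (hcd.of_le (m := 1) (by norm_cast)).eventually (by simp)
    rwa [insert_eq_of_mem hz₀S] at this
  obtain ⟨δ, hδ, hball⟩ := Metric.mem_nhdsWithin_iff.1 (hev1.and hev2)
  set B := Metric.ball z₀ δ ∩ S with hB
  have hBconv : Convex ℝ B := (convex_ball _ _).inter hconv
  -- Mean value inequality on the convex set `B`, a half-plane intersected with a ball; convexity is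
  -- what lets boundary points be treated like interior ones.
  have key : ∀ x ∈ B, ∀ y ∈ B, ‖Φ y - Φ x - A (y - x)‖ ≤ (‖α‖ - ‖β‖) / 2 * ‖y - x‖ := by
    intro x hx y hy
    refine Convex.norm_image_sub_le_of_norm_hasFDerivWithin_le' (f' := fderivWithin ℝ Φ S)
      (s := B) (fun w hw => ?_) (fun w hw => (hball hw).1.le) hBconv hx hy
    exact (((hball hw).2.differentiableWithinAt (by simp)).hasFDerivWithinAt).mono inter_subset_right
  refine ⟨α, hα, (dom b ∩ dom b') ∩ (dom b ∩ extChartAt (𝓡∂ 2) b ⁻¹' Metric.ball z₀ δ), ?_,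
    ⟨⟨hb, hb'⟩, hb, ?_⟩, inter_subset_left, ?_⟩
  · refine ((dom_open b).inter (dom_open b')).inter ?_
    have h : ContinuousOn (extChartAt (𝓡∂ 2) b) (extChartAt (𝓡∂ 2) b).source :=
      continuousOn_extChartAt b
    rw [extChartAt_source] at h
    exact h.isOpen_inter_preimage (dom_open b) Metric.isOpen_ball
  · exact Metric.mem_ball_self hδ
  · rintro x ⟨⟨hx, -⟩, -, hxB⟩ y ⟨⟨hy, -⟩, -, hyB⟩ hxy
    have hx1 : x ∈ (extChartAt (𝓡∂ 2) b).source := by rwa [extChartAt_source]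
    have hy1 : y ∈ (extChartAt (𝓡∂ 2) b).source := by rwa [extChartAt_source]
    have hmem : ∀ w : M, extChartAt (𝓡∂ 2) b w ∈ S := fun w => by
      rw [extChartAt_coe]; exact mem_range_self _
    have h1 := key _ ⟨hyB, hmem y⟩ _ ⟨hxB, hmem x⟩
    have hΦx : ∀ w ∈ (extChartAt (𝓡∂ 2) b).source, Φ (extChartAt (𝓡∂ 2) b w) =
        extChartAt (𝓡∂ 2) b' w := fun w hw => by
      rw [hΦ, Function.comp, (extChartAt (𝓡∂ 2) b).left_inv hw]
    rw [hΦx x hx1, hΦx y hy1] at h1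
    set v := extChartAt (𝓡∂ 2) b x - extChartAt (𝓡∂ 2) b y with hv
    have hz : coord b x - coord b y = planeEquiv v := by rw [hv, map_sub]; rfl
    have hz0 : 0 < ‖planeEquiv v‖ := by
      rw [← hz, norm_pos_iff, sub_ne_zero]
      exact fun h => hxy (coord_injOn b hx hy h)
    rw [hz]
    refine re_div_pos_of_norm_sub_lt ?_
    have e : coord b' x - coord b' y - α * planeEquiv v =
        planeEquiv (extChartAt (𝓡∂ 2) b' x - extChartAt (𝓡∂ 2) b' y - A v) +
          β * (starRingEnd ℂ) (planeEquiv v) := by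
      rw [map_sub planeEquiv _ (A v), map_sub planeEquiv (extChartAt (𝓡∂ 2) b' x), hAv]
      simp only [coord]
      ring
    rw [e, norm_mul]
    calc _ ≤ ‖planeEquiv (extChartAt (𝓡∂ 2) b' x - extChartAt (𝓡∂ 2) b' y - A v)‖ +
          ‖β * (starRingEnd ℂ) (planeEquiv v)‖ := norm_add_le _ _
      _ ≤ (‖α‖ - ‖β‖) / 2 * ‖planeEquiv v‖ + ‖β‖ * ‖planeEquiv v‖ := by
        rw [norm_mul, Complex.norm_conj, LinearIsometryEquiv.norm_map,
          LinearIsometryEquiv.norm_map]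
        exact add_le_add h1 le_rfl
      _ < ‖α‖ * ‖planeEquiv v‖ := by nlinarith

/-! ### Transverse intersections of parametrized curves -/

/-- The determinant of the velocities of `f` at `s` and of `h` at `t`, in the chart at `f s`. -/
def crossDet (f h : ℝ → M) (s t : ℝ) : ℝ :=
  deriv (fun u => extChartAt (𝓡∂ 2) (f s) (f u)) s 0 *
    deriv (fun u => extChartAt (𝓡∂ 2) (f s) (h u)) t 1 -
  deriv (fun u => extChartAt (𝓡∂ 2) (f s) (f u)) s 1 *
    deriv (fun u => extChartAt (𝓡∂ 2) (f s) (h u)) t 0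

/-- The curves `f` and `h` intersect transversally at the parameters `s` and `t`. -/
def TransAt (f h : ℝ → M) (s t : ℝ) : Prop :=
  DifferentiableAt ℝ (fun u => extChartAt (𝓡∂ 2) (f s) (f u)) s ∧
    DifferentiableAt ℝ (fun u => extChartAt (𝓡∂ 2) (f s) (h u)) t ∧ crossDet f h s t ≠ 0

/-- The sign of an intersection. -/
def crossSign (f h : ℝ → M) (s t : ℝ) : ℤ := (SignType.sign (crossDet f h s t) : ℤ)

/-- The difference of two curves, read in the chart at `b`. -/
def diffIn (b : M) (f h : ℝ → M) (s t : ℝ) : ℂ := coord b (f s) - coord b (h t)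

omit [IsManifold (𝓡∂ 2) ∞ M] in
-- The remainders of the two curves depend on separate variables, so their first-order expansions
-- add up to an expansion of the difference.
theorem diffIn_approx {f h : ℝ → M} {s t : ℝ} (hst : f s = h t) (ht : TransAt f h s t) :
    ∃ p q : ℂ, crossDet f h s t = p.re * q.im - p.im * q.re ∧
    ∀ ε > 0, ∃ δ > 0, ∀ s' t', |s' - s| ≤ δ → |t' - t| ≤ δ →
      ‖diffIn (f s) f h s' t' - (p * ((s' - s : ℝ) : ℂ) - q * ((t' - t : ℝ) : ℂ))‖ ≤
        ε * (|s' - s| + |t' - t|) := by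
  obtain ⟨hf, hh, -⟩ := ht
  refine ⟨planeEquiv (deriv (fun u => extChartAt (𝓡∂ 2) (f s) (f u)) s),
    planeEquiv (deriv (fun u => extChartAt (𝓡∂ 2) (f s) (h u)) t), ?_, ?_⟩
  · simp only [planeEquiv_re, planeEquiv_im, crossDet]
  intro ε hε
  have hf' := hf.hasDerivAt
  have hh' := hh.hasDerivAt
  rw [hasDerivAt_iff_isLittleO] at hf' hh'
  obtain ⟨δ₁, hδ₁, h1⟩ := Metric.eventually_nhds_iff.1 (hf'.def hε)
  obtain ⟨δ₂, hδ₂, h2⟩ := Metric.eventually_nhds_iff.1 (hh'.def hε)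
  refine ⟨min δ₁ δ₂ / 2, by positivity, fun s' t' hs' ht' => ?_⟩
  have g1 := @h1 s' (by
    rw [Real.dist_eq]
    have := min_le_left δ₁ δ₂
    have := lt_min hδ₁ hδ₂
    linarith)
  have g2 := @h2 t' (by
    rw [Real.dist_eq]
    have := min_le_right δ₁ δ₂
    have := lt_min hδ₁ hδ₂
    linarith)
  have e : diffIn (f s) f h s' t' -
      (planeEquiv (deriv (fun u => extChartAt (𝓡∂ 2) (f s) (f u)) s) * ((s' - s : ℝ) : ℂ) -
        planeEquiv (deriv (fun u => extChartAt (𝓡∂ 2) (f s) (h u)) t) * ((t' - t : ℝ) : ℂ)) =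
      planeEquiv (extChartAt (𝓡∂ 2) (f s) (f s') - extChartAt (𝓡∂ 2) (f s) (f s) -
        (s' - s) • deriv (fun u => extChartAt (𝓡∂ 2) (f s) (f u)) s) -
      planeEquiv (extChartAt (𝓡∂ 2) (f s) (h t') - extChartAt (𝓡∂ 2) (f s) (h t) -
        (t' - t) • deriv (fun u => extChartAt (𝓡∂ 2) (f s) (h u)) t) := by
    rw [← hst]
    simp only [map_sub, map_smul, diffIn, coord, Complex.real_smul]
    ring
  rw [e]
  refine (norm_sub_le _ _).trans ?_
  rw [LinearIsometryEquiv.norm_map, LinearIsometryEquiv.norm_map, mul_add]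
  exact add_le_add (by simpa using g1) (by simpa using g2)

/-- The winding number of the difference of two curves, read in any chart, around a box with a
single transverse intersection. -/
theorem boxVar_diffIn (hor : OrientedAtlas M) {b : M} {f h : ℝ → M} (hf : Continuous f)
    (hh : Continuous h) {a a' c c' s t : ℝ} (hs : s ∈ Ioo a a') (ht : t ∈ Ioo c c')
    (hfb : ∀ u ∈ Icc a a', f u ∈ dom b) (hhb : ∀ u ∈ Icc c c', h u ∈ dom b)
    (hst : f s = h t) (htr : TransAt f h s t)
    (honly : ∀ u ∈ Icc a a', ∀ v ∈ Icc c c', f u = h v → u = s ∧ v = t) :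
    boxVar (diffIn b f h) a a' c c' = 2 * Real.pi * Complex.I * (crossSign f h s t : ℂ) := by
  have hcont : ∀ (b : M) {a a' c c' : ℝ}, (∀ u ∈ Icc a a', f u ∈ dom b) →
      (∀ u ∈ Icc c c', h u ∈ dom b) →
      ContinuousOn (Function.uncurry (diffIn b f h)) (Icc a a' ×ˢ Icc c c') := by
    intro b a a' c c' h1 h2
    refine ContinuousOn.sub ?_ ?_
    · exact (coord_continuousOn b).comp (hf.comp continuous_fst).continuousOn fun x hx => h1 _ hx.1
    · exact (coord_continuousOn b).comp (hh.comp continuous_snd).continuousOn fun x hx => h2 _ hx.2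
  have hzero : ∀ (b : M) {a a' c c' : ℝ}, (∀ u ∈ Icc a a', f u ∈ dom b) →
      (∀ u ∈ Icc c c', h u ∈ dom b) → ∀ u ∈ Icc a a', ∀ v ∈ Icc c c',
      diffIn b f h u v = 0 → f u = h v := fun b _ _ _ _ h1 h2 u hu v hv h0 =>
    coord_injOn b (h1 u hu) (h2 v hv) (sub_eq_zero.1 h0)
  obtain ⟨R₁, hR₁, hloc⟩ := boxVar_localize hs ht (hcont b hfb hhb) fun u hu v hv h0 =>
    honly u hu v hv (hzero b hfb hhb u hu v hv h0)
  obtain ⟨p, q, hpq, happ⟩ := diffIn_approx hst htr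
  obtain ⟨R₂, hR₂, hsq⟩ := boxVar_of_approx (F := diffIn (f s) f h) (s₀ := s) (t₀ := t)
    (by rw [← hpq]; exact htr.2.2) happ
  obtain ⟨α, hα, U, hU, hpU, hUd, hrat⟩ := exists_coord_ratio hor (b := f s) (b' := b) (mem_dom (f s))
    (hfb s ⟨hs.1.le, hs.2.le⟩)
  obtain ⟨δ₁, hδ₁, hU1⟩ := Metric.isOpen_iff.1 (hU.preimage hf) s hpU
  obtain ⟨δ₂, hδ₂, hU2⟩ := Metric.isOpen_iff.1 (hU.preimage hh) t (by
    rw [mem_preimage, ← hst]; exact hpU)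
  set r := min (min R₁ R₂) (min δ₁ δ₂) / 2 with hr
  have hmin : 0 < min (min R₁ R₂) (min δ₁ δ₂) := by positivity
  have hr0 : 0 < r := by positivity
  have hrR₁ : r ≤ R₁ := by
    have : min (min R₁ R₂) (min δ₁ δ₂) ≤ R₁ := (min_le_left _ _).trans (min_le_left _ _)
    linarith
  have hrR₂ : r ≤ R₂ := by
    have : min (min R₁ R₂) (min δ₁ δ₂) ≤ R₂ := (min_le_left _ _).trans (min_le_right _ _)
    linarith
  have hrδ₁ : r < δ₁ := by
    have : min (min R₁ R₂) (min δ₁ δ₂) ≤ δ₁ := (min_le_right _ _).trans (min_le_left _ _)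
    linarith
  have hrδ₂ : r < δ₂ := by
    have : min (min R₁ R₂) (min δ₁ δ₂) ≤ δ₂ := (min_le_right _ _).trans (min_le_right _ _)
    linarith
  have hfU : ∀ u ∈ Icc (s - r) (s + r), f u ∈ U := fun u hu => hU1 (by
    rw [Metric.mem_ball, Real.dist_eq]
    exact (abs_le.2 ⟨by linarith [hu.1], by linarith [hu.2]⟩).trans_lt hrδ₁)
  have hhU : ∀ u ∈ Icc (t - r) (t + r), h u ∈ U := fun u hu => hU2 (by
    rw [Metric.mem_ball, Real.dist_eq]
    exact (abs_le.2 ⟨by linarith [hu.1], by linarith [hu.2]⟩).trans_lt hrδ₂)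
  obtain ⟨⟨i1, i2, i3, i4⟩, hok, hbox⟩ := hloc r hr0 hrR₁
  have hok' : BoxOK (diffIn (f s) f h) (s - r) (s + r) (t - r) (t + r) := by
    have hz : ∀ u ∈ Icc (s - r) (s + r), ∀ v ∈ Icc (t - r) (t + r),
        diffIn (f s) f h u v = 0 → u = s ∧ v = t := by
      intro u hu v hv h0
      exact honly u ⟨i1.trans hu.1, hu.2.trans i2⟩ v ⟨i3.trans hv.1, hv.2.trans i4⟩
        (hzero (f s) (fun u hu => (hUd (hfU u hu)).1) (fun u hu => (hUd (hhU u hu)).1) u hu v hv h0)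
    have l1 : s - r ≤ s + r := by linarith
    have l2 : t - r ≤ t + r := by linarith
    refine ⟨l1, l2, hcont _ (fun u hu => (hUd (hfU u hu)).1)
      (fun u hu => (hUd (hhU u hu)).1), ?_, ?_, ?_, ?_⟩
    · intro v hv h0
      linarith [(hz _ (left_mem_Icc.2 l1) _ hv h0).1]
    · intro v hv h0
      linarith [(hz _ (right_mem_Icc.2 l1) _ hv h0).1]
    · intro v hv h0
      linarith [(hz _ hv _ (left_mem_Icc.2 l2) h0).2]
    · intro v hv h0
      linarith [(hz _ hv _ (right_mem_Icc.2 l2) h0).2]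
  -- Shrink the box to a small square around the crossing, pass from the chart at `b` to the chart
  -- at the crossing, and use the linear approximation there.
  rw [hbox, boxVar_ratio hα hok' hok fun u hu v hv hn => hrat _ (hfU u hu) _ (hhU v hv) fun h =>
    hn (sub_eq_zero.2 (congrArg _ h)), hsq r hr0 hrR₂ hok', crossSign, hpq]

end Charts

/-! ### Classes of paths as elements of the fundamental group -/

section PathClasses

open Set

set_option linter.unusedSectionVars false

variable {M : Type*} [TopologicalSpace M]

theorem loopClass_trans {x₀ : M} (p q : Path.Homotopic.Quotient x₀ x₀) :
    loopClass (p.trans q) = loopClass p * loopClass q := rfl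

theorem loopClass_injective {x₀ : M} : Function.Injective (loopClass (x₀ := x₀)) :=
  fun _ _ h => MulOpposite.op_injective h

theorem loopClass_surjective {x₀ : M} : Function.Surjective (loopClass (x₀ := x₀)) :=
  fun g => ⟨FundamentalGroup.toPath g.unop, rfl⟩

variable [PathConnectedSpace M] (x₀ : M)

/-- A chosen class of arcs from the basepoint to a point, trivial at the basepoint. -/
def arc (p : M) : Path.Homotopic.Quotient x₀ p :=
  open Classical in
  if h : p = x₀ then (Path.Homotopic.Quotient.refl x₀).cast rfl h else Path.Homotopic.Quotient.mk (PathConnectedSpace.somePath x₀ p)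

theorem arc_self : arc x₀ x₀ = Path.Homotopic.Quotient.refl x₀ := by
  simp [arc]

/-- The element of the fundamental group obtained from a class of paths by joining its ends to the
basepoint with the chosen arcs. -/
def el {p q : M} (c : Path.Homotopic.Quotient p q) : LoopGroup x₀ :=
  loopClass ((arc x₀ p).trans (c.trans (arc x₀ q).symm))

theorem el_loop (c : Path.Homotopic.Quotient x₀ x₀) : el x₀ c = loopClass c := by
  have : (Path.Homotopic.Quotient.refl x₀).symm = Path.Homotopic.Quotient.refl x₀ := by
    rw [← Path.Homotopic.Quotient.mk_refl, ← Path.Homotopic.Quotient.mk_symm, Path.refl_symm]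
  rw [el, arc_self, this, Path.Homotopic.Quotient.trans_refl, Path.Homotopic.Quotient.refl_trans]

/-- The inner arcs cancel. Thus `el` carries the fundamental groupoid to the group `LoopGroup x₀`,
and identities between paths with varying ends become identities in one group. -/
theorem el_trans {p q r : M} (c : Path.Homotopic.Quotient p q) (d : Path.Homotopic.Quotient q r) :
    el x₀ (c.trans d) = el x₀ c * el x₀ d := by
  rw [el, el, el, ← loopClass_trans]
  congr 1
  simp only [Path.Homotopic.Quotient.trans_assoc]
  rw [← Path.Homotopic.Quotient.trans_assoc (arc x₀ q).symm (arc x₀ q), Path.Homotopic.Quotient.symm_trans, Path.Homotopic.Quotient.refl_trans]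

theorem el_refl (p : M) : el x₀ (Path.Homotopic.Quotient.refl p) = 1 := by
  have h : el x₀ (Path.Homotopic.Quotient.refl p) * el x₀ (Path.Homotopic.Quotient.refl p) = el x₀ (Path.Homotopic.Quotient.refl p) := by
    rw [← el_trans, Path.Homotopic.Quotient.refl_trans]
  exact mul_eq_right.1 h

theorem el_symm {p q : M} (c : Path.Homotopic.Quotient p q) : el x₀ c.symm = (el x₀ c)⁻¹ := by
  rw [eq_inv_iff_mul_eq_one, ← el_trans, Path.Homotopic.Quotient.symm_trans, el_refl]

theorem el_cast {p q p' q' : M} (c : Path.Homotopic.Quotient p q) (hp : p' = p) (hq : q' = q) :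
    el x₀ (c.cast hp hq) = el x₀ c := by
  subst hp hq
  rw [Path.Homotopic.Quotient.cast_rfl_rfl]

theorem el_injective {p q : M} {c d : Path.Homotopic.Quotient p q} (h : el x₀ c = el x₀ d) :
    c = d := by
  have h1 := loopClass_injective h
  have h2 : ∀ c : Path.Homotopic.Quotient p q, c = (arc x₀ p).symm.trans
      (((arc x₀ p).trans (c.trans (arc x₀ q).symm)).trans (arc x₀ q)) := by
    intro c
    simp only [Path.Homotopic.Quotient.trans_assoc, Path.Homotopic.Quotient.symm_trans, Path.Homotopic.Quotient.trans_refl]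
    rw [← Path.Homotopic.Quotient.trans_assoc, Path.Homotopic.Quotient.symm_trans, Path.Homotopic.Quotient.refl_trans]
  rw [h2 c, h1, ← h2 d]

theorem el_surjective (p q : M) (g : LoopGroup x₀) : ∃ c : Path p q, el x₀ (Path.Homotopic.Quotient.mk c) = g := by
  obtain ⟨d, rfl⟩ := loopClass_surjective g
  obtain ⟨c, hc⟩ := Path.Homotopic.Quotient.mk_surjective ((arc x₀ p).symm.trans (d.trans (arc x₀ q)))
  refine ⟨c, ?_⟩
  rw [hc, el]
  congr 1
  simp only [Path.Homotopic.Quotient.trans_assoc, Path.Homotopic.Quotient.trans_symm, Path.Homotopic.Quotient.trans_refl]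
  rw [← Path.Homotopic.Quotient.trans_assoc, Path.Homotopic.Quotient.trans_symm, Path.Homotopic.Quotient.refl_trans]

theorem el_eq_of_forall {a b a' b' : M} (p : Path a b) (q : Path a' b') (h : ∀ t, p t = q t) :
    el x₀ (Path.Homotopic.Quotient.mk p) = el x₀ (Path.Homotopic.Quotient.mk q) := by
  have ha : a = a' := by rw [← p.source, ← q.source, h]
  have hb : b = b' := by rw [← p.target, ← q.target, h]
  subst ha hb
  rw [Path.ext (funext h)]

/-- The part of the curve `f` from the parameter `a` to the parameter `b`. -/
def segPath (f : C(ℝ, M)) (a b : ℝ) : Path (f a) (f b) where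
  toFun u := f (a + u * (b - a))
  continuous_toFun := f.continuous.comp (by fun_prop)
  source' := by simp
  target' := by simp

/-- The class of the part of the curve `f` from `a` to `b`. -/
def hol (f : C(ℝ, M)) (a b : ℝ) : LoopGroup x₀ := el x₀ (Path.Homotopic.Quotient.mk (segPath f a b))

/-- Two paths in the line with the same ends are homotopic, so `hol` does not see parametrizations.
-/
theorem hol_eq_of_path (f : C(ℝ, M)) {a b : ℝ} (p : Path a b) {c d : M} (q : Path c d)
    (h : ∀ t, q t = f (p t)) : el x₀ (Path.Homotopic.Quotient.mk q) = hol x₀ f a b := by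
  have h1 : el x₀ (Path.Homotopic.Quotient.mk q) = el x₀ (Path.Homotopic.Quotient.mk (p.map f.continuous)) :=
    el_eq_of_forall x₀ _ _ h
  have h2 : el x₀ (Path.Homotopic.Quotient.mk (segPath f a b)) =
      el x₀ (Path.Homotopic.Quotient.mk ((segPath (ContinuousMap.id ℝ) a b).map f.continuous)) :=
    el_eq_of_forall x₀ _ _ fun t => rfl
  rw [h1, hol, h2]
  congr 1
  exact Path.Homotopic.Quotient.eq.2 (Path.Homotopic.map (SimplyConnectedSpace.paths_homotopic p _) f)

theorem hol_trans (f : C(ℝ, M)) (a b c : ℝ) : hol x₀ f a b * hol x₀ f b c = hol x₀ f a c := by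
  rw [hol, hol, ← el_trans, ← Path.Homotopic.Quotient.mk_trans]
  refine hol_eq_of_path x₀ f ((segPath (ContinuousMap.id ℝ) a b).trans
    (segPath (ContinuousMap.id ℝ) b c)) _ fun t => ?_
  have : (segPath f a b).trans (segPath f b c) = ((segPath (ContinuousMap.id ℝ) a b).trans
    (segPath (ContinuousMap.id ℝ) b c)).map f.continuous := by
    rw [Path.map_trans]
    rfl
  rw [this]
  rfl

theorem hol_self (f : C(ℝ, M)) (a : ℝ) : hol x₀ f a a = 1 := mul_eq_right.1 (hol_trans x₀ f a a a)

theorem hol_symm (f : C(ℝ, M)) (a b : ℝ) : hol x₀ f b a = (hol x₀ f a b)⁻¹ := by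
  rw [eq_inv_iff_mul_eq_one, hol_trans, hol_self]

theorem hol_comp (f : C(ℝ, M)) (φ : C(ℝ, ℝ)) (a b : ℝ) :
    hol x₀ (f.comp φ) a b = hol x₀ f (φ a) (φ b) :=
  hol_eq_of_path x₀ f ((segPath φ a b)) _ fun _ => rfl

theorem hol_congr {f g : C(ℝ, M)} {a b : ℝ} (h : EqOn f g (uIcc a b)) :
    hol x₀ f a b = hol x₀ g a b := by
  refine el_eq_of_forall x₀ _ _ fun t => h ?_
  rw [← segment_eq_uIcc, segment_eq_image']
  exact ⟨t, t.2, by simp [smul_eq_mul]⟩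

/-- The curve on the whole line which extends a path by constants. -/
def ext {a b : M} (p : Path a b) : C(ℝ, M) := ⟨p.extend, p.continuous_extend⟩

theorem hol_ext {a b : M} (p : Path a b) : hol x₀ (ext p) 0 1 = el x₀ (Path.Homotopic.Quotient.mk p) := by
  refine el_eq_of_forall x₀ _ _ fun t => ?_
  have h : ext p (0 + t * (1 - 0)) = p.extend t := by simp [ext]
  change ext p (0 + t * (1 - 0)) = _
  rw [h, Path.extend_apply p t.2]

theorem hol_ext_loop (p : Path x₀ x₀) : hol x₀ (ext p) 0 1 = loopClass (Path.Homotopic.Quotient.mk p) := by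
  rw [hol_ext, el_loop]

/-- The closed curve `γ` as a periodic function. -/
def per (γ : C(UnitAddCircle, M)) : C(ℝ, M) :=
  ⟨fun t => γ (t : UnitAddCircle), γ.continuous.comp (AddCircle.continuous_mk' (1 : ℝ))⟩

omit [PathConnectedSpace M] in
theorem per_add_one (γ : C(UnitAddCircle, M)) (t : ℝ) : per γ (t + 1) = per γ t := by
  simp only [per, ContinuousMap.coe_mk]
  rw [AddCircle.coe_add, AddCircle.coe_period, add_zero]

omit [PathConnectedSpace M] in
theorem per_add_int (γ : C(UnitAddCircle, M)) (t : ℝ) (n : ℤ) : per γ (t + n) = per γ t := by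
  simp only [per, ContinuousMap.coe_mk]
  rw [AddCircle.coe_add]
  have : ((n : ℝ) : UnitAddCircle) = 0 := by
    rw [AddCircle.coe_eq_zero_iff]
    exact ⟨n, by simp⟩
  rw [this, add_zero]

theorem hol_per_add_int (γ : C(UnitAddCircle, M)) (a b : ℝ) (n : ℤ) :
    hol x₀ (per γ) (a + n) (b + n) = hol x₀ (per γ) a b := by
  refine el_eq_of_forall x₀ _ _ fun t => ?_
  change per γ (a + n + t * (b + n - (a + n))) = per γ (a + t * (b - a))
  rw [← per_add_int γ (a + t * (b - a)) n]
  congr 1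
  ring

theorem hol_per_add_nat (γ : C(UnitAddCircle, M)) (a : ℝ) (n : ℕ) :
    hol x₀ (per γ) a (a + n) = hol x₀ (per γ) a (a + 1) ^ n := by
  induction n with
  | zero => simp [hol_self]
  | succ n ih =>
    rw [← hol_trans x₀ _ a (a + n), ih, pow_succ, Nat.cast_succ]
    congr 1
    have := hol_per_add_int x₀ γ a (a + 1) n
    rw [← this]
    congr 1
    push_cast
    ring

/-- The closed curve given by a loop. -/
def circ {q : M} (p : Path q q) : C(UnitAddCircle, M) :=
  ⟨AddCircle.liftIco (1 : ℝ) 0 p.extend, AddCircle.liftIco_zero_continuous (by simp)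
    p.continuous_extend.continuousOn⟩

theorem circ_coe {q : M} (p : Path q q) {t : ℝ} (ht : t ∈ Icc (0 : ℝ) 1) :
    circ p (t : UnitAddCircle) = p.extend t := by
  rcases ht.2.lt_or_eq with h | rfl
  · have := AddCircle.liftIco_zero_coe_apply (p := (1 : ℝ)) (f := p.extend) (x := t) ⟨ht.1, h⟩
    exact this
  · have := AddCircle.liftIco_zero_coe_apply (p := (1 : ℝ)) (f := p.extend) (x := 0) (by simp)
    rw [AddCircle.coe_period, ← AddCircle.coe_zero]
    exact this.trans (by simp)

theorem circle_induction {P : UnitAddCircle → Prop} (h : ∀ t ∈ Icc (0 : ℝ) 1, P t) (s) : P s := by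
  obtain ⟨t, rfl⟩ := QuotientAddGroup.mk_surjective s
  have h1 := h (Int.fract t) ⟨Int.fract_nonneg t, (Int.fract_lt_one t).le⟩
  rwa [AddCircle.coe_fract] at h1

theorem circ_basedAt (γ : C(UnitAddCircle, M)) : circ (basedAt γ 0) = γ := by
  ext s
  induction s using circle_induction with
  | h t ht =>
    rw [circ_coe _ ht, Path.extend_apply _ ht]
    simp [basedAt]

/-- A homotopy of loops relative to the ends is a closed curve in the space `C(I, M)`; descending
this curve to the circle and evaluating it gives the free homotopy. -/
theorem circ_homotopic {q : M} {p r : Path q q} (h : p.Homotopic r) :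
    ContinuousMap.Homotopic (circ p) (circ r) := by
  obtain ⟨H⟩ := h
  let G : C(ℝ, C(I, M)) := ⟨fun t => H.toHomotopy.toContinuousMap.comp
    ⟨fun u => (u, projIcc 0 1 zero_le_one t), by fun_prop⟩, by
      refine ContinuousMap.continuous_of_continuous_uncurry _ ?_
      exact H.toHomotopy.toContinuousMap.continuous.comp
        (continuous_snd.prodMk (continuous_projIcc.comp continuous_fst))⟩
  have hG : G 0 = G (0 + 1) := by
    ext u
    simp [G]
  let L : C(UnitAddCircle, C(I, M)) :=
    ⟨AddCircle.liftIco (1 : ℝ) 0 G, AddCircle.liftIco_continuous hG G.continuous.continuousOn⟩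
  have hL : ∀ t ∈ Icc (0 : ℝ) 1, L (t : UnitAddCircle) = G t := by
    intro t ht
    rcases ht.2.lt_or_eq with h | rfl
    · exact AddCircle.liftIco_zero_coe_apply (p := (1 : ℝ)) (f := G) (x := t) ⟨ht.1, h⟩
    · have := AddCircle.liftIco_zero_coe_apply (p := (1 : ℝ)) (f := G) (x := 0) (by simp)
      rw [AddCircle.coe_period, ← AddCircle.coe_zero]
      exact this.trans (by rw [hG, zero_add])
  refine ⟨⟨⟨fun z => L z.2 z.1, ?_⟩, fun s => ?_, fun s => ?_⟩⟩
  · exact continuous_eval.comp ((L.continuous.comp continuous_snd).prodMk continuous_fst)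
  · induction s using circle_induction with
    | h t ht =>
      change L t 0 = _
      rw [hL t ht, circ_coe _ ht, Path.extend_apply _ ht, projIcc_of_mem zero_le_one ht |>.symm]
      simp [G]
  · induction s using circle_induction with
    | h t ht =>
      change L t 1 = _
      rw [hL t ht, circ_coe _ ht, Path.extend_apply _ ht, projIcc_of_mem zero_le_one ht |>.symm]
      simp [G]

/-- The four sides of a square. -/
theorem hol_square (K : C(ℝ × ℝ, M)) :
    hol x₀ (K.comp ⟨fun t => (t, 0), by fun_prop⟩) 0 1 *
      hol x₀ (K.comp ⟨fun u => (1, u), by fun_prop⟩) 0 1 =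
    hol x₀ (K.comp ⟨fun u => (0, u), by fun_prop⟩) 0 1 *
      hol x₀ (K.comp ⟨fun t => (t, 1), by fun_prop⟩) 0 1 := by
  rw [hol, hol, hol, hol, ← el_trans, ← el_trans]
  congr 1
  rw [← Path.Homotopic.Quotient.mk_trans, ← Path.Homotopic.Quotient.mk_trans]
  refine Path.Homotopic.Quotient.eq.2 ?_
  let f1 : C(ℝ, ℝ × ℝ) := ⟨fun t => (t, 0), by fun_prop⟩
  let f2 : C(ℝ, ℝ × ℝ) := ⟨fun u => (1, u), by fun_prop⟩
  let f3 : C(ℝ, ℝ × ℝ) := ⟨fun u => (0, u), by fun_prop⟩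
  let f4 : C(ℝ, ℝ × ℝ) := ⟨fun t => (t, 1), by fun_prop⟩
  have := Path.Homotopic.map (SimplyConnectedSpace.paths_homotopic
    ((segPath f1 0 1).trans (segPath f2 0 1)) ((segPath f3 0 1).trans (segPath f4 0 1))) K
  rw [Path.map_trans, Path.map_trans] at this
  exact this

/-- A free homotopy on the strip is a square whose two vertical sides follow the same track; going
around it conjugates one closed curve into the other by the class of this track. -/
theorem hol_conj_of_homotopic {γ δ : C(UnitAddCircle, M)} (h : ContinuousMap.Homotopic γ δ) :
    ∃ g : LoopGroup x₀, hol x₀ (per δ) 0 1 = g⁻¹ * hol x₀ (per γ) 0 1 * g := by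
  obtain ⟨H⟩ := h
  let K : C(ℝ × ℝ, M) := ⟨fun z => H (projIcc 0 1 zero_le_one z.2, (z.1 : UnitAddCircle)),
    H.continuous.comp ((continuous_projIcc.comp continuous_snd).prodMk
      ((AddCircle.continuous_mk' (1 : ℝ)).comp continuous_fst))⟩
  have h1 : K.comp ⟨fun t => (t, 0), by fun_prop⟩ = per γ := by
    ext t
    simp [K, per]
  have h2 : K.comp ⟨fun t => (t, 1), by fun_prop⟩ = per δ := by
    ext t
    simp [K, per]
  have h3 : K.comp ⟨fun u => (1, u), by fun_prop⟩ = K.comp ⟨fun u => (0, u), by fun_prop⟩ := by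
    ext t
    simp only [K, ContinuousMap.comp_apply, ContinuousMap.coe_mk]
    rw [AddCircle.coe_period, ← AddCircle.coe_zero]
  have := hol_square x₀ K
  rw [h1, h2, h3] at this
  exact ⟨_, by rw [mul_assoc, this, inv_mul_cancel_left]⟩

end PathClasses

/-! ### Coordinate discs -/

section Discs

open Set Filter Topology MeasureTheory

set_option linter.unusedSectionVars false

variable {M : Type*} [TopologicalSpace M] [ChartedSpace (EuclideanHalfSpace 2) M]

/-- The point with a given coordinate in the chart at `b`. -/
def uncoord (b : M) (w : ℂ) : M := (extChartAt (𝓡∂ 2) b).symm (planeEquiv.symm w)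

theorem uncoord_coord {b x : M} (hx : x ∈ dom b) : uncoord b (coord b x) = x := by
  rw [uncoord, coord, LinearIsometryEquiv.symm_apply_apply, PartialEquiv.left_inv]
  rwa [extChartAt_source]

variable (M) in
/-- A convex region of a chart: the points whose coordinate lies in a ball, all points of the
half-plane in the ball being coordinates. -/
structure Disc where
  b : M
  z : ℂ
  r : ℝ
  surj : ∀ w, ‖w - z‖ < r → 0 ≤ w.re → ∃ x ∈ dom b, coord b x = w

namespace Disc

variable (Q : Disc M)

/-- The points of the disc. -/
def U : Set M := {x | x ∈ dom Q.b ∧ ‖coord Q.b x - Q.z‖ < Q.r}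

/-- The coordinates of the points of the disc. -/
def K : Set ℂ := {w | ‖w - Q.z‖ < Q.r ∧ 0 ≤ w.re}

theorem K_convex : Convex ℝ Q.K := by
  have : Q.K = Metric.ball Q.z Q.r ∩ {w | 0 ≤ w.re} := by
    ext w
    simp [K, dist_eq_norm]
  rw [this]
  exact (convex_ball _ _).inter (convex_halfSpace_re_ge 0)

theorem coord_mem {x : M} (hx : x ∈ Q.U) : coord Q.b x ∈ Q.K := ⟨hx.2, coord_re_nonneg _ _⟩

theorem uncoord_spec {w : ℂ} (hw : w ∈ Q.K) :
    uncoord Q.b w ∈ Q.U ∧ coord Q.b (uncoord Q.b w) = w := by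
  obtain ⟨x, hx, rfl⟩ := Q.surj w hw.1 hw.2
  rw [uncoord_coord hx]
  exact ⟨⟨hx, hw.1⟩, rfl⟩

theorem uncoord_continuousOn : ContinuousOn (uncoord Q.b) Q.K := by
  refine (continuousOn_extChartAt_symm Q.b).comp
    planeEquiv.symm.continuous.continuousOn fun w hw => ?_
  obtain ⟨x, hx, rfl⟩ := Q.surj w hw.1 hw.2
  rw [coord, LinearIsometryEquiv.symm_apply_apply]
  exact (extChartAt (𝓡∂ 2) Q.b).map_source (by rwa [extChartAt_source])

/-- The chart is open onto the half-plane, so a relative ball of coordinates around `p` is reached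
by points of `O`. Such half-balls are convex even at boundary points. -/
theorem exists_disc {b p : M} (hp : p ∈ dom b) {O : Set M} (hO : O ∈ 𝓝 p) :
    ∃ Q : Disc M, Q.b = b ∧ Q.z = coord b p ∧ 0 < Q.r ∧ Q.U ⊆ O := by
  have h1 := map_extChartAt_nhds' (x := b) (y := p) (by rwa [extChartAt_source (𝓡∂ 2)])
  have h2 : extChartAt (𝓡∂ 2) b '' (O ∩ dom b) ∈ 𝓝[range (𝓡∂ 2)] (extChartAt (𝓡∂ 2) b p) := by
    rw [← h1]
    exact image_mem_map (inter_mem hO ((dom_open b).mem_nhds hp))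
  obtain ⟨r, hr, h3⟩ := Metric.mem_nhdsWithin_iff.1 h2
  have h4 : ∀ w, ‖w - coord b p‖ < r → 0 ≤ w.re → ∃ x ∈ O ∩ dom b, coord b x = w := by
    intro w hw hw0
    obtain ⟨x, hx, h5⟩ := @h3 (planeEquiv.symm w) ⟨by
      rw [mem_ball_iff_norm, ← LinearIsometryEquiv.norm_map planeEquiv, map_sub,
        LinearIsometryEquiv.apply_symm_apply]
      exact hw, by
      rw [range_modelWithCornersEuclideanHalfSpace]
      change 0 ≤ (planeEquiv.symm w) 0
      rw [← planeEquiv_re, LinearIsometryEquiv.apply_symm_apply]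
      exact hw0⟩
    exact ⟨x, hx, by rw [coord, h5, LinearIsometryEquiv.apply_symm_apply]⟩
  refine ⟨⟨b, coord b p, r, fun w hw hw0 => ?_⟩, rfl, rfl, hr, ?_⟩
  · obtain ⟨x, hx, h5⟩ := h4 w hw hw0
    exact ⟨x, hx.2, h5⟩
  · rintro x ⟨hx, hx'⟩
    obtain ⟨y, hy, h5⟩ := h4 _ hx' (coord_re_nonneg b x)
    exact coord_injOn b hy.2 hx h5 ▸ hy.1

theorem U_open : IsOpen Q.U := by
  have := (coord_continuousOn Q.b).isOpen_inter_preimage (dom_open Q.b)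
    (Metric.isOpen_ball (x := Q.z) (ε := Q.r))
  convert this using 1
  ext x
  simp [U, dist_eq_norm]

/-- In coordinates the disc is a convex set, where any two paths with the same ends are homotopic.
-/
theorem el_eq [PathConnectedSpace M] (x₀ : M) {x y x' y' : M} (p : Path x y) (q : Path x' y')
    (hx : x = x') (hy : y = y') (hp : ∀ t, p t ∈ Q.U) (hq : ∀ t, q t ∈ Q.U) :
    el x₀ (Path.Homotopic.Quotient.mk p) = el x₀ (Path.Homotopic.Quotient.mk q) := by
  subst hx hy
  have hxU : x ∈ Q.U := by simpa using hp 0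
  have hyU : y ∈ Q.U := by simpa using hp 1
  have := Q.K_convex.contractibleSpace ⟨_, Q.coord_mem hxU⟩
  let lift : ∀ p : Path x y, (∀ t, p t ∈ Q.U) →
      Path (⟨_, Q.coord_mem hxU⟩ : Q.K) ⟨_, Q.coord_mem hyU⟩ := fun p hp =>
    { toFun := fun t => ⟨coord Q.b (p t), Q.coord_mem (hp t)⟩
      continuous_toFun := ((coord_continuousOn Q.b).comp_continuous p.continuous
        fun t => (hp t).1).subtype_mk _
      source' := by simp
      target' := by simp }
  let φ : C(Q.K, M) := ⟨fun w => uncoord Q.b w, Q.uncoord_continuousOn.comp_continuous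
    continuous_subtype_val fun w => w.2⟩
  have key : ∀ (p : Path x y) (hp : ∀ t, p t ∈ Q.U), el x₀ (Path.Homotopic.Quotient.mk p) =
      el x₀ (Path.Homotopic.Quotient.mk ((lift p hp).map φ.continuous)) := fun p hp =>
    el_eq_of_forall x₀ _ _ fun t => (uncoord_coord (hp t).1).symm
  rw [key p hp, key q hq]
  congr 1
  exact Path.Homotopic.Quotient.eq.2 (Path.Homotopic.map (SimplyConnectedSpace.paths_homotopic _ _) φ)

/-- The segment between two points of the disc. -/
def seg {x y : M} (hx : x ∈ Q.U) (hy : y ∈ Q.U) : Path x y where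
  toFun t := uncoord Q.b (coord Q.b x + (t : ℝ) * (coord Q.b y - coord Q.b x))
  continuous_toFun := by
    refine Q.uncoord_continuousOn.comp_continuous (by fun_prop) fun t => ?_
    have := Q.K_convex.add_smul_sub_mem (Q.coord_mem hx) (Q.coord_mem hy) t.2
    rwa [Complex.real_smul] at this
  source' := by simp [uncoord_coord hx.1]
  target' := by simp [uncoord_coord hy.1]

theorem seg_spec {x y : M} (hx : x ∈ Q.U) (hy : y ∈ Q.U) (t : I) :
    Q.seg hx hy t ∈ Q.U ∧
      coord Q.b (Q.seg hx hy t) = coord Q.b x + (t : ℝ) * (coord Q.b y - coord Q.b x) := by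
  refine Q.uncoord_spec ?_
  have := Q.K_convex.add_smul_sub_mem (Q.coord_mem hx) (Q.coord_mem hy) t.2
  rwa [Complex.real_smul] at this

theorem seg_re_pos {x y : M} (hx : x ∈ Q.U) (hy : y ∈ Q.U) (h1 : 0 < (coord Q.b x).re)
    (h2 : 0 < (coord Q.b y).re) (t : I) : 0 < (coord Q.b (Q.seg hx hy t)).re := by
  rw [(Q.seg_spec hx hy t).2]
  have h3 := t.2.1
  have h4 := t.2.2
  simp only [Complex.add_re, Complex.mul_re, Complex.ofReal_re, Complex.ofReal_im, zero_mul,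
    sub_zero, Complex.sub_re]
  rcases h3.eq_or_lt with h | h
  · rw [← h]
    linarith
  · nlinarith

end Disc

/-- The line through two points of the plane is a null set. -/
theorem volume_line (p v : ℂ) : volume {w : ℂ | ∃ r : ℝ, w = p + r * v} = 0 := by
  have h := Measure.addHaar_affineSubspace (volume : Measure ℂ)
    (AffineSubspace.mk' p (Submodule.span ℝ {v})) (by
      intro h
      have h1 : (Submodule.span ℝ {v}) = ⊤ := by
        rw [← AffineSubspace.direction_mk' p (Submodule.span ℝ {v}), h, AffineSubspace.direction_top]
      have h2 := finrank_span_le_card (R := ℝ) ({v} : Set ℂ)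
      rw [h1, finrank_top, Complex.finrank_real_complex] at h2
      simp at h2)
  refine measure_mono_null ?_ h
  rintro w ⟨r, rfl⟩
  rw [SetLike.mem_coe, AffineSubspace.mem_mk', Submodule.mem_span_singleton]
  exact ⟨r, by simp [Complex.real_smul]⟩

/-- Moving any coordinate slightly to the right shows that the half-ball contains a nonempty open
set of points of positive real part, and this set has positive area. -/
theorem Disc.exists_generic (Q : Disc M) (hne : Q.U.Nonempty) {Z : Set ℂ} (hZ : volume Z = 0) :
    ∃ w ∈ Q.U, coord Q.b w ∉ Z ∧ 0 < (coord Q.b w).re := by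
  obtain ⟨x, hx⟩ := hne
  have hopen : IsOpen {w : ℂ | ‖w - Q.z‖ < Q.r ∧ 0 < w.re} :=
    (isOpen_lt (f := fun w : ℂ => ‖w - Q.z‖) (by fun_prop) continuous_const).inter
      (isOpen_lt continuous_const Complex.continuous_re)
  have hne : {w : ℂ | ‖w - Q.z‖ < Q.r ∧ 0 < w.re}.Nonempty := by
    refine ⟨coord Q.b x + ((Q.r - ‖coord Q.b x - Q.z‖) / 2 : ℝ), ?_, ?_⟩
    · have e : coord Q.b x + ((Q.r - ‖coord Q.b x - Q.z‖) / 2 : ℝ) - Q.z =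
        (coord Q.b x - Q.z) + ((Q.r - ‖coord Q.b x - Q.z‖) / 2 : ℝ) := by ring
      rw [e]
      refine (norm_add_le _ _).trans_lt ?_
      rw [Complex.norm_real, Real.norm_of_nonneg (by linarith [hx.2])]
      linarith [hx.2]
    · rw [Complex.add_re, Complex.ofReal_re]
      linarith [hx.2, coord_re_nonneg Q.b x]
  have : ¬ {w : ℂ | ‖w - Q.z‖ < Q.r ∧ 0 < w.re} ⊆ Z := fun h =>
    (hopen.measure_pos volume hne).ne' (measure_mono_null h hZ)
  obtain ⟨w, hw, hwZ⟩ := not_subset.1 this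
  obtain ⟨h1, h2⟩ := Q.uncoord_spec (w := w) ⟨hw.1, hw.2.le⟩
  exact ⟨uncoord Q.b w, h1, by rwa [h2], by rw [h2]; exact hw.2⟩

/-- A set whose coordinates form a null set has empty interior. -/
theorem dense_compl_of_null {b : M} {A : Set M} (hA : A ⊆ dom b) (h0 : volume (coord b '' A) = 0) :
    Dense Aᶜ := by
  rw [← interior_eq_empty_iff_dense_compl]
  by_contra hne
  obtain ⟨p, hp⟩ := nonempty_iff_ne_empty.2 hne
  obtain ⟨Q, rfl, hz, hr, hU⟩ := Disc.exists_disc (hA (interior_subset hp))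
    (isOpen_interior.mem_nhds hp)
  obtain ⟨w, hw, h1, -⟩ := Q.exists_generic ⟨p, hA (interior_subset hp), by rw [hz]; simpa using hr⟩ h0
  exact h1 ⟨w, interior_subset (hU hw), rfl⟩

namespace Disc

variable (Q : Disc M)

/-- The path formed by two segments. -/
def bend {x w y : M} (hx : x ∈ Q.U) (hw : w ∈ Q.U) (hy : y ∈ Q.U) : Path x y :=
  (Q.seg hx hw).trans (Q.seg hw hy)

theorem bend_cases {P : M → Prop} {x w y : M} (hx : x ∈ Q.U) (hw : w ∈ Q.U) (hy : y ∈ Q.U)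
    (h1 : ∀ t, P (Q.seg hx hw t)) (h2 : ∀ t, P (Q.seg hw hy t)) (t : I) : P (Q.bend hx hw hy t) := by
  rw [bend, Path.trans_apply]
  split_ifs
  exacts [h1 _, h2 _]

theorem bend_mem {x w y : M} (hx : x ∈ Q.U) (hw : w ∈ Q.U) (hy : y ∈ Q.U) (t : I) :
    Q.bend hx hw hy t ∈ Q.U :=
  Q.bend_cases (P := fun x => x ∈ Q.U) hx hw hy (fun t => (Q.seg_spec _ _ t).1)
    (fun t => (Q.seg_spec _ _ t).1) t

theorem bend_re_pos {x w y : M} (hx : x ∈ Q.U) (hw : w ∈ Q.U) (hy : y ∈ Q.U)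
    (h1 : 0 < (coord Q.b x).re) (h2 : 0 < (coord Q.b w).re) (h3 : 0 < (coord Q.b y).re) (t : I) :
    0 < (coord Q.b (Q.bend hx hw hy t)).re :=
  Q.bend_cases (P := fun x => 0 < (coord Q.b x).re) hx hw hy (Q.seg_re_pos hx hw h1 h2)
    (Q.seg_re_pos hw hy h2 h3) t

theorem bend_dense {x w y : M} (hx : x ∈ Q.U) (hw : w ∈ Q.U) (hy : y ∈ Q.U) :
    Dense (range (Q.bend hx hw hy))ᶜ := by
  refine dense_compl_of_null (b := Q.b) ?_ ?_
  · rintro _ ⟨t, rfl⟩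
    exact (Q.bend_mem hx hw hy t).1
  · refine measure_mono_null ?_ (measure_union_null
      (volume_line (coord Q.b x) (coord Q.b w - coord Q.b x))
      (volume_line (coord Q.b w) (coord Q.b y - coord Q.b w)))
    rintro _ ⟨_, ⟨t, rfl⟩, rfl⟩
    refine Q.bend_cases (P := fun u => coord Q.b u ∈ _) hx hw hy (fun t => Or.inl ?_)
      (fun t => Or.inr ?_) t
    · exact ⟨t, (Q.seg_spec _ _ t).2⟩
    · exact ⟨t, (Q.seg_spec _ _ t).2⟩

/-- A segment avoids a point unless its end lies on the line through its origin and the point. -/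
theorem seg_ne {x w s : M} (hx : x ∈ Q.U) (hw : w ∈ Q.U) (hs : s ≠ x)
    (h : ¬ ∃ r : ℝ, coord Q.b w = coord Q.b x + r * (coord Q.b s - coord Q.b x)) (t : I) :
    Q.seg hx hw t ≠ s := by
  intro h1
  obtain ⟨h2, h3⟩ := Q.seg_spec hx hw t
  rw [h1] at h3
  have ht : (t : ℝ) ≠ 0 := by
    intro h0
    rw [h0, Complex.ofReal_zero, zero_mul, add_zero] at h3
    rw [h1] at h2
    exact hs (coord_injOn Q.b h2.1 hx.1 h3)
  refine h ⟨(t : ℝ)⁻¹, ?_⟩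
  rw [h3]
  have : ((t : ℝ) : ℂ) ≠ 0 := by exact_mod_cast ht
  push_cast
  field_simp
  ring

theorem seg_symm {x w : M} (hx : x ∈ Q.U) (hw : w ∈ Q.U) : (Q.seg hx hw).symm = Q.seg hw hx := by
  ext t
  change uncoord Q.b _ = uncoord Q.b _
  congr 1
  simp
  ring

theorem seg_ne' {x w s : M} (hx : x ∈ Q.U) (hw : w ∈ Q.U) (hs : s ≠ x)
    (h : ¬ ∃ r : ℝ, coord Q.b w = coord Q.b x + r * (coord Q.b s - coord Q.b x)) (t : I) :
    Q.seg hw hx t ≠ s := by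
  rw [← Q.seg_symm hx hw]
  exact Q.seg_ne hx hw hs h _

/-- The path is steered by its corner `w`. A segment from `x` through a point of `S` forces `w` onto
one line, and similarly for `y`; countably many lines are a null set, so a generic corner avoids
them all. -/
theorem exists_bend {x y : M} (hx : x ∈ Q.U) (hy : y ∈ Q.U) {S : Set M} (hS : S.Countable)
    (hxS : x ∉ S) (hyS : y ∉ S) {Z : Set ℂ} (hZ : volume Z = 0) :
    ∃ (w : M) (hw : w ∈ Q.U), coord Q.b w ∉ Z ∧ 0 < (coord Q.b w).re ∧
      ∀ t, Q.bend hx hw hy t ∉ S := by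
  have hN : volume (Z ∪ ⋃ s ∈ S, ({w : ℂ | ∃ r : ℝ, w = coord Q.b x + r * (coord Q.b s - coord Q.b x)} ∪
      {w : ℂ | ∃ r : ℝ, w = coord Q.b y + r * (coord Q.b s - coord Q.b y)})) = 0 :=
    measure_union_null hZ ((measure_biUnion_null_iff hS).2 fun s _ =>
      measure_union_null (volume_line _ _) (volume_line _ _))
  obtain ⟨w, hw, hwZ, hw0⟩ := Q.exists_generic ⟨x, hx⟩ hN
  simp only [mem_union, mem_iUnion, not_or, not_exists] at hwZ
  refine ⟨w, hw, hwZ.1, hw0, fun t => ?_⟩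
  refine Q.bend_cases (P := fun u => u ∉ S) hx hw hy (fun t ht => ?_) (fun t ht => ?_) t
  · exact Q.seg_ne hx hw (ne_of_mem_of_not_mem ht hxS) (fun ⟨r, hr⟩ => (hwZ.2 _ ht).1 ⟨r, hr⟩) t rfl
  · exact Q.seg_ne' hy hw (ne_of_mem_of_not_mem ht hyS) (fun ⟨r, hr⟩ => (hwZ.2 _ ht).2 ⟨r, hr⟩) t rfl

end Disc

end Discs

/-! ### Uniform scales on a compact surface -/

section Scales

open Set Filter Topology Metric

set_option linter.unusedSectionVars false

variable {M : Type*} [MetricSpace M] [CompactSpace M] [ChartedSpace (EuclideanHalfSpace 2) M]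

theorem exists_chart_scale : ∃ (t : Finset M) (R : ℝ), 0 < R ∧ ∀ x : M, ∃ b ∈ t, ball x R ⊆ dom b := by
  obtain ⟨t, ht⟩ := isCompact_univ.elim_finite_subcover (fun b : M => dom b) dom_open
    fun x _ => mem_iUnion.2 ⟨x, mem_dom x⟩
  obtain ⟨R, hR, h⟩ := lebesgue_number_lemma_of_metric (c := fun b : t => dom (b : M)) isCompact_univ
    (fun b => dom_open _) fun x hx => by
      obtain ⟨b, hb, h⟩ := mem_iUnion₂.1 (ht hx)
      exact mem_iUnion.2 ⟨⟨b, hb⟩, h⟩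
  refine ⟨t, R, hR, fun x => ?_⟩
  obtain ⟨b, hb⟩ := h x (mem_univ x)
  exact ⟨b, b.2, hb⟩

/-- A Lebesgue number for a cover by small discs. The centre `z` of the disc found for `p` is close
to `p`, so its chart still contains a ball of radius `R / 2` around `p`. -/
theorem exists_disc_scale_in {t : Finset M} {R : ℝ} (hR : 0 < R)
    (h : ∀ x : M, ∃ b ∈ t, ball x R ⊆ dom b) {ε : ℝ} (hε : 0 < ε) :
    ∃ δ > 0, ∀ p : M, ∃ Q : Disc M, Q.b ∈ t ∧ ball p (R / 2) ⊆ dom Q.b ∧ ball p δ ⊆ Q.U ∧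
      Q.U ⊆ ball p ε := by
  choose b hbt hb using h
  have hQ : ∀ z, ∃ Q : Disc M, Q.b = b z ∧ z ∈ Q.U ∧ Q.U ⊆ ball z (min ε R / 2) := by
    intro z
    obtain ⟨Q, h1, h2, h3, h4⟩ := Disc.exists_disc (hb z (mem_ball_self hR))
      (ball_mem_nhds z (ε := min ε R / 2) (by positivity))
    refine ⟨Q, h1, ⟨?_, ?_⟩, h4⟩
    · rw [h1]
      exact hb z (mem_ball_self hR)
    · rw [h1, h2, sub_self, norm_zero]
      exact h3
  choose Q hQb hQz hQU using hQ
  obtain ⟨δ, hδ, h⟩ := lebesgue_number_lemma_of_metric (c := fun z : M => (Q z).U) isCompact_univ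
    (fun z => (Q z).U_open) fun x hx => mem_iUnion.2 ⟨x, hQz x⟩
  refine ⟨δ, hδ, fun p => ?_⟩
  obtain ⟨z, hz⟩ := h p (mem_univ p)
  have hpz : dist p z < min ε R / 2 := hQU z (hz (mem_ball_self hδ))
  have h1 := min_le_left ε R
  have h2 := min_le_right ε R
  refine ⟨Q z, by rw [hQb]; exact hbt z, ?_, hz, fun u hu => ?_⟩
  · rw [hQb]
    intro u hu
    refine hb z ?_
    rw [mem_ball] at hu ⊢
    linarith [dist_triangle u p z]
  · have := hQU z hu
    rw [mem_ball] at this ⊢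
    linarith [dist_triangle u z p, dist_comm z p]

theorem exists_disc_scale {ε : ℝ} (hε : 0 < ε) :
    ∃ δ > 0, ∀ p : M, ∃ Q : Disc M, ball p δ ⊆ Q.U ∧ Q.U ⊆ ball p ε := by
  obtain ⟨t, R, hR, h⟩ := exists_chart_scale (M := M)
  obtain ⟨δ, hδ, h⟩ := exists_disc_scale_in hR h hε
  refine ⟨δ, hδ, fun p => ?_⟩
  obtain ⟨Q, -, -, h1, h2⟩ := h p
  exact ⟨Q, h1, h2⟩

/-- Only the finitely many pairs of charts from `t` matter, so the local comparison of charts holds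
on a uniform radius, a Lebesgue number for finite intersections of the neighbourhoods of
`exists_coord_ratio`. -/
theorem exists_ratio_scale [IsManifold (𝓡∂ 2) ∞ M] (hor : OrientedAtlas M) {t : Finset M} {R : ℝ}
    (hR : 0 < R) : ∃ ρ > 0, ∀ x y : M, dist x y < ρ → ∀ b ∈ t, ∀ b' ∈ t, ball x (R / 2) ⊆ dom b →
      ball y (R / 2) ⊆ dom b' → ball x ρ ⊆ dom b' ∧ ∃ α : ℂ, α ≠ 0 ∧ ∀ u ∈ ball x ρ, ∀ v ∈ ball x ρ,
        u ≠ v → 0 < ((coord b' u - coord b' v) / (α * (coord b u - coord b v))).re := by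
  have h1 : ∀ (z : M) (c : M × M), ∃ O : Set M, IsOpen O ∧ z ∈ O ∧ (z ∈ dom c.1 → z ∈ dom c.2 →
      O ⊆ dom c.2 ∧ ∃ α : ℂ, α ≠ 0 ∧ ∀ u ∈ O, ∀ v ∈ O, u ≠ v →
        0 < ((coord c.2 u - coord c.2 v) / (α * (coord c.1 u - coord c.1 v))).re) := by
    intro z c
    by_cases h : z ∈ dom c.1 ∧ z ∈ dom c.2
    · obtain ⟨α, hα, O, hO, hz, hd, hr⟩ := exists_coord_ratio hor h.1 h.2
      exact ⟨O, hO, hz, fun _ _ => ⟨fun x hx => (hd hx).2, α, hα, hr⟩⟩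
    · exact ⟨univ, isOpen_univ, mem_univ _, fun h1 h2 => (h ⟨h1, h2⟩).elim⟩
  choose O hO hzO hOr using h1
  obtain ⟨ρ, hρ, h⟩ := lebesgue_number_lemma_of_metric
    (c := fun z : M => (⋂ c ∈ t ×ˢ t, O z c) ∩ ball z (R / 4)) isCompact_univ
    (fun z => (isOpen_biInter_finset fun c _ => hO z c).inter isOpen_ball)
    fun x hx => mem_iUnion.2 ⟨x, mem_iInter₂.2 fun c _ => hzO x c, mem_ball_self (by positivity)⟩
  refine ⟨min ρ (R / 4), by positivity, fun x y hxy b hb b' hb' hxb hyb' => ?_⟩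
  have hxy' : dist x y < R / 4 := hxy.trans_le (min_le_right _ _)
  obtain ⟨z, hz⟩ := h x (mem_univ x)
  have hxz : dist x z < R / 4 := (hz (mem_ball_self hρ)).2
  have hsub : ball x (min ρ (R / 4)) ⊆ O z (b, b') := fun u hu =>
    mem_iInter₂.1 (hz (ball_subset_ball (min_le_left _ _) hu)).1 (b, b') (Finset.mk_mem_product hb hb')
  obtain ⟨h3, α, hα, h4⟩ := hOr z (b, b')
    (hxb (by rw [mem_ball, dist_comm]; linarith))
    (hyb' (by rw [mem_ball]; linarith [dist_triangle z x y, dist_comm z x]))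
  exact ⟨hsub.trans h3, α, hα, fun u hu v hv => h4 u (hsub hu) v (hsub hv)⟩

/-- Uniform data on a compact oriented surface: a radius, a chart around every ball of this radius,
the classes of short paths, and a smaller radius with convexity. -/
structure Scale (x₀ : M) [PathConnectedSpace M] where
  ρ : ℝ
  ρ_pos : 0 < ρ
  chart : M → M
  κ : M → M → LoopGroup x₀
  ball_dom : ∀ x, ball x ρ ⊆ dom (chart x)
  ratio : ∀ x y, dist x y < ρ → ball x ρ ⊆ dom (chart y) ∧ ∃ α : ℂ, α ≠ 0 ∧
    ∀ u ∈ ball x ρ, ∀ v ∈ ball x ρ, u ≠ v →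
      0 < ((coord (chart y) u - coord (chart y) v) / (α * (coord (chart x) u - coord (chart x) v))).re
  κ_mul : ∀ x, ∀ p ∈ ball x ρ, ∀ q ∈ ball x ρ, ∀ r ∈ ball x ρ, κ p q * κ q r = κ p r
  κ_hol : ∀ (x : M) (f : C(ℝ, M)) (a b : ℝ), (∀ t ∈ uIcc a b, f t ∈ ball x ρ) →
    hol x₀ f a b = κ (f a) (f b)
  η : ℝ
  η_pos : 0 < η
  η_le : η ≤ ρ / 16
  convex : ∀ p, ∃ (z : ℂ) (r : ℝ), (∀ u ∈ ball p η, ‖coord (chart p) u - z‖ < r) ∧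
    ∀ u ∈ ball p ρ, ρ / 8 ≤ dist u p → r ≤ ‖coord (chart p) u - z‖

/-- Inside a disc the class of a path is determined by its ends. Two scales are used: points at
distance less than `δ₁` are joined by paths of size `δ₀ / 4`, and these are compared inside discs
that contain balls of radius `δ₀`. -/
theorem exists_short_classes [PathConnectedSpace M] (x₀ : M) :
    ∃ (ρ : ℝ) (κ : M → M → LoopGroup x₀), 0 < ρ ∧
      (∀ x, ∀ p ∈ ball x ρ, ∀ q ∈ ball x ρ, ∀ r ∈ ball x ρ, κ p q * κ q r = κ p r) ∧
      ∀ (x : M) (f : C(ℝ, M)) (a b : ℝ), (∀ t ∈ uIcc a b, f t ∈ ball x ρ) →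
        hol x₀ f a b = κ (f a) (f b) := by
  classical
  obtain ⟨δ₀, hδ₀, h0⟩ := exists_disc_scale (M := M) one_pos
  obtain ⟨δ₁, hδ₁, h1⟩ := exists_disc_scale (M := M) (ε := δ₀ / 4) (by positivity)
  have hex : ∀ p q : M, dist q p < δ₁ → ∃ c : Path p q, ∀ t, dist (c t) p < δ₀ / 4 := by
    intro p q hpq
    obtain ⟨Q, hQ1, hQ2⟩ := h1 p
    exact ⟨Q.seg (hQ1 (mem_ball_self hδ₁)) (hQ1 hpq), fun t => hQ2 (Q.seg_spec _ _ t).1⟩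
  let κ : M → M → LoopGroup x₀ := fun p q =>
    if h : ∃ c : Path p q, ∀ t, dist (c t) p < δ₀ / 4 then
      el x₀ (Path.Homotopic.Quotient.mk h.choose) else 1
  have hκ : ∀ p q : M, dist q p < δ₁ → ∃ c : Path p q, (∀ t, dist (c t) p < δ₀ / 4) ∧
      κ p q = el x₀ (Path.Homotopic.Quotient.mk c) := by
    intro p q hpq
    have h := hex p q hpq
    exact ⟨h.choose, h.choose_spec, dif_pos h⟩
  have hmin1 := min_le_left (δ₁ / 2) (δ₀ / 4)
  have hmin2 := min_le_right (δ₁ / 2) (δ₀ / 4)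
  have hd : ∀ {x p q : M}, p ∈ ball x (min (δ₁ / 2) (δ₀ / 4)) → q ∈ ball x (min (δ₁ / 2) (δ₀ / 4)) →
      dist q p < δ₁ := by
    intro x p q hp hq
    rw [mem_ball] at hp hq
    linarith [dist_triangle q x p, dist_comm x p]
  have hm : ∀ {x p q : M} (c : Path p q), p ∈ ball x (min (δ₁ / 2) (δ₀ / 4)) →
      (∀ t, dist (c t) p < δ₀ / 4) → ∀ t, c t ∈ ball x δ₀ := by
    intro x p q c hp hc t
    rw [mem_ball] at hp ⊢
    linarith [dist_triangle (c t) p x, hc t]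
  refine ⟨min (δ₁ / 2) (δ₀ / 4), κ, by positivity, fun x p hp q hq r hr => ?_,
    fun x f a b hf => ?_⟩
  · obtain ⟨c1, hc1, e1⟩ := hκ p q (hd hp hq)
    obtain ⟨c2, hc2, e2⟩ := hκ q r (hd hq hr)
    obtain ⟨c3, hc3, e3⟩ := hκ p r (hd hp hr)
    obtain ⟨Q, hQ, -⟩ := h0 x
    rw [e1, e2, e3, ← el_trans, ← Path.Homotopic.Quotient.mk_trans]
    refine Q.el_eq x₀ _ _ rfl rfl (fun t => ?_) fun t => hQ (hm c3 hp hc3 t)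
    rw [Path.trans_apply]
    split_ifs
    · exact hQ (hm c1 hp hc1 _)
    · exact hQ (hm c2 hq hc2 _)
  · have ha := hf a left_mem_uIcc
    obtain ⟨c1, hc1, e1⟩ := hκ (f a) (f b) (hd ha (hf b right_mem_uIcc))
    obtain ⟨Q, hQ, -⟩ := h0 x
    rw [e1, hol]
    refine Q.el_eq x₀ _ _ rfl rfl (fun t => hQ ?_) fun t => hQ (hm c1 ha hc1 t)
    refine ball_subset_ball (hmin2.trans (by linarith)) (hf _ ?_)
    rw [← segment_eq_uIcc, segment_eq_image']
    exact ⟨t, t.2, by simp [smul_eq_mul]⟩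

/-- For the field `convex`, the disc at `p` contains the ball of radius `η` and lies in the ball of
radius `ρ / 8`; its round coordinate ball therefore separates points near `p` from points at
distance at least `ρ / 8`. -/
theorem exists_scale [PathConnectedSpace M] [IsManifold (𝓡∂ 2) ∞ M] (hor : OrientedAtlas M)
    (x₀ : M) : Nonempty (Scale x₀) := by
  obtain ⟨t, R, hR, ht⟩ := exists_chart_scale (M := M)
  obtain ⟨ρ₁, hρ₁, hrat⟩ := exists_ratio_scale hor (t := t) hR
  obtain ⟨ρ₂, κ, hρ₂, hκ1, hκ2⟩ := exists_short_classes x₀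
  set ρ := min (min ρ₁ ρ₂) (R / 2) with hρdef
  have hρ : 0 < ρ := by positivity
  have l1 : ρ ≤ ρ₁ := (min_le_left _ _).trans (min_le_left _ _)
  have l2 : ρ ≤ ρ₂ := (min_le_left _ _).trans (min_le_right _ _)
  have l3 : ρ ≤ R / 2 := min_le_right _ _
  obtain ⟨η, hη, hQ⟩ := exists_disc_scale_in hR ht (ε := ρ / 8) (by positivity)
  choose Q hQt hQR hQη hQε using hQ
  refine ⟨⟨ρ, hρ, fun p => (Q p).b, κ, fun x => (ball_subset_ball l3).trans (hQR x),
    fun x y hxy => ?_, fun x p hp q hq r hr => hκ1 x p (ball_subset_ball l2 hp) q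
      (ball_subset_ball l2 hq) r (ball_subset_ball l2 hr), fun x f a b hf => hκ2 x f a b fun t ht =>
      ball_subset_ball l2 (hf t ht), min η (ρ / 16), by positivity, min_le_right _ _, fun p =>
      ⟨(Q p).z, (Q p).r, fun u hu => (hQη p (ball_subset_ball (min_le_left _ _) hu)).2,
      fun u hu hup => ?_⟩⟩⟩
  · obtain ⟨h1, α, hα, h2⟩ := hrat x y (hxy.trans_le l1) _ (hQt x) _ (hQt y) (hQR x) (hQR y)
    exact ⟨(ball_subset_ball l1).trans h1, α, hα, fun u hu v hv =>
      h2 u (ball_subset_ball l1 hu) v (ball_subset_ball l1 hv)⟩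
  · by_contra h
    exact absurd (hQε p ⟨hQR p (ball_subset_ball l3 hu), not_le.1 h⟩) (by
      rw [mem_ball]
      linarith)

end Scales

/-! ### Products of a local cocycle along chains of points -/

section LocalCocycles

open Set Filter Topology Metric

set_option linter.unusedSectionVars false

variable {M Γ : Type*} [Monoid Γ]

/-- The product of the values of `g` along a chain of points. -/
def chainProd (g : M → M → Γ) (v : ℕ → M) : ℕ → Γ
  | 0 => 1
  | n + 1 => chainProd g v n * g (v n) (v (n + 1))

theorem chainProd_congr {g g' : M → M → Γ} {v v' : ℕ → M} {n : ℕ}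
    (h : ∀ i < n, g (v i) (v (i + 1)) = g' (v' i) (v' (i + 1))) :
    chainProd g v n = chainProd g' v' n := by
  induction n with
  | zero => rfl
  | succ n ih =>
    rw [chainProd, chainProd, ih fun i hi => h i (by omega), h n (by omega)]

theorem chainProd_add (g : M → M → Γ) (v : ℕ → M) (a b : ℕ) :
    chainProd g v (a + b) = chainProd g v a * chainProd g (fun i => v (a + i)) b := by
  induction b with
  | zero => simp [chainProd]
  | succ b ih => rw [← add_assoc, chainProd, chainProd, ih, mul_assoc, add_assoc]

variable [MetricSpace M]

/-- `g` is multiplicative on balls of radius `ε`. -/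
structure LocalCocycle (g : M → M → Γ) (ε : ℝ) : Prop where
  pos : 0 < ε
  one : ∀ p, g p p = 1
  mul : ∀ x, ∀ p ∈ ball x ε, ∀ q ∈ ball x ε, ∀ r ∈ ball x ε, g p q * g q r = g p r

namespace LocalCocycle

variable {g : M → M → Γ} {ε : ℝ} (hg : LocalCocycle g ε)

include hg

theorem chainProd_ball {v : ℕ → M} {x : M} {n : ℕ} (h : ∀ i ≤ n, v i ∈ ball x ε) :
    chainProd g v n = g (v 0) (v n) := by
  induction n with
  | zero => rw [hg.one, chainProd]
  | succ n ih =>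
    rw [chainProd, ih fun i hi => h i (by omega), hg.mul x _ (h _ (by omega)) _ (h _ (by omega)) _
      (h _ (by omega))]

/-- Each block of `k` steps stays in a ball where `g` is multiplicative, so it collapses to one
step. -/
theorem chainProd_refine {v w : ℕ → M} {k n : ℕ} (hw : ∀ i ≤ n, w (i * k) = v i)
    (h : ∀ i < n, ∃ x, ∀ j ≤ k, w (i * k + j) ∈ ball x ε) :
    chainProd g w (n * k) = chainProd g v n := by
  induction n with
  | zero => simp [chainProd]
  | succ n ih =>
    obtain ⟨x, hx⟩ := h n (by omega)
    rw [Nat.succ_mul, chainProd_add, ih (fun i hi => hw i (by omega)) fun i hi => h i (by omega),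
      chainProd, hg.chainProd_ball (v := fun i => w (n * k + i)) hx, ← Nat.succ_mul, add_zero,
      hw n (by omega), hw (n + 1) le_rfl]

/-- A ladder argument: every rung square lies in a ball where `g` is multiplicative, so the rung can
be pushed from the start to the end. -/
theorem chainProd_compare {v w : ℕ → M} {n : ℕ}
    (h : ∀ i < n, ∃ x, v i ∈ ball x ε ∧ v (i + 1) ∈ ball x ε ∧ w i ∈ ball x ε ∧ w (i + 1) ∈ ball x ε) :
    chainProd g v n * g (v n) (w n) = g (v 0) (w 0) * chainProd g w n := by
  induction n with
  | zero => simp [chainProd]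
  | succ n ih =>
    obtain ⟨x, h1, h2, h3, h4⟩ := h n (by omega)
    rw [chainProd, chainProd, mul_assoc, hg.mul x _ h1 _ h2 _ h4, ← mul_assoc, ← ih
      fun i hi => h i (by omega), mul_assoc, hg.mul x _ h1 _ h3 _ h4]

/-- Divide the homotopy into a fine grid. Consecutive rows are compared by `chainProd_compare`,
whose end rungs are trivial because the ends stay fixed. -/
theorem chainProd_homotopic {a b : M} {p q : Path a b} (h : p.Homotopic q) :
    ∃ N₀ : ℕ, ∀ N ≥ N₀, 0 < N →
      chainProd g (fun i => p.extend (i / N)) N = chainProd g (fun i => q.extend (i / N)) N := by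
  obtain ⟨H⟩ := h
  let π := projIcc (0 : ℝ) 1 zero_le_one
  have hH : UniformContinuous H := CompactSpace.uniformContinuous_of_continuous H.continuous
  obtain ⟨δ, hδ, hHδ⟩ := Metric.uniformContinuous_iff.1 hH ε hg.pos
  have hK : ∀ u u' t t' : ℝ, |u - u'| < δ → |t - t'| < δ →
      H (π u, π t) ∈ ball (H (π u', π t')) ε := by
    intro u u' t t' hu ht
    refine hHδ ?_
    rw [Prod.dist_eq]
    refine max_lt ?_ ?_
    · exact (abs_projIcc_sub_projIcc (zero_le_one' ℝ)).trans_lt hu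
    · exact (abs_projIcc_sub_projIcc (zero_le_one' ℝ)).trans_lt ht
  obtain ⟨N₀, hN₀⟩ := exists_nat_gt (1 / δ)
  refine ⟨N₀, fun N hN hN0 => ?_⟩
  have hNp : (0 : ℝ) < N := by exact_mod_cast hN0
  have hNδ : 1 / (N : ℝ) < δ := by
    rw [div_lt_comm₀ hNp hδ]
    exact hN₀.trans_le (by exact_mod_cast hN)
  have hstep : ∀ i : ℕ, |((i + 1 : ℕ) : ℝ) / N - i / N| < δ := by
    intro i
    rw [← sub_div]
    push_cast
    rw [add_sub_cancel_left, abs_of_pos (by positivity)]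
    exact hNδ
  have key : ∀ k : ℕ, chainProd g (fun i : ℕ => H (π (k / N), π (i / N))) N =
      chainProd g (fun i : ℕ => H (π ((k + 1 : ℕ) / N), π (i / N))) N := by
    intro k
    have h1 := hg.chainProd_compare (v := fun i : ℕ => H (π (k / N), π (i / N)))
      (w := fun i : ℕ => H (π ((k + 1 : ℕ) / N), π (i / N))) (n := N) fun i _ =>
      ⟨H (π (k / N), π (i / N)), hK _ _ _ _ (by simpa using hδ) (by simpa using hδ),
        hK _ _ _ _ (by simpa using hδ) (hstep i), hK _ _ _ _ (hstep k) (by simpa using hδ),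
        hK _ _ _ _ (hstep k) (hstep i)⟩
    have e1 : π ((N : ℝ) / N) = 1 := by
      rw [div_self hNp.ne']
      exact projIcc_right _
    have e0 : π (((0 : ℕ) : ℝ) / N) = 0 := by
      rw [Nat.cast_zero, zero_div]
      exact projIcc_left _
    simp only [e0, e1, Path.Homotopy.target, Path.Homotopy.source, hg.one, mul_one, one_mul] at h1
    exact h1
  have key2 : ∀ k : ℕ, chainProd g (fun i : ℕ => H (π ((0 : ℕ) / N), π (i / N))) N =
      chainProd g (fun i : ℕ => H (π (k / N), π (i / N))) N := by
    intro k
    induction k with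
    | zero => rfl
    | succ k ih => rw [ih, key k]
  have h2 := key2 N
  have e1 : π ((N : ℝ) / N) = 1 := by
    rw [div_self hNp.ne']
    exact projIcc_right _
  have e0 : π (((0 : ℕ) : ℝ) / N) = 0 := by
    rw [Nat.cast_zero, zero_div]
    exact projIcc_left _
  simp only [e0, e1, ContinuousMap.HomotopyWith.apply_zero, ContinuousMap.HomotopyWith.apply_one] at h2
  exact h2

/-- The product along a chain of points on a curve only depends on the homotopy class of the
curve. -/
theorem chainProd_eq [PathConnectedSpace M] (x₀ : M) {f f' : C(ℝ, M)} {n n' : ℕ} (hn : 0 < n)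
    (hn' : 0 < n') (h0 : f 0 = f' 0) (h1 : f n = f' n') (hol_eq : hol x₀ f 0 n = hol x₀ f' 0 n')
    (hf : ∀ i < n, ∃ x, ∀ t ∈ Icc (i : ℝ) (i + 1), f t ∈ ball x ε)
    (hf' : ∀ i < n', ∃ x, ∀ t ∈ Icc (i : ℝ) (i + 1), f' t ∈ ball x ε) :
    chainProd g (fun i => f i) n = chainProd g (fun i => f' i) n' := by
  have hom : (segPath f 0 n).Homotopic ((segPath f' 0 n').cast h0 h1) := by
    refine Path.Homotopic.Quotient.eq.1 (el_injective x₀ ?_)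
    exact hol_eq.trans (el_eq_of_forall x₀ _ _ fun t => rfl)
  obtain ⟨N₀, hN⟩ := hg.chainProd_homotopic hom
  have key : ∀ (f : C(ℝ, M)) {a b : M} (p : Path a b) (n : ℕ) (k : ℕ), 0 < n → 0 < k →
      (∀ t : I, p t = f (t * n)) →
      (∀ i < n, ∃ x, ∀ t ∈ Icc (i : ℝ) (i + 1), f t ∈ ball x ε) →
      chainProd g (fun i => p.extend (i / (n * k : ℕ))) (n * k) = chainProd g (fun i => f i) n := by
    intro f a b p n k hn hk hp hf
    have hn' : (0 : ℝ) < n := by exact_mod_cast hn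
    have hk' : (0 : ℝ) < k := by exact_mod_cast hk
    have hval : ∀ j : ℕ, j ≤ n * k → p.extend ((j : ℝ) / (n * k : ℕ)) = f (j / k) := by
      intro j hj
      have hj' : (j : ℝ) ≤ n * k := by exact_mod_cast hj
      rw [Path.extend_apply _ ⟨by positivity, by
        rw [div_le_one (by positivity)]
        exact_mod_cast hj⟩, hp]
      congr 1
      push_cast
      field_simp
    refine hg.chainProd_refine (fun i hi => ?_) fun i hi => ?_
    · rw [hval _ (Nat.mul_le_mul_right k hi)]
      congr 1
      push_cast
      field_simp
    · obtain ⟨x, hx⟩ := hf i hi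
      refine ⟨x, fun j hj => ?_⟩
      have hj' : (j : ℝ) ≤ k := by exact_mod_cast hj
      rw [hval _ (by nlinarith)]
      refine hx _ ⟨?_, ?_⟩
      · rw [le_div_iff₀ hk']
        push_cast
        linarith [(Nat.cast_nonneg j : (0 : ℝ) ≤ j)]
      · rw [div_le_iff₀ hk']
        push_cast
        linarith
  have hpos : 0 < N₀ + 1 := by omega
  -- Both chains are refined to the same number `n n' (N₀ + 1)` of steps, which is large enough for
  -- the grid of the homotopy.
  rw [← key f (segPath f 0 n) n (n' * (N₀ + 1)) hn (by positivity) (fun t => by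
      change f (0 + t * (n - 0)) = _
      congr 1
      ring) hf,
    ← key f' ((segPath f' 0 n').cast h0 h1) n' (n * (N₀ + 1)) hn' (by positivity) (fun t => by
      change f' (0 + t * (n' - 0)) = _
      congr 1
      ring) hf']
  have e : n' * (n * (N₀ + 1)) = n * (n' * (N₀ + 1)) := by ring
  rw [e]
  refine hN _ ?_ (by positivity)
  calc N₀ ≤ 1 * (1 * (N₀ + 1)) := by omega
    _ ≤ n * (n' * (N₀ + 1)) := Nat.mul_le_mul hn (Nat.mul_le_mul hn' le_rfl)

end LocalCocycle

end LocalCocycles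

/-! ### Crossing numbers of short curves -/

section CrossingNumbers

open Set Filter Topology Metric

set_option linter.unusedSectionVars false

/-- The integer `n` when `w = 2 π i n`. -/
def turns (w : ℂ) : ℤ := round (w / (2 * Real.pi * Complex.I)).re

theorem turns_spec {w : ℂ} (h : Complex.exp w = 1) : w = turns w * (2 * Real.pi * Complex.I) := by
  obtain ⟨n, hn⟩ := Complex.exp_eq_one_iff.1 h
  have : turns w = n := by
    rw [turns, hn, mul_div_assoc, div_self Complex.two_pi_I_ne_zero, mul_one, Complex.intCast_re,
      round_intCast]
  rw [this, hn]

/-- The corner values cancel in the product of the four quotients, so the total variation is a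
multiple of `2πi`. -/
theorem exp_boxVar {F : ℝ → ℝ → ℂ} {a b c d : ℝ} (h : BoxOK F a b c d) :
    Complex.exp (boxVar F a b c d) = 1 := by
  have l := left_mem_Icc.2 h.hab
  have r := right_mem_Icc.2 h.hab
  have bo := left_mem_Icc.2 h.hcd
  have up := right_mem_Icc.2 h.hcd
  have h1 := h.left c bo
  have h2 := h.left d up
  have h3 := h.right c bo
  have h4 := h.right d up
  rw [boxVar, Complex.exp_sub, Complex.exp_sub, Complex.exp_add, exp_logVar h.hcd h.nzL,
    exp_logVar h.hab h.nzT, exp_logVar h.hcd h.nzR, exp_logVar h.hab h.nzB]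
  field_simp

/-- Exchanging the two parameters reverses the orientation of the boundary; the constant factor `-1`
has no effect on variations of logarithms. -/
theorem boxVar_swap {F : ℝ → ℝ → ℂ} {a b c d : ℝ} (h : BoxOK F a b c d) :
    boxVar (fun t s => -F s t) c d a b = -boxVar F a b c d := by
  have key : ∀ {z : ℝ → ℂ} {a b : ℝ}, a ≤ b → NonzeroOn z a b →
      logVar (fun x => -z x) a b = logVar z a b := by
    intro z a b hab hz
    have := logVar_const_mul (neg_ne_zero.2 one_ne_zero) hab hz
    simpa using this
  rw [boxVar, boxVar, key h.hab h.nzB, key h.hcd h.nzR, key h.hab h.nzT, key h.hcd h.nzL]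
  ring

theorem logVar_of_slitPlane {w : ℝ → ℂ} {a b : ℝ} {α : ℂ} (hα : α ≠ 0) (hab : a ≤ b)
    (hc : ContinuousOn w (Icc a b)) (hw : ∀ x ∈ Icc a b, w x / α ∈ Complex.slitPlane) :
    logVar w a b = Complex.log (w b / α) - Complex.log (w a / α) := by
  rw [logVar_eq (g := fun x => Complex.log (w x / α) + Complex.log α) hab
    (((hc.div_const α).clog hw).add continuousOn_const) fun x hx => ?_]
  · ring
  · rw [Complex.exp_add, Complex.exp_log (Complex.slitPlane_ne_zero (hw x hx)), Complex.exp_log hα,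
      div_mul_cancel₀ _ hα]

variable {M : Type*} [MetricSpace M] [CompactSpace M] [ChartedSpace (EuclideanHalfSpace 2) M]
  [PathConnectedSpace M] [IsManifold (𝓡∂ 2) ∞ M] {x₀ : M} (S : Scale x₀)

/-- Two pieces of curves meet. -/
def Meets (f h : C(ℝ, M)) (a a' c c' : ℝ) : Prop := ∃ s ∈ Icc a a', ∃ t ∈ Icc c c', f s = h t

namespace Scale

/-- The piece of the curve `f` between `a` and `a'` is short. -/
def Short (f : C(ℝ, M)) (a a' : ℝ) : Prop := a ≤ a' ∧ ∀ t ∈ Icc a a', dist (f t) (f a) < S.η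

/-- Two short pieces of curves such that the ends of each lie off the other one. -/
structure Adm (f h : C(ℝ, M)) (a a' c c' : ℝ) : Prop where
  shortL : S.Short f a a'
  shortR : S.Short h c c'
  left : ∀ t ∈ Icc c c', f a ≠ h t
  right : ∀ t ∈ Icc c c', f a' ≠ h t
  bot : ∀ s ∈ Icc a a', f s ≠ h c
  top : ∀ s ∈ Icc a a', f s ≠ h c'

/-- The crossing number of two short pieces of curves. -/
def cr (f h : C(ℝ, M)) (a a' c c' : ℝ) : ℤ :=
  open Classical in
  if Meets f h a a' c c' then turns (boxVar (diffIn (S.chart (f a)) f h) a a' c c') else 0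

variable {S}

theorem diffIn_continuousOn {f h : C(ℝ, M)} {a a' c c' : ℝ} {b : M}
    (hf : ∀ s ∈ Icc a a', f s ∈ dom b) (hh : ∀ t ∈ Icc c c', h t ∈ dom b) :
    ContinuousOn (Function.uncurry (diffIn b f h)) (Icc a a' ×ˢ Icc c c') := by
  refine ContinuousOn.sub ?_ ?_
  · exact (coord_continuousOn b).comp (f.continuous.comp continuous_fst).continuousOn
      fun x hx => hf _ hx.1
  · exact (coord_continuousOn b).comp (h.continuous.comp continuous_snd).continuousOn
      fun x hx => hh _ hx.2

theorem diffIn_ne_zero {b x y : M} (hx : x ∈ dom b) (hy : y ∈ dom b) (h : x ≠ y) :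
    coord b x - coord b y ≠ 0 := fun h0 => h (coord_injOn b hx hy (sub_eq_zero.1 h0))

theorem Adm.boxOK {f h : C(ℝ, M)} {a a' c c' : ℝ} (H : S.Adm f h a a' c c') {b : M}
    (hf : ∀ s ∈ Icc a a', f s ∈ dom b) (hh : ∀ t ∈ Icc c c', h t ∈ dom b) :
    BoxOK (diffIn b f h) a a' c c' where
  hab := H.shortL.1
  hcd := H.shortR.1
  cont := diffIn_continuousOn hf hh
  left t ht := diffIn_ne_zero (hf _ (left_mem_Icc.2 H.shortL.1)) (hh t ht) (H.left t ht)
  right t ht := diffIn_ne_zero (hf _ (right_mem_Icc.2 H.shortL.1)) (hh t ht) (H.right t ht)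
  bot s hs := diffIn_ne_zero (hf s hs) (hh _ (left_mem_Icc.2 H.shortR.1)) (H.bot s hs)
  top s hs := diffIn_ne_zero (hf s hs) (hh _ (right_mem_Icc.2 H.shortR.1)) (H.top s hs)

/-- Pieces that meet are close to each other, since each has size at most `ρ / 16`. So all of both
lies in the chart at `f a`, which justifies its use in `cr`. -/
theorem Adm.dist_lt {f h : C(ℝ, M)} {a a' c c' : ℝ} (H : S.Adm f h a a' c c')
    (hm : Meets f h a a' c c') : dist (f a) (h c) < S.ρ / 8 := by
  obtain ⟨s, hs, t, ht, e⟩ := hm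
  have h1 := H.shortL.2 s hs
  have h2 := H.shortR.2 t ht
  rw [e] at h1
  linarith [dist_triangle (f a) (h t) (h c), dist_comm (f a) (h t), S.η_le]

theorem Short.mem_ball {f : C(ℝ, M)} {a a' : ℝ} (H : S.Short f a a') {p : M} {r r' : ℝ}
    (hp : dist (f a) p < r) (hr : r + S.ρ / 16 ≤ r') : ∀ t ∈ Icc a a', f t ∈ ball p r' := by
  intro t ht
  have := H.2 t ht
  rw [Metric.mem_ball]
  linarith [dist_triangle (f t) (f a) p, S.η_le]

/-- Independence of the chart: differences of points in two charts agree up to a constant and a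
factor of positive real part, which `boxVar_ratio` ignores. If the pieces do not meet, both sides
vanish. -/
theorem Adm.cr_spec {f h : C(ℝ, M)} {a a' c c' : ℝ} (H : S.Adm f h a a' c c') {x : M}
    (hf : ∀ s ∈ Icc a a', f s ∈ ball x S.ρ) (hh : ∀ t ∈ Icc c c', h t ∈ ball x S.ρ) :
    boxVar (diffIn (S.chart x) f h) a a' c c' =
      S.cr f h a a' c c' * (2 * Real.pi * Complex.I) := by
  have hf' : ∀ s ∈ Icc a a', f s ∈ dom (S.chart x) := fun s hs => S.ball_dom x (hf s hs)
  have hh' : ∀ s ∈ Icc c c', h s ∈ dom (S.chart x) := fun s hs => S.ball_dom x (hh s hs)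
  by_cases hm : Meets f h a a' c c'
  · obtain ⟨h1, α, hα, h2⟩ := S.ratio (f a) x (hf a (left_mem_Icc.2 H.shortL.1))
    have g1 : ∀ s ∈ Icc a a', f s ∈ ball (f a) S.ρ :=
      H.shortL.mem_ball (r := S.ρ / 8) (by simpa using S.ρ_pos) (by linarith [S.ρ_pos])
    have g2 : ∀ s ∈ Icc c c', h s ∈ ball (f a) S.ρ :=
      H.shortR.mem_ball (r := S.ρ / 8) (by rw [dist_comm]; exact H.dist_lt hm) (by linarith [S.ρ_pos])
    have ok := H.boxOK (fun s hs => S.ball_dom _ (g1 s hs)) (fun s hs => S.ball_dom _ (g2 s hs))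
    rw [cr, if_pos hm, ← turns_spec (exp_boxVar ok)]
    exact boxVar_ratio hα ok (H.boxOK hf' hh') fun s hs t ht hne =>
      h2 _ (g1 s hs) _ (g2 t ht) fun e => hne (by rw [diffIn, e, sub_self])
  · rw [cr, if_neg hm, Int.cast_zero, zero_mul]
    exact boxVar_eq_zero H.shortL.1 H.shortR.1 (diffIn_continuousOn hf' hh') fun s hs t ht =>
      diffIn_ne_zero (hf' s hs) (hh' t ht) fun e => hm ⟨s, hs, t, ht, e⟩

theorem two_pi_I_cancel {m n : ℤ}
    (h : (m : ℂ) * (2 * Real.pi * Complex.I) = n * (2 * Real.pi * Complex.I)) : m = n := by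
  exact_mod_cast mul_right_cancel₀ Complex.two_pi_I_ne_zero h

theorem Adm.swap {f h : C(ℝ, M)} {a a' c c' : ℝ} (H : S.Adm f h a a' c c') :
    S.Adm h f c c' a a' :=
  ⟨H.shortR, H.shortL, fun t ht => (H.bot t ht).symm, fun t ht => (H.top t ht).symm,
    fun t ht => (H.left t ht).symm, fun t ht => (H.right t ht).symm⟩

theorem meets_comm {f h : C(ℝ, M)} {a a' c c' : ℝ} : Meets h f c c' a a' ↔ Meets f h a a' c c' :=
  ⟨fun ⟨s, hs, t, ht, e⟩ => ⟨t, ht, s, hs, e.symm⟩, fun ⟨s, hs, t, ht, e⟩ => ⟨t, ht, s, hs, e.symm⟩⟩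

theorem Adm.cr_swap {f h : C(ℝ, M)} {a a' c c' : ℝ} (H : S.Adm f h a a' c c') :
    S.cr h f c c' a a' = -S.cr f h a a' c c' := by
  by_cases hm : Meets f h a a' c c'
  · have g1 : ∀ s ∈ Icc a a', f s ∈ ball (f a) S.ρ :=
      H.shortL.mem_ball (r := S.ρ / 8) (by simpa using S.ρ_pos) (by linarith [S.ρ_pos])
    have g2 : ∀ s ∈ Icc c c', h s ∈ ball (f a) S.ρ :=
      H.shortR.mem_ball (r := S.ρ / 8) (by rw [dist_comm]; exact H.dist_lt hm) (by linarith [S.ρ_pos])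
    have ok := H.boxOK (fun s hs => S.ball_dom _ (g1 s hs)) (fun s hs => S.ball_dom _ (g2 s hs))
    have e := boxVar_swap ok
    have e' : (fun t s => -diffIn (S.chart (f a)) f h s t) = diffIn (S.chart (f a)) h f := by
      funext t s
      simp [diffIn]
    rw [e', H.cr_spec g1 g2, H.swap.cr_spec g2 g1] at e
    refine two_pi_I_cancel (e.trans ?_)
    push_cast
    ring
  · rw [cr, if_neg (fun h => hm (meets_comm.1 h)), cr, if_neg hm, neg_zero]

theorem cr_eq_zero {f h : C(ℝ, M)} {a a' c c' : ℝ} (hm : ¬ Meets f h a a' c c') :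
    S.cr f h a a' c c' = 0 := if_neg hm

theorem cr_split {f h : C(ℝ, M)} {a m a' c c' : ℝ} (H1 : S.Adm f h a m c c')
    (H2 : S.Adm f h m a' c c') (H : S.Adm f h a a' c c') :
    S.cr f h a a' c c' = S.cr f h a m c c' + S.cr f h m a' c c' := by
  by_cases hm : Meets f h a a' c c'
  · have g1 : ∀ s ∈ Icc a a', f s ∈ ball (f a) S.ρ :=
      H.shortL.mem_ball (r := S.ρ / 8) (by simpa using S.ρ_pos) (by linarith [S.ρ_pos])
    have g2 : ∀ s ∈ Icc c c', h s ∈ ball (f a) S.ρ :=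
      H.shortR.mem_ball (r := S.ρ / 8) (by rw [dist_comm]; exact H.dist_lt hm) (by linarith [S.ρ_pos])
    have ok := H.boxOK (fun s hs => S.ball_dom _ (g1 s hs)) (fun s hs => S.ball_dom _ (g2 s hs))
    have k1 : ∀ s ∈ Icc a m, f s ∈ ball (f a) S.ρ := fun s hs => g1 s ⟨hs.1, hs.2.trans H2.shortL.1⟩
    have k2 : ∀ s ∈ Icc m a', f s ∈ ball (f a) S.ρ := fun s hs => g1 s ⟨H1.shortL.1.trans hs.1, hs.2⟩
    have e := boxVar_splitS (H1.boxOK (fun s hs => S.ball_dom _ (k1 s hs))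
      (fun s hs => S.ball_dom _ (g2 s hs))) (H2.boxOK (fun s hs => S.ball_dom _ (k2 s hs))
      (fun s hs => S.ball_dom _ (g2 s hs)))
    rw [H.cr_spec g1 g2, H1.cr_spec k1 g2, H2.cr_spec k2 g2] at e
    refine two_pi_I_cancel (e.trans ?_)
    push_cast
    ring
  · rw [cr_eq_zero hm, cr_eq_zero fun ⟨s, hs, t, ht, e⟩ =>
      hm ⟨s, ⟨hs.1, hs.2.trans H2.shortL.1⟩, t, ht, e⟩, cr_eq_zero fun ⟨s, hs, t, ht, e⟩ =>
      hm ⟨s, ⟨H1.shortL.1.trans hs.1, hs.2⟩, t, ht, e⟩, add_zero]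

/-! ### Replacing a piece of a curve -/

variable (S) in
/-- The winding number, around the point `q`, of the closed curve formed by a piece of `f` and the
reverse of a piece of `f'`. -/
def wind (f f' : C(ℝ, M)) (a a' A A' : ℝ) (q : M) : ℤ :=
  open Classical in
  if dist q (f a) < S.ρ / 2 then
    turns (logVar (fun s => coord (S.chart (f a)) (f s) - coord (S.chart (f a)) q) a a' -
      logVar (fun s => coord (S.chart (f a)) (f' s) - coord (S.chart (f a)) q) A A') else 0

theorem Short.mem_ball_self {f : C(ℝ, M)} {a a' : ℝ} (H : S.Short f a a') {p : M} (hp : f a = p) :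
    ∀ t ∈ Icc a a', f t ∈ ball p S.ρ :=
  H.mem_ball (r := S.ρ / 2) (by rw [hp, dist_self]; linarith [S.ρ_pos]) (by linarith [S.ρ_pos])

theorem nonzeroOn {f : C(ℝ, M)} {a a' : ℝ} (H : S.Short f a a') {p q : M} (hp : f a = p)
    (hq : q ∈ ball p S.ρ) (hfq : ∀ s ∈ Icc a a', f s ≠ q) :
    NonzeroOn (fun s => coord (S.chart p) (f s) - coord (S.chart p) q) a a' := by
  have h1 := H.mem_ball_self hp
  refine ⟨?_, fun s hs => diffIn_ne_zero (S.ball_dom _ (h1 s hs)) (S.ball_dom _ hq) (hfq s hs)⟩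
  exact ((coord_continuousOn _).comp f.continuous.continuousOn
    fun s hs => S.ball_dom _ (h1 s hs)).sub continuousOn_const

section Move

variable {f f' : C(ℝ, M)} {a a' A A' : ℝ} (hf : S.Short f a a') (hf' : S.Short f' A A')
  (h0 : f' A = f a) (h1 : f' A' = f a')

include hf hf' h0 h1

/-- Both pieces run between the same two points, so the variations of their logarithms differ by a
multiple of `2πi`. -/
theorem wind_spec {q : M} (hq : dist q (f a) < S.ρ / 2) (hfq : ∀ s ∈ Icc a a', f s ≠ q)
    (hfq' : ∀ s ∈ Icc A A', f' s ≠ q) :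
    logVar (fun s => coord (S.chart (f a)) (f s) - coord (S.chart (f a)) q) a a' -
      logVar (fun s => coord (S.chart (f a)) (f' s) - coord (S.chart (f a)) q) A A' =
    S.wind f f' a a' A A' q * (2 * Real.pi * Complex.I) := by
  have hqb : q ∈ ball (f a) S.ρ := by
    rw [Metric.mem_ball]
    linarith [S.ρ_pos]
  rw [wind, if_pos hq, ← turns_spec]
  have n1 := nonzeroOn hf rfl hqb hfq
  have n2 := nonzeroOn hf' h0 hqb hfq'
  rw [Complex.exp_sub, exp_logVar hf.1 n1, exp_logVar hf'.1 n2, h0, h1, div_self]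
  exact div_ne_zero (n1.2 a' (right_mem_Icc.2 hf.1)) (n1.2 a (left_mem_Icc.2 hf.1))

/-- If both pieces are seen from `q` within a slit plane, one branch of the logarithm serves for
both, and its end values agree. -/
theorem wind_eq_zero_of_slit {q : M} (hfq : ∀ s ∈ Icc a a', f s ≠ q)
    (hfq' : ∀ s ∈ Icc A A', f' s ≠ q)
    (hsl : dist q (f a) < S.ρ / 2 → ∃ α : ℂ, α ≠ 0 ∧ (∀ s ∈ Icc a a',
      (coord (S.chart (f a)) (f s) - coord (S.chart (f a)) q) / α ∈ Complex.slitPlane) ∧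
      ∀ s ∈ Icc A A',
      (coord (S.chart (f a)) (f' s) - coord (S.chart (f a)) q) / α ∈ Complex.slitPlane) :
    S.wind f f' a a' A A' q = 0 := by
  by_cases hq : dist q (f a) < S.ρ / 2
  · obtain ⟨α, hα, g1, g2⟩ := hsl hq
    have hqb : q ∈ ball (f a) S.ρ := by
      rw [Metric.mem_ball]
      linarith [S.ρ_pos]
    have := wind_spec hf hf' h0 h1 hq hfq hfq'
    rw [logVar_of_slitPlane hα hf.1 (nonzeroOn hf rfl hqb hfq).1 g1,
      logVar_of_slitPlane hα hf'.1 (nonzeroOn hf' h0 hqb hfq').1 g2, h0, h1, sub_self] at this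
    refine (two_pi_I_cancel (m := 0) (n := _) ?_).symm
    rw [← this]
    simp
  · exact if_neg hq

/-- Both pieces lie in the round coordinate ball of `S.convex`, and `q` lies outside it, so the
pieces are seen from `q` within a half-plane. -/
theorem wind_eq_zero_of_far {q : M} (hq : S.ρ / 8 ≤ dist q (f a)) :
    S.wind f f' a a' A A' q = 0 := by
  have hne : ∀ {g : C(ℝ, M)} {c c' : ℝ}, S.Short g c c' → g c = f a → ∀ s ∈ Icc c c', g s ≠ q := by
    intro g c c' hg hgc s hs e
    have := hg.2 s hs
    rw [e, hgc] at this
    linarith [S.η_le, S.ρ_pos]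
  refine wind_eq_zero_of_slit hf hf' h0 h1 (hne hf rfl) (hne hf' h0) fun hq2 => ?_
  obtain ⟨z, r, hz, hr⟩ := S.convex (f a)
  have hqb : q ∈ ball (f a) S.ρ := by
    rw [Metric.mem_ball]
    linarith [S.ρ_pos]
  have hrq := hr q hqb hq
  have hpos : 0 < r := (norm_nonneg _).trans_lt (hz (f a) (by simpa using S.η_pos))
  have key : ∀ u ∈ ball (f a) S.η, 0 < ((coord (S.chart (f a)) u - coord (S.chart (f a)) q) /
      (z - coord (S.chart (f a)) q)).re := by
    intro u hu
    refine re_div_pos_of_norm_sub_lt ?_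
    rw [sub_sub_sub_cancel_right, norm_sub_rev z]
    exact (hz u hu).trans_le hrq
  refine ⟨z - coord (S.chart (f a)) q, ?_, fun s hs => Or.inl (key _ (hf.2 s hs)), fun s hs =>
    Or.inl (key _ (by rw [← h0]; exact hf'.2 s hs))⟩
  intro e
  rw [norm_sub_rev, e, norm_zero] at hrq
  linarith

/-- A boundary point has first coordinate zero and all others are nonnegative, so differences to it
avoid the negative real axis. Hence ends on the boundary of the surface contribute nothing. -/
theorem wind_eq_zero_of_boundary {q : M} (hq : q ∈ (𝓡∂ 2).boundary M)
    (hfq : ∀ s ∈ Icc a a', f s ≠ q) (hfq' : ∀ s ∈ Icc A A', f' s ≠ q) :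
    S.wind f f' a a' A A' q = 0 := by
  refine wind_eq_zero_of_slit hf hf' h0 h1 hfq hfq' fun hq2 => ⟨1, one_ne_zero, ?_⟩
  have hqb : q ∈ ball (f a) S.ρ := by
    rw [Metric.mem_ball]
    linarith [S.ρ_pos]
  have hqd := S.ball_dom _ hqb
  have hq0 : (coord (S.chart (f a)) q).re = 0 := by
    refine le_antisymm (not_lt.1 fun h => ?_) (coord_re_nonneg _ _)
    have := (mem_interior_iff hqd).2 h
    rw [← ModelWithCorners.compl_interior] at hq
    exact hq this
  have key : ∀ u ∈ ball (f a) S.ρ, u ≠ q →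
      (coord (S.chart (f a)) u - coord (S.chart (f a)) q) / 1 ∈ Complex.slitPlane := by
    intro u hu hne
    have hn := diffIn_ne_zero (S.ball_dom _ hu) hqd hne
    have hre : 0 ≤ (coord (S.chart (f a)) u - coord (S.chart (f a)) q).re := by
      rw [Complex.sub_re, hq0, sub_zero]
      exact coord_re_nonneg _ _
    rw [div_one, Complex.mem_slitPlane_iff]
    rcases hre.lt_or_eq with h | h
    · exact Or.inl h
    · exact Or.inr fun him => hn (Complex.ext h.symm him)
  exact ⟨fun s hs => key _ (hf.mem_ball_self rfl s hs) (hfq s hs),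
    fun s hs => key _ (hf'.mem_ball_self h0 s hs) (hfq' s hs)⟩

/-- The sides of the two boxes along `h` are equal because the pieces have the same ends; the
remaining sides are the variations around `h c` and `h c'`. -/
theorem cr_sub_cr {h : C(ℝ, M)} {c c' : ℝ} (H : S.Adm f h a a' c c') (H' : S.Adm f' h A A' c c')
    (hc : dist (h c) (f a) < S.ρ / 4) : S.cr f h a a' c c' - S.cr f' h A A' c c' =
      S.wind f f' a a' A A' (h c') - S.wind f f' a a' A A' (h c) := by
  have g2 : ∀ s ∈ Icc c c', h s ∈ ball (f a) S.ρ :=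
      H.shortR.mem_ball (r := S.ρ / 4) hc (by linarith [S.ρ_pos])
  have e1 := H.cr_spec (hf.mem_ball_self rfl) g2
  have e2 := H'.cr_spec (hf'.mem_ball_self h0) g2
  have w1 := wind_spec hf hf' h0 h1 (q := h c) (by linarith [S.ρ_pos]) H.bot H'.bot
  have hc' := H.shortR.2 c' (right_mem_Icc.2 H.shortR.1)
  have w2 := wind_spec hf hf' h0 h1 (q := h c')
    (by linarith [S.ρ_pos, dist_triangle (h c') (h c) (f a), S.η_le]) H.top H'.top
  rw [boxVar] at e1 e2
  unfold diffIn at e1 e2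
  rw [h0, h1] at e2
  refine two_pi_I_cancel ?_
  push_cast
  rw [sub_mul, sub_mul, ← e1, ← e2, ← w1, ← w2]
  ring

/-- Replacing a short piece of `f` by another one with the same ends does not change the sum of the
crossing numbers with the pieces of `h`, weighted by labels which are locally constant. -/
theorem sum_cr_eq {Λ : Type*} [AddCommGroup Λ] {h : C(ℝ, M)} {t : ℕ → ℝ} {m : ℕ}
    (H : ∀ j < m, S.Adm f h a a' (t j) (t (j + 1))) (H' : ∀ j < m, S.Adm f' h A A' (t j) (t (j + 1)))
    {φ : ℕ → Λ} (hφ : ∀ j < m, dist (h (t j)) (f a) < S.ρ / 4 → φ j = φ (j + 1))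
    (hend : (h (t m) = h (t 0) ∧ φ m = φ 0) ∨
      (h (t 0) ∈ (𝓡∂ 2).boundary M ∧ h (t m) ∈ (𝓡∂ 2).boundary M)) :
    ∑ j ∈ Finset.range m, S.cr f h a a' (t j) (t (j + 1)) • φ j =
      ∑ j ∈ Finset.range m, S.cr f' h A A' (t j) (t (j + 1)) • φ j := by
  rcases Nat.eq_zero_or_pos m with rfl | hm
  · simp
  set W : ℕ → ℤ := fun j => S.wind f f' a a' A A' (h (t j)) with hW
  -- Summation by parts without a remainder: the label can change only where `h` is far from the
  -- piece, and there the winding numbers vanish.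
  have key : ∀ j < m, S.cr f h a a' (t j) (t (j + 1)) • φ j - S.cr f' h A A' (t j) (t (j + 1)) • φ j =
      W (j + 1) • φ (j + 1) - W j • φ j := by
    intro j hj
    by_cases hd : dist (h (t j)) (f a) < S.ρ / 4
    · rw [← sub_smul, cr_sub_cr hf hf' h0 h1 (H j hj) (H' j hj) hd, ← hφ j hj hd, sub_smul]
    · have hsh := (H j hj).shortR.2 _ (right_mem_Icc.2 (H j hj).shortR.1)
      have z1 : W j = 0 := wind_eq_zero_of_far hf hf' h0 h1 (by linarith [S.ρ_pos])
      have z2 : W (j + 1) = 0 := wind_eq_zero_of_far hf hf' h0 h1 (by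
        linarith [S.ρ_pos, S.η_le, dist_triangle (h (t j)) (h (t (j + 1))) (f a),
          dist_comm (h (t j)) (h (t (j + 1)))])
      rw [z1, z2, cr_eq_zero, cr_eq_zero]
      · simp
      · intro hm
        have := (H' j hj).dist_lt hm
        rw [h0, dist_comm] at this
        linarith [S.ρ_pos]
      · intro hm
        have := (H j hj).dist_lt hm
        rw [dist_comm] at this
        linarith [S.ρ_pos]
  rw [← sub_eq_zero, ← Finset.sum_sub_distrib,
    Finset.sum_congr rfl fun j hj => key j (Finset.mem_range.1 hj),
    Finset.sum_range_sub (fun j => W j • φ j)]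
  -- The telescoped end terms agree when `h` and its labels close up, and vanish separately when the
  -- ends are boundary points.
  rcases hend with ⟨e1, e2⟩ | ⟨b1, b2⟩
  · rw [hW]
    simp only
    rw [e1, e2, sub_self]
  · have z1 : W 0 = 0 := wind_eq_zero_of_boundary hf hf' h0 h1 b1 (H 0 hm).bot (H' 0 hm).bot
    obtain ⟨m, rfl⟩ : ∃ k, m = k + 1 := ⟨m - 1, by omega⟩
    have z2 : W (m + 1) = 0 := wind_eq_zero_of_boundary hf hf' h0 h1 b2
      (H m (by omega)).top (H' m (by omega)).top
    rw [z1, z2]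
    simp

end Move

end Scale

end CrossingNumbers

/-! ### Intersection sums of chains of short pieces -/

section Chains

open Set Filter Topology Metric

set_option linter.unusedSectionVars false

/-- A curve with a partition of a part of it. -/
structure Chain (M : Type*) [TopologicalSpace M] where
  f : C(ℝ, M)
  s : ℕ → ℝ
  n : ℕ

namespace Chain

variable {M : Type*} [TopologicalSpace M] (F : Chain M)

/-- The division points of the curve. -/
def vtx (i : ℕ) : M := F.f (F.s i)

/-- The class of the curve up to a division point. -/
def cls [PathConnectedSpace M] (x₀ : M) (i : ℕ) : LoopGroup x₀ := hol x₀ F.f (F.s 0) (F.s i)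

/-- A curve divided at the integers. -/
abbrev int (f : C(ℝ, M)) (n : ℕ) : Chain M := ⟨f, fun i => i, n⟩

theorem cls_succ [PathConnectedSpace M] (x₀ : M) (i : ℕ) :
    F.cls x₀ (i + 1) = F.cls x₀ i * hol x₀ F.f (F.s i) (F.s (i + 1)) := (hol_trans _ _ _ _ _).symm

theorem cls_zero [PathConnectedSpace M] (x₀ : M) : F.cls x₀ 0 = 1 := hol_self _ _ _

end Chain

variable {M : Type*} [MetricSpace M] [CompactSpace M] [ChartedSpace (EuclideanHalfSpace 2) M]

/-- The path consists of two coordinate segments with a generic corner. It lies on two lines of the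
chart, hence has dense complement, and it remains in the interior when its ends do. -/
theorem exists_connect [IsManifold (𝓡∂ 2) ∞ M] {ε : ℝ} (hε : 0 < ε) : ∃ δ > 0, ∀ p q : M, dist q p < δ → ∀ A : Set M,
    A.Countable → p ∉ A → q ∉ A → ∃ c : Path p q, (∀ t, c t ∈ ball p ε) ∧ (∀ t, c t ∉ A) ∧
      Dense (range c)ᶜ ∧ (p ∈ (𝓡∂ 2).interior M → q ∈ (𝓡∂ 2).interior M →
        ∀ t, c t ∈ (𝓡∂ 2).interior M) := by
  obtain ⟨δ, hδ, h⟩ := exists_disc_scale (M := M) hε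
  refine ⟨δ, hδ, fun p q hpq A hA hpA hqA => ?_⟩
  obtain ⟨Q, h1, h2⟩ := h p
  have hp : p ∈ Q.U := h1 (mem_ball_self hδ)
  have hq : q ∈ Q.U := h1 hpq
  obtain ⟨w, hw, -, hw0, hav⟩ := Q.exists_bend hp hq hA hpA hqA (Z := ∅) (by simp)
  refine ⟨Q.bend hp hw hq, fun t => h2 (Q.bend_mem hp hw hq t), hav, Q.bend_dense hp hw hq,
    fun hpi hqi t => ?_⟩
  rw [mem_interior_iff (Q.bend_mem hp hw hq t).1]
  exact Q.bend_re_pos hp hw hq ((mem_interior_iff hp.1).1 hpi) hw0 ((mem_interior_iff hq.1).1 hqi) t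

variable [PathConnectedSpace M] [IsManifold (𝓡∂ 2) ∞ M] {x₀ : M} (S : Scale x₀)

namespace Scale

/-- A radius such that points at smaller distance can be joined by short paths. -/
def δ : ℝ := min (exists_connect (M := M) (ε := S.η / 4) (by have := S.η_pos; positivity)).choose (S.η / 4)

theorem δ_pos : 0 < S.δ :=
  lt_min (exists_connect (M := M) (ε := S.η / 4) (by have := S.η_pos; positivity)).choose_spec.1
    (by have := S.η_pos; positivity)

theorem δ_le : S.δ ≤ S.η / 4 := min_le_right _ _

theorem connect {p q : M} (hpq : dist q p < S.δ) {A : Set M} (hA : A.Countable) (hp : p ∉ A)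
    (hq : q ∉ A) : ∃ c : Path p q, (∀ t, c t ∈ ball p (S.η / 4)) ∧ (∀ t, c t ∉ A) ∧
      Dense (range c)ᶜ ∧ (p ∈ (𝓡∂ 2).interior M → q ∈ (𝓡∂ 2).interior M →
        ∀ t, c t ∈ (𝓡∂ 2).interior M) :=
  (exists_connect (M := M) (ε := S.η / 4) (by have := S.η_pos; positivity)).choose_spec.2 p q
    (hpq.trans_le (min_le_left _ _)) A hA hp hq

variable {S} in
theorem κ_self (p : M) : S.κ p p = 1 := by
  have hp := mem_ball_self (x := p) S.ρ_pos
  exact mul_eq_right.1 (S.κ_mul p p hp p hp p hp)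

variable {S} in
theorem κ_inv {p q : M} (h : dist q p < S.ρ) : (S.κ p q)⁻¹ = S.κ q p := by
  have hp := mem_ball_self (x := p) S.ρ_pos
  rw [inv_eq_iff_mul_eq_one, S.κ_mul p p hp q h p hp, κ_self]

/-- All pieces of the two chains are short and have their ends off the pieces of the other one. -/
def Compat (F H : Chain M) : Prop :=
  ∀ i < F.n, ∀ j < H.n, S.Adm F.f H.f (F.s i) (F.s (i + 1)) (H.s j) (H.s (j + 1))

/-- The loop which runs along `F`, then back along `H`, with a change near division points. -/
def lab (F H : Chain M) (i j : ℕ) : LoopGroup x₀ :=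
  F.cls x₀ i * S.κ (F.vtx i) (H.vtx j) * (H.cls x₀ j)⁻¹

variable {Λ : Type*} [AddCommGroup Λ]

/-- The sum over the intersections of two chains, weighted by a function of the loops formed by
the two curves. -/
def isum (φ : LoopGroup x₀ → Λ) (F H : Chain M) : Λ :=
  ∑ i ∈ Finset.range F.n, ∑ j ∈ Finset.range H.n,
    S.cr F.f H.f (F.s i) (F.s (i + 1)) (H.s j) (H.s (j + 1)) • φ (S.lab F H i j)

/-- The weight is compatible with the ends of the chain. -/
def EndOK (φ : LoopGroup x₀ → Λ) (H : Chain M) : Prop :=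
  (H.vtx H.n = H.vtx 0 ∧ ∀ u, φ (u * (H.cls x₀ H.n)⁻¹) = φ u) ∨
    (H.vtx 0 ∈ (𝓡∂ 2).boundary M ∧ H.vtx H.n ∈ (𝓡∂ 2).boundary M)

variable {S}

theorem Compat.swap {F H : Chain M} (h : S.Compat F H) : S.Compat H F :=
  fun j hj i hi => (h i hi j hj).swap

/-- Moving the point where one passes to `h` along a short piece near `p` does not change the loop;
so the labels in an intersection sum are locally constant, as `sum_cr_eq` requires. -/
theorem lab_near {h : C(ℝ, M)} {c c' d : ℝ} (hh : S.Short h c c') {p : M}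
    (hp : dist (h c) p < S.ρ / 4) :
    S.κ p (h c) * (hol x₀ h d c)⁻¹ = S.κ p (h c') * (hol x₀ h d c')⁻¹ := by
  have h1 : ∀ t ∈ uIcc c c', h t ∈ ball p S.ρ := by
    rw [uIcc_of_le hh.1]
    exact hh.mem_ball hp (by linarith [S.ρ_pos])
  rw [← hol_trans x₀ h d c c', S.κ_hol p h c c' h1, mul_inv_rev,
    ← S.κ_mul p p (mem_ball_self S.ρ_pos) (h c) (h1 _ left_mem_uIcc) (h c') (h1 _ right_mem_uIcc)]
  group

/-- This is `sum_cr_eq` for the group-theoretic labels; `EndOK` supplies exactly its condition at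
the ends of `H`. -/
theorem sum_piece_eq {φ : LoopGroup x₀ → Λ} {H : Chain M} (hend : EndOK φ H) {f f' : C(ℝ, M)}
    {a a' A A' : ℝ} (h0 : f' A = f a) (h1 : f' A' = f a')
    (Hf : ∀ j < H.n, S.Adm f H.f a a' (H.s j) (H.s (j + 1)))
    (Hf' : ∀ j < H.n, S.Adm f' H.f A A' (H.s j) (H.s (j + 1))) (g : LoopGroup x₀) :
    ∑ j ∈ Finset.range H.n, S.cr f H.f a a' (H.s j) (H.s (j + 1)) •
        φ (g * (S.κ (f a) (H.vtx j) * (H.cls x₀ j)⁻¹)) =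
      ∑ j ∈ Finset.range H.n, S.cr f' H.f A A' (H.s j) (H.s (j + 1)) •
        φ (g * (S.κ (f a) (H.vtx j) * (H.cls x₀ j)⁻¹)) := by
  rcases Nat.eq_zero_or_pos H.n with hz | hm
  · rw [hz]
    simp
  refine sum_cr_eq (Hf 0 hm).shortL (Hf' 0 hm).shortL h0 h1 Hf Hf' (φ := fun j =>
    φ (g * (S.κ (f a) (H.vtx j) * (H.cls x₀ j)⁻¹))) (fun j hj hd => ?_) ?_
  · rw [Chain.vtx, Chain.cls, lab_near (Hf j hj).shortR hd]
    rfl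
  · rcases hend with ⟨e1, e2⟩ | h
    · refine Or.inl ⟨e1, ?_⟩
      rw [e1, ← mul_assoc, e2, H.cls_zero, inv_one, mul_one]
    · exact Or.inr h

theorem isum_eq_of_pieces {φ : LoopGroup x₀ → Λ} {F F' H : Chain M} (hend : EndOK φ H)
    (hF : S.Compat F H) (hF' : S.Compat F' H) (hn : F'.n = F.n) (hv : ∀ i ≤ F.n, F'.vtx i = F.vtx i)
    (hc : ∀ i ≤ F.n, F'.cls x₀ i = F.cls x₀ i) : S.isum φ F H = S.isum φ F' H := by
  rw [isum, isum, hn]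
  refine Finset.sum_congr rfl fun i hi => ?_
  rw [Finset.mem_range] at hi
  have := sum_piece_eq hend (hv i hi.le) (hv (i + 1) hi) (hF i hi) (hF' i (by omega)) (F.cls x₀ i)
  simp only [lab, hv i hi.le, hc i hi.le, mul_assoc]
  exact this

/-- Crossing numbers are antisymmetric, and the loop along `H` and back along `F` is the inverse of
the one along `F` and back along `H`. The labels need only be compared for pieces that meet, where
`κ_inv` applies. -/
theorem isum_swap {φ : LoopGroup x₀ → Λ} {F H : Chain M} (h : S.Compat F H) :
    S.isum φ F H = -S.isum (fun u => φ u⁻¹) H F := by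
  rw [isum, isum, Finset.sum_comm, ← Finset.sum_neg_distrib]
  refine Finset.sum_congr rfl fun j hj => ?_
  rw [← Finset.sum_neg_distrib]
  refine Finset.sum_congr rfl fun i hi => ?_
  rw [Finset.mem_range] at hi hj
  have H0 := h i hi j hj
  rw [H0.cr_swap, neg_smul, neg_neg]
  by_cases hm : Meets F.f H.f (F.s i) (F.s (i + 1)) (H.s j) (H.s (j + 1))
  · congr 2
    have : dist (F.vtx i) (H.vtx j) < S.ρ := (H0.dist_lt hm).trans (by linarith [S.ρ_pos])
    rw [lab, lab, mul_inv_rev, mul_inv_rev, inv_inv, κ_inv this, mul_assoc]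
  · rw [cr_eq_zero hm, zero_smul, zero_smul]

theorem isum_map {Λ' : Type*} [AddCommGroup Λ'] (T : Λ →+ Λ') (φ : LoopGroup x₀ → Λ) (F H : Chain M) :
    T (S.isum φ F H) = S.isum (fun u => T (φ u)) F H := by
  simp [isum, map_sum, map_zsmul]

/-! ### Invariance under homotopies of the first chain -/

variable (S) in
/-- The points off a chain. -/
def off (H : Chain M) : Set M :=
  {p | ∀ j < H.n, ∀ t ∈ Icc (H.s j) (H.s (j + 1)), p ≠ H.f t}

section Omega

variable (S) (φ : LoopGroup x₀ → Λ) (H : Chain M)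

/-- A chosen short path which avoids the division points of `H`. -/
def conn (p q : M) : C(ℝ, M) :=
  open Classical in
  if h : ∃ c : Path p q, ∀ t, dist (c t) p < S.η / 4 ∧ ∀ j ≤ H.n, c t ≠ H.vtx j then ext h.choose
  else ContinuousMap.const ℝ p

/-- The contribution of a short path to an intersection sum. -/
def omega (p q : M) (g : LoopGroup x₀) : Λ :=
  ∑ j ∈ Finset.range H.n, S.cr (S.conn H p q) H.f 0 1 (H.s j) (H.s (j + 1)) •
    φ (g * (S.κ p (H.vtx j) * (H.cls x₀ j)⁻¹))

variable {S φ H}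

theorem conn_spec {p q : M} (hp : p ∈ off H) (hq : q ∈ off H) (hpq : dist q p < S.δ)
    (hs : ∀ j < H.n, S.Short H.f (H.s j) (H.s (j + 1))) (hn : 0 < H.n) :
    ∃ c : Path p q, (∀ t, dist (c t) p < S.η / 4) ∧ (∀ t, ∀ j ≤ H.n, c t ≠ H.vtx j) ∧
      S.conn H p q = ext c := by
  have hoff : ∀ p ∈ off H, p ∉ H.vtx '' Iic H.n := by
    rintro p hp ⟨j, hj, rfl⟩
    rcases Nat.lt_or_ge j H.n with h | h
    · exact hp j h _ (left_mem_Icc.2 (hs j h).1) rfl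
    · obtain ⟨k, hk⟩ : ∃ k, H.n = k + 1 := ⟨H.n - 1, by omega⟩
      have hj' : j = k + 1 := by have := mem_Iic.1 hj; omega
      subst hj'
      exact hp k (by omega) _ (right_mem_Icc.2 (hs k (by omega)).1) rfl
  obtain ⟨c, h1, h2, -⟩ := S.connect hpq (A := H.vtx '' Iic H.n)
    ((finite_Iic _).image _).countable (hoff p hp) (hoff q hq)
  have hex : ∃ c : Path p q, ∀ t, dist (c t) p < S.η / 4 ∧ ∀ j ≤ H.n, c t ≠ H.vtx j :=
    ⟨c, fun t => ⟨h1 t, fun j hj e => h2 t ⟨j, hj, e.symm⟩⟩⟩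
  exact ⟨hex.choose, fun t => (hex.choose_spec t).1, fun t => (hex.choose_spec t).2, dif_pos hex⟩

theorem ext_mem {p q : M} (c : Path p q) {P : M → Prop} (h : ∀ t, P (c t)) (t : ℝ) : P (ext c t) :=
  h (projIcc 0 1 zero_le_one t)

@[simp] theorem ext_zero {p q : M} (c : Path p q) : ext c 0 = p := c.extend_zero

@[simp] theorem ext_one {p q : M} (c : Path p q) : ext c 1 = q := c.extend_one

theorem adm_of_avoid {f : C(ℝ, M)} {a a' : ℝ} (hf : S.Short f a a')
    (hs : ∀ j < H.n, S.Short H.f (H.s j) (H.s (j + 1))) (h0 : f a ∈ off H) (h1 : f a' ∈ off H)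
    (hav : ∀ t ∈ Icc a a', ∀ j ≤ H.n, f t ≠ H.vtx j) :
    ∀ j < H.n, S.Adm f H.f a a' (H.s j) (H.s (j + 1)) := fun j hj =>
  ⟨hf, hs j hj, h0 j hj, h1 j hj, fun s h => hav s h j hj.le, fun s h => hav s h (j + 1) hj⟩

/-- By `sum_piece_eq` the contribution does not depend on the short path chosen between the two
points. -/
theorem omega_eq (hend : EndOK φ H) {f : C(ℝ, M)} {a a' : ℝ}
    (Hf : ∀ j < H.n, S.Adm f H.f a a' (H.s j) (H.s (j + 1))) (hd : dist (f a') (f a) < S.δ)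
    (g : LoopGroup x₀) : S.omega φ H (f a) (f a') g =
      ∑ j ∈ Finset.range H.n, S.cr f H.f a a' (H.s j) (H.s (j + 1)) •
        φ (g * (S.κ (f a) (H.vtx j) * (H.cls x₀ j)⁻¹)) := by
  rcases Nat.eq_zero_or_pos H.n with hz | hm
  · rw [omega, hz]
    simp
  have hs : ∀ j < H.n, S.Short H.f (H.s j) (H.s (j + 1)) := fun j hj => (Hf j hj).shortR
  obtain ⟨c, h1, h2, h3⟩ := conn_spec (S := S) (H := H) (p := f a) (q := f a')
    (fun j hj => (Hf j hj).left) (fun j hj => (Hf j hj).right) hd hs hm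
  rw [omega, h3]
  refine (sum_piece_eq hend (ext_zero c) (ext_one c) Hf (adm_of_avoid (S := S)
    ⟨zero_le_one, fun t _ => ?_⟩ hs ?_ ?_ fun t _ => ext_mem c
      (P := fun u => ∀ j ≤ H.n, u ≠ H.vtx j) h2 t) g).symm
  · rw [ext_zero]
    exact ext_mem c (P := fun u => dist u (f a) < S.η) (fun t => (h1 t).trans
      (by linarith [S.η_pos])) t
  · rw [ext_zero]
    exact fun j hj => (Hf j hj).left
  · rw [ext_one]
    exact fun j hj => (Hf j hj).right

/-- The joined path is cut at `q`. On its second half the label starts from `g * κ p q`, which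
agrees with the label from `p` wherever the pieces meet. -/
theorem omega_add (hend : EndOK φ H) (hs : ∀ j < H.n, S.Short H.f (H.s j) (H.s (j + 1)))
    {p q r : M} (hp : p ∈ off H) (hq : q ∈ off H) (hr : r ∈ off H) (hpq : dist q p < S.δ)
    (hqr : dist r q < S.δ) (hpr : dist r p < S.δ) (g : LoopGroup x₀) :
    S.omega φ H p r g = S.omega φ H p q g + S.omega φ H q r (g * S.κ p q) := by
  rcases Nat.eq_zero_or_pos H.n with hz | hm
  · simp [omega, hz]
  have hη := S.η_pos
  have hηρ := S.η_le
  have hδη := S.δ_le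
  obtain ⟨c, h1, h2, -⟩ := conn_spec (S := S) hp hq hpq hs hm
  obtain ⟨d, k1, k2, -⟩ := conn_spec (S := S) hq hr hqr hs hm
  set E := ext (c.trans d) with hE
  have e0 : E 0 = p := ext_zero _
  have e1 : E 1 = r := ext_one _
  have eh : E (1 / 2) = q := by
    have h : (1 / 2 : ℝ) ∈ Icc (0 : ℝ) 1 := ⟨by norm_num, by norm_num⟩
    change (c.trans d).extend (1 / 2) = q
    rw [Path.extend_apply _ h, Path.trans_apply, dif_pos (le_refl _)]
    simp
  have hcd : ∀ t, (dist ((c.trans d) t) p < S.η / 2) ∧ ∀ j ≤ H.n, (c.trans d) t ≠ H.vtx j := by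
    intro t
    rw [Path.trans_apply]
    split_ifs
    · exact ⟨(h1 _).trans (by linarith), h2 _⟩
    · exact ⟨by linarith [dist_triangle (d ⟨2 * t - 1, by grind⟩) q p, k1 ⟨2 * t - 1, by grind⟩],
        k2 _⟩
  have hEp : ∀ t, dist (E t) p < S.η / 2 := ext_mem _ (P := fun u => dist u p < S.η / 2)
    fun t => (hcd t).1
  have hEv : ∀ t, ∀ j ≤ H.n, E t ≠ H.vtx j := ext_mem _ (P := fun u => ∀ j ≤ H.n, u ≠ H.vtx j)
    fun t => (hcd t).2
  have A1 : ∀ j < H.n, S.Adm E H.f 0 (1 / 2) (H.s j) (H.s (j + 1)) := adm_of_avoid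
    ⟨by norm_num, fun t _ => by rw [e0]; linarith [hEp t]⟩ hs (by rwa [e0]) (by rwa [eh])
      fun t _ => hEv t
  have A2 : ∀ j < H.n, S.Adm E H.f (1 / 2) 1 (H.s j) (H.s (j + 1)) := adm_of_avoid
    ⟨by norm_num, fun t _ => by
      rw [eh]
      linarith [hEp t, dist_triangle (E t) p q, dist_comm p q]⟩ hs (by rwa [eh]) (by rwa [e1])
      fun t _ => hEv t
  have A3 : ∀ j < H.n, S.Adm E H.f 0 1 (H.s j) (H.s (j + 1)) := adm_of_avoid
    ⟨by norm_num, fun t _ => by rw [e0]; linarith [hEp t]⟩ hs (by rwa [e0]) (by rwa [e1])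
      fun t _ => hEv t
  have w1 := omega_eq hend A1 (by rwa [e0, eh]) g
  have w2 := omega_eq hend A2 (by rwa [e1, eh]) (g * S.κ p q)
  have w3 := omega_eq hend A3 (by rwa [e0, e1]) g
  rw [e0, eh] at w1
  rw [e1, eh] at w2
  rw [e0, e1] at w3
  rw [w1, w2, w3, ← Finset.sum_add_distrib]
  refine Finset.sum_congr rfl fun j hj => ?_
  rw [Finset.mem_range] at hj
  rw [cr_split (A1 j hj) (A2 j hj) (A3 j hj), add_smul]
  congr 1
  by_cases hm : Meets E H.f (1 / 2) 1 (H.s j) (H.s (j + 1))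
  · have h5 := (A2 j hj).dist_lt hm
    rw [eh] at h5
    rw [mul_assoc g, ← mul_assoc (S.κ p q), S.κ_mul p p (mem_ball_self S.ρ_pos) q
      (by rw [mem_ball]; linarith) (H.vtx j)]
    rw [mem_ball, Chain.vtx]
    linarith [dist_triangle (H.f (H.s j)) q p, dist_comm q (H.f (H.s j))]
  · rw [cr_eq_zero hm, zero_smul, zero_smul]

theorem omega_self (hend : EndOK φ H) (hs : ∀ j < H.n, S.Short H.f (H.s j) (H.s (j + 1)))
    {p : M} (hp : p ∈ off H) (g : LoopGroup x₀) : S.omega φ H p p g = 0 := by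
  have h := omega_add hend hs hp hp hp (by simpa using S.δ_pos) (by simpa using S.δ_pos)
    (by simpa using S.δ_pos) g
  rw [κ_self, mul_one] at h
  exact left_eq_add.1 h

end Omega

/-- By `omega_add`, the map `(g, v) ↦ (g κ(p, q), v + omega p q g)` is a local cocycle in the points
`p`, `q`. Its product along a curve yields the class of the curve together with the intersection
sum, and is a homotopy invariant by `LocalCocycle.chainProd_eq`. -/
theorem isum_eq_of_hol {φ : LoopGroup x₀ → Λ} {H : Chain M} (hend : EndOK φ H)
    (hd : Dense (off H)) {f f' : C(ℝ, M)} {n n' : ℕ} (hn : 0 < n)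
    (hn' : 0 < n') (h0 : f 0 = f' 0) (h1 : f n = f' n') (hol_eq : hol x₀ f 0 n = hol x₀ f' 0 n')
    (hf : ∀ i < n, ∃ x, ∀ t ∈ Icc (i : ℝ) (i + 1), f t ∈ ball x (S.δ / 4))
    (hf' : ∀ i < n', ∃ x, ∀ t ∈ Icc (i : ℝ) (i + 1), f' t ∈ ball x (S.δ / 4))
    (hF : S.Compat (.int f n) H) (hF' : S.Compat (.int f' n') H) :
    S.isum φ (.int f n) H = S.isum φ (.int f' n') H := by
  classical
  rcases Nat.eq_zero_or_pos H.n with hz | hm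
  · simp [isum, hz]
  have hδ := S.δ_pos
  have hδη := S.δ_le
  have hηρ := S.η_le
  have hρ := S.ρ_pos
  have hs : ∀ j < H.n, S.Short H.f (H.s j) (H.s (j + 1)) := fun j hj => (hF 0 hn j hj).shortR
  -- The homotopy passes through points of `H`, where `omega` is not controlled, so points are first
  -- moved slightly off `H`; points already off `H` stay fixed.
  have hpick : ∀ p : M, ∃ q ∈ off H, dist q p < S.δ / 8 ∧ (p ∈ off H → q = p) := by
    intro p
    by_cases hp : p ∈ off H
    · exact ⟨p, hp, by rw [dist_self]; positivity, fun _ => rfl⟩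
    · obtain ⟨q, hq, h⟩ := hd.exists_dist_lt p (ε := S.δ / 8) (by positivity)
      exact ⟨q, hq, by rwa [dist_comm], fun h => (hp h).elim⟩
  choose pick hpo hpd hpe using hpick
  -- The opposite monoid is used because the steps of a chain act from left to right.
  let T : M → M → (Function.End (LoopGroup x₀ × Λ))ᵐᵒᵖ := fun p q => MulOpposite.op
    fun u => (u.1 * S.κ (pick p) (pick q), u.2 + S.omega φ H (pick p) (pick q) u.1)
  have hT : LocalCocycle T (S.δ / 4) := by
    refine ⟨by positivity, fun p => ?_, fun x p hp q hq r hr => ?_⟩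
    · refine MulOpposite.unop_injective (funext fun u => ?_)
      change (u.1 * S.κ (pick p) (pick p), u.2 + S.omega φ H (pick p) (pick p) u.1) = u
      rw [κ_self, mul_one, omega_self hend hs (hpo p), add_zero]
    · have hdist : ∀ p ∈ ball x (S.δ / 4), ∀ q ∈ ball x (S.δ / 4), dist (pick q) (pick p) < S.δ := by
        intro p hp q hq
        rw [mem_ball] at hp hq
        linarith [dist_triangle (pick q) q (pick p), dist_triangle q p (pick p),
          dist_triangle q x p, dist_comm x p, dist_comm p (pick p), hpd p, hpd q]
      have hball : ∀ p ∈ ball x (S.δ / 4), pick p ∈ ball x S.ρ := by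
        intro p hp
        rw [mem_ball] at hp ⊢
        linarith [dist_triangle (pick p) p x, hpd p]
      refine MulOpposite.unop_injective (funext fun u => ?_)
      change (u.1 * S.κ (pick p) (pick q) * S.κ (pick q) (pick r),
        u.2 + S.omega φ H (pick p) (pick q) u.1 +
          S.omega φ H (pick q) (pick r) (u.1 * S.κ (pick p) (pick q))) =
        (u.1 * S.κ (pick p) (pick r), u.2 + S.omega φ H (pick p) (pick r) u.1)
      rw [omega_add hend hs (hpo p) (hpo q) (hpo r) (hdist p hp q hq) (hdist q hq r hr)
        (hdist p hp r hr), mul_assoc, S.κ_mul x _ (hball p hp) _ (hball q hq) _ (hball r hr), add_assoc]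
  have key : ∀ (f : C(ℝ, M)) (n : ℕ), S.Compat (.int f n) H →
      (∀ i < n, ∃ x, ∀ t ∈ Icc (i : ℝ) (i + 1), f t ∈ ball x (S.δ / 4)) →
      (MulOpposite.unop (chainProd T (fun i => f i) n)) ((1 : LoopGroup x₀), (0 : Λ)) =
        (hol x₀ f 0 n, S.isum φ (.int f n) H) := by
    intro f n hF hf
    induction n with
    | zero =>
      change ((1 : LoopGroup x₀), (0 : Λ)) = _
      simp [isum, hol_self]
    | succ n ih =>
      have hF0 := hF n (Nat.lt_succ_self n)
      have hv0 : f n ∈ off H := fun j hj => (hF0 j hj).left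
      have hv1 : f (n + 1 : ℕ) ∈ off H := fun j hj => (hF0 j hj).right
      obtain ⟨x, hx⟩ := hf n (Nat.lt_succ_self n)
      have hx0 := hx n (by simp)
      have hx1 := hx (n + 1 : ℕ) (by simp)
      rw [chainProd, MulOpposite.unop_mul]
      change (MulOpposite.unop (T (f n) (f (n + 1 : ℕ))))
        ((MulOpposite.unop (chainProd T (fun i => f i) n)) (1, 0)) = _
      rw [ih (fun i hi => hF i (Nat.lt_succ_of_lt hi)) fun i hi => hf i (Nat.lt_succ_of_lt hi)]
      change (hol x₀ f 0 n * S.κ (pick (f n)) (pick (f (n + 1 : ℕ))), S.isum φ (.int f n) H +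
        S.omega φ H (pick (f n)) (pick (f (n + 1 : ℕ))) (hol x₀ f 0 n)) = _
      rw [hpe _ hv0, hpe _ hv1]
      have hκ : S.κ (f n) (f (n + 1 : ℕ)) = hol x₀ f n (n + 1 : ℕ) := by
        refine (S.κ_hol x f _ _ fun t ht => ?_).symm
        rw [uIcc_of_le (by simp)] at ht
        exact ball_subset_ball (by linarith) (hx t ⟨ht.1, by simpa using ht.2⟩)
      refine Prod.ext ?_ ?_
      · rw [hκ, hol_trans]
      · rw [omega_eq hend hF0 (by
          rw [mem_ball] at hx0 hx1
          linarith [dist_triangle (f (n + 1 : ℕ)) x (f n), dist_comm x (f n)])]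
        change _ = ∑ i ∈ Finset.range (n + 1), _
        rw [Finset.sum_range_succ]
        refine congrArg₂ (· + ·) rfl ?_
        refine Finset.sum_congr rfl fun j hj => ?_
        rw [lab]
        congr 2
        have e : (Chain.int f (n + 1)).cls x₀ n = hol x₀ f 0 n := by
          simp [Chain.cls]
        rw [mul_assoc, e]
        rfl
  have e1 := key f n hF hf
  have e2 := key f' n' hF' hf'
  rw [hT.chainProd_eq x₀ hn hn' h0 h1 hol_eq hf hf', e2] at e1
  exact (congrArg Prod.snd e1).symm

end Scale

end Chains

/-! ### Existence of chains and independence of choices -/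

section Join

open Set

variable {M : Type*} [TopologicalSpace M]

/-- The curve which agrees with `f` up to the parameter `a`, and runs along `g` afterwards. -/
def join (f g : C(ℝ, M)) (a : ℝ) (h : f a = g 0) : C(ℝ, M) where
  toFun t := if t ≤ a then f t else g (t - a)
  continuous_toFun := by
    refine Continuous.if_le f.continuous (g.continuous.comp (by fun_prop)) continuous_id
      continuous_const ?_
    rintro t rfl
    rw [h, sub_self]

theorem join_left {f g : C(ℝ, M)} {a : ℝ} (h : f a = g 0) {t : ℝ} (ht : t ≤ a) :
    join f g a h t = f t := if_pos ht

theorem join_right {f g : C(ℝ, M)} {a : ℝ} (h : f a = g 0) {t : ℝ} (ht : 0 ≤ t) :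
    join f g a h (a + t) = g t := by
  rcases ht.eq_or_lt with rfl | h0
  · rw [add_zero, join_left h le_rfl, h]
  · refine (if_neg (by linarith)).trans ?_
    rw [add_sub_cancel_left]

theorem hol_join_left [PathConnectedSpace M] (x₀ : M) {f g : C(ℝ, M)} {a : ℝ} (h : f a = g 0)
    {s t : ℝ} (hs : s ≤ a) (ht : t ≤ a) : hol x₀ (join f g a h) s t = hol x₀ f s t :=
  hol_congr x₀ fun _ hu => join_left h (hu.2.trans (max_le hs ht))

theorem hol_join_right [PathConnectedSpace M] (x₀ : M) {f g : C(ℝ, M)} {a : ℝ} (h : f a = g 0)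
    {s t : ℝ} (hs : 0 ≤ s) (ht : 0 ≤ t) :
    hol x₀ (join f g a h) (a + s) (a + t) = hol x₀ g s t := by
  have hc := hol_comp x₀ (join f g a h) ⟨fun u => a + u, by fun_prop⟩ s t
  refine hc.symm.trans ?_
  exact hol_congr x₀ fun _ hu => join_right h ((le_min hs ht).trans hu.1)

/-- A sequence of consecutive paths can be glued to a curve. -/
theorem exists_glue (v : ℕ → M) (e : ∀ i, Path (v i) (v (i + 1))) (n : ℕ) :
    ∃ f : C(ℝ, M), f n = v n ∧ ∀ i < n, ∀ t : I, f (i + t) = e i t := by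
  induction n with
  | zero => exact ⟨ContinuousMap.const ℝ (v 0), rfl, fun i hi => absurd hi (by omega)⟩
  | succ n ih =>
    obtain ⟨f, hf, h⟩ := ih
    have h0 : f n = ext (e n) 0 := by
      rw [hf]
      exact (e n).extend_zero.symm
    refine ⟨join f (ext (e n)) n h0, ?_, fun i hi t => ?_⟩
    · rw [Nat.cast_succ, join_right h0 zero_le_one]
      exact (e n).extend_one
    · rcases Nat.lt_succ_iff_lt_or_eq.1 hi with hi | rfl
      · rw [join_left, h i hi]
        have : (i : ℝ) + 1 ≤ n := by exact_mod_cast hi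
        linarith [t.2.2]
      · rw [join_right h0 t.2.1]
        exact Path.extend_apply _ t.2

end Join

/-! ### Approximation by chains of short arcs, and concatenation. -/

section Existence

open Set Filter Topology Metric

set_option linter.unusedSectionVars false

variable {M : Type*} [MetricSpace M] [CompactSpace M] [ChartedSpace (EuclideanHalfSpace 2) M]
  [PathConnectedSpace M] [IsManifold (𝓡∂ 2) ∞ M] {x₀ : M} (S : Scale x₀)

/-- In a small disc inside the open dense set, almost every point is interior to the surface and
avoids the countable set. -/
theorem exists_vertex {V : Set M} (hV : IsOpen V) (hVd : Dense V) {A : Set M} (hA : A.Countable)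
    (x : M) {ε : ℝ} (hε : 0 < ε) :
    ∃ w ∈ V, w ∉ A ∧ w ∈ (𝓡∂ 2).interior M ∧ dist w x < ε := by
  obtain ⟨v, hv, hvx⟩ := hVd.exists_dist_lt x hε
  obtain ⟨Q, hb, hz, hr, hQ⟩ := Disc.exists_disc (mem_dom v)
    ((hV.inter (isOpen_ball (x := x) (ε := ε))).mem_nhds ⟨hv, by rwa [mem_ball, dist_comm]⟩)
  obtain ⟨w, hw, hwA, hw0⟩ := Q.exists_generic ⟨v, by rw [hb]; exact mem_dom v, by
    rw [hb, hz, sub_self, norm_zero]; exact hr⟩ (Z := coord Q.b '' A)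
    ((hA.image _).measure_zero _)
  exact ⟨w, (hQ hw).1, fun h => hwA ⟨w, h, rfl⟩, (mem_interior_iff hw.1).2 hw0, (hQ hw).2⟩

namespace Scale

variable {S}

theorem κ_cocycle : LocalCocycle S.κ S.ρ := ⟨S.ρ_pos, κ_self, S.κ_mul⟩

theorem hol_eq_chainProd {f : C(ℝ, M)} {n : ℕ}
    (h : ∀ i < n, ∃ x, ∀ t ∈ Icc (i : ℝ) (i + 1), f t ∈ ball x S.ρ) :
    hol x₀ f 0 n = chainProd S.κ (fun i => f i) n := by
  induction n with
  | zero => simp [hol_self, chainProd]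
  | succ n ih =>
    obtain ⟨x, hx⟩ := h n (by omega)
    rw [chainProd, ← ih fun i hi => h i (by omega), ← hol_trans x₀ f 0 n (n + 1 : ℕ),
      S.κ_hol x f n (n + 1 : ℕ)]
    intro t ht
    rw [uIcc_of_le (by simp)] at ht
    exact hx t ⟨ht.1, by simpa using ht.2⟩

/-- Every path is homotopic to a chain of short paths of a given kind between points of a given
dense set. -/
theorem exists_polygon {p q : M} (ℓ : Path p q) {V : Set M}
    (hV : ∀ x, ∀ ε > 0, ∃ w ∈ V, dist w x < ε) (hp : p ∈ V) (hq : q ∈ V) {δ ε : ℝ} (hδ : 0 < δ)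
    (hδρ : δ ≤ S.ρ) (hε : ε ≤ S.ρ) (P : ∀ a b : M, Path a b → Prop)
    (hconn : ∀ a ∈ V, ∀ b ∈ V, dist b a < δ → ∃ c : Path a b, P a b c ∧ ∀ t, dist (c t) a < ε) :
    ∃ (f : C(ℝ, M)) (n : ℕ), 0 < n ∧ f 0 = p ∧ f n = q ∧
      hol x₀ f 0 n = el x₀ (Path.Homotopic.Quotient.mk ℓ) ∧ (∀ i ≤ n, f i ∈ V) ∧
      ∀ i < n, ∃ (a b : M) (c : Path a b), P a b c ∧ f i = a ∧ f (i + 1 : ℕ) = b ∧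
        (∀ t : I, f (i + t) = c t) ∧ ∀ t, dist (c t) (f i) < ε := by
  classical
  have hℓ : UniformContinuous ℓ := CompactSpace.uniformContinuous_of_continuous ℓ.continuous
  obtain ⟨τ, hτ, hℓτ⟩ := Metric.uniformContinuous_iff.1 hℓ (δ / 4) (by positivity)
  obtain ⟨N₀, hN₀⟩ := exists_nat_gt (1 / τ)
  set N := N₀ + 1 with hN
  have hNp : (0 : ℝ) < N := by positivity
  have hNτ : 1 / (N : ℝ) < τ := by
    rw [div_lt_comm₀ hNp hτ]
    refine hN₀.trans ?_
    rw [hN]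
    push_cast
    linarith
  -- The path `ℓ`, stretched to `[0, N]` so that the unit intervals are short.
  let F : C(ℝ, M) := (ext ℓ).comp ⟨fun t => t / N, by fun_prop⟩
  have hF : ∀ i : ℕ, ∀ t ∈ Icc (i : ℝ) (i + 1), dist (F t) (F i) < δ / 4 := by
    intro i t ht
    refine hℓτ ((abs_projIcc_sub_projIcc (zero_le_one' ℝ)).trans_lt ?_)
    change |t / N - i / N| < τ
    rw [← sub_div, abs_of_nonneg (div_nonneg (by linarith [ht.1]) hNp.le)]
    refine lt_of_le_of_lt ?_ hNτ
    exact div_le_div_of_nonneg_right (by linarith [ht.2]) hNp.le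
  have hF0 : F 0 = p := by simp [F]
  have hFN : F N = q := by
    change ext ℓ (N / N) = q
    rw [div_self hNp.ne']
    simp
  have hFhol : hol x₀ F 0 N = el x₀ (Path.Homotopic.Quotient.mk ℓ) := by
    rw [hol_comp]
    change hol x₀ (ext ℓ) (0 / N) (N / N) = _
    rw [div_self hNp.ne', zero_div, hol_ext]
  have hv : ∀ i : ℕ, ∃ w ∈ V, dist w (F i) < δ / 4 ∧ ((i = 0 ∨ i = N) → w = F i) := by
    intro i
    by_cases h : i = 0 ∨ i = N
    · refine ⟨F i, ?_, by rw [dist_self]; positivity, fun _ => rfl⟩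
      rcases h with rfl | rfl
      · rw [Nat.cast_zero, hF0]
        exact hp
      · rw [hFN]
        exact hq
    · obtain ⟨w, hw, hd⟩ := hV (F i) (δ / 4) (by positivity)
      exact ⟨w, hw, hd, fun h' => (h h').elim⟩
  choose v hvV hvd hve using hv
  have hstep : ∀ i : ℕ, dist (F (i + 1 : ℕ)) (F i) < δ / 4 := fun i => hF i _ (by simp)
  have hvv : ∀ i : ℕ, dist (v (i + 1)) (v i) < δ := by
    intro i
    linarith [dist_triangle (v (i + 1)) (F (i + 1 : ℕ)) (v i), hstep i, hvd i, hvd (i + 1),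
      dist_triangle (F (i + 1 : ℕ)) (F i) (v i), dist_comm (F i) (v i)]
  choose e heP hed using fun i => hconn (v i) (hvV i) (v (i + 1)) (hvV (i + 1)) (hvv i)
  obtain ⟨f, hfN, hf⟩ := exists_glue v e N
  have hfi : ∀ i ≤ N, f i = v i := by
    intro i hi
    rcases hi.lt_or_eq with h | rfl
    · have := hf i h 0
      simpa using this
    · exact hfN
  have hpiece : ∀ i < N, ∀ t ∈ Icc (i : ℝ) (i + 1), dist (f t) (v i) < ε := by
    intro i hi t ht
    have := hf i hi ⟨t - i, by linarith [ht.1], by linarith [ht.2]⟩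
    simp only [add_sub_cancel] at this
    rw [this]
    exact hed i _
  refine ⟨f, N, by omega, ?_, ?_, ?_, fun i hi => by rw [hfi i hi]; exact hvV i, fun i hi =>
    ⟨v i, v (i + 1), e i, heP i, hfi i hi.le, hfi (i + 1) hi, hf i hi, fun t => by
      rw [hfi i hi.le]; exact hed i t⟩⟩
  · have := hfi 0 (by omega)
    rw [Nat.cast_zero] at this
    rw [this, hve 0 (Or.inl rfl), Nat.cast_zero, hF0]
  · rw [hfN, hve N (Or.inr rfl), hFN]
  · rw [← hFhol, hol_eq_chainProd (S := S) (f := f) fun i hi => ⟨v i, fun t ht =>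
      (hpiece i hi t ht).trans_le hε⟩, hol_eq_chainProd (S := S) (f := F) fun i _ => ⟨F i, fun t ht =>
      (hF i t ht).trans_le (by linarith)⟩,
      chainProd_congr (g' := S.κ) (v' := v) fun i hi => by rw [hfi i hi.le, hfi (i + 1) hi]]
    -- The new chain follows `ℓ` closely with the same ends, so the ladder argument for `κ` shows
    -- that its class is unchanged.
    have := κ_cocycle.chainProd_compare (g := S.κ) (v := v) (w := fun i : ℕ => F i) (n := N)
      fun i hi => ⟨F i, by
        rw [mem_ball]; linarith [hvd i], by
        rw [mem_ball]; linarith [hvd (i + 1), hstep i, dist_triangle (v (i + 1)) (F (i + 1 : ℕ)) (F i)],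
        mem_ball_self S.ρ_pos, by
        rw [mem_ball]; linarith [hstep i]⟩
    rw [hve N (Or.inr rfl), hve 0 (Or.inl rfl), κ_self, κ_self, mul_one, one_mul] at this
    exact this

variable (S) in
/-- A curve on `[0, n]` formed by short pieces, with nowhere dense image. -/
structure Nice (f : C(ℝ, M)) (n : ℕ) : Prop where
  pos : 0 < n
  small : ∀ i < n, ∀ t ∈ Icc (i : ℝ) (i + 1), dist (f t) (f i) < S.δ / 4
  dense : Dense (f '' Icc 0 (n : ℝ))ᶜ

theorem exists_floor {n : ℕ} {t : ℝ} (hn : 0 < n) (ht : t ∈ Icc (0 : ℝ) n) :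
    ∃ i < n, t ∈ Icc (i : ℝ) (i + 1) := by
  rcases ht.2.lt_or_eq with h | rfl
  · exact ⟨⌊t⌋₊, (Nat.floor_lt ht.1).2 h, Nat.floor_le ht.1, (Nat.lt_floor_add_one t).le⟩
  · refine ⟨n - 1, by omega, ?_, ?_⟩
    · exact_mod_cast Nat.sub_le n 1
    · have : n ≤ n - 1 + 1 := by omega
      exact_mod_cast this

theorem Icc_sub {n i : ℕ} (hi : i < n) : Icc (i : ℝ) (i + 1) ⊆ Icc (0 : ℝ) n :=
  Icc_subset_Icc (Nat.cast_nonneg i) (by exact_mod_cast hi)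

theorem off_int {f : C(ℝ, M)} {n : ℕ} (hn : 0 < n) : off (.int f n) = (f '' Icc 0 (n : ℝ))ᶜ := by
  ext p
  constructor
  · rintro h ⟨t, ht, rfl⟩
    obtain ⟨i, hi, hti⟩ := exists_floor hn ht
    exact h i hi t (by simpa using hti) rfl
  · rintro h i hi t ht rfl
    exact h ⟨t, Icc_sub hi (by simpa using ht), rfl⟩

theorem Nice.off_open {f : C(ℝ, M)} {n : ℕ} (h : S.Nice f n) : IsOpen (off (.int f n)) := by
  rw [off_int h.pos]
  exact (isCompact_Icc.image f.continuous).isClosed.isOpen_compl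

theorem Nice.off_dense {f : C(ℝ, M)} {n : ℕ} (h : S.Nice f n) : Dense (off (.int f n)) := by
  rw [off_int h.pos]
  exact h.dense

theorem Nice.short {f : C(ℝ, M)} {n : ℕ} (h : S.Nice f n) {i : ℕ} (hi : i < n) :
    S.Short f (i : ℕ) ((i + 1 : ℕ) : ℝ) :=
  ⟨by simp, fun t ht => (h.small i hi t (by simpa using ht)).trans
    (by linarith [S.δ_le, S.η_pos])⟩

theorem Nice.fine {f : C(ℝ, M)} {n : ℕ} (h : S.Nice f n) :
    ∀ i < n, ∃ x, ∀ t ∈ Icc (i : ℝ) (i + 1), f t ∈ ball x (S.δ / 4) :=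
  fun i hi => ⟨f i, h.small i hi⟩

theorem Nice.compat {f h : C(ℝ, M)} {n m : ℕ} (hf : S.Nice f n) (hh : S.Nice h m)
    (h1 : ∀ i ≤ n, f i ∈ off (.int h m)) (h2 : ∀ j ≤ m, h j ∈ off (.int f n)) :
    S.Compat (.int f n) (.int h m) := fun i hi j hj =>
  ⟨hf.short hi, hh.short hj, h1 i hi.le j hj, h1 (i + 1) hi j hj,
    fun s hs e => h2 j hj.le i hi s hs e.symm, fun s hs e => h2 (j + 1) hj i hi s hs e.symm⟩

theorem Compat.off_left {f h : C(ℝ, M)} {n m : ℕ} (H : S.Compat (.int f n) (.int h m)) (hn : 0 < n)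
    {i : ℕ} (hi : i ≤ n) : f i ∈ off (.int h m) := by
  intro j hj
  rcases hi.lt_or_eq with h | rfl
  · exact (H i h j hj).left
  · obtain ⟨k, rfl⟩ : ∃ k, i = k + 1 := ⟨i - 1, by omega⟩
    exact (H k (Nat.lt_succ_self k) j hj).right

/-- Every class of paths is the class of a curve formed by short pieces between points of a dense
open set, which avoids a countable set and has nowhere dense image. -/
theorem exists_nice {V : Set M} (hV : IsOpen V) (hVd : Dense V) {A : Set M} (hA : A.Countable)
    {p q : M} (hp : p ∈ V) (hq : q ∈ V) (hpA : p ∉ A) (hqA : q ∉ A) (g : LoopGroup x₀) :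
    ∃ (f : C(ℝ, M)) (n : ℕ), S.Nice f n ∧ f 0 = p ∧ f n = q ∧ hol x₀ f 0 n = g ∧
      (∀ i ≤ n, f i ∈ V) ∧ (∀ t ∈ Icc (0 : ℝ) n, f t ∉ A) ∧
      (p ∈ (𝓡∂ 2).interior M → q ∈ (𝓡∂ 2).interior M →
        ∀ t ∈ Icc (0 : ℝ) n, f t ∈ (𝓡∂ 2).interior M) := by
  obtain ⟨ℓ, hℓ⟩ := el_surjective x₀ p q g
  have hδ := S.δ_pos
  obtain ⟨δ, hδ0, hc⟩ := exists_connect (M := M) (ε := S.δ / 4) (by positivity)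
  obtain ⟨f, n, hn, h0, h1, hhol, hfV, hpc⟩ := exists_polygon (S := S) ℓ
    (V := {w | w ∈ V ∧ w ∉ A ∧ (w ∈ (𝓡∂ 2).interior M ∨ w = p ∨ w = q)})
    (fun x ε hε => by
      obtain ⟨w, h1, h2, h3, h4⟩ := exists_vertex hV hVd hA x hε
      exact ⟨w, ⟨h1, h2, Or.inl h3⟩, h4⟩) ⟨hp, hpA, Or.inr (Or.inl rfl)⟩
    ⟨hq, hqA, Or.inr (Or.inr rfl)⟩ (δ := min δ S.ρ) (ε := S.δ / 4) (lt_min hδ0 S.ρ_pos)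
    (min_le_right _ _) (by linarith [S.δ_le, S.η_le, S.η_pos, S.ρ_pos])
    (fun a b c => (∀ t, c t ∉ A) ∧ Dense (range c)ᶜ ∧ (a ∈ (𝓡∂ 2).interior M →
      b ∈ (𝓡∂ 2).interior M → ∀ t, c t ∈ (𝓡∂ 2).interior M))
    (fun a ha b hb hab => by
      obtain ⟨c, c1, c2, c3, c4⟩ := hc a b (hab.trans_le (min_le_left _ _)) A hA ha.2.1 hb.2.1
      exact ⟨c, ⟨c2, c3, c4⟩, c1⟩)
  choose a b c hP ha hb hfc hd using hpc
  have hval : ∀ (i : ℕ) (hi : i < n), ∀ t ∈ Icc (i : ℝ) (i + 1), ∃ u : I, f t = c i hi u := by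
    intro i hi t ht
    have := hfc i hi ⟨t - i, by linarith [ht.1], by linarith [ht.2]⟩
    simp only [add_sub_cancel] at this
    exact ⟨_, this⟩
  refine ⟨f, n, ⟨hn, fun i hi t ht => ?_, ?_⟩, h0, h1, hhol.trans hℓ, fun i hi => (hfV i hi).1,
    fun t ht => ?_, fun hpi hqi t ht => ?_⟩
  · obtain ⟨u, hu⟩ := hval i hi t ht
    rw [hu]
    exact hd i hi u
  · have hsub : (⋂ i ∈ Finset.range n, (f '' Icc (i : ℝ) (i + 1))ᶜ) ⊆ (f '' Icc 0 (n : ℝ))ᶜ := by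
      rintro x hx ⟨t, ht, rfl⟩
      obtain ⟨i, hi, hti⟩ := exists_floor hn ht
      exact mem_iInter₂.1 hx i (Finset.mem_range.2 hi) ⟨t, hti, rfl⟩
    refine Dense.mono hsub ?_
    refine dense_biInter_of_isOpen (S := ((Finset.range n : Finset ℕ) : Set ℕ)) (fun i _ => ?_)
      (Finset.countable_toSet _) (fun i hi => ?_)
    · exact (isCompact_Icc.image f.continuous).isClosed.isOpen_compl
    · have hi' := Finset.mem_range.1 hi
      refine Dense.mono (compl_subset_compl.2 ?_) (hP i hi').2.1
      rintro _ ⟨t, ht, rfl⟩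
      obtain ⟨u, hu⟩ := hval i hi' t ht
      exact ⟨u, hu.symm⟩
  · obtain ⟨i, hi, hti⟩ := exists_floor hn ht
    obtain ⟨u, hu⟩ := hval i hi t hti
    rw [hu]
    exact (hP i hi).1 u
  · obtain ⟨i, hi, hti⟩ := exists_floor hn ht
    obtain ⟨u, hu⟩ := hval i hi t hti
    have hint : ∀ i ≤ n, f i ∈ (𝓡∂ 2).interior M := by
      intro i hi
      rcases (hfV i hi).2.2 with h | h | h
      · exact h
      · rwa [h]
      · rwa [h]
    rw [hu]
    exact (hP i hi).2.2 (by rw [← ha i hi]; exact hint i hi.le)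
      (by rw [← hb i hi]; exact hint (i + 1) hi) u

/-! ### Additivity -/

variable {Λ : Type*} [AddCommGroup Λ]

theorem Compat.join {f g : C(ℝ, M)} {n m : ℕ} {H : Chain M} (hfg : f n = g 0)
    (hf : S.Compat (.int f n) H) (hg : S.Compat (.int g m) H) :
    S.Compat (.int (join f g n hfg) (n + m)) H := by
  intro i hi j hj
  replace hi : i < n + m := hi
  change S.Adm (GenDehn.join f g n hfg) H.f (i : ℕ) ((i + 1 : ℕ) : ℝ) _ _
  rcases Nat.lt_or_ge i n with h | h
  · obtain ⟨h1, h2, h3, h4, h5, h6⟩ := hf i h j hj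
    have hin : ((i + 1 : ℕ) : ℝ) ≤ n := by exact_mod_cast h
    have e : ∀ t ∈ Icc (i : ℝ) (i + 1 : ℕ), GenDehn.join f g n hfg t = f t := fun t ht =>
      join_left hfg (ht.2.trans hin)
    have l : (i : ℝ) ∈ Icc (i : ℝ) (i + 1 : ℕ) := by simp
    have r : ((i + 1 : ℕ) : ℝ) ∈ Icc (i : ℝ) (i + 1 : ℕ) := by simp
    refine ⟨⟨h1.1, fun t ht => ?_⟩, h2, ?_, ?_, fun s hs => ?_, fun s hs => ?_⟩
    · rw [e t ht, e _ l]
      exact h1.2 t ht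
    · rw [e _ l]
      exact h3
    · rw [e _ r]
      exact h4
    · rw [e s hs]
      exact h5 s hs
    · rw [e s hs]
      exact h6 s hs
  · obtain ⟨k, rfl⟩ : ∃ k, i = n + k := ⟨i - n, by omega⟩
    obtain ⟨h1, h2, h3, h4, h5, h6⟩ := hg k (show k < m by omega) j hj
    have e : ∀ t ∈ Icc ((n + k : ℕ) : ℝ) ((n + k + 1 : ℕ) : ℝ), ∃ t' ∈ Icc (k : ℝ) (k + 1 : ℕ),
        GenDehn.join f g n hfg t = g t' := by
      intro t ht
      push_cast at ht
      refine ⟨t - n, ⟨by linarith [ht.1], by push_cast; linarith [ht.2]⟩, ?_⟩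
      have := join_right hfg (t := t - n) (by
        have : (0 : ℝ) ≤ k := Nat.cast_nonneg k
        linarith [ht.1])
      rwa [add_sub_cancel] at this
    have el : GenDehn.join f g n hfg ((n + k : ℕ) : ℝ) = g k := by
      rw [Nat.cast_add]
      exact join_right hfg (Nat.cast_nonneg k)
    have er : GenDehn.join f g n hfg ((n + k + 1 : ℕ) : ℝ) = g (k + 1 : ℕ) := by
      rw [add_assoc, Nat.cast_add]
      exact join_right hfg (Nat.cast_nonneg _)
    refine ⟨⟨by simp, fun t ht => ?_⟩, h2, ?_, ?_, fun s hs => ?_, fun s hs => ?_⟩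
    · obtain ⟨t', ht', e'⟩ := e t ht
      rw [e', el]
      exact h1.2 t' ht'
    · rw [el]
      exact h3
    · rw [er]
      exact h4
    · obtain ⟨t', ht', e'⟩ := e s hs
      rw [e']
      exact h5 t' ht'
    · obtain ⟨t', ht', e'⟩ := e s hs
      rw [e']
      exact h6 t' ht'

theorem hol_join {f g : C(ℝ, M)} {n : ℕ} (m : ℕ) (hfg : f n = g 0) :
    hol x₀ (join f g n hfg) 0 (n + m : ℕ) = hol x₀ f 0 n * hol x₀ g 0 m := by
  rw [← hol_trans x₀ _ 0 n, hol_join_left x₀ hfg (Nat.cast_nonneg n) le_rfl, Nat.cast_add]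
  have := hol_join_right x₀ hfg le_rfl (Nat.cast_nonneg m : (0 : ℝ) ≤ m)
  rw [add_zero] at this
  rw [this]

/-- Labels along the second curve begin with the class of the first, hence the translated weight.
Reparametrized pieces are identified by `sum_piece_eq`. -/
theorem isum_join {φ : LoopGroup x₀ → Λ} {f g : C(ℝ, M)} {n m : ℕ} {H : Chain M}
    (hend : EndOK φ H) (hfg : f n = g 0) (hf : S.Compat (.int f n) H) (hg : S.Compat (.int g m) H) :
    S.isum φ (.int (join f g n hfg) (n + m)) H =
      S.isum φ (.int f n) H + S.isum (fun u => φ (hol x₀ f 0 n * u)) (.int g m) H := by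
  have hj := Compat.join hfg hf hg
  have c1 : ∀ i ≤ n, (Chain.int (join f g n hfg) (n + m)).cls x₀ i = hol x₀ f 0 i := by
    intro i hi
    simp only [Chain.cls, Nat.cast_zero]
    exact hol_join_left x₀ hfg (Nat.cast_nonneg n) (by exact_mod_cast hi)
  have c2 : ∀ i, (Chain.int (join f g n hfg) (n + m)).cls x₀ (n + i) =
      hol x₀ f 0 n * hol x₀ g 0 i := by
    intro i
    simp only [Chain.cls, Nat.cast_zero]
    exact hol_join i hfg
  have v1 : ∀ i ≤ n, join f g n hfg i = f i := fun i hi => join_left hfg (by exact_mod_cast hi)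
  have v2 : ∀ i : ℕ, join f g n hfg (n + i : ℕ) = g i := by
    intro i
    rw [Nat.cast_add]
    exact join_right hfg (Nat.cast_nonneg i)
  rw [isum]
  change ∑ i ∈ Finset.range (n + m), _ = _
  rw [Finset.sum_range_add]
  refine congrArg₂ (· + ·) ?_ ?_
  · rw [isum]
    refine Finset.sum_congr rfl fun i hi => ?_
    replace hi : i < n := Finset.mem_range.1 hi
    have := sum_piece_eq hend (v1 i hi.le) (v1 (i + 1) hi) (hf i hi) (hj i (show i < n + m by omega)) (hol x₀ f 0 i)
    have l1 : ∀ j, S.lab (.int (join f g n hfg) (n + m)) H i j =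
        hol x₀ f 0 i * (S.κ (f i) (H.vtx j) * (H.cls x₀ j)⁻¹) := by
      intro j
      rw [lab, c1 i hi.le, mul_assoc]
      change _ * (S.κ (join f g n hfg i) _ * _) = _
      rw [v1 i hi.le]
    have l2 : ∀ j, S.lab (.int f n) H i j =
        hol x₀ f 0 i * (S.κ (f i) (H.vtx j) * (H.cls x₀ j)⁻¹) := by
      intro j
      rw [lab, mul_assoc]
      simp only [Chain.cls, Nat.cast_zero]
      rfl
    simp only [l1, l2]
    exact this.symm
  · rw [isum]
    refine Finset.sum_congr rfl fun i hi => ?_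
    replace hi : i < m := Finset.mem_range.1 hi
    have := sum_piece_eq hend (v2 i) (v2 (i + 1)) (hg i hi) (hj (n + i) (by simpa using hi))
      (hol x₀ f 0 n * hol x₀ g 0 i)
    have l1 : ∀ j, S.lab (.int (join f g n hfg) (n + m)) H (n + i) j =
        hol x₀ f 0 n * hol x₀ g 0 i * (S.κ (g i) (H.vtx j) * (H.cls x₀ j)⁻¹) := by
      intro j
      rw [lab, c2 i, mul_assoc]
      change _ * (S.κ (join f g n hfg (n + i : ℕ)) _ * _) = _
      rw [v2 i]
    have l2 : ∀ j, hol x₀ f 0 n * S.lab (.int g m) H i j =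
        hol x₀ f 0 n * hol x₀ g 0 i * (S.κ (g i) (H.vtx j) * (H.cls x₀ j)⁻¹) := by
      intro j
      rw [lab, mul_assoc, mul_assoc]
      simp only [Chain.cls, Nat.cast_zero]
      rfl
    simp only [l1, l2]
    exact this.symm

end Scale

end Existence

/-! ### Intersection sums of a loop and a closed curve -/

section ClosedSums

open Set Filter Topology Metric

set_option linter.unusedSectionVars false

variable {M : Type*} [MetricSpace M] [CompactSpace M] [ChartedSpace (EuclideanHalfSpace 2) M]
  [PathConnectedSpace M] [IsManifold (𝓡∂ 2) ∞ M] {x₀ : M} {S : Scale x₀}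

namespace Scale

/-- Nice curves have closed nowhere dense images, so a finite number of them can be avoided at once;
this provides auxiliary curves compatible with all given ones. -/
theorem off_inter_open {L : List (C(ℝ, M) × ℕ)} (hL : ∀ X ∈ L, S.Nice X.1 X.2) :
    IsOpen {p | ∀ X ∈ L, p ∈ off (.int X.1 X.2)} ∧ Dense {p | ∀ X ∈ L, p ∈ off (.int X.1 X.2)} := by
  induction L with
  | nil => simp
  | cons X L ih =>
    obtain ⟨h1, h2⟩ := ih fun Y hY => hL Y (List.mem_cons_of_mem _ hY)
    have hX := hL X List.mem_cons_self
    have e : {p | ∀ Y ∈ X :: L, p ∈ off (.int Y.1 Y.2)} =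
        off (.int X.1 X.2) ∩ {p | ∀ Y ∈ L, p ∈ off (.int Y.1 Y.2)} := by
      ext p
      simp
    rw [e]
    exact ⟨hX.off_open.inter h1, hX.off_dense.inter_of_isOpen_left h2 hX.off_open⟩

theorem exists_off {L : List (C(ℝ, M) × ℕ)} (hL : ∀ X ∈ L, S.Nice X.1 X.2) :
    ∃ p ∈ (𝓡∂ 2).interior M, ∀ X ∈ L, p ∈ off (.int X.1 X.2) := by
  obtain ⟨w, h1, -, h2, -⟩ := exists_vertex (off_inter_open hL).1 (off_inter_open hL).2
    (countable_empty) x₀ one_pos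
  exact ⟨w, h2, h1⟩

/-- Every class of paths is represented by a curve which is compatible with given curves. -/
theorem exists_nice_compat {L : List (C(ℝ, M) × ℕ)} (hL : ∀ X ∈ L, S.Nice X.1 X.2) {p q : M}
    (hp : ∀ X ∈ L, p ∈ off (.int X.1 X.2)) (hq : ∀ X ∈ L, q ∈ off (.int X.1 X.2))
    (g : LoopGroup x₀) : ∃ (h : C(ℝ, M)) (m : ℕ), S.Nice h m ∧ h 0 = p ∧ h m = q ∧
      hol x₀ h 0 m = g ∧ ∀ X ∈ L, S.Compat (.int X.1 X.2) (.int h m) := by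
  have hA : {w | ∃ X ∈ L, ∃ i ≤ X.2, X.1 (i : ℕ) = w}.Countable := by
    have : {w | ∃ X ∈ L, ∃ i ≤ X.2, X.1 (i : ℕ) = w} =
        ⋃ X ∈ {X | X ∈ L}, (fun i : ℕ => X.1 i) '' Iic X.2 := by
      ext w
      simp
    rw [this]
    exact (L.finite_toSet.biUnion fun X _ => (finite_Iic _).image _).countable
  have hoff : ∀ p, (∀ X ∈ L, p ∈ off (.int X.1 X.2)) →
      p ∉ {w | ∃ X ∈ L, ∃ i ≤ X.2, X.1 (i : ℕ) = w} := by
    rintro p hp ⟨X, hX, i, hi, rfl⟩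
    have h := hp X hX
    rw [off_int (hL X hX).pos] at h
    exact h ⟨i, ⟨Nat.cast_nonneg i, by exact_mod_cast hi⟩, rfl⟩
  obtain ⟨h, m, h1, h2, h3, h4, h5, h6, -⟩ := exists_nice (S := S) (off_inter_open hL).1
    (off_inter_open hL).2 hA (p := p) (q := q) hp hq (hoff p hp) (hoff q hq) g
  refine ⟨h, m, h1, h2, h3, h4, fun X hX => (hL X hX).compat h1 (fun i hi => ?_)
    fun j hj => h5 j hj X hX⟩
  rw [off_int h1.pos]
  rintro ⟨t, ht, e⟩
  exact h6 t ht ⟨X, hX, i, hi, e.symm⟩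

theorem fine_join {f g : C(ℝ, M)} {n m : ℕ} (hfg : f n = g 0) {ε : ℝ}
    (hf : ∀ i < n, ∃ x, ∀ t ∈ Icc (i : ℝ) (i + 1), f t ∈ ball x ε)
    (hg : ∀ i < m, ∃ x, ∀ t ∈ Icc (i : ℝ) (i + 1), g t ∈ ball x ε) :
    ∀ i < n + m, ∃ x, ∀ t ∈ Icc (i : ℝ) (i + 1), join f g n hfg t ∈ ball x ε := by
  intro i hi
  rcases Nat.lt_or_ge i n with h | h
  · obtain ⟨x, hx⟩ := hf i h
    refine ⟨x, fun t ht => ?_⟩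
    rw [join_left hfg (ht.2.trans (by exact_mod_cast h))]
    exact hx t ht
  · obtain ⟨k, rfl⟩ : ∃ k, i = n + k := ⟨i - n, by omega⟩
    obtain ⟨x, hx⟩ := hg k (by omega)
    refine ⟨x, fun t ht => ?_⟩
    push_cast at ht
    have := join_right hfg (t := t - n) (by
      have : (0 : ℝ) ≤ k := Nat.cast_nonneg k
      linarith [ht.1])
    rw [add_sub_cancel] at this
    rw [this]
    exact hx _ ⟨by linarith [ht.1], by linarith [ht.2]⟩

variable {Λ : Type*} [AddCommGroup Λ]

/-- The sum over the intersections of a loop and a closed curve of class `y`, weighted by a function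
of the class of the closed curve based at the intersection point. -/
abbrev csum (S : Scale x₀) (c : LoopGroup x₀ → Λ) (f : C(ℝ, M)) (n : ℕ) (h : C(ℝ, M)) (m : ℕ) : Λ :=
  S.isum (fun u => c (u * hol x₀ h 0 m * u⁻¹)) (.int f n) (.int h m)

theorem int_cls (f : C(ℝ, M)) (n i : ℕ) : (Chain.int f n).cls x₀ i = hol x₀ f 0 i := by
  simp [Chain.cls]

theorem endOK_closed {c : LoopGroup x₀ → Λ} {h : C(ℝ, M)} {m : ℕ} (hc : h m = h 0) :
    EndOK (fun u => c (u * hol x₀ h 0 m * u⁻¹)) (.int h m) := by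
  refine Or.inl ⟨by simpa [Chain.vtx] using hc, fun u => ?_⟩
  rw [int_cls]
  exact congrArg c (by group)

/-- The ends of the curve do not contribute to sums of conjugates with the given weight. -/
def LoopOK (c : LoopGroup x₀ → Λ) (f : C(ℝ, M)) (n : ℕ) : Prop :=
  (f n = f 0 ∧ ∀ a b, c (a * b * a⁻¹) = c b) ∨
    (f 0 ∈ (𝓡∂ 2).boundary M ∧ f n ∈ (𝓡∂ 2).boundary M)

theorem LoopOK.endOK {c : LoopGroup x₀ → Λ} {f : C(ℝ, M)} {n : ℕ} (hf : LoopOK c f n)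
    (y : LoopGroup x₀) : EndOK (fun u => c (u⁻¹ * y * u⁻¹⁻¹)) (.int f n) := by
  rcases hf with ⟨h1, h2⟩ | ⟨h1, h2⟩
  · refine Or.inl ⟨by simpa [Chain.vtx] using h1, fun u => ?_⟩
    change c (_ * _ * _) = c (_ * _ * _)
    rw [h2, h2]
  · exact Or.inr ⟨by simpa [Chain.vtx] using h1, h2⟩

/-- Let `C` run from `h` to `h'` with class `g`. After exchanging the roles of the curves, `C h'`
and `h C` are homotopic. The weight `u ↦ c(u⁻¹ y u)` does not change under `u ↦ y u`, so `C`
contributes equally to both sums and cancels. -/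
theorem csum_right {c : LoopGroup x₀ → Λ} {f h h' : C(ℝ, M)} {n m m' : ℕ} (hok : LoopOK c f n)
    (hf : S.Nice f n) (hh : S.Nice h m) (hh' : S.Nice h' m') (hc : h m = h 0) (hc' : h' m' = h' 0)
    (H : S.Compat (.int f n) (.int h m)) (H' : S.Compat (.int f n) (.int h' m')) {g : LoopGroup x₀}
    (hg : hol x₀ h' 0 m' = g⁻¹ * hol x₀ h 0 m * g) :
    S.csum c f n h m = S.csum c f n h' m' := by
  set y := hol x₀ h 0 m with hy
  have p0 : h 0 ∈ off (.int f n) := by simpa using H.swap.off_left hh.pos (Nat.zero_le m)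
  have q0 : h' 0 ∈ off (.int f n) := by simpa using H'.swap.off_left hh'.pos (Nat.zero_le m')
  obtain ⟨C, l, C1, C2, C3, C4, C5⟩ := exists_nice_compat (S := S) (L := [(f, n)]) (by simpa using hf)
    (p := h 0) (q := h' 0) (by simpa using p0) (by simpa using q0) g
  have HC : S.Compat (.int C l) (.int f n) := (C5 (f, n) (by simp)).swap
  have j1 : C l = h' 0 := C3
  have j2 : h m = C 0 := by rw [hc, C2]
  have hend := hok.endOK y
  have key := isum_eq_of_hol (S := S) hend hf.off_dense (f := join C h' l j1) (f' := join h C m j2)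
    (n := l + m') (n' := m + l) (by have := C1.pos; omega) (by have := C1.pos; omega)
    (by rw [join_left _ (Nat.cast_nonneg l), join_left _ (Nat.cast_nonneg m), C2])
    (by
      rw [Nat.cast_add, Nat.cast_add, join_right _ (Nat.cast_nonneg m'),
        join_right _ (Nat.cast_nonneg l), C3, hc'])
    (by rw [hol_join, hol_join, C4, hg, ← hy]; group) (fine_join j1 C1.fine hh'.fine)
    (fine_join j2 hh.fine C1.fine) (Compat.join j1 HC H'.swap) (Compat.join j2 H.swap HC)
  rw [isum_join hend j1 HC H'.swap, isum_join hend j2 H.swap HC, C4, ← hy] at key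
  have e1 : (fun u => c ((y * u)⁻¹ * y * (y * u)⁻¹⁻¹)) = fun u => c (u⁻¹ * y * u⁻¹⁻¹) := by
    funext u
    congr 1
    group
  rw [e1, add_comm, add_right_cancel_iff] at key
  rw [csum, csum, isum_swap H, isum_swap H', ← hy, ← key, hg]
  congr 2
  funext u
  congr 1
  group

theorem csum_left {c : LoopGroup x₀ → Λ} {f f' h : C(ℝ, M)} {n n' m : ℕ} (hf : S.Nice f n)
    (hf' : S.Nice f' n') (hh : S.Nice h m) (hc : h m = h 0) (h0 : f 0 = f' 0) (h1 : f n = f' n')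
    (hx : hol x₀ f 0 n = hol x₀ f' 0 n')
    (H : S.Compat (.int f n) (.int h m)) (H' : S.Compat (.int f' n') (.int h m)) :
    S.csum c f n h m = S.csum c f' n' h m :=
  isum_eq_of_hol (endOK_closed hc) hh.off_dense hf.pos hf'.pos h0 h1 hx hf.fine hf'.fine H H'

/-- A loop of class `x` and a closed curve in the conjugacy class of `y`. -/
structure Pair (S : Scale x₀) (x y : LoopGroup x₀) (f : C(ℝ, M)) (n : ℕ) (h : C(ℝ, M)) (m : ℕ) : Prop where
  niceL : S.Nice f n
  niceR : S.Nice h m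
  start : f 0 = x₀
  finish : f n = x₀
  holL : hol x₀ f 0 n = x
  closed : h m = h 0
  holR : ∃ g, hol x₀ h 0 m = g⁻¹ * y * g
  compat : S.Compat (.int f n) (.int h m)

theorem Pair.loopOK (hx₀ : x₀ ∈ (𝓡∂ 2).boundary M) {x y : LoopGroup x₀} {f h : C(ℝ, M)} {n m : ℕ}
    (P : S.Pair x y f n h m) (c : LoopGroup x₀ → Λ) : LoopOK c f n :=
  Or.inr ⟨by rwa [P.start], by rwa [P.finish]⟩

/-- Compare both pairs through a third closed curve `k` in general enough position: first the closed
curves are replaced by `k`, then the loops are exchanged. -/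
theorem Pair.csum_eq (hx₀ : x₀ ∈ (𝓡∂ 2).boundary M) {x y : LoopGroup x₀} {f h f' h' : C(ℝ, M)}
    {n m n' m' : ℕ} (P : S.Pair x y f n h m) (P' : S.Pair x y f' n' h' m') (c : LoopGroup x₀ → Λ) :
    S.csum c f n h m = S.csum c f' n' h' m' := by
  have hL : ∀ X ∈ [(f, n), (f', n')], S.Nice X.1 X.2 := by
    simpa using ⟨P.niceL, P'.niceL⟩
  obtain ⟨q, -, hq⟩ := exists_off hL
  obtain ⟨k, l, k1, k2, k3, k4, k5⟩ := exists_nice_compat hL hq hq y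
  obtain ⟨g, hg⟩ := P.holR
  obtain ⟨g', hg'⟩ := P'.holR
  have hc : k l = k 0 := k3.trans k2.symm
  have c1 := k5 (f, n) (by simp)
  have c2 := k5 (f', n') (by simp)
  rw [csum_right (g := g⁻¹) (P.loopOK hx₀ c) P.niceL P.niceR k1 P.closed hc P.compat c1
      (by rw [k4, hg]; group),
    csum_right (g := g'⁻¹) (P'.loopOK hx₀ c) P'.niceL P'.niceR k1 P'.closed hc P'.compat c2
      (by rw [k4, hg']; group)]
  exact csum_left P.niceL P'.niceL k1 hc (by rw [P.start, P'.start]) (by rw [P.finish, P'.finish])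
    (by rw [P.holL, P'.holL]) c1 c2

theorem exists_loop (S : Scale x₀) (x : LoopGroup x₀) : ∃ (f : C(ℝ, M)) (n : ℕ), S.Nice f n ∧ f 0 = x₀ ∧ f n = x₀ ∧
    hol x₀ f 0 n = x := by
  obtain ⟨f, n, h1, h2, h3, h4, -⟩ := exists_nice_compat (S := S) (L := []) (by simp) (p := x₀)
    (q := x₀) (by simp) (by simp) x
  exact ⟨f, n, h1, h2, h3, h4⟩

/-- The intersection sum of a loop of class `x` and a closed curve in the class of `y`. -/
def brk (S : Scale x₀) (x y : LoopGroup x₀) : MonoidAlgebra ℚ (LoopGroup x₀) :=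
  open Classical in
  if h : ∃ q : (C(ℝ, M) × ℕ) × (C(ℝ, M) × ℕ), S.Pair x y q.1.1 q.1.2 q.2.1 q.2.2 then
    S.csum (fun u => MonoidAlgebra.single u (1 : ℚ)) h.choose.1.1 h.choose.1.2 h.choose.2.1
      h.choose.2.2
  else 0

theorem Pair.brk_eq (hx₀ : x₀ ∈ (𝓡∂ 2).boundary M) {x y : LoopGroup x₀} {f h : C(ℝ, M)}
    {n m : ℕ} (P : S.Pair x y f n h m) :
    S.brk x y = S.csum (fun u => MonoidAlgebra.single u (1 : ℚ)) f n h m := by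
  have hex : ∃ q : (C(ℝ, M) × ℕ) × (C(ℝ, M) × ℕ), S.Pair x y q.1.1 q.1.2 q.2.1 q.2.2 :=
    ⟨((f, n), (h, m)), P⟩
  rw [brk, dif_pos hex]
  exact hex.choose_spec.csum_eq hx₀ P _

/-- Concatenation of loops: lassos on the second loop first run along the first one, hence are
conjugated by `x`. -/
theorem brk_mul (hx₀ : x₀ ∈ (𝓡∂ 2).boundary M) (x x' y : LoopGroup x₀) :
    S.brk (x * x') y = S.brk x y +
      MonoidAlgebra.single x 1 * S.brk x' y * MonoidAlgebra.single x⁻¹ 1 := by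
  obtain ⟨f, n, f1, f2, f3, f4⟩ := S.exists_loop x
  obtain ⟨f', n', g1, g2, g3, g4⟩ := S.exists_loop x'
  obtain ⟨f'', n'', k1, k2, k3, k4⟩ := S.exists_loop (x * x')
  have hL : ∀ X ∈ [(f, n), (f', n'), (f'', n'')], S.Nice X.1 X.2 := by
    simpa using ⟨f1, g1, k1⟩
  obtain ⟨q, -, hq⟩ := exists_off hL
  obtain ⟨h, m, h1, h2, h3, h4, h5⟩ := exists_nice_compat hL hq hq y
  have hc : h m = h 0 := h3.trans h2.symm
  have hg : ∃ g, hol x₀ h 0 m = g⁻¹ * y * g := ⟨1, by simpa using h4⟩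
  have c1 : S.Compat (.int f n) (.int h m) := h5 (f, n) (by simp)
  have c2 : S.Compat (.int f' n') (.int h m) := h5 (f', n') (by simp)
  have c3 : S.Compat (.int f'' n'') (.int h m) := h5 (f'', n'') (by simp)
  have hj : f n = f' 0 := by rw [f3, g2]
  rw [Pair.brk_eq hx₀ ⟨f1, h1, f2, f3, f4, hc, hg, c1⟩, Pair.brk_eq hx₀ ⟨g1, h1, g2, g3, g4, hc, hg, c2⟩,
    Pair.brk_eq hx₀ ⟨k1, h1, k2, k3, k4, hc, hg, c3⟩]
  have e1 := isum_eq_of_hol (S := S) (endOK_closed (c := fun u => MonoidAlgebra.single u (1 : ℚ)) hc)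
    h1.off_dense k1.pos (by have := f1.pos; omega) (f' := join f f' n hj) (n' := n + n')
    (by rw [join_left _ (Nat.cast_nonneg n), k2, f2])
    (by rw [Nat.cast_add, join_right _ (Nat.cast_nonneg n'), k3, g3]) (by rw [hol_join, k4, f4, g4])
    k1.fine (fine_join hj f1.fine g1.fine) c3 (Compat.join hj c1 c2)
  rw [csum, e1, isum_join (endOK_closed (c := fun u => MonoidAlgebra.single u (1 : ℚ)) hc) hj c1 c2]
  congr 1
  have := isum_map (S := S) ((AddMonoidHom.mulRight (MonoidAlgebra.single x⁻¹ (1 : ℚ))).comp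
    (AddMonoidHom.mulLeft (MonoidAlgebra.single x (1 : ℚ))))
    (fun u => MonoidAlgebra.single (u * hol x₀ h 0 m * u⁻¹) (1 : ℚ)) (.int f' n') (.int h m)
  refine Eq.trans ?_ this.symm
  congr 1
  funext u
  simp only [AddMonoidHom.comp_apply, AddMonoidHom.coe_mulLeft, AddMonoidHom.coe_mulRight,
    MonoidAlgebra.single_mul_single, mul_one]
  congr 1
  rw [f4]
  group

/-- The intersection sum is obtained from a Fox derivation in its second argument. -/
theorem exists_fox (hx₀ : x₀ ∈ (𝓡∂ 2).boundary M) (S : Scale x₀) (x : LoopGroup x₀) :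
    ∃ Θ : LoopGroup x₀ → MonoidAlgebra ℚ (LoopGroup x₀),
      (∀ y y', Θ (y * y') = Θ y + MonoidAlgebra.single y 1 * Θ y') ∧
      ∀ y, S.brk x y = MonoidAlgebra.mapDomain (fun u => u⁻¹ * y * u) (Θ y) := by
  obtain ⟨f, n, f1, f2, f3, f4⟩ := S.exists_loop x
  have hL : ∀ X ∈ [(f, n)], S.Nice X.1 X.2 := by simpa using f1
  obtain ⟨q, -, hq⟩ := exists_off hL
  choose h m h1 h2 h3 h4 h5 using exists_nice_compat hL hq hq
  have hc : ∀ y, h y (m y) = h y 0 := fun y => (h3 y).trans (h2 y).symm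
  have H : ∀ y, S.Compat (.int f n) (.int (h y) (m y)) := fun y => h5 y (f, n) (by simp)
  set φ : LoopGroup x₀ → MonoidAlgebra ℚ (LoopGroup x₀) := fun u => MonoidAlgebra.single u 1 with hφ
  have hend : ∀ φ : LoopGroup x₀ → MonoidAlgebra ℚ (LoopGroup x₀), EndOK φ (.int f n) := fun φ =>
    Or.inr ⟨by simpa [Chain.vtx, f2] using hx₀, by simpa [Chain.vtx, f3] using hx₀⟩
  -- The roles are exchanged: curves of class `y` based at a point `q` off `f` move, and `f` is
  -- fixed with its ends on the boundary. Every weight is then admissible, in particular the label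
  -- itself, so additivity under concatenation becomes the Fox rule. The sign is that of
  -- `isum_swap`.
  refine ⟨fun y => -S.isum φ (.int (h y) (m y)) (.int f n), fun y y' => ?_, fun y => ?_⟩
  · have hj : h y (m y) = h y' 0 := by rw [h3, h2]
    have e1 := isum_eq_of_hol (S := S) (hend φ) f1.off_dense (h1 (y * y')).pos
      (by have := (h1 y).pos; omega) (f' := join (h y) (h y') (m y) hj) (n' := m y + m y')
      (by rw [join_left _ (Nat.cast_nonneg _), h2, h2])
      (by rw [Nat.cast_add, join_right _ (Nat.cast_nonneg _), h3, h3])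
      (by rw [hol_join, h4, h4, h4]) (h1 _).fine (fine_join hj (h1 y).fine (h1 y').fine)
      (H _).swap (Compat.join hj (H y).swap (H y').swap)
    have e2 := isum_map (S := S) (AddMonoidHom.mulLeft (MonoidAlgebra.single y (1 : ℚ))) φ
      (.int (h y') (m y')) (.int f n)
    change -S.isum φ _ _ = -S.isum φ _ _ + _ * -S.isum φ _ _
    rw [e1, isum_join (hend φ) hj (H y).swap (H y').swap, neg_add, mul_neg, h4]
    congr 2
    refine Eq.trans ?_ e2.symm
    congr 1
    funext u
    simp [hφ, MonoidAlgebra.single_mul_single]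
  · rw [Pair.brk_eq hx₀ ⟨f1, h1 y, f2, f3, f4, hc y, ⟨1, by simpa using h4 y⟩, H y⟩, csum,
      isum_swap (H y)]
    have e2 := isum_map (S := S) (MonoidAlgebra.mapDomainLinearMap ℚ ℚ
      (fun u : LoopGroup x₀ => u⁻¹ * y * u)).toAddMonoidHom φ
      (.int (h y) (m y)) (.int f n)
    refine Eq.trans ?_ ((map_neg (MonoidAlgebra.mapDomainLinearMap ℚ ℚ
      (fun u : LoopGroup x₀ => u⁻¹ * y * u)).toAddMonoidHom _).trans (congrArg _ e2)).symm
    congr 1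
    congr 1
    funext u
    rw [h4]
    simp [hφ]

/-- With weight `1` the sum is a number that depends only on the classes. For three compatible
curves `f`, `h`, `k` of class `y`, invariance and antisymmetry give `f·h = f·k = -k·f = -k·h = h·k =
h·f = -f·h`. -/
theorem augmentation_brk_self (hx₀ : x₀ ∈ (𝓡∂ 2).boundary M) (y : LoopGroup x₀) :
    augmentation _ (S.brk y y) = 0 := by
  obtain ⟨f, n, f1, f2, f3, f4⟩ := S.exists_loop y
  have hL : ∀ X ∈ [(f, n)], S.Nice X.1 X.2 := by simpa using f1
  obtain ⟨q, -, hq⟩ := exists_off hL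
  obtain ⟨h, m, h1, h2, h3, h4, h5⟩ := exists_nice_compat hL hq hq y
  have hL' : ∀ X ∈ [(f, n), (h, m)], S.Nice X.1 X.2 := by simpa using ⟨f1, h1⟩
  obtain ⟨q', -, hq'⟩ := exists_off hL'
  obtain ⟨k, l, k1, k2, k3, k4, k5⟩ := exists_nice_compat hL' hq' hq' y
  have cfh := h5 (f, n) (by simp)
  have cfk := k5 (f, n) (by simp)
  have chk := k5 (h, m) (by simp)
  have hf : f n = f 0 := f3.trans f2.symm
  have hh : h m = h 0 := h3.trans h2.symm
  have hk : k l = k 0 := k3.trans k2.symm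
  rw [Pair.brk_eq hx₀ ⟨f1, h1, f2, f3, f4, hh, ⟨1, by simpa using h4⟩, cfh⟩, csum]
  have e := isum_map (S := S) (augmentation (LoopGroup x₀)).toLinearMap.toAddMonoidHom
    (fun u => MonoidAlgebra.single (u * hol x₀ h 0 m * u⁻¹) (1 : ℚ)) (.int f n) (.int h m)
  refine Eq.trans e ?_
  have e2 : (fun u => (augmentation (LoopGroup x₀)).toLinearMap.toAddMonoidHom
      (MonoidAlgebra.single (u * hol x₀ h 0 m * u⁻¹) (1 : ℚ))) = fun _ => 1 := by
    funext u
    simp [augmentation]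
  rw [e2]
  have ok : ∀ (f : C(ℝ, M)) (n : ℕ), f n = f 0 → LoopOK (fun _ : LoopGroup x₀ => (1 : ℚ)) f n :=
    fun f n h => Or.inl ⟨h, fun _ _ => rfl⟩
  have t1 := csum_right (g := 1) (ok f n hf) f1 h1 k1 hh hk cfh cfk (by rw [h4, k4]; group)
  have t2 := csum_right (g := 1) (ok k l hk) k1 f1 h1 hf hh cfk.swap chk.swap (by rw [h4, f4]; group)
  have t3 := csum_right (g := 1) (ok h m hh) h1 f1 k1 hf hk cfh.swap chk (by rw [f4, k4]; group)
  have s1 := isum_swap (φ := fun _ : LoopGroup x₀ => (1 : ℚ)) cfh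
  have s2 := isum_swap (φ := fun _ : LoopGroup x₀ => (1 : ℚ)) cfk
  have s3 := isum_swap (φ := fun _ : LoopGroup x₀ => (1 : ℚ)) chk
  simp only [csum] at t1 t2 t3
  linarith

end Scale

end ClosedSums

/-! ### Intersections of a based loop and a closed curve -/

namespace Crossing

variable {M : Type*} [TopologicalSpace M] [PathConnectedSpace M] {x₀ : M} {ℓ : Path x₀ x₀}
  {γ : C(UnitAddCircle, M)}

/-- The class of the loop which follows `ℓ` to the intersection point, runs along `γ`, and returns
along `ℓ`. -/
def lasso (c : Crossing ℓ γ) : LoopGroup x₀ :=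
  hol x₀ (ext ℓ) 0 c.time * el x₀ (Path.Homotopic.Quotient.mk c.loop) * (hol x₀ (ext ℓ) 0 c.time)⁻¹

theorem el_subpath (a b : I) :
    el x₀ (Path.Homotopic.Quotient.mk (ℓ.subpath a b)) = hol x₀ (ext ℓ) a b := by
  refine el_eq_of_forall x₀ _ _ fun u => ?_
  have h : (a : ℝ) + u * (b - a) = Set.Icc.convexComb a b u := by
    simp [Set.Icc.convexComb]
    ring
  change _ = ℓ.extend (a + u * (b - a))
  rw [h, Path.extend_apply _ (Set.Icc.convexComb a b u).2]
  rfl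

theorem el_loop_eq_hol (c : Crossing ℓ γ) {t : ℝ} (ht : (t : UnitAddCircle) = c.param) :
    el x₀ (Path.Homotopic.Quotient.mk c.loop) = hol x₀ (per γ) t (t + 1) := by
  refine el_eq_of_forall x₀ _ _ fun u => ?_
  change γ (c.param + ((u : ℝ) : UnitAddCircle)) = γ ((t + u * (t + 1 - t) : ℝ) : UnitAddCircle)
  rw [← ht, ← AddCircle.coe_add]
  congr 3
  ring

/-- Following `ℓ` back to the basepoint and forward again separates the inserted loop as a left
factor; this is how `σ(γ)(x)` acquires the form `b(x, y) x`. -/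
theorem insertOnce_eq (c : Crossing ℓ γ) :
    c.insertOnce = c.lasso * loopClass (Path.Homotopic.Quotient.mk ℓ) := by
  rw [insertOnce, ← el_loop, el_cast, el_trans, el_trans, el_subpath, el_subpath, lasso,
    ← hol_ext_loop, ← hol_trans x₀ (ext ℓ) 0 c.time 1]
  simp [mul_assoc]

variable [ChartedSpace (EuclideanHalfSpace 2) M]

/-- The loop at the intersection, with the exponent given by the sign. -/
def signedLasso (c : Crossing ℓ γ) : LoopGroup x₀ := if c.sign = 1 then c.lasso else c.lasso⁻¹

theorem signedLasso_eq (c : Crossing ℓ γ) : c.signedLasso =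
    hol x₀ (ext ℓ) 0 c.time * el x₀ c.signedLoop * (hol x₀ (ext ℓ) 0 c.time)⁻¹ := by
  rw [signedLasso, signedLoop, lasso]
  split_ifs
  · rfl
  · rw [Path.Homotopic.Quotient.mk_symm, el_symm]
    group

/-- Each inserted copy of `γ`, joined to the basepoint along `ℓ`, moves to the left as a signed
lasso, in the order of the list. -/
theorem hol_mul_el_insertFrom (t : I) (cs : List (Crossing ℓ γ)) :
    hol x₀ (ext ℓ) 0 t * el x₀ (insertFrom t cs) =
      (cs.map signedLasso).prod * loopClass (Path.Homotopic.Quotient.mk ℓ) := by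
  induction cs generalizing t with
  | nil =>
    rw [insertFrom, el_cast, el_subpath, List.map_nil, List.prod_nil, one_mul, ← hol_ext_loop]
    exact hol_trans x₀ (ext ℓ) 0 t 1
  | cons c cs ih =>
    rw [insertFrom, el_trans, el_trans, el_subpath, ← mul_assoc, hol_trans, List.map_cons,
      List.prod_cons, mul_assoc, ← ih c.time, signedLasso_eq]
    group

theorem insertAll_eq (cs : List (Crossing ℓ γ)) : insertAll cs =
    (cs.map signedLasso).prod * loopClass (Path.Homotopic.Quotient.mk ℓ) := by
  rw [← hol_mul_el_insertFrom 0, insertAll, ← el_loop, el_cast]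
  simp [hol_self]

omit [PathConnectedSpace M] in
theorem curveInChart_comp (c : Crossing ℓ γ) {t : ℝ} (ht : (t : UnitAddCircle) = c.param) :
    c.curveInChart = fun u => extChartAt (𝓡∂ 2) (ext ℓ c.time) (per γ (t + u)) := by
  funext u
  have h1 : ext ℓ c.time = ℓ c.time := Path.extend_apply _ c.time.2
  rw [curveInChart, h1, ← ht]
  rfl

omit [PathConnectedSpace M] in
theorem loopInChart_eq (c : Crossing ℓ γ) :
    c.loopInChart = fun u => extChartAt (𝓡∂ 2) (ext ℓ c.time) (ext ℓ u) := by
  funext u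
  have h1 : ext ℓ c.time = ℓ c.time := Path.extend_apply _ c.time.2
  rw [loopInChart, h1]
  rfl

omit [PathConnectedSpace M] in
theorem det_eq (c : Crossing ℓ γ) {t : ℝ} (ht : (t : UnitAddCircle) = c.param) :
    c.det = crossDet (ext ℓ) (per γ) c.time t := by
  have h := deriv_comp_const_add (f := fun u => extChartAt (𝓡∂ 2) (ext ℓ c.time) (per γ u)) t 0
  rw [add_zero] at h
  rw [det, crossDet, c.curveInChart_comp ht, c.loopInChart_eq, h]

omit [PathConnectedSpace M] in
theorem transverse_iff (c : Crossing ℓ γ) {t : ℝ} (ht : (t : UnitAddCircle) = c.param) :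
    c.Transverse ↔ TransAt (ext ℓ) (per γ) c.time t := by
  have h := differentiableAt_comp_add_left (𝕜 := ℝ) (x := (0 : ℝ))
    (f := fun u => extChartAt (𝓡∂ 2) (ext ℓ c.time) (per γ u)) t
  rw [add_zero] at h
  rw [Transverse, TransAt, ← c.det_eq ht, c.curveInChart_comp ht, c.loopInChart_eq, h]

omit [PathConnectedSpace M] in
theorem crossSign_eq (c : Crossing ℓ γ) {t : ℝ} (ht : (t : UnitAddCircle) = c.param) :
    crossSign (ext ℓ) (per γ) c.time t = (c.sign : ℤ) := by
  rw [crossSign, sign, c.det_eq ht]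

end Crossing

/-! ### The intersection sum of curves in general position -/

section Partitions

open Set

/-- There are partitions of arbitrarily small mesh which avoid a finite set. -/
theorem exists_partition {a b : ℝ} (hab : a < b) {B : Set ℝ} (hB : B.Finite) (ha : a ∉ B)
    (hb : b ∉ B) {ε : ℝ} (hε : 0 < ε) : ∃ (s : ℕ → ℝ) (n : ℕ), 0 < n ∧ StrictMonoOn s (Iic n) ∧
      s 0 = a ∧ s n = b ∧ (∀ i < n, s (i + 1) - s i < ε) ∧ ∀ i ≤ n, s i ∉ B := by
  obtain ⟨N, hN⟩ := exists_nat_gt (2 * (b - a) / ε)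
  have hba : 0 < b - a := sub_pos.2 hab
  have hN0 : (0 : ℝ) < N := lt_trans (by positivity) hN
  have hNn : 0 < N := by exact_mod_cast hN0
  set d := (b - a) / N with hd
  have hd0 : 0 < d := by positivity
  have hdε : 2 * d < ε := by
    rw [hd, ← mul_div_assoc, div_lt_comm₀ hN0 hε]
    exact hN
  have hx : ∀ i : ℕ, ∃ x ∈ Ioo (a + d * i - d) (a + d * i), x ∉ B := fun i =>
    (Ioo_infinite (by linarith)).exists_notMem_finite hB
  choose x hx hxB using hx
  let s : ℕ → ℝ := fun i => if i = 0 then a else if i < N then x i else b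
  have hsN : ∀ i, i ≤ N → a + d * i - d ≤ s i ∧ s i ≤ a + d * i ∧ (i < N → 0 < i → s i < a + d * i) ∧
      (0 < i → a + d * i - d < s i) := by
    intro i hi
    simp only [s]
    split_ifs with h1 h2
    · subst h1
      simp
      linarith
    · exact ⟨(hx i).1.le, (hx i).2.le, fun _ _ => (hx i).2, fun _ => (hx i).1⟩
    · have : i = N := by omega
      subst this
      have : d * i = b - a := by rw [hd]; field_simp
      rw [this]
      exact ⟨by linarith, by linarith, fun h => absurd h (lt_irrefl _), fun _ => by linarith⟩
  have hstep : ∀ i < N, s i < s (i + 1) := by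
    intro i hi
    obtain ⟨h1, h2, h3, h4⟩ := hsN i hi.le
    obtain ⟨k1, k2, k3, k4⟩ := hsN (i + 1) hi
    have := k4 (by omega)
    push_cast at this
    linarith
  refine ⟨s, N, hNn, ?_, by simp [s], by simp [s, hNn.ne'], fun i hi => ?_, fun i hi => ?_⟩
  · refine strictMonoOn_of_lt_succ ordConnected_Iic fun i _ hi hi' => ?_
    exact hstep i (by simpa [Order.succ_eq_add_one] using hi')
  · obtain ⟨h1, h2, h3, h4⟩ := hsN i hi.le
    obtain ⟨k1, k2, k3, k4⟩ := hsN (i + 1) hi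
    push_cast at k2
    linarith
  · simp only [s]
    split_ifs with h1 h2
    · exact ha
    · exact hxB i
    · exact hb

theorem exists_mem_Ioo_of_partition {s : ℕ → ℝ} {n : ℕ} {t : ℝ} (h0 : s 0 < t) (hn : t < s n)
    (hne : ∀ i ≤ n, s i ≠ t) : ∃ i < n, t ∈ Ioo (s i) (s (i + 1)) := by
  classical
  have hex : ∃ i, t < s i := ⟨n, hn⟩
  have hle : Nat.find hex ≤ n := Nat.find_min' hex hn
  have hpos : Nat.find hex ≠ 0 := fun h => by
    have := Nat.find_spec hex
    rw [h] at this
    linarith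
  obtain ⟨k, hk⟩ := Nat.exists_eq_succ_of_ne_zero hpos
  refine ⟨k, by omega, lt_of_le_of_ne (not_lt.1 (Nat.find_min hex (by omega))) (hne k (by omega)), ?_⟩
  have := Nat.find_spec hex
  rwa [hk] at this

theorem eq_of_mem_Ioo_of_partition {s : ℕ → ℝ} {n : ℕ} (hs : StrictMonoOn s (Iic n)) {t : ℝ} {i j : ℕ}
    (hi : i < n) (hj : j < n) (h : t ∈ Ioo (s i) (s (i + 1))) (h' : t ∈ Ioo (s j) (s (j + 1))) :
    i = j := by
  have key : ∀ {i j : ℕ}, j < n → t ∈ Ioo (s i) (s (i + 1)) → t ∈ Ioo (s j) (s (j + 1)) →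
      ¬ i < j := by
    intro i j hj h h' hij
    have := hs.monotoneOn (mem_Iic.2 (show i + 1 ≤ n by omega)) (mem_Iic.2 hj.le) hij
    linarith [h.2, h'.1]
  have := key hj h h'
  have := key hi h' h
  omega

end Partitions

/-! ### Replacing arbitrary continuous chains by nice curves. -/

section Wild

open Set Filter Topology Metric

set_option linter.unusedSectionVars false

variable {M : Type*} [MetricSpace M] [CompactSpace M] [ChartedSpace (EuclideanHalfSpace 2) M]
  [PathConnectedSpace M] [IsManifold (𝓡∂ 2) ∞ M] {x₀ : M} {S : Scale x₀}

namespace Scale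

variable (S) in
/-- A radius such that points at smaller distance can be joined by paths which are short enough for
a nice curve. -/
def δ' : ℝ :=
  (exists_connect (M := M) (ε := S.δ / 4) (by have := S.δ_pos; positivity)).choose

variable (S) in
theorem δ'_pos : 0 < S.δ' :=
  (exists_connect (M := M) (ε := S.δ / 4) (by have := S.δ_pos; positivity)).choose_spec.1

/-- The pieces of a chain can be replaced by pieces of a nice curve which avoids a given
countable set. -/
theorem exists_nice_replace {F : Chain M} (hn : 0 < F.n)
    (hstep : ∀ i < F.n, dist (F.vtx (i + 1)) (F.vtx i) < S.δ')
    (hsh : ∀ i < F.n, S.Short F.f (F.s i) (F.s (i + 1))) {A : Set M} (hA : A.Countable)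
    (hFA : ∀ i ≤ F.n, F.vtx i ∉ A) : ∃ f : C(ℝ, M), S.Nice f F.n ∧ (∀ i ≤ F.n, f i = F.vtx i) ∧
      (∀ i ≤ F.n, hol x₀ f 0 i = F.cls x₀ i) ∧ ∀ t ∈ Icc (0 : ℝ) F.n, f t ∉ A := by
  classical
  have hδ := S.δ_pos
  have hδη := S.δ_le
  have hη := S.η_pos
  have hηρ := S.η_le
  have hc := (exists_connect (M := M) (ε := S.δ / 4) (by positivity)).choose_spec.2
  have hex : ∀ i, ∃ c : Path (F.vtx i) (F.vtx (i + 1)), i < F.n → (∀ t, dist (c t) (F.vtx i) < S.δ / 4) ∧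
      (∀ t, c t ∉ A) ∧ Dense (range c)ᶜ := by
    intro i
    by_cases hi : i < F.n
    · obtain ⟨c, c1, c2, c3, -⟩ := hc _ _ (hstep i hi) A hA (hFA i hi.le) (hFA (i + 1) hi)
      exact ⟨c, fun _ => ⟨c1, c2, c3⟩⟩
    · exact ⟨PathConnectedSpace.somePath _ _, fun h => absurd h hi⟩
  choose c hcc using hex
  obtain ⟨f, hfn, hf⟩ := exists_glue F.vtx c F.n
  have hval : ∀ i < F.n, ∀ t ∈ Icc (i : ℝ) (i + 1), ∃ u : I, f t = c i u := by
    intro i hi t ht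
    have := hf i hi ⟨t - i, by linarith [ht.1], by linarith [ht.2]⟩
    simp only [add_sub_cancel] at this
    exact ⟨_, this⟩
  have hv : ∀ i ≤ F.n, f i = F.vtx i := by
    intro i hi
    rcases hi.lt_or_eq with h | rfl
    · simpa using hf i h 0
    · exact hfn
  have hsmall : ∀ i < F.n, ∀ t ∈ Icc (i : ℝ) (i + 1), dist (f t) (f i) < S.δ / 4 := by
    intro i hi t ht
    obtain ⟨u, hu⟩ := hval i hi t ht
    rw [hu, hv i hi.le]
    exact (hcc i hi).1 u
  refine ⟨f, ⟨hn, hsmall, ?_⟩, hv, fun i hi => ?_, fun t ht => ?_⟩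
  · have hsub : (⋂ i ∈ Finset.range F.n, (f '' Icc (i : ℝ) (i + 1))ᶜ) ⊆ (f '' Icc 0 (F.n : ℝ))ᶜ := by
      rintro x hx ⟨t, ht, rfl⟩
      obtain ⟨i, hi, hti⟩ := exists_floor hn ht
      exact mem_iInter₂.1 hx i (Finset.mem_range.2 hi) ⟨t, hti, rfl⟩
    refine Dense.mono hsub (dense_biInter_of_isOpen (S := ((Finset.range F.n : Finset ℕ) : Set ℕ))
      (fun i _ => (isCompact_Icc.image f.continuous).isClosed.isOpen_compl)
      (Finset.countable_toSet _) (fun i hi => ?_))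
    have hi' := Finset.mem_range.1 hi
    refine Dense.mono (compl_subset_compl.2 ?_) (hcc i hi').2.2
    rintro _ ⟨t, ht, rfl⟩
    obtain ⟨u, hu⟩ := hval i hi' t ht
    exact ⟨u, hu.symm⟩
  · induction i with
    | zero => rw [Nat.cast_zero, hol_self, F.cls_zero]
    | succ i ih =>
      have hi' : i < F.n := hi
      have e1 : hol x₀ f i (i + 1 : ℕ) = S.κ (f i) (f (i + 1 : ℕ)) := by
        refine S.κ_hol (f i) f _ _ fun t ht => ?_
        rw [uIcc_of_le (by simp)] at ht
        have := hsmall i hi' t (by simpa using ht)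
        rw [mem_ball]
        linarith [S.ρ_pos]
      have e2 : hol x₀ F.f (F.s i) (F.s (i + 1)) = S.κ (F.vtx i) (F.vtx (i + 1)) := by
        refine S.κ_hol (F.vtx i) F.f _ _ fun t ht => ?_
        rw [uIcc_of_le (hsh i hi').1] at ht
        have := (hsh i hi').2 t ht
        rw [mem_ball, Chain.vtx]
        linarith [S.ρ_pos]
      rw [F.cls_succ, ← ih hi'.le, ← hol_trans x₀ f 0 i, e1, e2, hv i hi'.le, hv (i + 1) hi]
  · obtain ⟨i, hi, hti⟩ := exists_floor hn ht
    obtain ⟨u, hu⟩ := hval i hi t hti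
    rw [hu]
    exact (hcc i hi).2.1 u

variable {Λ : Type*} [AddCommGroup Λ]

/-- A chain from the basepoint to itself and a closed chain, with short pieces and such that the
ends of the pieces are off the other curve, can be replaced by nice curves. -/
theorem exists_pair_of_compat (hx₀ : x₀ ∈ (𝓡∂ 2).boundary M) {F H : Chain M} (hFn : 0 < F.n)
    (hHn : 0 < H.n) (H0 : S.Compat F H) (hF0 : F.vtx 0 = x₀) (hF1 : F.vtx F.n = x₀)
    (hH : H.vtx H.n = H.vtx 0) (hFs : ∀ i < F.n, dist (F.vtx (i + 1)) (F.vtx i) < S.δ')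
    (hHs : ∀ i < H.n, dist (H.vtx (i + 1)) (H.vtx i) < S.δ') (hHoff : ∀ j ≤ H.n, H.vtx j ∈ off F)
    (hFoff : ∀ i ≤ F.n, F.vtx i ∈ off H) (c : LoopGroup x₀ → Λ) :
    ∃ f h : C(ℝ, M), S.Pair (F.cls x₀ F.n) (H.cls x₀ H.n) f F.n h H.n ∧
      S.isum (fun u => c (u * H.cls x₀ H.n * u⁻¹)) F H = S.csum c f F.n h H.n := by
  have hFsh : ∀ i < F.n, S.Short F.f (F.s i) (F.s (i + 1)) := fun i hi => (H0 i hi 0 hHn).shortL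
  have hHsh : ∀ j < H.n, S.Short H.f (H.s j) (H.s (j + 1)) := fun j hj => (H0 0 hFn j hj).shortR
  have hvtx : ∀ {F H : Chain M}, 0 < F.n → (∀ i < F.n, F.s i ≤ F.s (i + 1)) → ∀ {p}, p ∈ off F → ∀ i ≤ F.n, F.vtx i ≠ p := by
    intro F H hn hs p hp i hi e
    rcases hi.lt_or_eq with h | rfl
    · exact hp i h _ (left_mem_Icc.2 (hs i h)) e.symm
    · obtain ⟨k, hk⟩ : ∃ k, F.n = k + 1 := ⟨F.n - 1, by omega⟩
      rw [hk] at e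
      exact hp k (by omega) _ (right_mem_Icc.2 (hs k (by omega))) e.symm
  obtain ⟨f, f1, f2, f3, f4⟩ := exists_nice_replace hFn hFs hFsh
    ((finite_Iic H.n).image H.vtx).countable (A := H.vtx '' Iic H.n) (by
      rintro i hi ⟨j, hj, e⟩
      exact hvtx (H := H) hFn (fun i hi => (hFsh i hi).1) (hHoff j hj) i hi e.symm)
  obtain ⟨h, h1, h2, h3, h4⟩ := exists_nice_replace hHn hHs hHsh
    ((finite_Iic F.n).image F.vtx).countable (A := F.vtx '' Iic F.n) (by
      rintro j hj ⟨i, hi, e⟩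
      exact hvtx (H := H) hFn (fun i hi => (hFsh i hi).1) (hHoff j hj) i hi e)
  have hfoffH : ∀ i ≤ F.n, f i ∈ off H := fun i hi => by rw [f2 i hi]; exact hFoff i hi
  have Cf : S.Compat (.int f F.n) H := by
    intro i hi j hj
    refine ⟨f1.short hi, hHsh j hj, ?_, ?_, ?_, ?_⟩
    · exact hfoffH i (le_of_lt hi) j hj
    · exact hfoffH (i + 1) hi j hj
    · exact fun s hs e => f4 s (Icc_sub hi (by simpa using hs)) ⟨j, hj.le, e.symm⟩
    · exact fun s hs e => f4 s (Icc_sub hi (by simpa using hs)) ⟨j + 1, hj, e.symm⟩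
  have Cfh : S.Compat (.int f F.n) (.int h H.n) := f1.compat h1 (fun i hi => by
      rw [off_int h1.pos]
      rintro ⟨t, ht, e⟩
      exact h4 t ht ⟨i, hi, by rw [e, f2 i hi]⟩) fun j hj => by
      rw [off_int f1.pos]
      rintro ⟨t, ht, e⟩
      exact f4 t ht ⟨j, hj, by rw [e, h2 j hj]⟩
  have y1 : hol x₀ h 0 H.n = H.cls x₀ H.n := h3 _ le_rfl
  have P : S.Pair (F.cls x₀ F.n) (H.cls x₀ H.n) f F.n h H.n := by
    refine ⟨f1, h1, ?_, ?_, f3 _ le_rfl, ?_, ⟨1, by simpa using y1⟩, Cfh⟩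
    · rw [← hF0, ← f2 0 (Nat.zero_le _), Nat.cast_zero]
    · rw [f2 _ le_rfl, hF1]
    · rw [h2 _ le_rfl, hH, ← h2 0 (Nat.zero_le _), Nat.cast_zero]
  refine ⟨f, h, P, ?_⟩
  -- The two chains are replaced one at a time, the second after exchanging roles.
  have s1 := isum_eq_of_pieces (S := S) (φ := fun u => c (u * H.cls x₀ H.n * u⁻¹)) (F := F)
    (F' := .int f F.n) (H := H) (Or.inl ⟨hH, fun u => congrArg c (by group)⟩) H0 Cf rfl f2
    (fun i hi => by rw [int_cls, f3 i hi])
  have s2 := isum_eq_of_pieces (S := S) (φ := fun u => c (u⁻¹ * H.cls x₀ H.n * u⁻¹⁻¹)) (F := H)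
    (F' := .int h H.n) (H := .int f F.n) ((P.loopOK hx₀ c).endOK _) Cf.swap Cfh.swap rfl h2
    (fun i hi => by rw [int_cls, h3 i hi])
  rw [s1, csum, isum_swap Cf, isum_swap Cfh, s2, y1]

end Scale

end Wild

/-! ### Evaluating the intersection sum at transverse crossings. -/

section GeneralPositionSum

open Set Filter Topology Metric

set_option linter.unusedSectionVars false

variable {M : Type*} [MetricSpace M] [CompactSpace M] [ChartedSpace (EuclideanHalfSpace 2) M]
  [PathConnectedSpace M] [IsManifold (𝓡∂ 2) ∞ M] {x₀ : M} {S : Scale x₀} {ℓ : Path x₀ x₀}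
  {γ : C(UnitAddCircle, M)}

namespace Scale

section Box

variable {c : Crossing ℓ γ} {a a' b b' τ : ℝ} (H : S.Adm (ext ℓ) (per γ) a a' b b')
  (hs : (c.time : ℝ) ∈ Ioo a a') (hτ : τ ∈ Ioo b b') (hc : (τ : UnitAddCircle) = c.param)

include hc in
theorem ext_time : ext ℓ c.time = per γ τ := by
  have h1 : ext ℓ c.time = ℓ c.time := Path.extend_apply _ c.time.2
  have h2 : per γ τ = γ (τ : UnitAddCircle) := rfl
  rw [h1, h2, hc, c.eq]

include H hs hτ hc in
theorem box_mem_ball : (∀ s ∈ Icc a a', ext ℓ s ∈ ball (ext ℓ a) S.ρ) ∧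
    ∀ s ∈ Icc b b', per γ s ∈ ball (ext ℓ a) S.ρ :=
  ⟨H.shortL.mem_ball (r := S.ρ / 8) (by simpa using S.ρ_pos) (by linarith [S.ρ_pos]),
    H.shortR.mem_ball (r := S.ρ / 8) (by
      rw [dist_comm]
      exact H.dist_lt ⟨c.time, Ioo_subset_Icc_self hs, τ, Ioo_subset_Icc_self hτ, ext_time hc⟩)
      (by linarith [S.ρ_pos])⟩

include hs hτ hc in
-- A box with a single transverse crossing has winding number equal to its sign, in whichever chart
-- it is read.
theorem cr_of_crossing (hor : OrientedAtlas M) (H : S.Adm (ext ℓ) (per γ) a a' b b') (ht : c.Transverse)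
    (honly : ∀ u ∈ Icc a a', ∀ v ∈ Icc b b', ext ℓ u = per γ v → u = c.time ∧ v = τ) :
    S.cr (ext ℓ) (per γ) a a' b b' = (c.sign : ℤ) := by
  obtain ⟨h1, h2⟩ := box_mem_ball H hs hτ hc
  have e := H.cr_spec h1 h2
  rw [boxVar_diffIn hor (ext ℓ).continuous (per γ).continuous hs hτ (fun u hu => S.ball_dom _ (h1 u hu))
    (fun u hu => S.ball_dom _ (h2 u hu)) (ext_time hc) ((c.transverse_iff hc).1 ht) honly,
    c.crossSign_eq hc] at e
  refine (two_pi_I_cancel ?_).symm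
  rw [← e]
  ring

include H hs hτ hc in
-- In the small ball, passing from the corner of the box on `ℓ` to its corner on `γ` is the same as
-- going through the crossing. So the label of the box conjugates `γ`, based at its parameter `t₀`,
-- into the lasso.
theorem conj_of_crossing (t₀ : ℝ) :
    (hol x₀ (ext ℓ) 0 a * S.κ (ext ℓ a) (per γ b) * (hol x₀ (per γ) t₀ b)⁻¹) *
      hol x₀ (per γ) t₀ (t₀ + 1) *
      (hol x₀ (ext ℓ) 0 a * S.κ (ext ℓ a) (per γ b) * (hol x₀ (per γ) t₀ b)⁻¹)⁻¹ = c.lasso := by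
  obtain ⟨h1, h2⟩ := box_mem_ball H hs hτ hc
  have l : a ∈ Icc a a' := left_mem_Icc.2 H.shortL.1
  have l' : b ∈ Icc b b' := left_mem_Icc.2 H.shortR.1
  have e1 : hol x₀ (ext ℓ) a c.time = S.κ (ext ℓ a) (ext ℓ c.time) := S.κ_hol _ _ _ _ fun t ht => by
    rw [uIcc_of_le hs.1.le] at ht
    exact h1 t ⟨ht.1, ht.2.trans hs.2.le⟩
  have e2 : hol x₀ (per γ) τ b = S.κ (ext ℓ c.time) (per γ b) := by
    rw [ext_time hc]
    refine S.κ_hol (ext ℓ a) _ _ _ fun t ht => ?_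
    rw [uIcc_of_ge hτ.1.le] at ht
    exact h2 t ⟨ht.1, ht.2.trans hτ.2.le⟩
  have e3 : S.κ (ext ℓ a) (per γ b) = hol x₀ (ext ℓ) a c.time * hol x₀ (per γ) τ b := by
    rw [e1, e2]
    exact (S.κ_mul (ext ℓ a) _ (h1 _ l) _ (h1 _ (Ioo_subset_Icc_self hs)) _ (h2 _ l')).symm
  have e4 : hol x₀ (per γ) (t₀ + 1) (τ + 1) = hol x₀ (per γ) t₀ τ := by
    simpa using hol_per_add_int x₀ γ t₀ τ 1
  have e5 : hol x₀ (per γ) τ (τ + 1) =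
      (hol x₀ (per γ) t₀ τ)⁻¹ * hol x₀ (per γ) t₀ (t₀ + 1) * hol x₀ (per γ) t₀ τ := by
    nth_rewrite 2 [← e4]
    rw [mul_assoc, hol_trans, eq_inv_mul_iff_mul_eq, hol_trans]
  have e6 : hol x₀ (ext ℓ) 0 a * S.κ (ext ℓ a) (per γ b) * (hol x₀ (per γ) t₀ b)⁻¹ =
      hol x₀ (ext ℓ) 0 c.time * (hol x₀ (per γ) t₀ τ)⁻¹ := by
    rw [e3, ← mul_assoc, hol_trans, mul_assoc, ← hol_symm, hol_trans, hol_symm x₀ (per γ) t₀ τ]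
  rw [e6, Crossing.lasso, c.el_loop_eq_hol hc, e5]
  group

end Box

/-- The ends of `ℓ` are boundary points, whereas `γ` lies in the interior. -/
theorem crossing_time_mem (hx₀ : x₀ ∈ (𝓡∂ 2).boundary M) (hγ : ∀ s, γ s ∈ (𝓡∂ 2).interior M)
    (c : Crossing ℓ γ) : (c.time : ℝ) ≠ 0 ∧ (c.time : ℝ) ≠ 1 := by
  have hne : ℓ c.time ≠ x₀ := fun e => by
    have h := hγ c.param
    rw [c.eq, e] at h
    exact disjoint_left.1 (ModelWithCorners.disjoint_interior_boundary) h hx₀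
  refine ⟨fun e => hne ?_, fun e => hne ?_⟩
  · rw [show c.time = 0 from Subtype.ext e, ℓ.source]
  · rw [show c.time = 1 from Subtype.ext e, ℓ.target]

/-- The intersection sum of curves in general position is determined by their classes. -/
theorem intersectionSum_eq_brk (hor : OrientedAtlas M) (hx₀ : x₀ ∈ (𝓡∂ 2).boundary M)
    (S : Scale x₀) (gp : GeneralPosition ℓ γ) {y : LoopGroup x₀}
    (hy : ∃ g, hol x₀ (per γ) 0 1 = g⁻¹ * y * g) :
    intersectionSum ℓ γ = S.brk (loopClass (Path.Homotopic.Quotient.mk ℓ)) y *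
      MonoidAlgebra.single (loopClass (Path.Homotopic.Quotient.mk ℓ)) 1 := by
  classical
  obtain ⟨hγ, hfin, htr⟩ := gp
  have := Fintype.ofFinite (Crossing ℓ γ)
  -- The circle is cut at a parameter which belongs to no crossing, so that each crossing has a
  -- unique representative parameter inside `(t₀, t₀ + 1)`.
  obtain ⟨t₀, ht₀⟩ : ∃ t₀ : ℝ, ∀ c : Crossing ℓ γ, (t₀ : UnitAddCircle) ≠ c.param := by
    obtain ⟨t, ht, h⟩ := (Ioo_infinite (zero_lt_one' ℝ)).exists_notMem_finite
      (finite_range fun c : Crossing ℓ γ => ((AddCircle.equivIco 1 0 c.param : ℝ)))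
    refine ⟨t, fun c e => h ⟨c, ?_⟩⟩
    have := AddCircle.equivIco_coe_eq (p := (1 : ℝ)) (a := 0) (x := t) ⟨ht.1.le, by linarith [ht.2]⟩
    simp only [← e]
    rw [this]
  let τ : Crossing ℓ γ → ℝ := fun c => (AddCircle.equivIco 1 t₀ c.param : ℝ)
  have hτc : ∀ c, (τ c : UnitAddCircle) = c.param := fun c => AddCircle.coe_equivIco
  have hτm : ∀ c, t₀ < τ c ∧ τ c < t₀ + 1 := fun c =>
    ⟨lt_of_le_of_ne (AddCircle.equivIco 1 t₀ c.param).2.1 fun e => ht₀ c (by rw [← hτc, ← e]),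
      (AddCircle.equivIco 1 t₀ c.param).2.2⟩
  have htm : ∀ c : Crossing ℓ γ, 0 < (c.time : ℝ) ∧ (c.time : ℝ) < 1 := fun c =>
    ⟨lt_of_le_of_ne c.time.2.1 (crossing_time_mem hx₀ hγ c).1.symm,
      lt_of_le_of_ne c.time.2.2 (crossing_time_mem hx₀ hγ c).2⟩
  have hcross : ∀ s ∈ Icc (0 : ℝ) 1, ∀ t ∈ Icc t₀ (t₀ + 1), ext ℓ s = per γ t →
      ∃ c : Crossing ℓ γ, (c.time : ℝ) = s ∧ τ c = t := by
    intro s hs t ht e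
    have e' : γ (t : UnitAddCircle) = ℓ ⟨s, hs⟩ := by
      have h1 : ext ℓ s = ℓ ⟨s, hs⟩ := Path.extend_apply _ hs
      rw [← h1, e]
      rfl
    let c : Crossing ℓ γ := ⟨⟨s, hs⟩, t, e'⟩
    have hne : t ≠ t₀ + 1 := fun h => ht₀ c (by
      change _ = (t : UnitAddCircle)
      rw [h, AddCircle.coe_add, AddCircle.coe_period, add_zero])
    refine ⟨c, rfl, ?_⟩
    have := AddCircle.equivIco_coe_eq (p := (1 : ℝ)) (a := t₀) (x := t)
      ⟨ht.1, lt_of_le_of_ne ht.2 hne⟩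
    exact congrArg Subtype.val this
  have hinj : ∀ c c' : Crossing ℓ γ, (c.time : ℝ) = c'.time → τ c = τ c' → c = c' := by
    rintro ⟨s, t, e⟩ ⟨s', t', e'⟩ h1 h2
    have h3 : t = t' := by
      have := hτc ⟨s, t, e⟩
      rw [h2, hτc] at this
      exact this.symm
    have h4 : s = s' := Subtype.ext h1
    subst h3 h4
    rfl
  -- a mesh which separates the intersections
  have hmin : 0 < min S.δ' S.η := lt_min S.δ'_pos S.η_pos
  obtain ⟨ε₁, hε₁, h1⟩ := Metric.uniformContinuousOn_iff.1 ((isCompact_Icc (a := (0 : ℝ)) (b := 1)).uniformContinuousOn_of_continuous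
    (ext ℓ).continuous.continuousOn) _ hmin
  obtain ⟨ε₂, hε₂, h2⟩ := Metric.uniformContinuousOn_iff.1 ((isCompact_Icc (a := t₀) (b := t₀ + 1)).uniformContinuousOn_of_continuous
    (per γ).continuous.continuousOn) _ hmin
  obtain ⟨ε₃, hε₃, h3⟩ : ∃ ε > 0, ∀ c c' : Crossing ℓ γ, |(c.time : ℝ) - c'.time| < ε →
      |τ c - τ c'| < ε → c = c' := by
    have : ∀ᶠ ε in 𝓝[>] (0 : ℝ), ∀ c c' : Crossing ℓ γ, |(c.time : ℝ) - c'.time| < ε →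
        |τ c - τ c'| < ε → c = c' := by
      refine eventually_all.2 fun c => eventually_all.2 fun c' => ?_
      by_cases h : c = c'
      · exact Eventually.of_forall fun _ _ _ => h
      · have hpos : 0 < max |(c.time : ℝ) - c'.time| |τ c - τ c'| := by
          by_contra hle
          rw [not_lt, max_le_iff] at hle
          exact h (hinj c c' (sub_eq_zero.1 (abs_nonpos_iff.1 hle.1))
            (sub_eq_zero.1 (abs_nonpos_iff.1 hle.2)))
        filter_upwards [nhdsWithin_le_nhds (Iio_mem_nhds hpos)] with ε hε a1 a2
        exact absurd (max_lt a1 a2) (not_lt.2 (le_of_lt hε))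
    obtain ⟨ε, h, hε⟩ := (this.and self_mem_nhdsWithin).exists
    exact ⟨ε, hε, h⟩
  set ε := min ε₁ (min ε₂ ε₃) with hε
  have hε0 : 0 < ε := by positivity
  have hεa : ε ≤ ε₁ := min_le_left _ _
  have hεb : ε ≤ ε₂ := (min_le_right _ _).trans (min_le_left _ _)
  have hεc : ε ≤ ε₃ := (min_le_right _ _).trans (min_le_right _ _)
  obtain ⟨s, n, hn, hsm, hs0, hsn, hsε, hsB⟩ := exists_partition zero_lt_one
    (finite_range fun c : Crossing ℓ γ => (c.time : ℝ)) (by rintro ⟨c, e⟩; exact (htm c).1.ne' e)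
    (by rintro ⟨c, e⟩; exact (htm c).2.ne e) hε0
  obtain ⟨t, m, hm, htm', ht0, htn, htε, htB⟩ := exists_partition (a := t₀) (b := t₀ + 1) (by linarith)
    (finite_range τ) (by rintro ⟨c, e⟩; exact (hτm c).1.ne' e)
    (by rintro ⟨c, e⟩; exact (hτm c).2.ne e) hε0
  have hslt : ∀ i < n, s i < s (i + 1) := fun i hi =>
    hsm (mem_Iic.2 hi.le) (mem_Iic.2 hi) (Nat.lt_succ_self i)
  have htlt : ∀ i < m, t i < t (i + 1) := fun i hi =>
    htm' (mem_Iic.2 hi.le) (mem_Iic.2 hi) (Nat.lt_succ_self i)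
  have hsI : ∀ i ≤ n, s i ∈ Icc (0 : ℝ) 1 := fun i hi => by
    rw [← hs0, ← hsn]
    exact ⟨hsm.monotoneOn (mem_Iic.2 (Nat.zero_le n)) (mem_Iic.2 hi) (Nat.zero_le i),
      hsm.monotoneOn (mem_Iic.2 hi) (mem_Iic.2 le_rfl) hi⟩
  have htI : ∀ i ≤ m, t i ∈ Icc t₀ (t₀ + 1) := fun i hi => by
    rw [← htn, ← ht0]
    exact ⟨htm'.monotoneOn (mem_Iic.2 (Nat.zero_le m)) (mem_Iic.2 hi) (Nat.zero_le i),
      htm'.monotoneOn (mem_Iic.2 hi) (mem_Iic.2 le_rfl) hi⟩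
  have hsS : ∀ i < n, ∀ u ∈ Icc (s i) (s (i + 1)), u ∈ Icc (0 : ℝ) 1 := fun i hi u hu =>
    ⟨(hsI i hi.le).1.trans hu.1, hu.2.trans (hsI (i + 1) hi).2⟩
  have htS : ∀ i < m, ∀ u ∈ Icc (t i) (t (i + 1)), u ∈ Icc t₀ (t₀ + 1) := fun i hi u hu =>
    ⟨(htI i hi.le).1.trans hu.1, hu.2.trans (htI (i + 1) hi).2⟩
  have hsd : ∀ i < n, ∀ u ∈ Icc (s i) (s (i + 1)), dist (ext ℓ u) (ext ℓ (s i)) < min S.δ' S.η := by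
    intro i hi u hu
    refine h1 u (hsS i hi u hu) (s i) (hsI i hi.le) ?_
    rw [Real.dist_eq, abs_of_nonneg (by linarith [hu.1])]
    linarith [hu.2, hsε i hi]
  have htd : ∀ i < m, ∀ u ∈ Icc (t i) (t (i + 1)), dist (per γ u) (per γ (t i)) < min S.δ' S.η := by
    intro i hi u hu
    refine h2 u (htS i hi u hu) (t i) (htI i hi.le) ?_
    rw [Real.dist_eq, abs_of_nonneg (by linarith [hu.1])]
    linarith [hu.2, htε i hi]
  have hav1 : ∀ i ≤ n, ∀ u ∈ Icc t₀ (t₀ + 1), ext ℓ (s i) ≠ per γ u := fun i hi u hu e => by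
    obtain ⟨c, c1, -⟩ := hcross _ (hsI i hi) u hu e
    exact hsB i hi ⟨c, c1⟩
  have hav2 : ∀ j ≤ m, ∀ u ∈ Icc (0 : ℝ) 1, ext ℓ u ≠ per γ (t j) := fun j hj u hu e => by
    obtain ⟨c, -, c1⟩ := hcross u hu _ (htI j hj) e
    exact htB j hj ⟨c, c1⟩
  let F : Chain M := ⟨ext ℓ, s, n⟩
  let H : Chain M := ⟨per γ, t, m⟩
  have HC : S.Compat F H := fun i hi j hj =>
    ⟨⟨(hslt i hi).le, fun u hu => (hsd i hi u hu).trans_le (min_le_right _ _)⟩,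
      ⟨(htlt j hj).le, fun u hu => (htd j hj u hu).trans_le (min_le_right _ _)⟩,
      fun u hu => hav1 i (le_of_lt hi) u (htS j hj u hu), fun u hu => hav1 (i + 1) hi u (htS j hj u hu),
      fun u hu => hav2 j hj.le u (hsS i hi u hu), fun u hu => hav2 (j + 1) hj u (hsS i hi u hu)⟩
  have hx : F.cls x₀ n = loopClass (Path.Homotopic.Quotient.mk ℓ) := by
    change hol x₀ (ext ℓ) (s 0) (s n) = _
    rw [hs0, hsn, hol_ext_loop]
  have hy0 : H.cls x₀ m = hol x₀ (per γ) t₀ (t₀ + 1) := by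
    change hol x₀ (per γ) (t 0) (t m) = _
    rw [ht0, htn]
  obtain ⟨f, h, P, hsum⟩ := exists_pair_of_compat hx₀ (F := F) (H := H) hn hm HC
    (by change ext ℓ (s 0) = x₀; rw [hs0, ext_zero]) (by change ext ℓ (s n) = x₀; rw [hsn, ext_one])
    (by change per γ (t m) = per γ (t 0); rw [ht0, htn, per_add_one])
    (fun i hi => (hsd i hi _ (right_mem_Icc.2 (hslt i hi).le)).trans_le (min_le_left _ _))
    (fun i hi => (htd i hi _ (right_mem_Icc.2 (htlt i hi).le)).trans_le (min_le_left _ _))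
    (fun j hj i hi u hu e => hav2 j hj u (hsS i hi u hu) e.symm)
    (fun i hi j hj u hu => hav1 i hi u (htS j hj u hu)) (fun u => MonoidAlgebra.single u (1 : ℚ))
  -- Cutting at `t₀` instead of `0` conjugates the class of `γ`, which a `Pair` permits.
  have P' : S.Pair (loopClass (Path.Homotopic.Quotient.mk ℓ)) y f n h m := by
    obtain ⟨g, hg⟩ := hy
    obtain ⟨g', hg'⟩ := P.holR
    refine ⟨P.niceL, P.niceR, P.start, P.finish, P.holL.trans hx, P.closed,
      ⟨g * hol x₀ (per γ) 0 t₀ * g', hg'.trans ?_⟩, P.compat⟩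
    have e1 : hol x₀ (per γ) 0 t₀ * hol x₀ (per γ) t₀ (t₀ + 1) =
        hol x₀ (per γ) 0 1 * hol x₀ (per γ) 0 t₀ := by
      have := hol_per_add_int x₀ γ 0 t₀ 1
      rw [zero_add, Int.cast_one] at this
      nth_rewrite 2 [← this]
      rw [hol_trans, hol_trans]
    have e2 : H.cls x₀ m = (hol x₀ (per γ) 0 t₀)⁻¹ * (g⁻¹ * y * g) * hol x₀ (per γ) 0 t₀ := by
      rw [hy0, ← hg, mul_assoc, eq_inv_mul_iff_mul_eq, e1]
    change g'⁻¹ * H.cls x₀ m * g' = _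
    rw [e2]
    group
  rw [P'.brk_eq hx₀]
  have hsum' : S.csum (fun u => MonoidAlgebra.single u (1 : ℚ)) f n h m =
      ∑ c : Crossing ℓ γ, MonoidAlgebra.single c.lasso ((c.sign : ℤ) : ℚ) := by
    refine hsum.symm.trans ?_
    have hI : ∀ c : Crossing ℓ γ, ∃ i < n, (c.time : ℝ) ∈ Ioo (s i) (s (i + 1)) := fun c =>
      exists_mem_Ioo_of_partition (by rw [hs0]; exact (htm c).1) (by rw [hsn]; exact (htm c).2)
        fun i hi e => hsB i hi ⟨c, e.symm⟩
    have hJ : ∀ c : Crossing ℓ γ, ∃ j < m, τ c ∈ Ioo (t j) (t (j + 1)) := fun c =>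
      exists_mem_Ioo_of_partition (by rw [ht0]; exact (hτm c).1) (by rw [htn]; exact (hτm c).2)
        fun i hi e => htB i hi ⟨c, e.symm⟩
    choose I₁ hI1 hI2 using hI
    choose J₁ hJ1 hJ2 using hJ
    -- The crossings are sorted by the box that contains them. The mesh is below `ε₃`, so a box
    -- contains at most one of them, and an empty box contributes zero.
    rw [isum, ← Finset.sum_product', ← Finset.sum_fiberwise_of_maps_to
      (s := (Finset.univ : Finset (Crossing ℓ γ))) (t := Finset.range n ×ˢ Finset.range m)
      (g := fun c => (I₁ c, J₁ c)) fun c _ => Finset.mem_product.2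
        ⟨Finset.mem_range.2 (hI1 c), Finset.mem_range.2 (hJ1 c)⟩]
    refine Finset.sum_congr rfl fun ij hij => ?_
    obtain ⟨i, j⟩ := ij
    obtain ⟨hi, hj⟩ := Finset.mem_product.1 hij
    replace hi : i < n := Finset.mem_range.1 hi
    replace hj : j < m := Finset.mem_range.1 hj
    have hbox : ∀ u ∈ Icc (s i) (s (i + 1)), ∀ v ∈ Icc (t j) (t (j + 1)), ext ℓ u = per γ v →
        ∃ c : Crossing ℓ γ, (c.time : ℝ) = u ∧ τ c = v ∧ I₁ c = i ∧ J₁ c = j := by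
      intro u hu v hv e
      obtain ⟨c, c1, c2⟩ := hcross u (hsS i hi u hu) v (htS j hj v hv) e
      refine ⟨c, c1, c2, eq_of_mem_Ioo_of_partition hsm (hI1 c) hi (hI2 c) ?_,
        eq_of_mem_Ioo_of_partition htm' (hJ1 c) hj (hJ2 c) ?_⟩
      · rw [← c1] at hu
        exact ⟨lt_of_le_of_ne hu.1 fun e => hsB i hi.le ⟨c, e.symm⟩,
          lt_of_le_of_ne hu.2 fun e => hsB (i + 1) hi ⟨c, e⟩⟩
      · rw [← c2] at hv
        exact ⟨lt_of_le_of_ne hv.1 fun e => htB j hj.le ⟨c, e.symm⟩,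
          lt_of_le_of_ne hv.2 fun e => htB (j + 1) hj ⟨c, e⟩⟩
    have huniq : ∀ c c' : Crossing ℓ γ, I₁ c = i → J₁ c = j → I₁ c' = i → J₁ c' = j → c = c' := by
      intro c c' a1 a2 a3 a4
      have b1 := hI2 c
      have b2 := hI2 c'
      have b3 := hJ2 c
      have b4 := hJ2 c'
      rw [a1] at b1
      rw [a3] at b2
      rw [a2] at b3
      rw [a4] at b4
      refine h3 c c' (abs_lt.2 ⟨?_, ?_⟩) (abs_lt.2 ⟨?_, ?_⟩)
      · linarith [b1.1, b2.2, hsε i hi]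
      · linarith [b1.2, b2.1, hsε i hi]
      · linarith [b3.1, b4.2, htε j hj]
      · linarith [b3.2, b4.1, htε j hj]
    by_cases hex : ∃ c : Crossing ℓ γ, I₁ c = i ∧ J₁ c = j
    · obtain ⟨c, ci, cj⟩ := hex
      have hfil : Finset.univ.filter (fun c' : Crossing ℓ γ => (I₁ c', J₁ c') = (i, j)) = {c} := by
        ext c'
        simp only [Finset.mem_filter, Finset.mem_univ, true_and, Prod.mk.injEq,
          Finset.mem_singleton]
        exact ⟨fun hc' => huniq c' c hc'.1 hc'.2 ci cj, fun e => by rw [e]; exact ⟨ci, cj⟩⟩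
      have b1 := hI2 c
      have b2 := hJ2 c
      rw [ci] at b1
      rw [cj] at b2
      have hcr := cr_of_crossing (S := S) b1 b2 (hτc c) hor (HC i hi j hj) (htr c) fun u hu v hv e => by
        obtain ⟨c', d1, d2, d3, d4⟩ := hbox u hu v hv e
        obtain rfl := huniq c' c d3 d4 ci cj
        exact ⟨d1.symm, d2.symm⟩
      have hcj := conj_of_crossing (HC i hi j hj) b1 b2 (hτc c) t₀
      have hlab : S.lab F H i j = hol x₀ (ext ℓ) 0 (s i) * S.κ (ext ℓ (s i)) (per γ (t j)) *
          (hol x₀ (per γ) t₀ (t j))⁻¹ := by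
        rw [← hs0, ← ht0]
        rfl
      rw [hfil, Finset.sum_singleton, hlab, ← hcj]
      change S.cr (ext ℓ) (per γ) (s i) (s (i + 1)) (t j) (t (j + 1)) •
        MonoidAlgebra.single (_ * H.cls x₀ m * _) (1 : ℚ) = _
      rw [hcr, hy0, MonoidAlgebra.smul_single]
      simp
      rfl
    · have hfil : Finset.univ.filter (fun c' : Crossing ℓ γ => (I₁ c', J₁ c') = (i, j)) = ∅ := by
        ext c'
        simp only [Finset.mem_filter, Finset.mem_univ, true_and, Prod.mk.injEq, Finset.notMem_empty,
          iff_false]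
        exact fun hc' => hex ⟨c', hc'⟩
      rw [hfil, Finset.sum_empty, cr_eq_zero, zero_smul]
      rintro ⟨u, hu, v, hv, e⟩
      obtain ⟨c', -, -, d3, d4⟩ := hbox u hu v hv e
      exact hex ⟨c', d3, d4⟩
  rw [hsum', intersectionSum, finsum_eq_sum_of_fintype, Finset.sum_mul]
  refine Finset.sum_congr rfl fun c _ => ?_
  rw [MonoidAlgebra.single_mul_single, mul_one, c.insertOnce_eq]

end Scale

end GeneralPositionSum

/-! ### Transversality -/

section Transversality

open Set Filter Topology Metric MeasureTheory

/-- The determinant of two vectors of the plane. -/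
def cross (v w : ℂ) : ℝ := v.re * w.im - v.im * w.re

/-- The equidimensional form of Sard's lemma: the image of a set on which the derivative is singular
is null. It needs differentiability only at the points of the set. -/
theorem volume_image_of_rank_lt {Φ : ℂ → ℂ} {C : Set ℂ} (h : ∀ z ∈ C, ∃ a b : ℂ, cross a b = 0 ∧
    HasFDerivAt Φ (Complex.reCLM.smulRight a + Complex.imCLM.smulRight b) z) :
    volume (Φ '' C) = 0 := by
  choose! a b hab hd using h
  refine addHaar_image_eq_zero_of_det_fderivWithin_eq_zero volume
    (fun z hz => (hd z hz).hasFDerivWithinAt) fun z hz => ?_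
  rw [ContinuousLinearMap.det, ← LinearMap.det_toMatrix Complex.basisOneI, Matrix.det_fin_two]
  have := hab z hz
  simp only [cross] at this
  simp [LinearMap.toMatrix_apply, Complex.basisOneI]
  linarith

/-- The directions in which a curve is seen tangentially from a point form a null set. -/
theorem volume_tangents (μ : ℝ → ℂ) (p : ℂ) : volume ((fun z : ℂ => p + z.im * (μ z.re - p)) ''
    {z | ∃ v, HasDerivAt μ v z.re ∧ cross v (μ z.re - p) = 0}) = 0 := by
  refine volume_image_of_rank_lt ?_
  rintro z ⟨v, hv, h0⟩
  -- The two partial derivatives of `(τ, r) ↦ p + r (μ(τ) - p)`; they are parallel exactly because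
  -- the velocity is parallel to the line of sight, or `r = 0`.
  refine ⟨z.im * v, μ z.re - p, ?_, ?_⟩
  · simp only [cross, Complex.re_ofReal_mul, Complex.im_ofReal_mul] at h0 ⊢
    linear_combination z.im * h0
  · have h1 : HasFDerivAt (fun z : ℂ => μ z.re - p) (Complex.reCLM.smulRight v) z := by
      have := (hv.hasFDerivAt.comp z Complex.reCLM.hasFDerivAt).sub_const p
      refine this.congr_fderiv ?_
      ext x
      simp [ContinuousLinearMap.smulRight_apply]
    have h2 : HasFDerivAt (fun z : ℂ => (z.im : ℂ)) (Complex.ofRealCLM.comp Complex.imCLM) z :=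
      (Complex.ofRealCLM.comp Complex.imCLM).hasFDerivAt
    refine HasFDerivAt.congr_fderiv (f := fun z : ℂ => p + (z.im : ℂ) * (μ z.re - p))
      ((h2.mul h1).const_add p) ?_
    ext x
    simp [ContinuousLinearMap.smulRight_apply]
    ring

/-- Regarded as a function on the plane that ignores the second variable, the curve has derivative
of rank at most one. -/
theorem volume_curve (μ : ℝ → ℂ) :
    volume ((fun z : ℂ => μ z.re) '' {z | ∃ v, HasDerivAt μ v z.re}) = 0 := by
  refine volume_image_of_rank_lt ?_
  rintro z ⟨v, hv⟩
  refine ⟨v, 0, by simp [cross], ?_⟩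
  refine (hv.hasFDerivAt.comp z Complex.reCLM.hasFDerivAt).congr_fderiv ?_
  ext x
  simp [ContinuousLinearMap.smulRight_apply]

section Charts

variable {M : Type*} [TopologicalSpace M] [ChartedSpace (EuclideanHalfSpace 2) M]

theorem extChartAt_eq_coord (b x : M) : extChartAt (𝓡∂ 2) b x = planeEquiv.symm (coord b x) := by
  rw [coord, LinearIsometryEquiv.symm_apply_apply]

theorem HasDerivAt.extChartAt {b : M} {f : ℝ → M} {v : ℂ} {s : ℝ}
    (h : HasDerivAt (fun u => coord b (f u)) v s) :
    HasDerivAt (fun u => extChartAt (𝓡∂ 2) b (f u)) (planeEquiv.symm v) s := by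
  simp only [extChartAt_eq_coord]
  exact planeEquiv.symm.toContinuousLinearEquiv.toContinuousLinearMap.hasFDerivAt.comp_hasDerivAt s h

variable [IsManifold (𝓡∂ 2) ∞ M]

/-- The effect of a change of charts on velocities. -/
theorem exists_chart_change (hor : OrientedAtlas M) {b b' x : M} (hb : x ∈ dom b) (hb' : x ∈ dom b')
    (hx : x ∈ (𝓡∂ 2).interior M) : ∃ A : ℂ → ℂ, (∃ d > 0, ∀ v w, cross (A v) (A w) = d * cross v w) ∧
      ∀ (f : ℝ → M) (s : ℝ) (v : ℂ), Continuous f → f s = x →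
        HasDerivAt (fun u => coord b (f u)) v s → HasDerivAt (fun u => coord b' (f u)) (A v) s := by
  set Φ := extChartAt (𝓡∂ 2) b' ∘ (extChartAt (𝓡∂ 2) b).symm with hΦ
  set z₀ := extChartAt (𝓡∂ 2) b x with hz₀
  have hbs : x ∈ (extChartAt (𝓡∂ 2) b).source := by rwa [extChartAt_source]
  have hbs' : x ∈ (extChartAt (𝓡∂ 2) b').source := by rwa [extChartAt_source]
  have hsrc : z₀ ∈ ((extChartAt (𝓡∂ 2) b).symm.trans (extChartAt (𝓡∂ 2) b')).source := by
    rw [PartialEquiv.trans_source, PartialEquiv.symm_source]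
    refine ⟨(extChartAt (𝓡∂ 2) b).map_source hbs, ?_⟩
    rw [mem_preimage, hz₀, (extChartAt (𝓡∂ 2) b).left_inv hbs]
    exact hbs'
  have hdet := hor (chartAt _ b) (chart_mem_atlas _ b) (chartAt _ b') (chart_mem_atlas _ b') z₀ hsrc
  have hcd : ContDiffWithinAt ℝ ∞ Φ (range (𝓡∂ 2)) z₀ := contDiffWithinAt_ext_coord_change b' b hsrc
  -- At interior points the derivative within the half-plane is a genuine derivative, so it acts on
  -- velocities by the chain rule.
  have hint : range (𝓡∂ 2) ∈ 𝓝 z₀ := by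
    rw [← mem_interior_iff_mem_nhds, interior_range_modelWithCornersEuclideanHalfSpace]
    have := (mem_interior_iff hb).1 hx
    rwa [coord_re] at this
  have hd := ((hcd.differentiableWithinAt (by simp)).hasFDerivWithinAt).hasFDerivAt hint
  obtain ⟨α, β, hβα, hAv⟩ := exists_conformal_part _ hdet
  refine ⟨fun v => α * v + β * (starRingEnd ℂ) v, ⟨‖α‖ ^ 2 - ‖β‖ ^ 2, ?_, fun v w => ?_⟩, ?_⟩
  · nlinarith [norm_nonneg β]
  · rw [← Complex.normSq_eq_norm_sq, ← Complex.normSq_eq_norm_sq]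
    simp only [cross, Complex.add_re, Complex.add_im, Complex.mul_re, Complex.mul_im, Complex.conj_re,
      Complex.conj_im, Complex.normSq_apply]
    ring
  · intro f s v hf hs hv
    have hv' := HasDerivAt.extChartAt hv
    have hd' : HasFDerivAt Φ (fderivWithin ℝ Φ (range (𝓡∂ 2)) z₀) (extChartAt (𝓡∂ 2) b (f s)) := by
      rw [hs]
      exact hd
    have h1 := planeEquiv.toContinuousLinearEquiv.toContinuousLinearMap.hasFDerivAt.comp_hasDerivAt s
      (hd'.comp_hasDerivAt s hv')
    have e : planeEquiv (fderivWithin ℝ Φ (range (𝓡∂ 2)) z₀ (planeEquiv.symm v)) =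
        α * v + β * (starRingEnd ℂ) v := by
      refine (hAv _).trans ?_
      rw [LinearIsometryEquiv.apply_symm_apply]
    change HasDerivAt _ (α * v + β * (starRingEnd ℂ) v) s
    rw [← e]
    refine h1.congr_of_eventuallyEq ?_
    filter_upwards [hf.continuousAt.preimage_mem_nhds ((dom_open b).mem_nhds (by rwa [hs]))] with u hu
    have hu' : f u ∈ (extChartAt (𝓡∂ 2) b).source := by rwa [extChartAt_source]
    change planeEquiv _ = planeEquiv (extChartAt (𝓡∂ 2) b' ((extChartAt (𝓡∂ 2) b).symm _))
    rw [(extChartAt (𝓡∂ 2) b).left_inv hu']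

/-- Transversality can be checked in any chart: a change of charts multiplies the determinant of
velocities by a positive number. -/
theorem transAt_of_chart (hor : OrientedAtlas M) {f h : ℝ → M} (hf : Continuous f) (hh : Continuous h)
    {b : M} {s t : ℝ} {v w : ℂ} (hst : f s = h t) (hb : f s ∈ dom b)
    (hi : f s ∈ (𝓡∂ 2).interior M) (hv : HasDerivAt (fun u => coord b (f u)) v s)
    (hw : HasDerivAt (fun u => coord b (h u)) w t) (hvw : cross v w ≠ 0) : TransAt f h s t := by
  obtain ⟨A, ⟨d, hd, hA⟩, hc⟩ := exists_chart_change hor hb (mem_dom (f s)) hi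
  have h1 := HasDerivAt.extChartAt (hc f s v hf rfl hv)
  have h2 := HasDerivAt.extChartAt (hc h t w hh hst.symm hw)
  refine ⟨h1.differentiableAt, h2.differentiableAt, ?_⟩
  rw [crossDet, h1.deriv, h2.deriv]
  have e := hA v w
  have e0 : ∀ v : ℂ, (planeEquiv.symm v) 0 = v.re := fun v => by
    rw [← planeEquiv_re, LinearIsometryEquiv.apply_symm_apply]
  have e1 : ∀ v : ℂ, (planeEquiv.symm v) 1 = v.im := fun v => by
    rw [← planeEquiv_im, LinearIsometryEquiv.apply_symm_apply]
  rw [e0, e1, e0, e1]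
  rw [cross] at e
  rw [e]
  exact mul_ne_zero hd.ne' hvw

omit [IsManifold (𝓡∂ 2) ∞ M] in
/-- Transverse intersections are isolated. -/
theorem TransAt.isolated {f h : ℝ → M} {s t : ℝ} (hst : f s = h t) (ht : TransAt f h s t) :
    ∃ δ > 0, ∀ s' t', |s' - s| ≤ δ → |t' - t| ≤ δ → f s' = h t' → s' = s ∧ t' = t := by
  obtain ⟨p, q, hpq, happ⟩ := diffIn_approx hst ht
  have hD : p.re * q.im - p.im * q.re ≠ 0 := by
    rw [← hpq]
    exact ht.2.2
  have hp : 0 < ‖p‖ + ‖q‖ := by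
    rcases eq_or_ne p 0 with rfl | hp
    · simp at hD
    · have := norm_pos_iff.2 hp
      positivity
  have hD' := abs_pos.2 hD
  obtain ⟨δ, hδ, happ⟩ := happ (|p.re * q.im - p.im * q.re| / 2 / (‖p‖ + ‖q‖)) (by positivity)
  refine ⟨δ, hδ, fun s' t' hs' ht' e => ?_⟩
  have h1 := happ s' t' hs' ht'
  rw [diffIn, e, sub_self, zero_sub, norm_neg] at h1
  set a := s' - s
  set b := t' - t
  set z := p * (a : ℂ) - q * (b : ℂ) with hz
  have c1 : |p.re * q.im - p.im * q.re| * |a| ≤ ‖q‖ * ‖z‖ := by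
    have : (p.re * q.im - p.im * q.re) * a = -(((starRingEnd ℂ) q * z).im) := by
      simp [hz, Complex.mul_im]
      ring
    rw [← abs_mul, this, abs_neg]
    refine (Complex.abs_im_le_norm _).trans ?_
    rw [norm_mul, Complex.norm_conj]
  have c2 : |p.re * q.im - p.im * q.re| * |b| ≤ ‖p‖ * ‖z‖ := by
    have : (p.re * q.im - p.im * q.re) * b = -(((starRingEnd ℂ) p * z).im) := by
      simp [hz, Complex.mul_im]
      ring
    rw [← abs_mul, this, abs_neg]
    refine (Complex.abs_im_le_norm _).trans ?_
    rw [norm_mul, Complex.norm_conj]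
  have c3 : |p.re * q.im - p.im * q.re| * (|a| + |b|) ≤
      |p.re * q.im - p.im * q.re| / 2 * (|a| + |b|) := by
    calc _ ≤ (‖p‖ + ‖q‖) * ‖z‖ := by linarith
      _ ≤ (‖p‖ + ‖q‖) * (|p.re * q.im - p.im * q.re| / 2 / (‖p‖ + ‖q‖) * (|a| + |b|)) :=
        mul_le_mul_of_nonneg_left h1 hp.le
      _ = _ := by field_simp
  have c4 : |a| + |b| ≤ 0 := by
    by_contra hlt
    rw [not_le] at hlt
    nlinarith
  have ha := abs_nonneg a
  have hb := abs_nonneg b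
  exact ⟨sub_eq_zero.1 (abs_eq_zero.1 (by linarith)), sub_eq_zero.1 (abs_eq_zero.1 (by linarith))⟩

omit [IsManifold (𝓡∂ 2) ∞ M] in
-- Infinitely many crossings would accumulate in the compact parameter space; the limit is again a
-- crossing, and by transversality it is isolated.
theorem finite_of_transverse [T2Space M] {x₀ : M} {ℓ : Path x₀ x₀} {γ : C(UnitAddCircle, M)}
    (h : ∀ c : Crossing ℓ γ, c.Transverse) : Finite (Crossing ℓ γ) := by
  by_contra hinf
  rw [not_finite_iff_infinite] at hinf
  let z : Crossing ℓ γ → ℝ × ℝ := fun c => (c.time, (AddCircle.equivIco 1 0 c.param : ℝ))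
  have hz : Function.Injective z := by
    rintro ⟨s, t, e⟩ ⟨s', t', e'⟩ h
    obtain ⟨h1, h2⟩ := Prod.mk.inj h
    have h3 : t = t' := (AddCircle.equivIco 1 0).injective (Subtype.ext h2)
    have h4 : s = s' := Subtype.ext h1
    subst h3 h4
    rfl
  have heq : ∀ c, ext ℓ (z c).1 = per γ (z c).2 := by
    intro c
    have h1 : ext ℓ c.time = ℓ c.time := Path.extend_apply _ c.time.2
    refine h1.trans (c.eq.symm.trans ?_)
    exact congrArg γ AddCircle.coe_equivIco.symm
  obtain ⟨a, ha, hacc⟩ := (infinite_range_of_injective hz).exists_accPt_of_subset_isCompact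
    ((isCompact_Icc (a := (0 : ℝ)) (b := 1)).prod (isCompact_Icc (a := (0 : ℝ)) (b := 1))) (by
      rintro _ ⟨c, rfl⟩
      have := (AddCircle.equivIco 1 0 c.param).2
      exact ⟨c.time.2, this.1, by linarith [this.2]⟩)
  have hcl : ext ℓ a.1 = per γ a.2 := by
    have hclosed : IsClosed {w : ℝ × ℝ | ext ℓ w.1 = per γ w.2} :=
      isClosed_eq ((ext ℓ).continuous.comp continuous_fst) ((per γ).continuous.comp continuous_snd)
    refine hclosed.closure_subset_iff.2 ?_ (mem_closure_iff_clusterPt.2 hacc.clusterPt)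
    rintro _ ⟨c, rfl⟩
    exact heq c
  have e' : γ (a.2 : UnitAddCircle) = ℓ ⟨a.1, ha.1⟩ := by
    have h1 : ext ℓ a.1 = ℓ ⟨a.1, ha.1⟩ := Path.extend_apply _ ha.1
    rw [← h1, hcl]
    rfl
  obtain ⟨δ, hδ, hiso⟩ := TransAt.isolated hcl
    ((Crossing.transverse_iff ⟨⟨a.1, ha.1⟩, a.2, e'⟩ rfl).1 (h _))
  rw [accPt_iff_nhds] at hacc
  obtain ⟨w, ⟨hw, ⟨c, rfl⟩⟩, hne⟩ := hacc (closedBall a δ) (closedBall_mem_nhds a hδ)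
  rw [mem_closedBall, Prod.dist_eq, max_le_iff, Real.dist_eq, Real.dist_eq] at hw
  exact hne (Prod.ext_iff.2 (hiso _ _ hw.1 hw.2 (heq c)))

end Charts

end Transversality

/-! ### Existence of representatives in general position -/

section Representatives

open Set Filter Topology Metric MeasureTheory

set_option linter.unusedSectionVars false

/-! ### Velocities of broken segments. -/

section Bends

variable {M : Type*} [TopologicalSpace M] [ChartedSpace (EuclideanHalfSpace 2) M] (Q : Disc M)
  {x w y : M} (hx : x ∈ Q.U) (hw : w ∈ Q.U) (hy : y ∈ Q.U)

theorem ext_bend_left {t : ℝ} (ht : t ∈ Icc (0 : ℝ) (1 / 2)) :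
    coord Q.b (ext (Q.bend hx hw hy) t) =
      coord Q.b x + ((2 * t : ℝ) : ℂ) * (coord Q.b w - coord Q.b x) := by
  have h : ext (Q.bend hx hw hy) t = Q.seg hx hw ⟨2 * t, by linarith [ht.1], by linarith [ht.2]⟩ := by
    have e : ext (Q.bend hx hw hy) t = Q.bend hx hw hy ⟨t, ht.1, by linarith [ht.2]⟩ :=
      Path.extend_apply (Q.bend hx hw hy) ⟨ht.1, by linarith [ht.2]⟩
    rw [e, Disc.bend, Path.trans_apply, dif_pos ht.2]
  rw [h, (Q.seg_spec hx hw _).2]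

theorem ext_bend_right {t : ℝ} (ht : t ∈ Ioc (1 / 2 : ℝ) 1) :
    coord Q.b (ext (Q.bend hx hw hy) t) =
      coord Q.b w + ((2 * t - 1 : ℝ) : ℂ) * (coord Q.b y - coord Q.b w) := by
  have h : ext (Q.bend hx hw hy) t =
      Q.seg hw hy ⟨2 * t - 1, by linarith [ht.1], by linarith [ht.2]⟩ := by
    have e : ext (Q.bend hx hw hy) t = Q.bend hx hw hy ⟨t, by linarith [ht.1], ht.2⟩ :=
      Path.extend_apply (Q.bend hx hw hy) ⟨by linarith [ht.1], ht.2⟩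
    rw [e, Disc.bend, Path.trans_apply, dif_neg (not_le.2 ht.1)]
  rw [h, (Q.seg_spec hw hy _).2]

theorem hasDerivAt_bend_left {t : ℝ} (ht : t ∈ Ioo (0 : ℝ) (1 / 2)) :
    HasDerivAt (fun u => coord Q.b (ext (Q.bend hx hw hy) u))
      (2 * (coord Q.b w - coord Q.b x)) t := by
  have h1 : HasDerivAt (fun u : ℝ => coord Q.b x + ((2 * u : ℝ) : ℂ) * (coord Q.b w - coord Q.b x))
      (2 * (coord Q.b w - coord Q.b x)) t := by
    have := (((hasDerivAt_id t).const_mul 2).ofReal_comp.mul_const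
      (coord Q.b w - coord Q.b x)).const_add (coord Q.b x)
    simpa using this
  refine h1.congr_of_eventuallyEq ?_
  filter_upwards [isOpen_Ioo.mem_nhds ht] with u hu
  exact ext_bend_left Q hx hw hy (Ioo_subset_Icc_self hu)

theorem hasDerivAt_bend_right {t : ℝ} (ht : t ∈ Ioo (1 / 2 : ℝ) 1) :
    HasDerivAt (fun u => coord Q.b (ext (Q.bend hx hw hy) u))
      (2 * (coord Q.b y - coord Q.b w)) t := by
  have h1 : HasDerivAt (fun u : ℝ => coord Q.b w + ((2 * u - 1 : ℝ) : ℂ) * (coord Q.b y - coord Q.b w))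
      (2 * (coord Q.b y - coord Q.b w)) t := by
    have := ((((hasDerivAt_id t).const_mul 2).sub_const 1).ofReal_comp.mul_const
      (coord Q.b y - coord Q.b w)).const_add (coord Q.b w)
    simpa using this
  refine h1.congr_of_eventuallyEq ?_
  filter_upwards [isOpen_Ioo.mem_nhds ht] with u hu
  exact ext_bend_right Q hx hw hy (Ioo_subset_Ioc_self hu)

theorem hasDerivAt_bend {t : ℝ} (ht : t ∈ Ioo (0 : ℝ) 1) (ht' : t ≠ 1 / 2) :
    ∃ v, HasDerivAt (fun u => coord Q.b (ext (Q.bend hx hw hy) u)) v t := by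
  rcases lt_or_gt_of_ne ht' with h | h
  · exact ⟨_, hasDerivAt_bend_left Q hx hw hy ⟨ht.1, h⟩⟩
  · exact ⟨_, hasDerivAt_bend_right Q hx hw hy ⟨h, ht.2⟩⟩

/-- Near `s`, the loop `ℓ` is the piece `c` reparametrized at speed `n`. -/
theorem hasDerivAt_of_piece {f : C(ℝ, M)} {b : M} {p q p' q' : M} {c : Path p q} {ℓ : Path p' q'} {i n : ℕ}
    (hfc : ∀ t : I, f (i + t) = c t) (hℓ : ∀ t : I, ℓ t = f (t * n)) {s : ℝ} (hs : s ∈ Ioo (0 : ℝ) 1)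
    (hsi : s * n - i ∈ Ioo (0 : ℝ) 1) {v : ℂ}
    (hv : HasDerivAt (fun u => coord b (ext c u)) v (s * n - i)) :
    HasDerivAt (fun u => coord b (ext ℓ u)) ((n : ℝ) • v) s := by
  have h1 : HasDerivAt (fun u : ℝ => u * n - i) (n : ℝ) s := by
    simpa using ((hasDerivAt_id s).mul_const (n : ℝ)).sub_const (i : ℝ)
  refine (hv.scomp s h1).congr_of_eventuallyEq ?_
  filter_upwards [isOpen_Ioo.mem_nhds hs, h1.continuousAt.preimage_mem_nhds (isOpen_Ioo.mem_nhds hsi)]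
    with u hu hu'
  have e1 : ext ℓ u = ℓ ⟨u, hu.1.le, hu.2.le⟩ := Path.extend_apply _ _
  have e2 : ext c (u * n - i) = c ⟨u * n - i, hu'.1.le, hu'.2.le⟩ := Path.extend_apply _ _
  rw [e1, hℓ, Function.comp_apply, e2, ← hfc]
  simp

end Bends

variable {M : Type*} [MetricSpace M] [CompactSpace M] [ChartedSpace (EuclideanHalfSpace 2) M]
  [PathConnectedSpace M] [IsManifold (𝓡∂ 2) ∞ M] {x₀ : M}

/-- Every loop in the interior is homotopic to a polygon. -/
theorem exists_polygonal_loop (S : Scale x₀) {p₀ : M} (hp₀ : p₀ ∈ (𝓡∂ 2).interior M) (ℓ₀ : Path p₀ p₀) :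
    ∃ ℓ : Path p₀ p₀, ℓ.Homotopic ℓ₀ ∧ (∀ t, ℓ t ∈ (𝓡∂ 2).interior M) ∧ Dense (range ℓ)ᶜ ∧
      ∃ C : Set M, C.Finite ∧ p₀ ∈ C ∧ C ⊆ range ℓ ∧ ∀ t : I, ℓ t ∉ C →
        ∃ b v, ℓ t ∈ dom b ∧ HasDerivAt (fun u => coord b (ext ℓ u)) v t := by
  classical
  obtain ⟨δ, hδ, hdisc⟩ := exists_disc_scale (M := M) S.ρ_pos
  obtain ⟨f, n, hn, h0, h1, hhol, hfV, hpc⟩ := Scale.exists_polygon (S := S) ℓ₀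
    (V := (𝓡∂ 2).interior M) (fun x ε hε => by
      obtain ⟨w, -, -, h3, h4⟩ := exists_vertex isOpen_univ dense_univ countable_empty x hε
      exact ⟨w, h3, h4⟩) hp₀ hp₀ (δ := min δ S.ρ) (ε := S.ρ) (lt_min hδ S.ρ_pos)
    (min_le_right _ _) le_rfl
    (fun a b c => (∀ t, c t ∈ (𝓡∂ 2).interior M) ∧ Dense (range c)ᶜ ∧ ∀ t ∈ Ioo (0 : ℝ) 1, t ≠ 1 / 2 →
      ∃ b' v, ext c t ∈ dom b' ∧ HasDerivAt (fun u => coord b' (ext c u)) v t)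
    (fun a ha b hb hab => by
      obtain ⟨Q, h1, h2⟩ := hdisc a
      have ha' : a ∈ Q.U := h1 (mem_ball_self hδ)
      have hb' : b ∈ Q.U := h1 (hab.trans_le (min_le_left _ _))
      -- With the corner placed at the end `b`, the path is a segment followed by a constant path,
      -- which is differentiable except possibly at its middle and its ends.
      refine ⟨Q.bend ha' hb' hb', ⟨fun t => ?_, Q.bend_dense _ _ _, fun t ht ht' => ?_⟩,
        fun t => h2 (Q.bend_mem _ _ _ t)⟩
      · rw [mem_interior_iff (Q.bend_mem _ _ _ t).1]
        exact Q.bend_re_pos _ _ _ ((mem_interior_iff ha'.1).1 ha) ((mem_interior_iff hb'.1).1 hb)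
          ((mem_interior_iff hb'.1).1 hb) t
      · obtain ⟨v, hv⟩ := hasDerivAt_bend Q ha' hb' hb' ht ht'
        exact ⟨Q.b, v, (Q.bend_mem _ _ _ _).1, hv⟩)
  choose a b c hP ha hb hfc hd using hpc
  have hn0 : (0 : ℝ) < n := by exact_mod_cast hn
  let ℓ : Path p₀ p₀ := (segPath f 0 n).cast h0.symm h1.symm
  have hℓ : ∀ t : I, ℓ t = f (t * n) := fun t => by
    change f (0 + t * (n - 0)) = _
    rw [zero_add, sub_zero]
  have htn : ∀ t : I, (t : ℝ) * n ∈ Icc (0 : ℝ) n := fun t =>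
    ⟨mul_nonneg t.2.1 hn0.le, mul_le_of_le_one_left hn0.le t.2.2⟩
  have hval : ∀ t : I, ∃ i, ∃ hi : i < n, (t : ℝ) * n - i ∈ Icc (0 : ℝ) 1 ∧
      ℓ t = ext (c i hi) (t * n - i) := by
    intro t
    obtain ⟨i, hi, h⟩ := Scale.exists_floor hn (htn t)
    have hm : (t : ℝ) * n - i ∈ Icc (0 : ℝ) 1 := ⟨by linarith [h.1], by linarith [h.2]⟩
    refine ⟨i, hi, hm, ?_⟩
    have e := hfc i hi ⟨_, hm⟩
    have e2 : ext (c i hi) (t * n - i) = c i hi ⟨_, hm⟩ := Path.extend_apply _ _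
    rw [e2, ← e, hℓ]
    simp
  -- The exceptional set consists of the vertices and of the points at half-integer parameters,
  -- where the velocity may jump.
  refine ⟨ℓ, ?_, fun t => ?_, ?_, (fun k : ℕ => f (k / 2)) '' Iic (2 * n), (finite_Iic _).image _,
    ⟨0, by simp, by simpa using h0⟩, ?_, fun t ht => ?_⟩
  · refine Path.Homotopic.Quotient.eq.1 (el_injective x₀ ?_)
    rw [← hhol]
    exact el_eq_of_forall x₀ _ _ fun t => rfl
  · obtain ⟨i, hi, -, e⟩ := hval t
    rw [e]
    exact (hP i hi).1 _
  · have hsub : (⋂ i ∈ Finset.range n, (⋂ hi : i < n, (range (c i hi))ᶜ)) ⊆ (range ℓ)ᶜ := by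
      rintro x hx ⟨t, rfl⟩
      obtain ⟨i, hi, -, e⟩ := hval t
      exact mem_iInter.1 (mem_iInter₂.1 hx i (Finset.mem_range.2 hi)) hi ⟨_, e.symm⟩
    refine Dense.mono hsub (dense_biInter_of_isOpen (S := ((Finset.range n : Finset ℕ) : Set ℕ))
      (fun i hi => ?_) (Finset.countable_toSet _) fun i hi => ?_)
    · have hi' : i < n := Finset.mem_range.1 hi
      simp only [hi', iInter_true]
      exact (isCompact_range (c i hi').continuous).isClosed.isOpen_compl
    · have hi' : i < n := Finset.mem_range.1 hi
      simp only [hi', iInter_true]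
      exact (hP i hi').2.1
  · rintro _ ⟨k, hk, rfl⟩
    have hk' : (k : ℝ) ≤ 2 * n := by exact_mod_cast hk
    have hm : (k : ℝ) / 2 / n ∈ Icc (0 : ℝ) 1 := ⟨by positivity, by
      rw [div_le_one hn0]
      linarith⟩
    refine ⟨⟨_, hm⟩, ?_⟩
    rw [hℓ]
    change f (k / 2 / n * n) = f (k / 2)
    rw [div_mul_cancel₀ _ hn0.ne']
  · have hC : ∀ k : ℕ, k ≤ 2 * n → (t : ℝ) * n ≠ k / 2 := fun k hk e => ht ⟨k, hk, by
      rw [hℓ, e]⟩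
    obtain ⟨i, hi, hm, e⟩ := hval t
    have hm' : (t : ℝ) * n - i ∈ Ioo (0 : ℝ) 1 := by
      refine ⟨lt_of_le_of_ne hm.1 fun e => hC (2 * i) (by omega) ?_,
        lt_of_le_of_ne hm.2 fun e => hC (2 * (i + 1)) (by omega) ?_⟩
      · push_cast
        linarith
      · push_cast
        linarith
    have hh : (t : ℝ) * n - i ≠ 1 / 2 := fun e => hC (2 * i + 1) (by omega) (by
      push_cast
      linarith)
    have ht0 : (t : ℝ) ∈ Ioo (0 : ℝ) 1 := by
      refine ⟨lt_of_le_of_ne t.2.1 fun e => hC 0 (by omega) ?_,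
        lt_of_le_of_ne t.2.2 fun e => hC (2 * n) le_rfl ?_⟩
      · rw [← e]
        simp
      · rw [e]
        push_cast
        ring
    obtain ⟨b', v, hb', hv⟩ := (hP i hi).2.2 _ hm' hh
    exact ⟨b', _, by rw [e]; exact hb', hasDerivAt_of_piece (hfc i hi) hℓ ht0 hm' hv⟩

/-- Two points of a disc can be joined by two segments which intersect a given curve
transversally. -/
theorem exists_transverse_bend (hor : OrientedAtlas M) (Q : Disc M) {p q : M} (hp : p ∈ Q.U)
    (hq : q ∈ Q.U) {h : C(ℝ, M)} (hint : ∀ t, h t ∈ (𝓡∂ 2).interior M) {C : Set M} (hC : C.Countable)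
    (hdiff : ∀ t, h t ∉ C → ∃ b v, h t ∈ dom b ∧ HasDerivAt (fun u => coord b (h u)) v t)
    (hpC : p ∉ C) (hqC : q ∉ C) :
    ∃ c : Path p q, (∀ t, c t ∈ Q.U) ∧ (∀ τ, ext c (1 / 2) ≠ h τ) ∧
      ∀ t ∈ Ioo (0 : ℝ) 1, t ≠ 1 / 2 → ∀ τ, ext c t = h τ → ∃ v v',
        HasDerivAt (fun u => coord Q.b (ext c u)) v t ∧
        HasDerivAt (fun u => coord Q.b (h u)) v' τ ∧ cross v v' ≠ 0 := by
  set μ : ℝ → ℂ := fun u => coord Q.b (h u) with hμ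
  -- The corner `w` avoids the differentiable part of the curve, so it is not a crossing, as well as
  -- every line from `p` or from `q` which is tangent to the curve. The segments also avoid the
  -- exceptional points in `C`.
  obtain ⟨w, hw, hwZ, -, hav⟩ := Q.exists_bend hp hq hC hpC hqC (measure_union_null
    (volume_curve μ) (measure_union_null (volume_tangents μ (coord Q.b p))
      (volume_tangents μ (coord Q.b q))))
  simp only [mem_union, not_or] at hwZ
  obtain ⟨hw1, hw2, hw3⟩ := hwZ
  have hder : ∀ t τ, ext (Q.bend hp hw hq) t = h τ → ∃ v', HasDerivAt μ v' τ := by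
    intro t τ e
    have hτC : h τ ∉ C := by
      rw [← e]
      exact Scale.ext_mem _ (P := fun u => u ∉ C) hav t
    obtain ⟨b, v, hb, hv⟩ := hdiff τ hτC
    have hτQ : h τ ∈ dom Q.b := by
      rw [← e]
      exact Scale.ext_mem _ (P := fun u => u ∈ dom Q.b) (fun t => (Q.bend_mem _ _ _ t).1) t
    obtain ⟨A, -, hA⟩ := exists_chart_change hor hb hτQ (hint τ)
    exact ⟨A v, hA h τ v h.continuous rfl hv⟩
  have hmem : ∀ t, ext (Q.bend hp hw hq) t ∈ dom Q.b :=
    fun t => Scale.ext_mem _ (P := fun u => u ∈ dom Q.b) (fun t => (Q.bend_mem _ _ _ t).1) t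
  refine ⟨Q.bend hp hw hq, Q.bend_mem hp hw hq, fun τ e => ?_, fun t ht ht' τ e => ?_⟩
  · obtain ⟨v', hv'⟩ := hder _ τ e
    refine hw1 ⟨(τ : ℂ), ⟨v', by simpa using hv'⟩, ?_⟩
    have := ext_bend_left Q hp hw hq (t := 1 / 2) (by norm_num)
    simp only [Complex.ofReal_re, hμ, ← e]
    rw [this]
    push_cast
    ring
  · obtain ⟨v', hv'⟩ := hder _ τ e
    rcases lt_or_gt_of_ne ht' with hlt | hgt
    · refine ⟨_, v', hasDerivAt_bend_left Q hp hw hq ⟨ht.1, hlt⟩, hv', fun h0 => hw2 ?_⟩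
      have h1 := ext_bend_left Q hp hw hq (t := t) ⟨ht.1.le, hlt.le⟩
      rw [e] at h1
      have ht0 : (t : ℂ) ≠ 0 := by exact_mod_cast ht.1.ne'
      -- On the first segment the crossing lies at fraction `2 t` of the way from `p` to `w`; so `w`
      -- is on the line from `p` through it, at the inverse ratio, and would be excluded if this
      -- line were tangent.
      refine ⟨⟨τ, (2 * t)⁻¹⟩, ⟨v', hv', ?_⟩, ?_⟩
      · simp only [hμ, h1]
        simp only [cross, add_sub_cancel_left, Complex.ofReal_re, Complex.ofReal_im,
          Complex.mul_re, Complex.mul_im, Complex.re_ofNat, Complex.im_ofNat] at h0 ⊢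
        linear_combination -t * h0
      · simp only [hμ, h1]
        push_cast
        field_simp
        ring
    · refine ⟨_, v', hasDerivAt_bend_right Q hp hw hq ⟨hgt, ht.2⟩, hv', fun h0 => hw3 ?_⟩
      have h1 := ext_bend_right Q hp hw hq (t := t) ⟨hgt, ht.2.le⟩
      rw [e] at h1
      have ht0 : (1 - t : ℂ) ≠ 0 := by
        have : (1 - t : ℝ) ≠ 0 := by linarith [ht.2]
        exact_mod_cast this
      have h2 : coord Q.b (h τ) - coord Q.b q =
          ((2 * (1 - t) : ℝ) : ℂ) * (coord Q.b w - coord Q.b q) := by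
        rw [h1]
        push_cast
        ring
      refine ⟨⟨τ, (2 * (1 - t))⁻¹⟩, ⟨v', hv', ?_⟩, ?_⟩
      · simp only [hμ, h2]
        simp only [cross, Complex.ofReal_re, Complex.ofReal_im, Complex.sub_re, Complex.sub_im,
          Complex.mul_re, Complex.mul_im, Complex.re_ofNat, Complex.im_ofNat] at h0 ⊢
        linear_combination (1 - t) * h0
      · simp only [hμ, h2]
        push_cast
        field_simp
        ring

/-- Every free loop in the interior and every based loop have representatives in general
position. -/
theorem exists_represents (hor : OrientedAtlas M) (S : Scale x₀) (hx₀ : x₀ ∈ (𝓡∂ 2).boundary M)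
    (α : C(UnitAddCircle, M)) (hα : α 0 ∈ (𝓡∂ 2).interior M) (x : LoopGroup x₀) :
    ∃ r, Represents α x r := by
  -- The closed curve is made polygonal first; the based loop is then built transverse to it, with
  -- its vertices off the closed curve.
  obtain ⟨lam, hlam, hlint, hldense, C, hCf, hp₀, hCr, hdiff⟩ := exists_polygonal_loop S hα (basedAt α 0)
  set γ := circ lam with hγ
  have hfract : ∀ τ : ℝ, per γ τ = ext lam (Int.fract τ) := by
    intro τ
    have h1 : per γ τ = γ ((Int.fract τ : ℝ) : UnitAddCircle) := by
      rw [AddCircle.coe_fract]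
      rfl
    rw [h1]
    exact circ_coe lam ⟨Int.fract_nonneg τ, (Int.fract_lt_one τ).le⟩
  have hγint : ∀ s, γ s ∈ (𝓡∂ 2).interior M := fun s => by
    induction s using circle_induction with
    | h t ht =>
      rw [hγ, circ_coe lam ht]
      exact hlint _
  have hper : ∀ τ, per γ τ ∈ (𝓡∂ 2).interior M := fun τ => hγint _
  have hperR : ∀ τ, per γ τ ∈ range lam := fun τ => by
    rw [hfract]
    exact ⟨_, rfl⟩
  have hpdiff : ∀ τ, per γ τ ∉ C → ∃ b v, per γ τ ∈ dom b ∧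
      HasDerivAt (fun u => coord b (per γ u)) v τ := by
    intro τ hτ
    have hfr : Int.fract τ ∈ Ioo (0 : ℝ) 1 := by
      refine ⟨lt_of_le_of_ne (Int.fract_nonneg τ) fun e => hτ ?_, Int.fract_lt_one τ⟩
      rw [hfract, ← e, Scale.ext_zero]
      exact hp₀
    have e0 : ext lam (Int.fract τ) = lam ⟨Int.fract τ, hfr.1.le, hfr.2.le⟩ := Path.extend_apply _ _
    obtain ⟨b, v, hb, hv⟩ := hdiff ⟨Int.fract τ, hfr.1.le, hfr.2.le⟩ (by
      rw [← e0, ← hfract]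
      exact hτ)
    refine ⟨b, v, by rw [hfract, e0]; exact hb, ?_⟩
    have h1 : HasDerivAt (fun u => coord b (ext lam (u - ⌊τ⌋))) v τ := HasDerivAt.comp_sub_const τ _ hv
    refine h1.congr_of_eventuallyEq ?_
    have hτ1 : τ ∈ Ioo (⌊τ⌋ : ℝ) (⌊τ⌋ + 1) := by
      refine ⟨?_, Int.lt_floor_add_one τ⟩
      have := hfr.1
      rw [Int.fract] at this
      linarith
    filter_upwards [isOpen_Ioo.mem_nhds hτ1] with u hu
    rw [hfract, Int.fract, Int.floor_eq_iff.2 ⟨hu.1.le, hu.2⟩]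
  have hRc : IsClosed (range lam) := (isCompact_range lam.continuous).isClosed
  have hx₀R : x₀ ∉ range lam := by
    rintro ⟨t, e⟩
    have := hlint t
    rw [e] at this
    exact disjoint_left.1 ModelWithCorners.disjoint_interior_boundary this hx₀
  obtain ⟨ℓ₀, hℓ₀⟩ := el_surjective x₀ x₀ x₀ x
  obtain ⟨δ, hδ, hdisc⟩ := exists_disc_scale (M := M) S.ρ_pos
  obtain ⟨f, n, hn, h0, h1, hhol, hfV, hpc⟩ := Scale.exists_polygon (S := S) ℓ₀
    (V := (range lam)ᶜ) (fun x ε hε => by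
      obtain ⟨w, hw, hd⟩ := hldense.exists_dist_lt x hε
      exact ⟨w, hw, by rwa [dist_comm]⟩) hx₀R hx₀R (δ := min δ S.ρ) (ε := S.ρ) (lt_min hδ S.ρ_pos)
    (min_le_right _ _) le_rfl
    (fun a b c => (∀ τ, ext c (1 / 2) ≠ per γ τ) ∧ ∀ t ∈ Ioo (0 : ℝ) 1, t ≠ 1 / 2 →
      ∀ τ, ext c t = per γ τ → ∃ b' v v', ext c t ∈ dom b' ∧
        HasDerivAt (fun u => coord b' (ext c u)) v t ∧
        HasDerivAt (fun u => coord b' (per γ u)) v' τ ∧ cross v v' ≠ 0)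
    (fun a ha b hb hab => by
      obtain ⟨Q, h1, h2⟩ := hdisc a
      have ha' : a ∈ Q.U := h1 (mem_ball_self hδ)
      have hb' : b ∈ Q.U := h1 (hab.trans_le (min_le_left _ _))
      obtain ⟨c, c1, c2, c3⟩ := exists_transverse_bend hor Q ha' hb' hper hCf.countable hpdiff
        (fun h => ha (hCr h)) (fun h => hb (hCr h))
      refine ⟨c, ⟨c2, fun t ht ht' τ e => ?_⟩, fun t => h2 (c1 t)⟩
      obtain ⟨v, v', h⟩ := c3 t ht ht' τ e
      exact ⟨Q.b, v, v', (c1 _).1, h⟩)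
  choose a b c hP ha hb hfc hd using hpc
  have hn0 : (0 : ℝ) < n := by exact_mod_cast hn
  let ℓ : Path x₀ x₀ := (segPath f 0 n).cast h0.symm h1.symm
  have hℓ : ∀ t : I, ℓ t = f (t * n) := fun t => by
    change f (0 + t * (n - 0)) = _
    rw [zero_add, sub_zero]
  have hℓx : loopClass (Path.Homotopic.Quotient.mk ℓ) = x := by
    rw [← el_loop, ← hℓ₀, ← hhol]
    exact el_eq_of_forall x₀ _ _ fun t => rfl
  -- A crossing can occur neither at a vertex, since vertices are off `γ`, nor at a corner of a
  -- bend, so both velocities exist there.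
  have htr : ∀ cr : Crossing ℓ γ, cr.Transverse := by
    intro cr
    obtain ⟨τ, hτ⟩ := QuotientAddGroup.mk_surjective cr.param
    rw [cr.transverse_iff hτ]
    set s := (cr.time : ℝ) with hs
    have e0 : ext ℓ s = per γ τ := Scale.ext_time hτ
    have e1 : ext ℓ s = f (s * n) := (Path.extend_apply _ cr.time.2).trans (hℓ _)
    have hmem : s * n ∈ Icc (0 : ℝ) n :=
      ⟨mul_nonneg cr.time.2.1 hn0.le, mul_le_of_le_one_left hn0.le cr.time.2.2⟩
    obtain ⟨i, hi, hm⟩ := Scale.exists_floor hn hmem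
    have hv : ∀ j ≤ n, s * n ≠ (j : ℕ) := fun j hj e => hfV j hj (by
      rw [← e, ← e1, e0]
      exact hperR τ)
    have hm' : s * n - i ∈ Ioo (0 : ℝ) 1 := by
      refine ⟨?_, ?_⟩
      · linarith [lt_of_le_of_ne hm.1 (hv i hi.le).symm]
      · have := hv (i + 1) hi
        push_cast at this
        linarith [lt_of_le_of_ne hm.2 this]
    have e2 : ext ℓ s = ext (c i hi) (s * n - i) := by
      have e3 : ext (c i hi) (s * n - i) = c i hi ⟨_, hm'.1.le, hm'.2.le⟩ := Path.extend_apply _ _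
      rw [e1, e3, ← hfc i hi]
      simp
    have hhalf : s * n - i ≠ 1 / 2 := fun e => (hP i hi).1 τ (by rw [← e, ← e2, e0])
    have hs01 : s ∈ Ioo (0 : ℝ) 1 := by
      have h3 := Scale.crossing_time_mem hx₀ hγint cr
      exact ⟨lt_of_le_of_ne cr.time.2.1 h3.1.symm, lt_of_le_of_ne cr.time.2.2 h3.2⟩
    obtain ⟨b', v, v', hb', hv1, hv2, hcross⟩ := (hP i hi).2 _ hm' hhalf τ (by rw [← e2, e0])
    refine transAt_of_chart hor (ext ℓ).continuous (per γ).continuous e0 (by rw [e2]; exact hb')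
      (by rw [e0]; exact hper τ) (hasDerivAt_of_piece (hfc i hi) hℓ hs01 hm' hv1) hv2 ?_
    have : cross ((n : ℝ) • v) v' = n * cross v v' := by
      simp only [cross, Complex.real_smul, Complex.re_ofReal_mul, Complex.im_ofReal_mul]
      ring
    rw [this]
    exact mul_ne_zero hn0.ne' hcross
  refine ⟨(ℓ, γ), hℓx, ?_, hγint, finite_of_transverse htr, htr⟩
  have := circ_homotopic hlam
  rwa [circ_basedAt] at this

/-- The action of a free loop is an intersection sum of classes. -/
theorem loopAction_eq (hor : OrientedAtlas M) (S : Scale x₀) (hx₀ : x₀ ∈ (𝓡∂ 2).boundary M)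
    (α : C(UnitAddCircle, M)) (hα : α 0 ∈ (𝓡∂ 2).interior M) (x : LoopGroup x₀) {y : LoopGroup x₀}
    (hy : ∃ g, hol x₀ (per α) 0 1 = g⁻¹ * y * g) :
    loopAction α x = S.brk x y * MonoidAlgebra.single x 1 := by
  have hex := exists_represents hor S hx₀ α hα x
  rw [loopAction, dif_pos hex]
  obtain ⟨h1, h2, h3⟩ := hex.choose_spec
  obtain ⟨g, hg⟩ := hy
  obtain ⟨g', hg'⟩ := hol_conj_of_homotopic x₀ h2
  have := Scale.intersectionSum_eq_brk hor hx₀ S h3 (y := y) ⟨g * g'⁻¹, by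
    have : hol x₀ (per hex.choose.2) 0 1 = g' * hol x₀ (per α) 0 1 * g'⁻¹ := by
      rw [hg']
      group
    rw [this, hg]
    group⟩
  rw [h1] at this
  exact this

end Representatives

/-! ### The logarithm of a unipotent element -/

section Logarithm

open Finset Polynomial

/-- The polynomial whose values at the natural numbers are the binomial coefficients. -/
def choosePoly : ℕ → ℚ[X]
  | 0 => 1
  | m + 1 => C ((m + 1 : ℚ)⁻¹) * (choosePoly m * (X - C (m : ℚ)))

theorem choosePoly_eval (m j : ℕ) : (choosePoly m).eval (j : ℚ) = j.choose m := by
  induction m with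
  | zero => simp [choosePoly]
  | succ m ih =>
    have hm : (m + 1 : ℚ) ≠ 0 := by positivity
    rw [choosePoly, eval_C_mul, eval_mul, ih, eval_sub, eval_X, eval_C, inv_mul_eq_iff_eq_mul₀ hm]
    rcases le_or_gt m j with h | h
    · have := Nat.choose_succ_right_eq j m
      rw [← Nat.cast_sub h]
      exact_mod_cast by linarith
    · rw [Nat.choose_eq_zero_of_lt h, Nat.choose_eq_zero_of_lt (by omega)]
      simp

theorem choosePoly_coeff_zero (m : ℕ) : (choosePoly m).coeff 0 = if m = 0 then 1 else 0 := by
  rw [coeff_zero_eq_eval_zero, ← Nat.cast_zero, choosePoly_eval]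
  rcases m with _ | m <;> simp

/-- The logarithm is the derivative at `j = 0` of `(1 + w)^j = ∑ binom(j, m) w^m`; its coefficients
are therefore the linear coefficients of the binomial polynomials. -/
theorem choosePoly_coeff_one (m : ℕ) : (choosePoly m).coeff 1 = PowerSeries.coeff m logSeries := by
  rw [logSeries, PowerSeries.coeff_mk]
  induction m with
  | zero => simp [choosePoly, coeff_one]
  | succ m ih =>
    have hm : (m + 1 : ℚ) ≠ 0 := by positivity
    rw [choosePoly, coeff_C_mul, mul_sub, coeff_sub, coeff_mul_X, coeff_mul_C,
      choosePoly_coeff_zero, ih, if_neg m.succ_ne_zero]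
    rcases m with _ | m
    · simp
    · have hm' : (m + 1 : ℚ) ≠ 0 := by positivity
      simp only [Nat.succ_ne_zero, if_false, Nat.add_sub_cancel, pow_succ]
      push_cast at hm ⊢
      field_simp
      ring

variable {A : Type*} [Ring A] [Algebra ℚ A]

/-- The truncated logarithm of `1 + w`. -/
def logTrunc (N : ℕ) (w : A) : A := ∑ m ∈ range N, PowerSeries.coeff m logSeries • w ^ m

theorem one_add_pow_eq_sum {N : ℕ} {w : A} (hw : w ^ N = 0) (j : ℕ) :
    (1 + w) ^ j = ∑ m ∈ range N, (j.choose m : ℚ) • w ^ m := by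
  have h1 : (1 + w) ^ j = ∑ m ∈ range (j + 1), (j.choose m : ℚ) • w ^ m := by
    rw [add_comm, (Commute.one_right w).add_pow]
    refine sum_congr rfl fun m _ => ?_
    rw [one_pow, mul_one, ← Nat.cast_comm, ← nsmul_eq_mul, Nat.cast_smul_eq_nsmul]
  have h2 : ∀ K, N ≤ K → j + 1 ≤ K → (1 + w) ^ j = ∑ m ∈ range K, (j.choose m : ℚ) • w ^ m := by
    intro K _ h
    rw [h1]
    refine sum_subset (range_mono h) fun m _ hm => ?_
    rw [Nat.choose_eq_zero_of_lt (by simpa using hm), Nat.cast_zero, zero_smul]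
  rw [h2 _ (le_max_left N (j + 1)) (le_max_right _ _)]
  refine (sum_subset (range_mono (le_max_left N (j + 1))) fun m _ hm => ?_).symm
  rw [pow_eq_zero_of_le (by simpa using hm) hw, smul_zero]

/-- The logarithm of a product of commuting unipotent elements. -/
theorem logTrunc_mul {N : ℕ} {u v w : A} (hu : u ^ N = 0) (hv : v ^ N = 0) (hw : w ^ N = 0)
    (huv : Commute u v) (h : 1 + w = (1 + u) * (1 + v)) :
    logTrunc N w = logTrunc N u + logTrunc N v := by
  rcases N with _ | N
  · simp [logTrunc]
  rw [← sub_eq_zero, ← Module.forall_dual_apply_eq_zero_iff ℚ]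
  intro φ
  set n := N + 1
  -- As a function of `j` this is `φ` applied to `(1 + w)^j - (1 + u)^j (1 + v)^j`, which vanishes
  -- at all natural numbers; so the polynomial is zero, and its linear coefficient is the claim
  -- tested against `φ`.
  let P : ℚ[X] := ∑ m ∈ range n, C (φ (w ^ m)) * choosePoly m -
    ∑ m ∈ range n, ∑ m' ∈ range n, C (φ (u ^ m * v ^ m')) * (choosePoly m * choosePoly m')
  have hP : P = 0 := by
    refine P.eq_zero_of_infinite_isRoot (Set.Infinite.mono ?_
      (Set.infinite_range_of_injective (Nat.cast_injective (R := ℚ))))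
    rintro _ ⟨j, rfl⟩
    change P.eval (j : ℚ) = 0
    have h1 : φ ((1 + w) ^ j) = ∑ m ∈ range n, φ (w ^ m) * j.choose m := by
      rw [one_add_pow_eq_sum hw, map_sum]
      exact sum_congr rfl fun m _ => by rw [map_smul, smul_eq_mul, mul_comm]
    have h2 : φ ((1 + u) ^ j * (1 + v) ^ j) = ∑ m ∈ range n, ∑ m' ∈ range n,
        φ (u ^ m * v ^ m') * (j.choose m * j.choose m') := by
      rw [one_add_pow_eq_sum hu, one_add_pow_eq_sum hv, sum_mul_sum, map_sum]
      refine sum_congr rfl fun m _ => ?_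
      rw [map_sum]
      refine sum_congr rfl fun m' _ => ?_
      rw [smul_mul_assoc, mul_smul_comm, map_smul, map_smul, smul_eq_mul, smul_eq_mul]
      ring
    have hc : Commute (1 + u) (1 + v) :=
      ((Commute.one_left _).add_left ((Commute.one_right u).add_right huv))
    simp only [P, eval_sub, eval_finsetSum, eval_mul, eval_C, choosePoly_eval]
    rw [← h1, ← h2, h, hc.mul_pow, sub_self]
  have h1 : P.coeff 1 = 0 := by rw [hP, coeff_zero]
  have hc : ∀ m m', (choosePoly m * choosePoly m').coeff 1 =
      (if m = 0 then PowerSeries.coeff m' logSeries else 0) +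
        if m' = 0 then PowerSeries.coeff m logSeries else 0 := by
    intro m m'
    rw [mul_coeff_one, choosePoly_coeff_zero, choosePoly_coeff_zero, choosePoly_coeff_one,
      choosePoly_coeff_one]
    split_ifs <;> simp
  simp only [P, coeff_sub, finsetSum_coeff, coeff_C_mul, choosePoly_coeff_one, hc, mul_add,
    sum_add_distrib, mul_ite, mul_zero, sum_ite_eq'] at h1
  have e1 : ∑ m ∈ range n, ∑ m' ∈ range n,
      (if m = 0 then φ (u ^ m * v ^ m') * PowerSeries.coeff m' logSeries else 0) =
        ∑ m' ∈ range n, φ (v ^ m') * PowerSeries.coeff m' logSeries := by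
    rw [sum_comm]
    refine sum_congr rfl fun m' _ => ?_
    rw [sum_ite_eq' _ 0 fun m => φ (u ^ m * v ^ m') * PowerSeries.coeff m' logSeries,
      if_pos (by simp [n]), pow_zero, one_mul]
  have e2 : 0 ∈ range n := by simp [n]
  rw [e1] at h1
  simp only [e2, if_true, pow_zero, mul_one] at h1
  simp only [logTrunc, map_sub, map_add, map_sum, map_smul, smul_eq_mul]
  simp only [mul_comm (PowerSeries.coeff _ _)]
  linarith

end Logarithm

/-! ### Conjugation with coefficients in the group algebra -/

section Conjugation

variable {G : Type*} [Group G]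

open MonoidAlgebra

theorem augmentation_single (g : G) (c : ℚ) : augmentation G (single g c) = c := by
  simp [augmentation]

theorem single_sub_one_mem (g : G) : (single g 1 : MonoidAlgebra ℚ G) - 1 ∈ augIdeal G := by
  rw [RingHom.mem_ker, map_sub, map_one]
  simp [augmentation_single]

theorem sub_augmentation_mem_span (a : MonoidAlgebra ℚ G) : a - augmentation G a • 1 ∈
    Submodule.span ℚ (Set.range fun g : G => (single g 1 : MonoidAlgebra ℚ G) - 1) := by
  induction a using MonoidAlgebra.induction_linear with
  | zero => simp
  | add p q hp hq =>
    rw [map_add, add_smul, add_sub_add_comm]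
    exact add_mem hp hq
  | single g c =>
    have : single g c - augmentation G (single g c) • (1 : MonoidAlgebra ℚ G) =
        c • ((single g 1 : MonoidAlgebra ℚ G) - 1) := by
      rw [augmentation_single, smul_sub, smul_single, smul_eq_mul, mul_one]
    rw [this]
    exact Submodule.smul_mem _ _ (Submodule.subset_span ⟨g, rfl⟩)

theorem augIdeal_induction {p : MonoidAlgebra ℚ G → Prop} {a : MonoidAlgebra ℚ G}
    (ha : a ∈ augIdeal G) (zero : p 0) (add : ∀ a b, p a → p b → p (a + b))
    (smul : ∀ (c : ℚ) a, p a → p (c • a)) (single : ∀ g : G, p (single g 1 - 1)) : p a := by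
  have h := sub_augmentation_mem_span a
  rw [show augmentation G a = 0 from ha, zero_smul, sub_zero] at h
  refine Submodule.span_induction (p := fun a _ => p a) ?_ zero (fun a b _ _ => add a b)
    (fun c a _ => smul c a) h
  rintro _ ⟨g, rfl⟩
  exact single g

/-- As `I` is spanned by the elements `g - 1`, the power `I^(n+1)` is additively generated by the
products `a (g - 1)` with `a ∈ I^n`; scalars are absorbed into `a`. -/
theorem augIdeal_pow_induction {p : MonoidAlgebra ℚ G → Prop} {n : ℕ} {a : MonoidAlgebra ℚ G}
    (ha : a ∈ augIdeal G ^ (n + 1)) (zero : p 0) (add : ∀ a b, p a → p b → p (a + b))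
    (mul : ∀ a ∈ augIdeal G ^ n, ∀ g : G, p (a * (single g 1 - 1))) : p a := by
  rw [Submodule.pow_succ] at ha
  refine Submodule.mul_induction_on ha (fun a ha b hb => ?_) add
  have key : ∀ a ∈ augIdeal G ^ n, p (a * b) := by
    refine augIdeal_induction (p := fun b => ∀ a ∈ augIdeal G ^ n, p (a * b)) hb ?_ ?_ ?_ ?_
    · intro a _
      rwa [mul_zero]
    · intro b b' h h' a ha
      rw [mul_add]
      exact add _ _ (h a ha) (h' a ha)
    · intro c b h a ha
      rw [mul_smul_comm, ← smul_mul_assoc]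
      exact h _ (Submodule.smul_of_tower_mem _ c ha)
    · intro g a ha
      exact mul a ha g
  exact key a ha

theorem augIdeal_pow_le {m n : ℕ} (h : m ≤ n) : augIdeal G ^ n ≤ augIdeal G ^ m :=
  Ideal.pow_le_pow_right h

theorem mul_mem_augIdeal_pow {m n : ℕ} {a b : MonoidAlgebra ℚ G} (ha : a ∈ augIdeal G ^ m)
    (hb : b ∈ augIdeal G ^ n) : a * b ∈ augIdeal G ^ (m + n) := by
  rw [Ideal.IsTwoSided.pow_add]
  exact Ideal.mul_mem_mul ha hb

/-- The linear extension `θ ↦ ∑ θ_u u⁻¹ b u` of conjugation. -/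
def conjBy : MonoidAlgebra ℚ G →ₗ[ℚ] MonoidAlgebra ℚ G →ₗ[ℚ] MonoidAlgebra ℚ G :=
  (Finsupp.linearCombination ℚ fun u : G =>
    (LinearMap.mulLeft ℚ (single u⁻¹ 1)).comp (LinearMap.mulRight ℚ (single u 1))).comp
      (coeffLinearEquiv ℚ).toLinearMap

theorem conjBy_single (u : G) (c : ℚ) (b : MonoidAlgebra ℚ G) :
    conjBy (single u c) b = c • (single u⁻¹ 1 * b * single u 1) := by
  have : coeffLinearEquiv ℚ (single u c : MonoidAlgebra ℚ G) = Finsupp.single u c := rfl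
  simp [conjBy, this, mul_assoc]

theorem conjBy_mul_single (θ b : MonoidAlgebra ℚ G) (u : G) :
    conjBy (θ * single u 1) b = single u⁻¹ 1 * conjBy θ b * single u 1 := by
  induction θ using MonoidAlgebra.induction_linear with
  | zero => simp
  | add p q hp hq => simp only [add_mul, map_add, LinearMap.add_apply, hp, hq, mul_add]
  | single g c =>
    rw [single_mul_single, conjBy_single, conjBy_single, mul_smul_comm, smul_mul_assoc, mul_one,
      mul_inv_rev, ← one_mul (1 : ℚ), ← single_mul_single, ← single_mul_single, one_mul]
    simp only [mul_assoc]

theorem conjBy_single_mul (θ b : MonoidAlgebra ℚ G) (z : G) :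
    conjBy (single z 1 * θ) b = conjBy θ (single z⁻¹ 1 * b * single z 1) := by
  induction θ using MonoidAlgebra.induction_linear with
  | zero => simp
  | add p q hp hq => simp only [mul_add, map_add, LinearMap.add_apply, hp, hq]
  | single g c =>
    rw [single_mul_single, conjBy_single, conjBy_single, one_mul,
      mul_inv_rev, ← one_mul (1 : ℚ), ← single_mul_single, ← single_mul_single, one_mul]
    simp only [mul_assoc]

theorem conjBy_one_right (θ : MonoidAlgebra ℚ G) : conjBy θ 1 = augmentation G θ • 1 := by
  induction θ using MonoidAlgebra.induction_linear with
  | zero => simp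
  | add p q hp hq => simp only [map_add, LinearMap.add_apply, hp, hq, add_smul]
  | single g c =>
    rw [conjBy_single, augmentation_single, mul_one, single_mul_single, inv_mul_cancel, mul_one]
    rfl

theorem conjBy_one_left (b : MonoidAlgebra ℚ G) : conjBy 1 b = b := by
  have : (1 : MonoidAlgebra ℚ G) = single 1 1 := rfl
  rw [this, conjBy_single, inv_one, one_smul, ← this, one_mul, mul_one]

theorem augmentation_conjBy (θ b : MonoidAlgebra ℚ G) :
    augmentation G (conjBy θ b) = augmentation G θ * augmentation G b := by
  induction θ using MonoidAlgebra.induction_linear with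
  | zero => simp
  | add p q hp hq => simp only [map_add, LinearMap.add_apply, hp, hq, add_mul]
  | single g c =>
    rw [conjBy_single, map_smul, map_mul, map_mul]
    simp [augmentation_single]

theorem conjBy_single_right (θ : MonoidAlgebra ℚ G) (y : G) :
    conjBy θ (single y 1) = mapDomain (fun u => u⁻¹ * y * u) θ := by
  induction θ using MonoidAlgebra.induction_linear with
  | zero => simp
  | add p q hp hq => simp only [map_add, LinearMap.add_apply, hp, hq, mapDomain_add]
  | single g c =>
    rw [conjBy_single, single_mul_single, single_mul_single, mapDomain_single, smul_single]
    simp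

/-- A factor `g - 1` in the weight replaces `c` by `g⁻¹ c g - c`, which is a combination of `(g⁻¹ -
1) c g` and `c (g - 1)` and lies one step deeper in the filtration. -/
theorem conjBy_mem {r s : ℕ} {θ b : MonoidAlgebra ℚ G} (hθ : θ ∈ augIdeal G ^ r)
    (hb : b ∈ augIdeal G ^ s) : conjBy θ b ∈ augIdeal G ^ (r + s) := by
  induction r generalizing θ with
  | zero =>
    rw [zero_add]
    clear hθ
    induction θ using MonoidAlgebra.induction_linear with
    | zero => simp
    | add p q hp hq =>
      rw [map_add, LinearMap.add_apply]
      exact add_mem hp hq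
    | single g c =>
      rw [conjBy_single]
      exact Submodule.smul_of_tower_mem _ c (Ideal.mul_mem_right _ _ (Ideal.mul_mem_left _ _ hb))
  | succ r ih =>
    refine augIdeal_pow_induction (p := fun θ => conjBy θ b ∈ augIdeal G ^ (r + 1 + s)) hθ ?_ ?_ ?_
    · simp
    · intro a a' h h'
      rw [map_add, LinearMap.add_apply]
      exact add_mem h h'
    · intro a ha g
      have e : conjBy (a * (single g 1 - 1)) b = (single g⁻¹ 1 - 1) * conjBy a b * single g 1 +
          conjBy a b * (single g 1 - 1) := by
        rw [mul_sub, mul_one, map_sub, LinearMap.sub_apply, conjBy_mul_single]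
        noncomm_ring
      have h1 := Submodule.pow_one (augIdeal G)
      rw [e]
      refine add_mem (Ideal.mul_mem_right _ _ ?_) ?_
      · rw [show r + 1 + s = 1 + (r + s) by ring]
        exact mul_mem_augIdeal_pow (by rw [h1]; exact single_sub_one_mem _) (ih ha)
      · rw [show r + 1 + s = (r + s) + 1 by ring]
        exact mul_mem_augIdeal_pow (ih ha) (by rw [h1]; exact single_sub_one_mem _)

end Conjugation

/-! ### Exponentials of derivations of the completed group algebra -/

section Exponential

variable {G : Type*} [Group G]

/-- The derivation `d` of the group algebra maps into the augmentation ideal `I`, and its square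
maps into `I ^ 2`. -/
structure IsUnipotentDer (d : MonoidAlgebra ℚ G →ₗ[ℚ] MonoidAlgebra ℚ G) : Prop where
  leib : ∀ a b, d (a * b) = a * d b + d a * b
  mem : ∀ a, d a ∈ augIdeal G
  sq_mem : ∀ a, d (d a) ∈ augIdeal G ^ 2

namespace IsUnipotentDer

variable {d : MonoidAlgebra ℚ G →ₗ[ℚ] MonoidAlgebra ℚ G} (hd : IsUnipotentDer d)
include hd

theorem neg : IsUnipotentDer (-d) where
  leib a b := by
    simp only [LinearMap.neg_apply, hd.leib]
    noncomm_ring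
  mem a := neg_mem (hd.mem a)
  sq_mem a := by
    simp only [LinearMap.neg_apply, map_neg, neg_neg]
    exact hd.sq_mem a

theorem map_mem {n : ℕ} {a : MonoidAlgebra ℚ G} (ha : a ∈ augIdeal G ^ n) :
    d a ∈ augIdeal G ^ n := by
  induction n generalizing a with
  | zero =>
    rw [Submodule.pow_zero, Ideal.one_eq_top]
    exact Submodule.mem_top
  | succ n ih =>
    refine augIdeal_pow_induction (p := fun a => d a ∈ augIdeal G ^ (n + 1)) ha ?_ ?_ ?_
    · simp
    · intro a b h h'
      rw [map_add]
      exact add_mem h h'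
    · intro a ha g
      rw [hd.leib, Submodule.pow_succ]
      exact add_mem (Ideal.mul_mem_mul ha (hd.mem _)) (Ideal.mul_mem_mul (ih ha) (single_sub_one_mem g))

theorem pow_map_mem (s : ℕ) {n : ℕ} {a : MonoidAlgebra ℚ G} (ha : a ∈ augIdeal G ^ n) :
    (d ^ s) a ∈ augIdeal G ^ n := by
  induction s generalizing a with
  | zero => exact ha
  | succ s ih =>
    rw [pow_succ, Module.End.mul_apply]
    exact ih (hd.map_mem ha)

/-- In the Leibniz expansion of `d^(s+t) (a b)` every term applies `d` at least `s` times to `a` or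
at least `t` times to `b`, and either improves the degree by one. -/
theorem pow_mul_mem {n s t : ℕ} {a b : MonoidAlgebra ℚ G} (ha : a ∈ augIdeal G ^ n)
    (hb : b ∈ augIdeal G ^ 1) (has : (d ^ s) a ∈ augIdeal G ^ (n + 1))
    (hbt : (d ^ t) b ∈ augIdeal G ^ 2) : (d ^ (s + t)) (a * b) ∈ augIdeal G ^ (n + 2) := by
  induction hm : s + t generalizing s t a b with
  | zero =>
    obtain ⟨rfl, rfl⟩ : s = 0 ∧ t = 0 := by omega
    exact mul_mem_augIdeal_pow ha hbt
  | succ m ih =>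
    rcases s with _ | s
    · exact hd.pow_map_mem _ (mul_mem_augIdeal_pow (n := 1) has hb)
    rcases t with _ | t
    · exact hd.pow_map_mem _ (mul_mem_augIdeal_pow ha hbt)
    rw [pow_succ, Module.End.mul_apply, hd.leib, map_add]
    refine add_mem (ih ha (hd.map_mem hb) has ?_ (by omega : s + 1 + t = m))
      (ih (hd.map_mem ha) hb ?_ hbt (by omega : s + (t + 1) = m))
    · rwa [pow_succ, Module.End.mul_apply] at hbt
    · rwa [pow_succ, Module.End.mul_apply] at has

/-- Nilpotency on `I / I²` propagates to all quotients `I^n / I^(n+1)`: each new factor `g - 1`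
costs two more applications of `d`. -/
theorem exists_pow_mem (n : ℕ) : ∃ s, ∀ a ∈ augIdeal G ^ n, (d ^ s) a ∈ augIdeal G ^ (n + 1) := by
  induction n with
  | zero => exact ⟨1, fun a _ => by simpa [Submodule.pow_one] using hd.mem a⟩
  | succ n ih =>
    obtain ⟨s, hs⟩ := ih
    refine ⟨s + 2, fun a ha => ?_⟩
    refine augIdeal_pow_induction (p := fun a => (d ^ (s + 2)) a ∈ augIdeal G ^ (n + 1 + 1)) ha ?_ ?_ ?_
    · simp
    · intro a b h h'
      rw [map_add]
      exact add_mem h h'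
    · intro a ha g
      refine hd.pow_mul_mem ha ?_ (hs a ha) ?_
      · rw [Submodule.pow_one]
        exact single_sub_one_mem g
      · rw [pow_two]
        exact hd.sq_mem _

theorem exists_pow_mem_pow (N : ℕ) : ∃ s, ∀ a, (d ^ s) a ∈ augIdeal G ^ N := by
  induction N with
  | zero => exact ⟨0, fun a => by simp [Submodule.pow_zero, Ideal.one_eq_top]⟩
  | succ N ih =>
    obtain ⟨s, hs⟩ := ih
    obtain ⟨t, ht⟩ := hd.exists_pow_mem N
    refine ⟨t + s, fun a => ?_⟩
    rw [pow_add, Module.End.mul_apply]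
    exact ht _ (hs a)

end IsUnipotentDer

/-- The endomorphism of `ℚ[G] / I ^ N` induced by a filtered endomorphism of `ℚ[G]`. -/
def quotEnd {N : ℕ} (d : MonoidAlgebra ℚ G →ₗ[ℚ] MonoidAlgebra ℚ G)
    (h : ∀ a ∈ augIdeal G ^ N, d a ∈ augIdeal G ^ N) : Module.End ℚ (QuotPow G N) where
  toFun := fun v => Ideal.Quotient.mk _ (d (Function.surjInv Ideal.Quotient.mk_surjective v))
  map_add' := by
    intro v w
    rw [← map_add, ← map_add, Ideal.Quotient.eq, ← map_sub]
    refine h _ (Ideal.Quotient.eq.1 ?_)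
    simp only [map_add, Function.surjInv_eq]
  map_smul' := by
    intro c v
    have e : ∀ a : MonoidAlgebra ℚ G, Ideal.Quotient.mk (augIdeal G ^ N) (c • a) =
      c • Ideal.Quotient.mk (augIdeal G ^ N) a := fun a => rfl
    rw [RingHom.id_apply, ← e, ← map_smul, Ideal.Quotient.eq, ← map_sub]
    refine h _ (Ideal.Quotient.eq.1 ?_)
    rw [e, Function.surjInv_eq Ideal.Quotient.mk_surjective,
      Function.surjInv_eq Ideal.Quotient.mk_surjective]

theorem quotEnd_mk {N : ℕ} (d : MonoidAlgebra ℚ G →ₗ[ℚ] MonoidAlgebra ℚ G)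
    (h : ∀ a ∈ augIdeal G ^ N, d a ∈ augIdeal G ^ N) (a : MonoidAlgebra ℚ G) :
    quotEnd d h (Ideal.Quotient.mk _ a) = Ideal.Quotient.mk _ (d a) := by
  change Ideal.Quotient.mk _ (d _) = _
  rw [Ideal.Quotient.eq, ← map_sub]
  exact h _ (Ideal.Quotient.eq.1 (Function.surjInv_eq _ _))

theorem level_toCompletion (N : ℕ) (a : MonoidAlgebra ℚ G) :
    level N (toCompletion a) = Ideal.Quotient.mk (augIdeal G ^ N) a := rfl

theorem exists_level_eq (N : ℕ) (v : CompletedAlgebra G) :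
    ∃ a, level N v = Ideal.Quotient.mk (augIdeal G ^ N) a := by
  obtain ⟨a, ha⟩ := Ideal.Quotient.mk_surjective (level N v)
  exact ⟨a, ha.symm⟩

theorem transition_level {m n : ℕ} (h : m ≤ n) (v : CompletedAlgebra G) :
    transition G h (level n v) = level m v := v.2 m n h

theorem transition_mk {m n : ℕ} (h : m ≤ n) (a : MonoidAlgebra ℚ G) :
    transition G h (Ideal.Quotient.mk _ a) = Ideal.Quotient.mk _ a := rfl

theorem mem_filtration {N : ℕ} {v : CompletedAlgebra G} :
    v ∈ filtration (G := G) N ↔ level N v = 0 := RingHom.mem_ker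

theorem sub_mem_filtration {N : ℕ} {v w : CompletedAlgebra G} :
    v - w ∈ filtration (G := G) N ↔ level N v = level N w := by
  rw [mem_filtration, map_sub (level (G := G) N), sub_eq_zero]

variable (G) in
/-- A sequence of derivations of the group algebra which converges in the completion. -/
structure DerSystem where
  /-- the `N`-th derivation, which is correct modulo `I ^ N` -/
  d : ℕ → MonoidAlgebra ℚ G →ₗ[ℚ] MonoidAlgebra ℚ G
  der : ∀ N, IsUnipotentDer (d N)
  compat : ∀ {N N'}, N ≤ N' → ∀ a, d N' a - d N a ∈ augIdeal G ^ N

namespace DerSystem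

variable (S : DerSystem G)

/-- The endomorphism of `ℚ[G] / I ^ N` induced by the `N`-th derivation. -/
def bar (N : ℕ) : Module.End ℚ (QuotPow G N) := quotEnd (S.d N) fun _ => (S.der N).map_mem

theorem bar_mk (N : ℕ) (a : MonoidAlgebra ℚ G) :
    S.bar N (Ideal.Quotient.mk _ a) = Ideal.Quotient.mk _ (S.d N a) := quotEnd_mk _ _ a

theorem bar_pow_mk (N s : ℕ) (a : MonoidAlgebra ℚ G) :
    (S.bar N ^ s) (Ideal.Quotient.mk _ a) = Ideal.Quotient.mk _ ((S.d N ^ s) a) := by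
  induction s generalizing a with
  | zero => rfl
  | succ s ih => rw [pow_succ, pow_succ, Module.End.mul_apply, Module.End.mul_apply, bar_mk, ih]

theorem bar_mul (N : ℕ) (v w : QuotPow G N) : S.bar N (v * w) = v * S.bar N w + S.bar N v * w := by
  obtain ⟨a, rfl⟩ := Ideal.Quotient.mk_surjective v
  obtain ⟨b, rfl⟩ := Ideal.Quotient.mk_surjective w
  rw [← map_mul, bar_mk, bar_mk, bar_mk, (S.der N).leib, map_add, map_mul, map_mul]

theorem bar_nilpotent (N : ℕ) : IsNilpotent (S.bar N) := by
  obtain ⟨s, hs⟩ := (S.der N).exists_pow_mem_pow N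
  refine ⟨s, LinearMap.ext fun v => ?_⟩
  obtain ⟨a, rfl⟩ := Ideal.Quotient.mk_surjective v
  rw [bar_pow_mk]
  exact Ideal.Quotient.eq_zero_iff_mem.2 (hs a)

theorem bar_transition {m n : ℕ} (h : m ≤ n) (v : QuotPow G n) :
    transition G h (S.bar n v) = S.bar m (transition G h v) := by
  obtain ⟨a, rfl⟩ := Ideal.Quotient.mk_surjective v
  rw [bar_mk, transition_mk, transition_mk, bar_mk]
  exact Ideal.Quotient.eq.2 (S.compat h a)

/-- The limit of the derivations. -/
def D : CompletedAlgebra G →ₗ[ℚ] CompletedAlgebra G where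
  toFun v := ⟨fun N => S.bar N (level N v), fun m n h => by
    rw [bar_transition, transition_level]⟩
  map_add' v w := completion_ext fun N => by
    change S.bar N (level N (v + w)) = S.bar N (level N v) + S.bar N (level N w)
    rw [map_add, map_add]
  map_smul' c v := completion_ext fun N => by
    change S.bar N (level N (c • v)) = c • S.bar N (level N v)
    rw [map_smul, map_smul]

theorem level_D (N : ℕ) (v : CompletedAlgebra G) : level N (S.D v) = S.bar N (level N v) := rfl

theorem level_D_pow (N s : ℕ) (v : CompletedAlgebra G) :
    level N ((S.D ^ s) v) = (S.bar N ^ s) (level N v) := by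
  induction s generalizing v with
  | zero => rfl
  | succ s ih => rw [pow_succ, pow_succ, Module.End.mul_apply, Module.End.mul_apply, ih, level_D]

/-- The exponential of the derivation of `ℚ[G] / I ^ N`. -/
def expBar (N : ℕ) : QuotPow G N →ₐ[ℚ] QuotPow G N :=
  AlgHom.ofLinearMap (IsNilpotent.exp (S.bar N)) (by
    have h0 : S.bar N 1 = 0 := by
      have := S.bar_mul N 1 1
      simpa using this
    obtain ⟨k, hk⟩ := S.bar_nilpotent N
    have hk' : S.bar N ^ (k + 1) = 0 := by rw [pow_succ, hk, zero_mul]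
    rw [IsNilpotent.exp_eq_sum hk', LinearMap.sum_apply, Finset.sum_eq_single 0]
    · simp
    · intro i _ hi
      obtain ⟨i, rfl⟩ := Nat.exists_eq_succ_of_ne_zero hi
      rw [LinearMap.smul_apply, pow_succ, Module.End.mul_apply, h0, map_zero, smul_zero]
    · simp)
    -- The exponential of a nilpotent derivation is multiplicative.
    (Module.End.exp_mul_of_derivation ℚ _ (S.bar N) (S.bar_mul N) (S.bar_nilpotent N))

theorem expBar_apply (N : ℕ) (v : QuotPow G N) : S.expBar N v = IsNilpotent.exp (S.bar N) v := rfl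

theorem expBar_transition {m n : ℕ} (h : m ≤ n) (v : QuotPow G n) :
    transition G h (S.expBar n v) = S.expBar m (transition G h v) := by
  have := Module.End.commute_exp_left_of_commute (S.bar_nilpotent n) (S.bar_nilpotent m)
    (g := (transition G h).toLinearMap) (LinearMap.ext fun v => (S.bar_transition h v).symm)
  exact (LinearMap.congr_fun this v).symm

/-- The exponential of the limit derivation, as an algebra endomorphism. -/
def expHom : CompletedAlgebra G →ₐ[ℚ] CompletedAlgebra G :=
  (AlgHom.pi fun N => (S.expBar N).comp (level N)).codRestrict (completion G) (by
    intro v m n h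
    change transition G h (S.expBar n (level n v)) = S.expBar m (level m v)
    rw [expBar_transition, transition_level])

/-- The opposite derivations. -/
def neg : DerSystem G where
  d N := -S.d N
  der N := (S.der N).neg
  compat h a := by
    rw [LinearMap.neg_apply, LinearMap.neg_apply, ← neg_sub']
    exact neg_mem (S.compat h a)

theorem bar_neg (N : ℕ) : S.neg.bar N = -S.bar N := by
  refine LinearMap.ext fun v => ?_
  obtain ⟨a, rfl⟩ := Ideal.Quotient.mk_surjective v
  rw [bar_mk, LinearMap.neg_apply, bar_mk, ← map_neg]
  rfl

/-- The exponential of the limit derivation. -/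
def exp : CompletedAlgebra G ≃ₐ[ℚ] CompletedAlgebra G :=
  AlgEquiv.ofAlgHom S.expHom S.neg.expHom
    (AlgHom.ext fun v => completion_ext fun N => by
      change S.expBar N (S.neg.expBar N (level N v)) = level N v
      rw [expBar_apply, expBar_apply, bar_neg, ← Module.End.mul_apply,
        IsNilpotent.exp_mul_exp_neg_self (S.bar_nilpotent N), Module.End.one_apply])
    (AlgHom.ext fun v => completion_ext fun N => by
      change S.neg.expBar N (S.expBar N (level N v)) = level N v
      rw [expBar_apply, expBar_apply, bar_neg, ← Module.End.mul_apply,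
        IsNilpotent.exp_neg_mul_exp_self (S.bar_nilpotent N), Module.End.one_apply])

theorem level_exp (N : ℕ) (v : CompletedAlgebra G) :
    level N (S.exp v) = IsNilpotent.exp (S.bar N) (level N v) := rfl

/-- Modulo each `I^m` the exponential series is a finite sum, as the induced derivation is
nilpotent. -/
theorem convergesTo_exp (v : CompletedAlgebra G) :
    ConvergesTo (fun N => ∑ n ∈ Finset.range N, ((n.factorial : ℚ)⁻¹) • (S.D ^ n) v) (S.exp v) := by
  intro m
  obtain ⟨k, hk⟩ := S.bar_nilpotent m
  refine ⟨k, fun N hN => ?_⟩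
  rw [sub_mem_filtration, map_sum, level_exp,
    IsNilpotent.exp_eq_sum (pow_eq_zero_of_le hN hk), LinearMap.sum_apply]
  refine Finset.sum_congr rfl fun n _ => ?_
  rw [map_smul, level_D_pow, LinearMap.smul_apply]

theorem D_mem_filtration (m : ℕ) {v : CompletedAlgebra G} (hv : v ∈ filtration (G := G) m) :
    S.D v ∈ filtration (G := G) m := by
  rw [mem_filtration] at hv ⊢
  rw [level_D, hv, map_zero]

/-- The exponentials of derivations which correspond to each other under a homomorphism. -/
theorem completionMap_exp {H : Type*} [Group H] (S' : DerSystem H) (f : G →* H)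
    (h : ∀ N a, MonoidAlgebra.mapDomainAlgHom ℚ ℚ f (S.d N a) -
      S'.d N (MonoidAlgebra.mapDomainAlgHom ℚ ℚ f a) ∈ augIdeal H ^ N) (v : CompletedAlgebra G) :
    completionMap f (S.exp v) = S'.exp (completionMap f v) := by
  refine completion_ext fun N => ?_
  rw [level_completionMap, level_exp, level_exp, level_completionMap]
  have := Module.End.commute_exp_left_of_commute (S.bar_nilpotent N) (S'.bar_nilpotent N)
    (g := (levelMap f N).toLinearMap) (LinearMap.ext fun v => by
      obtain ⟨a, rfl⟩ := Ideal.Quotient.mk_surjective v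
      change S'.bar N (Ideal.Quotient.mk _ (MonoidAlgebra.mapDomainAlgHom ℚ ℚ f a)) =
        levelMap f N (S.bar N (Ideal.Quotient.mk _ a))
      rw [bar_mk, bar_mk]
      exact (Ideal.Quotient.eq.2 (h N a)).symm)
  exact (LinearMap.congr_fun this _).symm

end DerSystem

theorem eq_of_convergesTo {u : ℕ → CompletedAlgebra G} {v w : CompletedAlgebra G}
    (hv : ConvergesTo u v) (hw : ConvergesTo u w) : v = w := by
  refine completion_ext fun m => ?_
  obtain ⟨N, hN⟩ := hv m
  obtain ⟨N', hN'⟩ := hw m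
  have h1 := hN _ (le_max_left N N')
  have h2 := hN' _ (le_max_right N N')
  rw [sub_mem_filtration] at h1 h2
  rw [← h1, h2]

/-- Continuous endomorphisms of the completion which agree on the group algebra are equal. -/
theorem eq_of_continuous {D D' : CompletedAlgebra G →ₗ[ℚ] CompletedAlgebra G}
    (hD : ∀ m : ℕ, ∃ n : ℕ, ∀ v ∈ filtration (G := G) n, D v ∈ filtration m)
    (hD' : ∀ m : ℕ, ∃ n : ℕ, ∀ v ∈ filtration (G := G) n, D' v ∈ filtration m)
    (h : ∀ a, D (toCompletion a) = D' (toCompletion a)) : D = D' := by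
  refine LinearMap.ext fun v => completion_ext fun m => ?_
  obtain ⟨n, hn⟩ := hD m
  obtain ⟨n', hn'⟩ := hD' m
  obtain ⟨a, ha⟩ := exists_level_eq (max n n') v
  have hmem : ∀ k ≤ max n n', v - toCompletion a ∈ filtration (G := G) k := by
    intro k hk
    rw [sub_mem_filtration, ← transition_level hk, ← transition_level hk, ha, level_toCompletion]
  have h1 := hn _ (hmem n (le_max_left _ _))
  have h2 := hn' _ (hmem n' (le_max_right _ _))
  rw [map_sub D, sub_mem_filtration] at h1
  rw [map_sub D', sub_mem_filtration] at h2
  rw [h1, h2, h]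

end Exponential

/-! ### The derivation attached to a loop -/

section Weights

open MonoidAlgebra Polynomial

variable {G : Type*} [Group G]

/-- Weights `θ_x` such that `x ↦ (∑ θ_{x,u} u⁻¹ yʲ u) x` is a derivation for all `j`. -/
structure TwistWeights (y : G) where
  /-- the weights -/
  wt : G → MonoidAlgebra ℚ G
  cocycle : ∀ (x x' : G) (j : ℕ), conjBy (wt (x * x')) (single y 1 ^ j) =
    conjBy (wt x) (single y 1 ^ j) + single x 1 * conjBy (wt x') (single y 1 ^ j) * single x⁻¹ 1
  aug_self : augmentation G (wt y) = 0

/-- The polynomial of the truncated logarithm. -/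
def logPoly (N : ℕ) : ℚ[X] := ∑ m ∈ Finset.range N, C (PowerSeries.coeff m logSeries) * X ^ m

theorem aeval_logPoly {A : Type*} [Ring A] [Algebra ℚ A] (N : ℕ) (w : A) :
    aeval w (logPoly N) = logTrunc N w := by
  simp [logPoly, logTrunc, Algebra.smul_def]

theorem logPoly_coeff_zero (N : ℕ) : (logPoly N).coeff 0 = 0 := by
  rw [logPoly, finsetSum_coeff]
  refine Finset.sum_eq_zero fun m _ => ?_
  rcases m with _ | m
  · simp [logSeries]
  · simp

theorem logTrunc_sub_mem {N N' r s : ℕ} (h : N ≤ N') {w : MonoidAlgebra ℚ G} (hw : w ∈ augIdeal G ^ r)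
    (hs : s ≤ r * N) : logTrunc N' w - logTrunc N w ∈ augIdeal G ^ s := by
  have hpow : ∀ m, w ^ m ∈ augIdeal G ^ (r * m) := by
    intro m
    induction m with
    | zero => simp [Submodule.pow_zero, Ideal.one_eq_top]
    | succ m ih =>
      rw [pow_succ, Nat.mul_succ]
      exact mul_mem_augIdeal_pow ih hw
  rw [logTrunc, logTrunc, ← Finset.sum_Ico_eq_sub _ h]
  refine Submodule.sum_mem _ fun m hm => Submodule.smul_of_tower_mem _ _ ?_
  exact augIdeal_pow_le (hs.trans (Nat.mul_le_mul_left r (Finset.mem_Ico.1 hm).1)) (hpow m)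

namespace TwistWeights

variable {y : G} (W : TwistWeights y)

/-- The linear map `x ↦ (∑ θ_{x,u} u⁻¹ b u) x`. -/
def der : MonoidAlgebra ℚ G →ₗ[ℚ] MonoidAlgebra ℚ G →ₗ[ℚ] MonoidAlgebra ℚ G :=
  LinearMap.flip ((Finsupp.linearCombination ℚ fun x : G =>
    (LinearMap.mulRight ℚ (single x 1)).comp (conjBy (W.wt x))).comp
      (coeffLinearEquiv ℚ).toLinearMap)

theorem der_single (b : MonoidAlgebra ℚ G) (x : G) (c : ℚ) :
    W.der b (single x c) = c • (conjBy (W.wt x) b * single x 1) := by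
  have : coeffLinearEquiv ℚ (single x c : MonoidAlgebra ℚ G) = Finsupp.single x c := rfl
  simp [der, this]

theorem cocycle_aeval (x x' : G) (q : ℚ[X]) :
    conjBy (W.wt (x * x')) (aeval (single y 1) q) = conjBy (W.wt x) (aeval (single y 1) q) +
      single x 1 * conjBy (W.wt x') (aeval (single y 1) q) * single x⁻¹ 1 := by
  induction q using Polynomial.induction_on' with
  | add p q hp hq =>
    simp only [map_add, hp, hq, mul_add, add_mul]
    abel
  | monomial n c =>
    rw [aeval_monomial, ← Algebra.smul_def, map_smul, map_smul, map_smul, W.cocycle, smul_add,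
      mul_smul_comm, smul_mul_assoc]

theorem cocycle_aeval_sub_one (x x' : G) (q : ℚ[X]) :
    conjBy (W.wt (x * x')) (aeval (single y 1 - 1) q) = conjBy (W.wt x) (aeval (single y 1 - 1) q) +
      single x 1 * conjBy (W.wt x') (aeval (single y 1 - 1) q) * single x⁻¹ 1 := by
  have : aeval (single y 1 - 1 : MonoidAlgebra ℚ G) q = aeval (single y 1) (q.comp (X - 1)) := by
    rw [aeval_comp]
    simp
  rw [this]
  exact W.cocycle_aeval x x' _

/-- Written out on group elements, the Leibniz rule is the cocycle condition of the weights; the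
latter extends linearly from powers of `y` to polynomials in `y - 1`. -/
theorem der_mul (q : ℚ[X]) (a b : MonoidAlgebra ℚ G) :
    W.der (aeval (single y 1 - 1) q) (a * b) =
      a * W.der (aeval (single y 1 - 1) q) b + W.der (aeval (single y 1 - 1) q) a * b := by
  induction a using MonoidAlgebra.induction_linear with
  | zero => simp
  | add p p' hp hp' =>
    rw [add_mul, map_add, hp, hp', map_add]
    noncomm_ring
  | single x c =>
    induction b using MonoidAlgebra.induction_linear with
    | zero => simp
    | add p p' hp hp' =>
      rw [mul_add, map_add, hp, hp', map_add]
      noncomm_ring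
    | single x' c' =>
      have e1 : (single x c : MonoidAlgebra ℚ G) = c • single x 1 := by simp
      have e2 : (single x' c' : MonoidAlgebra ℚ G) = c' • single x' 1 := by simp
      have e3 : (single x⁻¹ 1 * (single x 1 * single x' 1) : MonoidAlgebra ℚ G) = single x' 1 := by
        rw [single_mul_single, single_mul_single]
        simp
      rw [single_mul_single, der_single, der_single, der_single, cocycle_aeval_sub_one, e1, e2,
        ← one_mul (1 : ℚ), ← single_mul_single, one_mul]
      simp only [smul_mul_assoc, mul_smul_comm, smul_smul, add_mul, smul_add, mul_assoc, e3]
      rw [mul_comm c c', add_comm]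

theorem der_mem_of_mem {N : ℕ} {b : MonoidAlgebra ℚ G} (hb : b ∈ augIdeal G ^ N)
    (a : MonoidAlgebra ℚ G) : W.der b a ∈ augIdeal G ^ N := by
  induction a using MonoidAlgebra.induction_linear with
  | zero => simp
  | add p p' hp hp' =>
    rw [map_add]
    exact add_mem hp hp'
  | single x c =>
    rw [der_single]
    refine Submodule.smul_of_tower_mem _ c (Ideal.mul_mem_right _ _ ?_)
    have := conjBy_mem (r := 0) (θ := W.wt x) (by simp [Submodule.pow_zero, Ideal.one_eq_top]) hb
    rwa [zero_add] at this

/-- Modulo `I²` the derivation sends `x` to `c aug(θ_x) (y - 1)` with `c` the linear coefficient of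
`q`: a transvection on `I / I²` in the direction of `y`. It kills `y - 1` because `aug(θ_y) = 0`, so
its square maps into `I²`. -/
theorem isUnipotentDer {q : ℚ[X]} (hq : q.coeff 0 = 0) :
    IsUnipotentDer (W.der (aeval (single y 1 - 1) q)) := by
  set w : MonoidAlgebra ℚ G := single y 1 - 1 with hw
  have hw1 : w ∈ augIdeal G ^ 1 := by
    rw [Submodule.pow_one]
    exact single_sub_one_mem y
  set b := aeval w q with hb
  set c := q.coeff 1
  have hb2 : b - c • w ∈ augIdeal G ^ 2 := by
    have e : b - c • w = w * w * aeval w q.divX.divX := by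
      rw [hb]
      nth_rewrite 1 [← divX_mul_X_add q]
      nth_rewrite 1 [← divX_mul_X_add q.divX]
      rw [hq, coeff_divX, zero_add]
      simp only [map_add, map_mul, aeval_X, aeval_C, map_zero, add_zero, add_mul,
        ← Algebra.smul_def]
      have hcomm : Commute w (aeval w q.divX.divX) := by
        have := (Polynomial.commute_X q.divX.divX).map (aeval w)
        rwa [aeval_X] at this
      rw [mul_assoc w w, hcomm.eq, ← mul_assoc, hcomm.eq]
      exact add_sub_cancel_right _ _
    rw [e]
    exact Ideal.mul_mem_right _ _ (mul_mem_augIdeal_pow hw1 hw1)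
  have hb1 : b ∈ augIdeal G ^ 1 := by
    have := add_mem (augIdeal_pow_le one_le_two hb2) (Submodule.smul_of_tower_mem _ c hw1)
    rwa [sub_add_cancel] at this
  have hmem : ∀ a, W.der b a ∈ augIdeal G := fun a => by
    have := W.der_mem_of_mem hb1 a
    rwa [Submodule.pow_one] at this
  have h2 : ∀ a ∈ augIdeal G ^ 2, W.der b a ∈ augIdeal G ^ 2 := by
    intro a ha
    refine augIdeal_pow_induction (n := 1) (p := fun a => W.der b a ∈ augIdeal G ^ 2) ha ?_ ?_ ?_
    · simp
    · intro a a' h h'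
      rw [map_add]
      exact add_mem h h'
    · intro a ha g
      rw [W.der_mul]
      refine add_mem (mul_mem_augIdeal_pow ha (n := 1) ?_)
        (mul_mem_augIdeal_pow (m := 1) (n := 1) ?_ ?_)
      · rw [Submodule.pow_one]
        exact hmem _
      · rw [Submodule.pow_one]
        exact hmem _
      · rw [Submodule.pow_one]
        exact single_sub_one_mem g
  have h3 : ∀ x, W.der b (single x 1) - (c * augmentation G (W.wt x)) • w ∈ augIdeal G ^ 2 := by
    intro x
    have e : W.der b (single x 1) - (c * augmentation G (W.wt x)) • w =
        conjBy (W.wt x) (b - c • w) * single x 1 +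
        c • (conjBy (W.wt x - augmentation G (W.wt x) • 1) w * single x 1) +
        (c * augmentation G (W.wt x)) • (w * (single x 1 - 1)) := by
      rw [der_single, one_smul, map_sub (conjBy (W.wt x)), map_smul (conjBy (W.wt x)), map_sub conjBy,
        map_smul conjBy, LinearMap.sub_apply,
        LinearMap.smul_apply, conjBy_one_left]
      simp only [sub_mul, mul_sub, smul_sub, smul_mul_assoc, smul_smul, mul_one]
      abel
    rw [e]
    refine add_mem (add_mem (Ideal.mul_mem_right _ _ ?_) (Submodule.smul_of_tower_mem _ c
      (Ideal.mul_mem_right _ _ ?_))) (Submodule.smul_of_tower_mem _ _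
        (mul_mem_augIdeal_pow hw1 (n := 1) ?_))
    · have := conjBy_mem (r := 0) (θ := W.wt x) (by simp [Submodule.pow_zero, Ideal.one_eq_top]) hb2
      rwa [zero_add] at this
    · refine conjBy_mem (r := 1) (s := 1) ?_ hw1
      rw [Submodule.pow_one, RingHom.mem_ker, map_sub, map_smul, map_one, smul_eq_mul, mul_one, sub_self]
    · rw [Submodule.pow_one]
      exact single_sub_one_mem x
  have hone : W.der b 1 = 0 := by
    have := W.der_mul q 1 1
    simpa using this
  have h4 : W.der b w ∈ augIdeal G ^ 2 := by
    have := h3 y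
    rw [W.aug_self, mul_zero, zero_smul, sub_zero] at this
    rwa [hw, map_sub, hone, sub_zero]
  refine ⟨W.der_mul q, hmem, fun a => ?_⟩
  induction a using MonoidAlgebra.induction_linear with
  | zero => simp
  | add p p' hp hp' =>
    rw [map_add, map_add]
    exact add_mem hp hp'
  | single x r =>
    have e1 : (single x r : MonoidAlgebra ℚ G) = r • single x 1 := by simp
    rw [e1, map_smul, map_smul]
    refine Submodule.smul_of_tower_mem _ r ?_
    have := add_mem (h2 _ (h3 x)) (Submodule.smul_of_tower_mem _ (c * augmentation G (W.wt x)) h4)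
    rwa [map_sub, map_smul, sub_add_cancel] at this

/-- The derivations for the truncated logarithms. -/
def system : DerSystem G where
  d N := W.der (logTrunc N (single y 1 - 1))
  der N := by
    rw [← aeval_logPoly]
    exact W.isUnipotentDer (logPoly_coeff_zero N)
  -- The logarithm of `y` only exists in the completion. Its truncations of orders `N` and `N'`
  -- differ by an element of `I^N`, which suffices for compatible derivations.
  compat {N N'} h a := by
    rw [← LinearMap.sub_apply, ← map_sub]
    refine W.der_mem_of_mem (logTrunc_sub_mem h (r := 1) ?_ (by omega)) a
    rw [Submodule.pow_one]
    exact single_sub_one_mem y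

theorem system_d (N : ℕ) : W.system.d N = W.der (logTrunc N (single y 1 - 1)) := rfl

end TwistWeights

/-- The differential equation `(1 + X) L' = log` for `X = x - 1`, which follows from `(1 + X) log' =
1`; it expresses `x L'(x) = log x`. -/
theorem coeff_halfLogSq (m : ℕ) : m * PowerSeries.coeff m halfLogSq +
    (m + 1) * PowerSeries.coeff (m + 1) halfLogSq = PowerSeries.coeff m logSeries := by
  have h1 : (1 + PowerSeries.X) * PowerSeries.derivative ℚ logSeries = 1 := by
    refine PowerSeries.ext fun n => ?_
    rw [add_mul, one_mul, map_add]
    rcases n with _ | n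
    · simp [PowerSeries.coeff_derivative, logSeries]
    · have hn : (n + 1 : ℚ) ≠ 0 := by positivity
      have hn' : (n + 1 + 1 : ℚ) ≠ 0 := by positivity
      rw [PowerSeries.coeff_succ_X_mul, PowerSeries.coeff_derivative, PowerSeries.coeff_derivative,
        PowerSeries.coeff_one, logSeries, PowerSeries.coeff_mk, PowerSeries.coeff_mk]
      simp only [Nat.succ_ne_zero, if_false, Nat.add_sub_cancel, pow_succ]
      push_cast
      field_simp
      ring
  have h2 : (1 + PowerSeries.X) * PowerSeries.derivative ℚ halfLogSq = logSeries := by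
    rw [halfLogSq, Derivation.map_smul, pow_two, Derivation.leibniz, smul_eq_mul, ← two_smul ℚ, smul_smul]
    norm_num
    linear_combination logSeries * h1
  have h3 := congrArg (PowerSeries.coeff m) h2
  rw [add_mul, one_mul, map_add, PowerSeries.coeff_derivative] at h3
  rcases m with _ | m
  · simpa [mul_comm] using h3
  · rw [PowerSeries.coeff_succ_X_mul, PowerSeries.coeff_derivative] at h3
    push_cast at h3 ⊢
    linarith

/-- The partial sums of `(1 + w) L'(w)` are those of the logarithm up to one boundary term, as `(1 +
w) w^(m-1)` contributes to two neighbouring powers. -/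
theorem sum_halfLogSq {A : Type*} [Ring A] [Algebra ℚ A] (w : A) (M : ℕ) :
    ∑ m ∈ Finset.range (M + 1), PowerSeries.coeff m halfLogSq • (m : ℚ) • ((1 + w) * w ^ (m - 1)) =
      logTrunc M w + (M * PowerSeries.coeff M halfLogSq) • w ^ M := by
  induction M with
  | zero => simp [logTrunc]
  | succ M ih =>
    rw [Finset.sum_range_succ, ih, logTrunc, logTrunc, Finset.sum_range_succ, ← coeff_halfLogSq M,
      Nat.add_sub_cancel, add_mul, one_mul, ← pow_succ', smul_add, smul_add, smul_smul, smul_smul,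
      add_smul, mul_comm (PowerSeries.coeff (M + 1) halfLogSq)]
    push_cast
    abel

/-- The Euler operator `z d/dz` applied to the expansion of `(z - 1)^m`. It accounts for the factor
`j` with which the power `γ^j` acts. -/
theorem sum_choose_pow {A : Type*} [Ring A] [Algebra ℚ A] (z : A) (m : ℕ) :
    ∑ j ∈ Finset.range (m + 1), ((-1 : ℚ) ^ (m - j) * (m.choose j : ℚ)) • (j : ℚ) • z ^ j =
      (m : ℚ) • (z * (z - 1) ^ (m - 1)) := by
  let L : ℚ[X] →ₗ[ℚ] A := (aeval z).toLinearMap.comp ((LinearMap.mulLeft ℚ X).comp derivative)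
  have hL : ∀ p, L p = z * aeval z (derivative p) := fun p => by
    change aeval z (X * derivative p) = _
    rw [map_mul, aeval_X]
  have h1 : (X - 1 : ℚ[X]) ^ m = ∑ j ∈ Finset.range (m + 1),
      ((-1 : ℚ) ^ (m - j) * (m.choose j : ℚ)) • X ^ j := by
    rw [sub_eq_add_neg, add_pow]
    refine Finset.sum_congr rfl fun j _ => ?_
    simp only [smul_eq_C_mul, map_mul, map_pow, map_neg, map_one, map_natCast]
    ring
  have h2 : L ((X - 1) ^ m) = (m : ℚ) • (z * (z - 1) ^ (m - 1)) := by
    rw [hL, derivative_pow, derivative_sub, derivative_X, derivative_one, sub_zero, mul_one]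
    simp only [map_mul, map_natCast, map_pow, map_sub, aeval_X, map_one]
    rw [Nat.cast_smul_eq_nsmul, nsmul_eq_mul, ← mul_assoc, ← mul_assoc, (Nat.cast_commute m z).eq]
  have h3 : ∀ j : ℕ, L (X ^ j) = (j : ℚ) • z ^ j := by
    intro j
    rw [hL, derivative_X_pow]
    rcases j with _ | j
    · simp
    · rw [map_mul, map_pow, aeval_X, aeval_C, ← Algebra.smul_def, mul_smul_comm, Nat.add_sub_cancel,
        ← pow_succ']
  rw [← h2, h1, map_sum]
  exact Finset.sum_congr rfl fun j _ => by rw [map_smul, h3]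

end Weights

/-! ### Compatibility with the coproduct -/

section Coproduct

open MonoidAlgebra

variable {G : Type*} [Group G]

/-- The map of group algebras induced by a homomorphism. -/
abbrev push {H : Type*} [Group H] (f : G →* H) : MonoidAlgebra ℚ G →ₐ[ℚ] MonoidAlgebra ℚ H :=
  mapDomainAlgHom ℚ ℚ f

theorem push_single {H : Type*} [Group H] (f : G →* H) (x : G) (c : ℚ) :
    push f (single x c) = single (f x) c := by
  simp

theorem push_mem {H : Type*} [Group H] (f : G →* H) {n : ℕ} {a : MonoidAlgebra ℚ G}
    (ha : a ∈ augIdeal G ^ n) : push f a ∈ augIdeal H ^ n := augIdeal_pow_le_comap f n ha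

/-- Only equivariance of `g` under conjugation through `f` is needed. Hence weights pushed along the
diagonal act on both tensor factors as the original weights do. -/
theorem conjBy_push {H : Type*} [Group H] {f g : G →* H}
    (h : ∀ u v, (f u)⁻¹ * g v * f u = g (u⁻¹ * v * u)) (θ b : MonoidAlgebra ℚ G) :
    conjBy (push f θ) (push g b) = push g (conjBy θ b) := by
  induction θ using MonoidAlgebra.induction_linear with
  | zero => simp only [map_zero, LinearMap.zero_apply]
  | add p q hp hq => simp only [map_add, LinearMap.add_apply, hp, hq]
  | single u c =>
    induction b using MonoidAlgebra.induction_linear with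
    | zero => simp only [map_zero]
    | add p q hp hq => simp only [map_add, hp, hq]
    | single v r =>
      rw [push_single, push_single, conjBy_single, conjBy_single, map_smul, single_mul_single,
        single_mul_single, single_mul_single, single_mul_single, push_single, h]

variable (G) in
/-- The first inclusion `a ↦ a ⊗ 1`. -/
abbrev inclL : MonoidAlgebra ℚ G →ₐ[ℚ] MonoidAlgebra ℚ (G × G) := push (MonoidHom.inl G G)

variable (G) in
/-- The second inclusion `a ↦ 1 ⊗ a`. -/
abbrev inclR : MonoidAlgebra ℚ G →ₐ[ℚ] MonoidAlgebra ℚ (G × G) := push (MonoidHom.inr G G)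

variable (G) in
/-- The coproduct of the group algebra. -/
abbrev diag : MonoidAlgebra ℚ G →ₐ[ℚ] MonoidAlgebra ℚ (G × G) :=
  push ((MonoidHom.id G).prod (MonoidHom.id G))

theorem inclR_mul_inclL (a b : MonoidAlgebra ℚ G) : inclR G b * inclL G a = inclL G a * inclR G b := by
  induction a using MonoidAlgebra.induction_linear with
  | zero => simp only [map_zero, zero_mul, mul_zero]
  | add p q hp hq => simp only [map_add, mul_add, add_mul, hp, hq]
  | single x c =>
    induction b using MonoidAlgebra.induction_linear with
    | zero => simp only [map_zero, zero_mul, mul_zero]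
    | add p q hp hq => simp only [map_add, mul_add, add_mul, hp, hq]
    | single v r =>
      rw [push_single, push_single, single_mul_single, single_mul_single, mul_comm c r]
      simp

theorem single_prod (x x' : G) : (single (x, x') 1 : MonoidAlgebra ℚ (G × G)) =
    inclL G (single x 1) * inclR G (single x' 1) := by
  rw [push_single, push_single, single_mul_single]
  simp

theorem prod_induction {p : MonoidAlgebra ℚ (G × G) → Prop} (a : MonoidAlgebra ℚ (G × G))
    (zero : p 0) (add : ∀ a b, p a → p b → p (a + b)) (smul : ∀ (c : ℚ) a, p a → p (c • a))
    (mul : ∀ x x', p (inclL G (single x 1) * inclR G (single x' 1))) : p a := by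
  induction a using MonoidAlgebra.induction_linear with
  | zero => exact zero
  | add a b ha hb => exact add a b ha hb
  | single z c =>
    have : (single z c : MonoidAlgebra ℚ (G × G)) = c • single (z.1, z.2) 1 := by simp
    rw [this, single_prod]
    exact smul _ _ (mul _ _)

/-- The endomorphism `d ⊗ 1 + 1 ⊗ d`. -/
def tens (d : MonoidAlgebra ℚ G →ₗ[ℚ] MonoidAlgebra ℚ G) :
    MonoidAlgebra ℚ (G × G) →ₗ[ℚ] MonoidAlgebra ℚ (G × G) :=
  (Finsupp.linearCombination ℚ fun z : G × G =>
    inclL G (d (single z.1 1)) * inclR G (single z.2 1) +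
      inclL G (single z.1 1) * inclR G (d (single z.2 1))).comp (coeffLinearEquiv ℚ).toLinearMap

theorem tens_mul (d : MonoidAlgebra ℚ G →ₗ[ℚ] MonoidAlgebra ℚ G) (a b : MonoidAlgebra ℚ G) :
    tens d (inclL G a * inclR G b) = inclL G (d a) * inclR G b + inclL G a * inclR G (d b) := by
  induction a using MonoidAlgebra.induction_linear with
  | zero => simp only [map_zero, zero_mul, add_zero]
  | add p q hp hq =>
    simp only [map_add, add_mul, hp, hq]
    abel
  | single x c =>
    induction b using MonoidAlgebra.induction_linear with
    | zero => simp only [map_zero, mul_zero, add_zero]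
    | add p q hp hq =>
      simp only [map_add, mul_add, hp, hq]
      abel
    | single x' r =>
      have e1 : (single x c : MonoidAlgebra ℚ G) = c • single x 1 := by simp
      have e2 : (single x' r : MonoidAlgebra ℚ G) = r • single x' 1 := by simp
      have e3 : coeffLinearEquiv ℚ (single (x, x') 1 : MonoidAlgebra ℚ (G × G)) =
        Finsupp.single (x, x') 1 := rfl
      have e4 : tens d (inclL G (single x 1) * inclR G (single x' 1)) =
          inclL G (d (single x 1)) * inclR G (single x' 1) +
            inclL G (single x 1) * inclR G (d (single x' 1)) := by
        rw [← single_prod, tens, LinearMap.comp_apply]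
        change Finsupp.linearCombination ℚ _ (coeffLinearEquiv ℚ _) = _
        rw [e3, Finsupp.linearCombination_single, one_smul]
      rw [e1, e2]
      simp only [map_smul, smul_mul_assoc, mul_smul_comm, e4, smul_add]

theorem tens_sub (d d' : MonoidAlgebra ℚ G →ₗ[ℚ] MonoidAlgebra ℚ G) (a : MonoidAlgebra ℚ (G × G)) :
    tens (d - d') a = tens d a - tens d' a := by
  refine prod_induction (p := fun a => tens (d - d') a = tens d a - tens d' a) a (by simp)
    (fun a b h h' => ?_) (fun c a h => ?_) fun x x' => ?_
  · simp only [map_add, h, h']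
    abel
  · simp only [map_smul, h, smul_sub]
  · simp only [tens_mul, LinearMap.sub_apply, map_sub, sub_mul, mul_sub]
    abel

theorem tens_mem {d : MonoidAlgebra ℚ G →ₗ[ℚ] MonoidAlgebra ℚ G} {N : ℕ}
    (hd : ∀ a, d a ∈ augIdeal G ^ N) (a : MonoidAlgebra ℚ (G × G)) :
    tens d a ∈ augIdeal (G × G) ^ N := by
  refine prod_induction (p := fun a => tens d a ∈ augIdeal (G × G) ^ N) a ?_ (fun a b h h' => ?_)
    (fun c a h => ?_) fun x x' => ?_
  · rw [map_zero]
    exact zero_mem _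
  · rw [map_add]
    exact add_mem h h'
  · rw [map_smul]
    exact Submodule.smul_of_tower_mem _ c h
  · rw [tens_mul]
    exact add_mem (Ideal.mul_mem_right _ _ (push_mem _ (hd _)))
      (Ideal.mul_mem_left _ _ (push_mem _ (hd _)))

theorem IsUnipotentDer.tens {d : MonoidAlgebra ℚ G →ₗ[ℚ] MonoidAlgebra ℚ G} (hd : IsUnipotentDer d) :
    IsUnipotentDer (GenDehn.tens d) where
  leib a b := by
    refine prod_induction (p := fun a => GenDehn.tens d (a * b) = a * GenDehn.tens d b +
      GenDehn.tens d a * b) a (by simp) (fun a a' h h' => ?_) (fun c a h => ?_) fun x x' => ?_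
    · simp only [map_add, add_mul, h, h']
      abel
    · simp only [map_smul, smul_mul_assoc, h, smul_add]
    refine prod_induction (p := fun b => GenDehn.tens d (_ * b) = _ * GenDehn.tens d b +
      GenDehn.tens d _ * b) b (by simp) (fun a a' h h' => ?_) (fun c a h => ?_) fun z z' => ?_
    · simp only [map_add, mul_add, h, h']
      abel
    · simp only [map_smul, mul_smul_comm, h, smul_add]
    · have key : ∀ p q p' q' : MonoidAlgebra ℚ G, inclL G p * inclR G q * (inclL G p' * inclR G q') =
          inclL G (p * p') * inclR G (q * q') := by
        intro p q p' q'
        rw [mul_assoc, ← mul_assoc (inclR G q), inclR_mul_inclL, map_mul, map_mul]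
        simp only [mul_assoc]
      rw [key, tens_mul, tens_mul, tens_mul, hd.leib, hd.leib, mul_add, add_mul, key, key, key, key,
        map_add, map_add, add_mul, mul_add]
      abel
  mem a := by
    have := tens_mem (d := d) (N := 1) (fun a => by rw [Submodule.pow_one]; exact hd.mem a) a
    rwa [Submodule.pow_one] at this
  sq_mem a := by
    refine prod_induction (p := fun a => GenDehn.tens d (GenDehn.tens d a) ∈ augIdeal (G × G) ^ 2) a
      ?_ (fun a b h h' => ?_) (fun c a h => ?_) fun x x' => ?_
    · rw [map_zero, map_zero]
      exact zero_mem _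
    · rw [map_add, map_add]
      exact add_mem h h'
    · rw [map_smul, map_smul]
      exact Submodule.smul_of_tower_mem _ c h
    · have h1 : ∀ a, d a ∈ augIdeal G ^ 1 := fun a => by rw [Submodule.pow_one]; exact hd.mem a
      rw [tens_mul, map_add, tens_mul, tens_mul]
      exact add_mem (add_mem (Ideal.mul_mem_right _ _ (push_mem _ (hd.sq_mem _)))
        (mul_mem_augIdeal_pow (m := 1) (n := 1) (push_mem _ (h1 _)) (push_mem _ (h1 _))))
        (add_mem (mul_mem_augIdeal_pow (m := 1) (n := 1) (push_mem _ (h1 _)) (push_mem _ (h1 _)))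
          (Ideal.mul_mem_left _ _ (push_mem _ (hd.sq_mem _))))

/-- The derivations `d ⊗ 1 + 1 ⊗ d`. -/
def DerSystem.tens (S : DerSystem G) : DerSystem (G × G) where
  d N := GenDehn.tens (S.d N)
  der N := (S.der N).tens
  compat h a := by
    rw [← tens_sub]
    exact tens_mem (S.compat h) a

theorem map_logTrunc {A B : Type*} [Ring A] [Algebra ℚ A] [Ring B] [Algebra ℚ B] (f : A →ₐ[ℚ] B)
    (N : ℕ) (w : A) : f (logTrunc N w) = logTrunc N (f w) := by
  simp [logTrunc]

/-- The logarithm of a group element is primitive. -/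
theorem diag_logTrunc (N : ℕ) (y : G) :
    diag G (logTrunc N (single y 1 - 1)) - (inclL G (logTrunc N (single y 1 - 1)) +
      inclR G (logTrunc N (single y 1 - 1))) ∈ augIdeal (G × G) ^ N := by
  let q := Ideal.Quotient.mkₐ ℚ (augIdeal (G × G) ^ N)
  have hnil : ∀ f : G →* G × G, (q (push f (single y 1 - 1))) ^ N = 0 := by
    intro f
    rw [← map_pow, ← map_pow]
    refine Ideal.Quotient.eq_zero_iff_mem.2 (push_mem f ?_)
    exact Ideal.pow_mem_pow (single_sub_one_mem y) N
  refine Ideal.Quotient.eq.1 ?_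
  change q _ = q _
  rw [map_add, map_logTrunc, map_logTrunc, map_logTrunc, map_logTrunc, map_logTrunc, map_logTrunc]
  -- The element `y ⊗ y` is the product of the commuting unipotent elements `y ⊗ 1` and `1 ⊗ y`.
  refine logTrunc_mul (hnil _) (hnil _) (hnil _) ?_ ?_
  · change q _ * q _ = q _ * q _
    rw [← map_mul, ← map_mul, inclR_mul_inclL]
  · have e : ∀ f : G →* G × G, (1 : QuotPow (G × G) N) + q (push f (single y 1 - 1)) =
        q (single (f y) 1) := by
      intro f
      rw [map_sub, map_one, push_single, map_sub, map_one, add_sub_cancel]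
    rw [e, e, e, ← map_mul, single_mul_single]
    simp

namespace TwistWeights

variable {y : G} (W : TwistWeights y)

/-- The failure of the derivation to commute with the coproduct is the failure of `b` to be
primitive, conjugated with the diagonal weights. For the truncated logarithm it is negligible by
`diag_logTrunc`. -/
theorem diag_der_single (b : MonoidAlgebra ℚ G) (x : G) :
    diag G (W.der b (single x 1)) - tens (W.der b) (diag G (single x 1)) =
      conjBy (diag G (W.wt x)) (diag G b - (inclL G b + inclR G b)) * diag G (single x 1) := by
  have hdiag : diag G (single x 1) = inclL G (single x 1) * inclR G (single x 1) := by
    rw [← single_prod, push_single]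
    rfl
  have h1 := conjBy_push (f := (MonoidHom.id G).prod (MonoidHom.id G))
    (g := (MonoidHom.id G).prod (MonoidHom.id G)) (fun u v => by simp) (W.wt x) b
  have h2 := conjBy_push (f := (MonoidHom.id G).prod (MonoidHom.id G)) (g := MonoidHom.inl G G)
    (fun u v => by simp) (W.wt x) b
  have h3 := conjBy_push (f := (MonoidHom.id G).prod (MonoidHom.id G)) (g := MonoidHom.inr G G)
    (fun u v => by simp) (W.wt x) b
  have h4 : diag G (W.der b (single x 1)) = conjBy (diag G (W.wt x)) (diag G b) *
      diag G (single x 1) := by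
    rw [der_single, one_smul, map_mul, h1]
  rw [h4, hdiag, tens_mul, map_sub, map_add, h2, h3, der_single, one_smul, map_mul, map_mul,
    sub_mul, add_mul, mul_assoc (inclL G (conjBy (W.wt x) b)), ← mul_assoc (inclR G (conjBy (W.wt x) b)),
    inclR_mul_inclL, mul_assoc (inclL G (single x 1))]

theorem diag_der (N : ℕ) (a : MonoidAlgebra ℚ G) :
    diag G (W.system.d N a) - W.system.tens.d N (diag G a) ∈ augIdeal (G × G) ^ N := by
  change diag G (W.der _ a) - tens (W.der _) (diag G a) ∈ _
  induction a using MonoidAlgebra.induction_linear with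
  | zero =>
    simp only [map_zero, sub_zero]
    exact zero_mem _
  | add p q hp hq =>
    simp only [map_add, add_sub_add_comm]
    exact add_mem hp hq
  | single x c =>
    have e0 : (single x c : MonoidAlgebra ℚ G) = c • single x 1 := by simp
    have key := diag_logTrunc N y
    generalize logTrunc N (single y 1 - 1 : MonoidAlgebra ℚ G) = b at key
    rw [e0, map_smul (W.der b), map_smul (diag G), map_smul (diag G), map_smul (tens _), ← smul_sub,
      diag_der_single]
    refine Submodule.smul_of_tower_mem _ c (Ideal.mul_mem_right _ _ ?_)
    have := conjBy_mem (r := 0) (θ := diag G (W.wt x)) (by simp [Submodule.pow_zero, Ideal.one_eq_top]) key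
    rwa [zero_add] at this

theorem incl_der (N : ℕ) (a : MonoidAlgebra ℚ G) :
    inclL G (W.system.d N a) = W.system.tens.d N (inclL G a) ∧
      inclR G (W.system.d N a) = W.system.tens.d N (inclR G a) := by
  have h0 : W.system.d N 1 = 0 := by
    have := (W.system.der N).leib 1 1
    simpa using this
  constructor
  · have := tens_mul (W.system.d N) a 1
    simp only [h0, map_one, map_zero, mul_zero, mul_one, add_zero] at this
    exact this.symm
  · have := tens_mul (W.system.d N) 1 a
    simp only [h0, map_one, map_zero, zero_mul, one_mul, zero_add] at this
    exact this.symm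

theorem comul_exp (u : CompletedAlgebra G) :
    comul (W.system.exp u) = W.system.tens.exp (comul u) :=
  W.system.completionMap_exp _ _ W.diag_der u

theorem tmul_exp (u v : CompletedAlgebra G) :
    tmul (W.system.exp u) (W.system.exp v) = W.system.tens.exp (tmul u v) := by
  rw [tmul, tmul, map_mul, W.system.completionMap_exp W.system.tens (MonoidHom.inl G G) fun N a => by
      rw [(W.incl_der N a).1, sub_self]; exact zero_mem _,
    W.system.completionMap_exp W.system.tens (MonoidHom.inr G G) fun N a => by
      rw [(W.incl_der N a).2, sub_self]; exact zero_mem _]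

/-- The exponential intertwines both `Δ(u)` and `u ⊗ u` with one automorphism of the completed
tensor square, hence preserves their equality. -/
theorem isGroupLike_exp {u : CompletedAlgebra G} : IsGroupLike (W.system.exp u) ↔ IsGroupLike u := by
  rw [IsGroupLike, IsGroupLike, comul_exp, tmul_exp, EmbeddingLike.apply_eq_iff_eq,
    EmbeddingLike.map_ne_zero_iff]

/-- The automorphism of the Malcev completion. -/
def malcevAut : MulAut (Malcev G) where
  toFun u := ⟨Units.mapEquiv W.system.exp.toMulEquiv u, W.isGroupLike_exp.2 u.2⟩
  invFun u := ⟨(Units.mapEquiv W.system.exp.toMulEquiv).symm u, by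
    refine W.isGroupLike_exp.1 ?_
    have : W.system.exp (W.system.exp.symm ((u : (CompletedAlgebra G)ˣ) : CompletedAlgebra G)) =
        ((u : (CompletedAlgebra G)ˣ) : CompletedAlgebra G) :=
      AlgEquiv.apply_symm_apply _ _
    change IsGroupLike (W.system.exp (W.system.exp.symm ((u : (CompletedAlgebra G)ˣ) : CompletedAlgebra G)))
    rw [this]
    exact u.2⟩
  left_inv u := Subtype.ext ((Units.mapEquiv W.system.exp.toMulEquiv).symm_apply_apply _)
  right_inv u := Subtype.ext ((Units.mapEquiv W.system.exp.toMulEquiv).apply_symm_apply _)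
  map_mul' u v := Subtype.ext (map_mul (Units.mapEquiv W.system.exp.toMulEquiv) _ _)

theorem malcevAut_coe (u : Malcev G) :
    (((W.malcevAut u : Malcev G) : (CompletedAlgebra G)ˣ) : CompletedAlgebra G) =
      W.system.exp ((u : (CompletedAlgebra G)ˣ) : CompletedAlgebra G) := rfl

theorem level_exp_eq_zero (m : ℕ) (v : CompletedAlgebra G) :
    level m (W.system.exp v) = 0 ↔ level m v = 0 := by
  rw [DerSystem.level_exp]
  refine ⟨fun h => ?_, fun h => by rw [h, map_zero]⟩
  have := IsNilpotent.exp_neg_mul_exp_self (W.system.bar_nilpotent m)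
  have h2 := LinearMap.congr_fun this (level m v)
  rw [Module.End.mul_apply, h, map_zero] at h2
  exact h2.symm

theorem malcevAut_mem (m : ℕ) (u : Malcev G) :
    W.malcevAut u ∈ malcevFiltration G m ↔ u ∈ malcevFiltration G m := by
  have e : W.system.exp ((u : (CompletedAlgebra G)ˣ) : CompletedAlgebra G) - 1 =
      W.system.exp (((u : (CompletedAlgebra G)ˣ) : CompletedAlgebra G) - 1) := by
    rw [map_sub W.system.exp, map_one]
  rw [mem_malcevFiltration, mem_malcevFiltration, malcevAut_coe, mem_filtration, mem_filtration, e,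
    level_exp_eq_zero]

/-- The automorphism of a nilpotent quotient of the Malcev completion. -/
def malcevQuotAut (m : ℕ) : MulAut (Malcev G ⧸ malcevFiltration G m) :=
  QuotientGroup.congr _ _ W.malcevAut (by
    ext u
    rw [Subgroup.mem_map]
    constructor
    · rintro ⟨v, hv, rfl⟩
      exact (W.malcevAut_mem m v).2 hv
    · intro hu
      refine ⟨W.malcevAut.symm u, (W.malcevAut_mem m _).1 ?_, ?_⟩
      · rw [MulEquiv.apply_symm_apply]
        exact hu
      · exact W.malcevAut.apply_symm_apply u)

theorem malcevQuotAut_mk (m : ℕ) (u : Malcev G) :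
    W.malcevQuotAut m (QuotientGroup.mk u) = QuotientGroup.mk (W.malcevAut u) := rfl

end TwistWeights

end Coproduct

/-! ### The series of the logarithm and the generalized Dehn twist -/

section Series

open MonoidAlgebra

variable {M : Type*} [TopologicalSpace M] [ChartedSpace (EuclideanHalfSpace 2) M] {x₀ : M}
  {γ : C(UnitAddCircle, M)} {y : LoopGroup x₀} (W : TwistWeights y)

theorem sigma_eq_der {j : ℕ} (h : ∀ x, loopAction (curvePow γ j) x =
    (j : ℚ) • (conjBy (W.wt x) (single y 1 ^ j) * single x 1)) :
    sigma x₀ (curvePow γ j) = W.der ((j : ℚ) • single y 1 ^ j) := by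
  refine LinearMap.ext fun a => ?_
  induction a using MonoidAlgebra.induction_linear with
  | zero => rw [map_zero, map_zero]
  | add p q hp hq => rw [map_add, map_add, hp, hq]
  | single x c =>
    have e : coeffLinearEquiv ℚ (single x c : MonoidAlgebra ℚ (LoopGroup x₀)) = Finsupp.single x c := rfl
    rw [W.der_single, sigma, LinearMap.comp_apply]
    change Finsupp.linearCombination ℚ _ (coeffLinearEquiv ℚ _) = _
    rw [e, Finsupp.linearCombination_single, h, map_smul, smul_mul_assoc]

variable (h : ∀ (j : ℕ) x, loopAction (curvePow γ j) x =
    (j : ℚ) • (conjBy (W.wt x) (single y 1 ^ j) * single x 1))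
include h

/-- Since `γ^j` acts through `j y^j`, a combination `f(γ)` acts through the Euler derivative of `f`
at `y`. -/
theorem sigmaSubOnePow_eq_der (m : ℕ) : sigmaSubOnePow x₀ γ m =
    W.der ((m : ℚ) • (single y 1 * (single y 1 - 1) ^ (m - 1))) := by
  rw [← sum_choose_pow, map_sum, sigmaSubOnePow]
  refine Finset.sum_congr rfl fun j _ => ?_
  rw [sigma_eq_der W (h j)]
  simp only [map_smul]

theorem isSigmaSeries : IsSigmaSeries x₀ halfLogSq γ W.system.D := by
  refine ⟨fun m => ⟨m, fun v => W.system.D_mem_filtration m⟩, fun a m => ⟨m + 1, fun N hN => ?_⟩⟩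
  -- The partial sum of length `K + 1` acts through the logarithm truncated at `K` plus a multiple
  -- of `(y - 1)^K`, which lies in `I^m` once `K ≥ m`.
  obtain ⟨K, rfl⟩ : ∃ K, N = K + 1 := ⟨N - 1, by omega⟩
  have hK : m ≤ K := by omega
  have e : ∑ i ∈ Finset.range (K + 1), PowerSeries.coeff i halfLogSq •
      toCompletion (sigmaSubOnePow x₀ γ i a) = toCompletion (W.der (logTrunc K (single y 1 - 1) +
        (K * PowerSeries.coeff K halfLogSq) • (single y 1 - 1) ^ K) a) := by
    rw [← sum_halfLogSq, map_sum, LinearMap.sum_apply, map_sum]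
    refine Finset.sum_congr rfl fun i _ => ?_
    rw [sigmaSubOnePow_eq_der W h, add_sub_cancel]
    simp only [map_smul, LinearMap.smul_apply]
  rw [sub_mem_filtration]
  beta_reduce
  rw [e, DerSystem.level_D, level_toCompletion, level_toCompletion,
    DerSystem.bar_mk, Ideal.Quotient.eq, TwistWeights.system_d, ← LinearMap.sub_apply, ← map_sub]
  refine W.der_mem_of_mem ?_ a
  have hw : (single y 1 - 1 : MonoidAlgebra ℚ (LoopGroup x₀)) ∈ augIdeal (LoopGroup x₀) ^ 1 := by
    rw [Submodule.pow_one]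
    exact single_sub_one_mem y
  rw [add_sub_right_comm]
  refine add_mem (logTrunc_sub_mem hK hw (by omega)) (Submodule.smul_of_tower_mem _ _ ?_)
  exact augIdeal_pow_le hK (Ideal.pow_mem_pow (single_sub_one_mem y) K)

/-- Uniqueness holds because limits are unique and a continuous endomorphism of the completion is
determined on the group algebra; existence is the system of derivations. -/
theorem isGeneralizedDehnTwist_iff
    {T : CompletedAlgebra (LoopGroup x₀) ≃ₐ[ℚ] CompletedAlgebra (LoopGroup x₀)} :
    IsGeneralizedDehnTwist x₀ γ T ↔ T = W.system.exp := by
  constructor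
  · rintro ⟨D, ⟨h1, h2⟩, h3⟩
    obtain ⟨h1', h2'⟩ := isSigmaSeries W h
    have hD : D = W.system.D := eq_of_continuous h1 h1' fun a => eq_of_convergesTo (h2 a) (h2' a)
    subst hD
    exact AlgEquiv.ext fun v => eq_of_convergesTo (h3 v) (W.system.convergesTo_exp v)
  · rintro rfl
    exact ⟨_, isSigmaSeries W h, W.system.convergesTo_exp⟩

end Series

/-! ### Automorphisms of nilpotent quotients -/

section LowerCentral

open scoped commutatorElement

variable {G : Type*} [Group G]

/-- The three subgroups lemma, applied in the quotient by the target term. -/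
theorem lowerCentralSeries_commutator_le (i j : ℕ) :
    ⁅(⊤ : Subgroup G).lowerCentralSeries i, (⊤ : Subgroup G).lowerCentralSeries j⁆ ≤
      (⊤ : Subgroup G).lowerCentralSeries (i + j + 1) := by
  induction j generalizing i with
  | zero => exact le_rfl
  | succ j ih =>
    set N := (⊤ : Subgroup G).lowerCentralSeries (i + (j + 1) + 1) with hN
    have key : ∀ H : Subgroup G, H.map (QuotientGroup.mk' N) = ⊥ ↔ H ≤ N := fun H => by
      rw [Subgroup.map_eq_bot_iff, QuotientGroup.ker_mk']
    rw [Subgroup.commutator_comm, Subgroup.lowerCentralSeries_succ, ← key, Subgroup.map_commutator,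
      Subgroup.map_commutator]
    refine Subgroup.commutator_commutator_eq_bot_of_rotate ?_ ?_
    · rw [← Subgroup.map_commutator, ← Subgroup.map_commutator, key, Subgroup.commutator_comm ⊤]
      refine (ih (i + 1)).trans_eq ?_
      rw [hN]
      congr 1
      ring
    · rw [← Subgroup.map_commutator, ← Subgroup.map_commutator, key]
      exact Subgroup.commutator_mono (ih i) le_rfl

theorem Gam_antitone {i j : ℕ} (h : i ≤ j) : Gam G j ≤ Gam G i :=
  Subgroup.lowerCentralSeries_antitone _ (Nat.sub_le_sub_right h 1)

theorem commutator_mem_Gam {i j m : ℕ} (hi : 1 ≤ i) (hj : 1 ≤ j) (hm : m ≤ i + j) {a b : G}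
    (ha : a ∈ Gam G i) (hb : b ∈ Gam G j) : ⁅a, b⁆ ∈ Gam G m := by
  refine Gam_antitone hm ?_
  have := lowerCentralSeries_commutator_le (G := G) (i - 1) (j - 1)
    (Subgroup.commutator_mem_commutator ha hb)
  rwa [show i - 1 + (j - 1) + 1 = i + j - 1 by omega] at this

theorem commute_mk_of_mem {i j m : ℕ} (hi : 1 ≤ i) (hj : 1 ≤ j) (hm : m ≤ i + j) {a b : G}
    (ha : a ∈ Gam G i) (hb : b ∈ Gam G j) :
    Commute (QuotientGroup.mk a : G ⧸ Gam G m) (QuotientGroup.mk b) := by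
  rw [← commutatorElement_eq_one_iff_commute]
  have h1 := (QuotientGroup.eq_one_iff (N := Gam G m) ⁅a, b⁆).2 (commutator_mem_Gam hi hj hm ha hb)
  rw [← h1]
  rfl

/-- An endomorphism which moves each term of a finite filtration into the next one is
bijective. -/
theorem bijective_of_filtration {Q : Type*} [Group Q] (f : Q →* Q) (F : ℕ → Subgroup Q) (n : ℕ)
    (h0 : F 0 = ⊤) (hn : F n = ⊥) (hF : ∀ i < n, ∀ g ∈ F i, f g * g⁻¹ ∈ F (i + 1)) :
    Function.Bijective f := by
  constructor
  · rw [injective_iff_map_eq_one]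
    intro g hg
    have h : ∀ i ≤ n, g ∈ F i := by
      intro i hi
      induction i with
      | zero =>
        rw [h0]
        exact Subgroup.mem_top g
      | succ i ih =>
        have := hF i (by omega) g (ih (by omega))
        rwa [hg, one_mul, inv_mem_iff] at this
    have := h n le_rfl
    rwa [hn, Subgroup.mem_bot] at this
  · have h : ∀ j ≤ n, ∀ g ∈ F (n - j), ∃ a, f a = g := by
      intro j hj
      induction j with
      | zero =>
        intro g hg
        rw [Nat.sub_zero, hn, Subgroup.mem_bot] at hg
        exact ⟨1, by rw [map_one, hg]⟩
      | succ j ih =>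
        intro g hg
        have h1 := hF (n - (j + 1)) (by omega) g hg
        rw [show n - (j + 1) + 1 = n - j by omega] at h1
        obtain ⟨a, ha⟩ := ih (by omega) _ h1
        exact ⟨a⁻¹ * g, by rw [map_mul, map_inv, ha]; group⟩
    intro g
    exact h n le_rfl g (by rw [Nat.sub_self, h0]; exact Subgroup.mem_top g)

variable (G) in
/-- The image of `Γ_k` in `G / Γ_{2k}`, which is commutative. -/
def layer (k : ℕ) : Subgroup (G ⧸ Gam G (2 * k)) := (Gam G k).map (QuotientGroup.mk' _)

theorem layer_commute {k : ℕ} (hk : 1 ≤ k) {a b : G ⧸ Gam G (2 * k)} (ha : a ∈ layer G k)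
    (hb : b ∈ layer G k) : a * b = b * a := by
  obtain ⟨a, ha, rfl⟩ := ha
  obtain ⟨b, hb, rfl⟩ := hb
  exact commute_mk_of_mem hk hk (by omega) ha hb

/-- The commutative group structure of the image of `Γ_k` in `G / Γ_{2k}`. -/
abbrev layerCommGroup {k : ℕ} (hk : 1 ≤ k) : CommGroup (layer G k) :=
  { (inferInstance : Group (layer G k)) with
    mul_comm := fun a b => Subtype.ext (layer_commute hk a.2 b.2) }

/-- The product `∏ gⁿ` in `G / Γ_{2k}` over the terms `n g` with `g ∈ Γ_k` of an integral combination
of group elements. -/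
theorem exists_eval {k : ℕ} (hk : 1 ≤ k) : ∃ v : MonoidAlgebra ℤ G → G ⧸ Gam G (2 * k),
    v 0 = 1 ∧ (∀ a b, v (a + b) = v a * v b) ∧ (∀ a, v a ∈ layer G k) ∧
    (∀ g ∈ Gam G k, ∀ n, v (MonoidAlgebra.single g n) = (QuotientGroup.mk g) ^ n) ∧
    ∀ g ∉ Gam G k, ∀ n, v (MonoidAlgebra.single g n) = 1 := by
  classical
  let _ := layerCommGroup (G := G) hk
  -- Elements outside `Γ_k` are sent to the neutral element, so that the evaluation is defined on
  -- all of `ℤ[G]` and can be applied to identities there.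
  let β : G → Additive (layer G k) := fun g =>
    if h : g ∈ Gam G k then Additive.ofMul ⟨QuotientGroup.mk g, ⟨g, h, rfl⟩⟩ else 0
  let V : (G →₀ ℤ) →+ Additive (layer G k) :=
    Finsupp.liftAddHom fun g => (zmultiplesHom (Additive (layer G k))) (β g)
  have hV : ∀ g n, V (Finsupp.single g n) = n • β g := by
    intro g n
    simp [V]
  refine ⟨fun a => ((V a.coeff).toMul : layer G k), ?_, fun a b => ?_, fun a => Subtype.property _,
    fun g hg n => ?_, fun g hg n => ?_⟩
  · change ((V 0).toMul : G ⧸ Gam G (2 * k)) = 1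
    rw [map_zero]
    rfl
  · change ((V (a.coeff + b.coeff)).toMul : G ⧸ Gam G (2 * k)) = _
    rw [map_add]
    rfl
  · change ((V (Finsupp.single g n)).toMul : G ⧸ Gam G (2 * k)) = _
    rw [hV]
    simp only [β, dif_pos hg]
    rfl
  · change ((V (Finsupp.single g n)).toMul : G ⧸ Gam G (2 * k)) = _
    rw [hV]
    simp only [β, dif_neg hg]
    rw [smul_zero]
    rfl

end LowerCentral

namespace TwistWeights

open MonoidAlgebra

variable {G : Type*} [Group G] {y : G} (W : TwistWeights y)

/-- The weights of `x` are represented by the conjugates of `y^{±1}` in the list `L`. -/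
structure Represented (x : G) (L : List (G × ℤ)) : Prop where
  sign : ∀ p ∈ L, p.2 = 1 ∨ p.2 = -1
  conj : ∀ p ∈ L, ∃ u, p.1 = u⁻¹ * y * u
  sum : conjBy (W.wt x) (single y 1) = (L.map fun p => single p.1 (p.2 : ℚ)).sum

variable {W}

theorem Represented.mem {x : G} {L : List (G × ℤ)} (h : W.Represented x L) {k : ℕ}
    (hy : y ∈ Gam G k) {p : G × ℤ} (hp : p ∈ L) : p.1 ∈ Gam G k := by
  obtain ⟨u, hu⟩ := h.conj p hp
  rw [hu]
  have := (inferInstance : (Gam G k).Normal).conj_mem y hy u⁻¹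
  rwa [inv_inv] at this

/-- The homomorphism `x ↦ (∏ gᵋ) x`. -/
theorem exists_hom (hW : ∀ x, ∃ L, W.Represented x L) {k : ℕ} (hk : 1 ≤ k) (hy : y ∈ Gam G k) :
    ∃ t : G →* G ⧸ Gam G (2 * k), ∀ x L, W.Represented x L →
      t x = QuotientGroup.mk ((L.map fun p => p.1 ^ p.2).prod * x) := by
  obtain ⟨v, v0, vadd, vmem, v1, v2⟩ := exists_eval (G := G) hk
  let ζ : MonoidAlgebra ℤ G →+* MonoidAlgebra ℚ G := mapRingHom G (Int.castRingHom ℚ)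
  have hζ : ∀ g n, ζ (single g n) = single g (n : ℚ) := fun g n => by simp [ζ]
  have hinj : Function.Injective ζ := by
    intro a b h
    refine MonoidAlgebra.ext (Finsupp.ext fun g => ?_)
    have := congrArg (fun c : MonoidAlgebra ℚ G => c.coeff g) h
    have h2 : ((a.coeff g : ℤ) : ℚ) = (b.coeff g : ℤ) := this
    exact_mod_cast h2
  let s : List (G × ℤ) → MonoidAlgebra ℤ G := fun L => (L.map fun p => single p.1 p.2).sum
  have hs : ∀ L, ζ (s L) = (L.map fun p => single p.1 (p.2 : ℚ)).sum := by
    intro L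
    simp only [s, map_list_sum, List.map_map]
    congr 1
    exact List.map_congr_left fun p _ => hζ _ _
  have hv : ∀ L : List (G × ℤ), (∀ p ∈ L, p.1 ∈ Gam G k) →
      v (s L) = QuotientGroup.mk (L.map fun p => p.1 ^ p.2).prod := by
    intro L hL
    induction L with
    | nil => exact v0
    | cons p L ih =>
      simp only [s, List.map_cons, List.sum_cons, List.prod_cons] at ih ⊢
      rw [vadd, v1 _ (hL p (by simp)), ih fun q hq => hL q (by simp [hq])]
      rfl
  choose L hL using hW
  -- The cocycle identity has integral terms, and `ℤ[G]` embeds into `ℚ[G]`. Evaluating it in the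
  -- commutative layer shows that the product over a list depends only on the sum in the group ring,
  -- and turns the additive cocycle into a multiplicative one.
  have hcoc : ∀ x x', s (L (x * x')) = s (L x) + single x 1 * s (L x') * single x⁻¹ 1 := by
    intro x x'
    refine hinj ?_
    have h1 := W.cocycle x x' 1
    simp only [pow_one] at h1
    rw [map_add, map_mul, map_mul, hs, hs, hs, ← (hL _).sum, ← (hL _).sum, ← (hL _).sum, h1, hζ, hζ,
      Int.cast_one]
  have hconj : ∀ (x : G) (a : MonoidAlgebra ℤ G), v (single x 1 * a * single x⁻¹ 1) =
      QuotientGroup.mk x * v a * (QuotientGroup.mk x)⁻¹ := by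
    intro x a
    induction a using MonoidAlgebra.induction_linear with
    | zero => rw [mul_zero, zero_mul, v0]; group
    | add a b ha hb =>
      rw [mul_add, add_mul, vadd, ha, hb, vadd]
      group
    | single g n =>
      rw [single_mul_single, single_mul_single, one_mul, mul_one]
      by_cases hg : g ∈ Gam G k
      · rw [v1 _ hg, v1 _ ((inferInstance : (Gam G k).Normal).conj_mem g hg x), ← conj_zpow]
        rfl
      · rw [v2 _ hg, v2]
        · group
        · intro h
          refine hg ?_
          have := (inferInstance : (Gam G k).Normal).conj_mem _ h x⁻¹
          have e : x⁻¹ * (x * g * x⁻¹) * x⁻¹⁻¹ = g := by group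
          rwa [e] at this
  refine ⟨MonoidHom.mk' (fun x => v (s (L x)) * QuotientGroup.mk x) fun x x' => ?_, fun x L' h' => ?_⟩
  · rw [hcoc, vadd, hconj, QuotientGroup.mk_mul]
    group
  · change v (s (L x)) * QuotientGroup.mk x = _
    have e : s (L x) = s L' := hinj (by rw [hs, hs, ← (hL x).sum, ← h'.sum])
    rw [e, hv L' fun p hp => h'.mem hy hp]
    rfl

end TwistWeights

/-! ### The action on the nilpotent quotients -/

namespace TwistWeights

open MonoidAlgebra
open scoped commutatorElement

variable {G : Type*} [Group G] {y : G} {W : TwistWeights y}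

/-! ### Bijectivity of the induced map on `G / Γ_{2k}`. -/

section Bijective

variable (hW : ∀ x, ∃ L, W.Represented x L) {k : ℕ} (hk : 1 ≤ k) (hy : y ∈ Gam G k)
  {t : G →* G ⧸ Gam G (2 * k)} (ht : ∀ x L, W.Represented x L →
    t x = QuotientGroup.mk ((L.map fun p => p.1 ^ p.2).prod * x))

theorem commutatorElement_mul_mul {P : Type*} [Group P] {u v a b : P} (hu : ∀ z, Commute u z)
    (hva : Commute v a) (hvb : Commute v ⁅a, b⁆) : ⁅u * a, v * b⁆ = ⁅a, b⁆ := by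
  have h1 : ⁅u * a, v * b⁆ = ⁅a, v * b⁆ := by
    rw [commutatorElement_def, commutatorElement_def, mul_inv_rev]
    have := (hu (a * (v * b) * a⁻¹)).eq
    calc u * a * (v * b) * (a⁻¹ * u⁻¹) * (v * b)⁻¹ =
        u * (a * (v * b) * a⁻¹) * u⁻¹ * (v * b)⁻¹ := by group
      _ = _ := by rw [this]; group
  rw [h1]
  calc ⁅a, v * b⁆ = a * v * b * a⁻¹ * b⁻¹ * v⁻¹ := by rw [commutatorElement_def]; group
    _ = v * ⁅a, b⁆ * v⁻¹ := by rw [← hva.eq, commutatorElement_def]; group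
    _ = ⁅a, b⁆ := by rw [hvb.eq]; group

set_option linter.unusedSectionVars false

include hW hk hy ht

theorem hom_mul_inv_mem_layer (x : G) : t x * (QuotientGroup.mk x)⁻¹ ∈ layer G k := by
  obtain ⟨L, hL⟩ := hW x
  refine ⟨(L.map fun p => p.1 ^ p.2).prod, ?_, ?_⟩
  · refine Subgroup.list_prod_mem _ fun z hz => ?_
    obtain ⟨p, hp, rfl⟩ := List.mem_map.1 hz
    exact Subgroup.zpow_mem _ (hL.mem hy hp) _
  · rw [ht x L hL, QuotientGroup.mk_mul, mul_inv_cancel_right]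
    rfl

/-- The map moves `Γ_{i+1}` by elements of `Γ_{k+i}`. Inductively, for a commutator of `a ∈ Γ_{i+1}`
and `b`, one has `t a = a' a` and `t b = b' b` with `a' ∈ Γ_{k+i+1}` and `b' ∈ Γ_k`, up to the shift
of `i` in the code. Modulo the next term `a'` is central and `b'` commutes with `a` and `[a, b]`, so
the commutator is unchanged. -/
theorem hom_mul_inv_mem (i : ℕ) {x : G} (hx : x ∈ Gam G (i + 1)) :
    t x * (QuotientGroup.mk x)⁻¹ ∈ (Gam G (k + i)).map (QuotientGroup.mk' (Gam G (2 * k))) := by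
  induction i generalizing x with
  | zero => exact hom_mul_inv_mem_layer hW hk hy ht x
  | succ i ih =>
    set N := (Gam G (k + (i + 1))).map (QuotientGroup.mk' (Gam G (2 * k))) with hN
    have : N.Normal := Subgroup.Normal.map inferInstance _ (QuotientGroup.mk'_surjective _)
    let r := QuotientGroup.mk' N
    have hr : ∀ z : G ⧸ Gam G (2 * k), r z = 1 ↔ z ∈ N := fun z => QuotientGroup.eq_one_iff z
    let f : G →* (G ⧸ Gam G (2 * k)) ⧸ N := r.comp t
    let g : G →* (G ⧸ Gam G (2 * k)) ⧸ N := r.comp (QuotientGroup.mk' _)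
    have hfg : ∀ z, f z = g z ↔ t z * (QuotientGroup.mk z)⁻¹ ∈ N := by
      intro z
      rw [← hr, map_mul, map_inv, mul_inv_eq_one]
      rfl
    have hcomm : ∀ {p q : ℕ}, 1 ≤ p → 1 ≤ q → k + (i + 1) ≤ p + q → ∀ a ∈ Gam G p, ∀ b ∈ Gam G q,
        Commute (g a) (g b) := by
      intro p q hp hq hpq a ha b hb
      rw [← commutatorElement_eq_one_iff_commute, ← map_commutatorElement]
      exact (hr _).2 ⟨_, commutator_mem_Gam hp hq hpq ha hb, rfl⟩
    refine (hfg x).1 ?_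
    have hle : Gam G (i + 1 + 1) ≤ f.eqLocus g := by
      change (⊤ : Subgroup G).lowerCentralSeries (i + 1) ≤ _
      rw [Subgroup.lowerCentralSeries_succ, Subgroup.commutator_le]
      intro a ha b _
      replace ha : a ∈ Gam G (i + 1) := ha
      change f ⁅a, b⁆ = g ⁅a, b⁆
      obtain ⟨a', ha', ea⟩ := ih ha
      obtain ⟨b', hb', eb⟩ := hom_mul_inv_mem_layer hW hk hy ht b
      have ea' : f a = g a' * g a := by
        change r (t a) = r (QuotientGroup.mk' _ a') * r _
        rw [ea, ← map_mul]
        exact congrArg r (inv_mul_cancel_right _ _).symm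
      have eb' : f b = g b' * g b := by
        change r (t b) = r (QuotientGroup.mk' _ b') * r _
        rw [eb, ← map_mul]
        exact congrArg r (inv_mul_cancel_right _ _).symm
      rw [map_commutatorElement, map_commutatorElement, ea', eb']
      refine commutatorElement_mul_mul (fun z => ?_) ?_ ?_
      · obtain ⟨z, rfl⟩ := QuotientGroup.mk_surjective z
        obtain ⟨z, rfl⟩ := QuotientGroup.mk_surjective z
        exact hcomm (by omega) le_rfl (by omega) a' ha' z (Subgroup.mem_top z)
      · exact hcomm hk (by omega) (by omega) b' hb' a ha
      · rw [← map_commutatorElement]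
        exact hcomm (q := i + 1) hk (by omega) (by omega) b' hb' _
          (commutator_mem_Gam (by omega) le_rfl (by omega) ha (Subgroup.mem_top (b : G)))
    exact hle hx

omit hW hk hy ht in
theorem map_Gam_eq_bot (m : ℕ) : (Gam G m).map (QuotientGroup.mk' (Gam G m)) = ⊥ := by
  rw [Subgroup.map_eq_bot_iff, QuotientGroup.ker_mk']

omit hW hk hy ht in
-- The target is nilpotent of the same class, so every homomorphism to it kills `Γ_m` and descends
-- to `G / Γ_m`.
theorem hom_eq_one (m : ℕ) (t : G →* G ⧸ Gam G m) {x : G} (hx : x ∈ Gam G m) : t x = 1 := by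
  have h1 : t x ∈ (⊤ : Subgroup (G ⧸ Gam G m)).lowerCentralSeries (m - 1) := by
    have : t x ∈ ((⊤ : Subgroup G).lowerCentralSeries (m - 1)).map t := Subgroup.mem_map_of_mem t hx
    rw [Subgroup.map_lowerCentralSeries] at this
    exact Subgroup.lowerCentralSeries_mono _ le_top this
  have h2 := map_Gam_eq_bot (G := G) m
  rw [show (Gam G m).map (QuotientGroup.mk' (Gam G m)) = _ from
    Subgroup.map_lowerCentralSeries _ _ _, ← MonoidHom.range_eq_map,
    MonoidHom.range_eq_top.2 (QuotientGroup.mk'_surjective _)] at h2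
  rwa [h2, Subgroup.mem_bot] at h1

/-- For `k ≥ 2` the lower central filtration is moved strictly deeper by `hom_mul_inv_mem`. For `k =
1` this fails, and the map is a transvection of the abelianization along `y`, which fixes `y` since
`aug(θ_y) = 0`; the filtration is then `⊤`, the subgroup generated by `y`, and `⊥`. -/
theorem lift_bijective : Function.Bijective
    (QuotientGroup.lift (Gam G (2 * k)) t fun _ h => hom_eq_one _ t h) := by
  set f := QuotientGroup.lift (Gam G (2 * k)) t fun _ h => hom_eq_one _ t h with hf
  rcases hk.eq_or_lt with rfl | hk2
  · have hcomm : ∀ a b : G ⧸ Gam G (2 * 1), a * b = b * a := by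
      intro a b
      obtain ⟨a, rfl⟩ := QuotientGroup.mk_surjective a
      obtain ⟨b, rfl⟩ := QuotientGroup.mk_surjective b
      exact commute_mk_of_mem le_rfl le_rfl le_rfl (Subgroup.mem_top a) (Subgroup.mem_top b)
    have hconj : ∀ u, (QuotientGroup.mk (u⁻¹ * y * u) : G ⧸ Gam G (2 * 1)) = QuotientGroup.mk y := by
      intro u
      rw [QuotientGroup.mk_mul, hcomm, ← QuotientGroup.mk_mul]
      exact congrArg QuotientGroup.mk (by group)
    have hprod : ∀ x L, W.Represented x L →
        (QuotientGroup.mk (L.map fun p => p.1 ^ p.2).prod : G ⧸ Gam G (2 * 1)) =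
          QuotientGroup.mk y ^ (L.map Prod.snd).sum := by
      intro x L hL
      have hc := hL.conj
      clear hL
      induction L with
      | nil => rw [List.map_nil, List.map_nil, List.sum_nil, zpow_zero]; rfl
      | cons p L ih =>
        obtain ⟨u, hu⟩ := hc p (by simp)
        rw [List.map_cons, List.prod_cons, List.map_cons, List.sum_cons, zpow_add, QuotientGroup.mk_mul,
          ih fun q hq => hc q (by simp [hq]), hu]
        exact congrArg (· * _) (congrArg (· ^ p.2) (hconj u))
    refine bijective_of_filtration f (fun i => if i = 0 then ⊤ else if i = 1 then
      Subgroup.zpowers (QuotientGroup.mk y) else ⊥) 2 (by simp) (by simp) fun i hi g hg => ?_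
    interval_cases i
    · obtain ⟨x, rfl⟩ := QuotientGroup.mk_surjective g
      obtain ⟨L, hL⟩ := hW x
      change t x * _ ∈ Subgroup.zpowers _
      rw [ht x L hL, QuotientGroup.mk_mul, mul_inv_cancel_right, hprod x L hL]
      exact Subgroup.zpow_mem _ (Subgroup.mem_zpowers _) _
    · change g ∈ Subgroup.zpowers _ at hg
      change _ ∈ (⊥ : Subgroup _)
      obtain ⟨n, rfl⟩ := Subgroup.mem_zpowers_iff.1 hg
      have hty : f (QuotientGroup.mk y) = QuotientGroup.mk y := by
        change t y = _
        obtain ⟨L, hL⟩ := hW y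
        have h0 : (L.map Prod.snd).sum = 0 := by
          have h1 := congrArg (augmentation G) hL.sum
          rw [augmentation_conjBy, W.aug_self, zero_mul, map_list_sum, List.map_map] at h1
          have h2 : (L.map ((augmentation G) ∘ fun p => single p.1 (p.2 : ℚ))) =
              (L.map Prod.snd).map (Int.castRingHom ℚ) := by
            rw [List.map_map]
            exact List.map_congr_left fun p _ => augmentation_single _ _
          rw [h2, ← map_list_sum] at h1
          have h3 : (((L.map Prod.snd).sum : ℤ) : ℚ) = 0 := h1.symm
          exact_mod_cast h3
        rw [ht y L hL, QuotientGroup.mk_mul, hprod y L hL, h0, zpow_zero, one_mul]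
      rw [Subgroup.mem_bot, map_zpow, hty, mul_inv_cancel]
  · refine bijective_of_filtration f (fun i => (Gam G (i + 1)).map (QuotientGroup.mk' _)) (2 * k - 1)
      ?_ ?_ fun i hi g hg => ?_
    · change (⊤ : Subgroup G).map _ = ⊤
      rw [← MonoidHom.range_eq_map, MonoidHom.range_eq_top.2 (QuotientGroup.mk'_surjective _)]
    · rw [show 2 * k - 1 + 1 = 2 * k by omega]
      exact map_Gam_eq_bot _
    · obtain ⟨x, hx, rfl⟩ := hg
      exact Subgroup.map_mono (Gam_antitone (by omega)) (hom_mul_inv_mem hW hk hy ht i hx)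

end Bijective

/-! ### The twist modulo `I^(2k)`. -/

section Estimate

theorem single_sub_one_mem_pow {m : ℕ} {g : G} (hg : g ∈ Gam G m) :
    (single g 1 - 1 : MonoidAlgebra ℚ G) ∈ augIdeal G ^ m := by
  have h := Gam_le m hg
  rwa [Subgroup.mem_comap, toMalcev_mem_malcevFiltration, MonoidAlgebra.of_apply] at h

/-- On `Γ_k` the map `g ↦ g - 1` is additive modulo `I^(2k)`, because the correction `(g - 1)(h -
1)` lies in `I^k I^k`. -/
theorem prod_sub_one_sub_sum_mem {k : ℕ} {L : List (G × ℤ)} (h : ∀ p ∈ L, p.2 = 1 ∨ p.2 = -1)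
    (hL : ∀ p ∈ L, p.1 ∈ Gam G k) :
    (single (L.map fun p => p.1 ^ p.2).prod 1 : MonoidAlgebra ℚ G) - 1 -
      (L.map fun p => (p.2 : ℚ) • (single p.1 1 - 1 : MonoidAlgebra ℚ G)).sum ∈ augIdeal G ^ (k + k) := by
  induction L with
  | nil =>
    have : (single 1 1 : MonoidAlgebra ℚ G) = 1 := rfl
    simp [this]
  | cons p L ih =>
    set z := (L.map fun p => p.1 ^ p.2).prod with hz
    set s := (L.map fun p => (p.2 : ℚ) • (single p.1 1 - 1 : MonoidAlgebra ℚ G)).sum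
    have hzm : z ∈ Gam G k := by
      refine Subgroup.list_prod_mem _ fun w hw => ?_
      obtain ⟨q, hq, rfl⟩ := List.mem_map.1 hw
      exact Subgroup.zpow_mem _ (hL q (by simp [hq])) _
    have hp := hL p (by simp)
    have h1 : (single (p.1 ^ p.2) 1 : MonoidAlgebra ℚ G) - 1 - (p.2 : ℚ) • (single p.1 1 - 1) ∈
        augIdeal G ^ (k + k) := by
      rcases h p (by simp) with e | e
      · simp [e]
      · have e2 : (single (p.1 ^ p.2) 1 : MonoidAlgebra ℚ G) - 1 - (p.2 : ℚ) • (single p.1 1 - 1) =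
            (single p.1 1 - 1) * -(single p.1⁻¹ 1 - 1) := by
          have e3 : (single p.1 1 * single p.1⁻¹ 1 : MonoidAlgebra ℚ G) = 1 := by
            rw [single_mul_single, mul_inv_cancel, one_mul]
            rfl
          rw [e, zpow_neg, zpow_one, Int.cast_neg, Int.cast_one, neg_smul, one_smul, mul_neg, sub_mul,
            mul_sub, e3]
          noncomm_ring
        rw [e2]
        exact mul_mem_augIdeal_pow (single_sub_one_mem_pow hp)
          (neg_mem (single_sub_one_mem_pow (inv_mem hp)))
    have h2 := ih (fun q hq => h q (by simp [hq])) fun q hq => hL q (by simp [hq])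
    have h3 : (single (p.1 ^ p.2) 1 - 1 : MonoidAlgebra ℚ G) * (single z 1 - 1) ∈ augIdeal G ^ (k + k) :=
      mul_mem_augIdeal_pow (single_sub_one_mem_pow (Subgroup.zpow_mem _ hp _))
        (single_sub_one_mem_pow hzm)
    have e : (single (p.1 ^ p.2 * z) 1 : MonoidAlgebra ℚ G) - 1 -
        ((p.2 : ℚ) • (single p.1 1 - 1) + s) =
        ((single (p.1 ^ p.2) 1 : MonoidAlgebra ℚ G) - 1 - (p.2 : ℚ) • (single p.1 1 - 1)) +
        (single z 1 - 1 - s) + (single (p.1 ^ p.2) 1 - 1) * (single z 1 - 1) := by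
      have : (single (p.1 ^ p.2 * z) 1 : MonoidAlgebra ℚ G) = single (p.1 ^ p.2) 1 * single z 1 := by
        rw [single_mul_single, one_mul]
      rw [this]
      noncomm_ring
    rw [List.map_cons, List.prod_cons, List.map_cons, List.sum_cons, e]
    exact add_mem (add_mem h1 h2) h3

variable {k : ℕ} (hk : 1 ≤ k) (hy : y ∈ Gam G k) (hθ : ∀ x, W.wt x ∈ augIdeal G ^ (k - 1))
include hk hy hθ

/-- The weights lie in `I^(k-1)` and `log y` in `I^k`, so the derivation maps into `I^(2k-1)`. For
`k ≥ 2` the Leibniz rule on `I^(2k-2) · I` then gives `I^(2k)`. For `k = 1` the estimate is too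
weak, and unipotence on `I / I²` is used instead. -/
theorem system_sq_mem (a : MonoidAlgebra ℚ G) :
    W.system.d (2 * k) (W.system.d (2 * k) a) ∈ augIdeal G ^ (2 * k) := by
  rcases hk.eq_or_lt with rfl | hk2
  · exact (W.system.der _).sq_mem a
  have hd := W.system.der (2 * k)
  have hb : logTrunc (2 * k) (single y 1 - 1 : MonoidAlgebra ℚ G) ∈ augIdeal G ^ k := by
    have := logTrunc_sub_mem (N := 1) (N' := 2 * k) (s := k) (by omega) (single_sub_one_mem_pow hy)
      (by omega)
    have h1 : logTrunc 1 (single y 1 - 1 : MonoidAlgebra ℚ G) = 0 := by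
      simp [logTrunc, logSeries]
    rwa [h1, sub_zero] at this
  have h1 : ∀ a, W.system.d (2 * k) a ∈ augIdeal G ^ (2 * k - 1) := by
    intro a
    rw [system_d]
    induction a using MonoidAlgebra.induction_linear with
    | zero => rw [map_zero]; exact zero_mem _
    | add p q hp hq => rw [map_add]; exact add_mem hp hq
    | single x c =>
      rw [der_single]
      refine Submodule.smul_of_tower_mem _ c (Ideal.mul_mem_right _ _ ?_)
      have := conjBy_mem (hθ x) hb
      rwa [show k - 1 + k = 2 * k - 1 by omega] at this
  have ha := h1 a
  rw [show 2 * k - 1 = 2 * k - 2 + 1 by omega] at ha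
  refine augIdeal_pow_induction (p := fun a => W.system.d (2 * k) a ∈ augIdeal G ^ (2 * k)) ha ?_ ?_ ?_
  · rw [map_zero]
    exact zero_mem _
  · intro a b h h'
    rw [map_add]
    exact add_mem h h'
  · intro a ha g
    rw [hd.leib]
    refine add_mem (augIdeal_pow_le ?_ (mul_mem_augIdeal_pow ha (h1 _)))
      (augIdeal_pow_le ?_ (mul_mem_augIdeal_pow (n := 1) (h1 a) ?_))
    · omega
    · omega
    · rw [Submodule.pow_one]
      exact single_sub_one_mem g

/-- Only `1 + D` survives modulo `I^(2k)`, and `log y` may be replaced by `y - 1`. The resulting sum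
`∑ ε (g - 1)` over the conjugates `g` of `y` agrees with the product minus one by
`prod_sub_one_sub_sum_mem`. -/
theorem level_exp_single {x : G} {L : List (G × ℤ)} (hL : W.Represented x L) :
    level (2 * k) (W.system.exp (toCompletion (single x 1))) =
      Ideal.Quotient.mk _ (single ((L.map fun p => p.1 ^ p.2).prod * x) 1) := by
  have hsq : W.system.bar (2 * k) ^ 2 = 0 := by
    refine LinearMap.ext fun v => ?_
    obtain ⟨a, rfl⟩ := Ideal.Quotient.mk_surjective v
    rw [DerSystem.bar_pow_mk, pow_two]
    exact Ideal.Quotient.eq_zero_iff_mem.2 (system_sq_mem hk hy hθ a)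
  rw [DerSystem.level_exp, IsNilpotent.exp_eq_sum hsq, level_toCompletion, Finset.sum_range_succ,
    Finset.sum_range_one, pow_zero, pow_one]
  simp only [Nat.factorial_zero, Nat.factorial_one, Nat.cast_one, inv_one, one_smul,
    LinearMap.add_apply, Module.End.one_apply]
  rw [DerSystem.bar_mk, ← map_add, Ideal.Quotient.eq, system_d, der_single, one_smul]
  set b := logTrunc (2 * k) (single y 1 - 1 : MonoidAlgebra ℚ G)
  have hb : b - (single y 1 - 1) ∈ augIdeal G ^ (2 * k) := by
    have := logTrunc_sub_mem (N := 2) (N' := 2 * k) (s := 2 * k) (by omega) (single_sub_one_mem_pow hy)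
      (by omega)
    have h1 : logTrunc 2 (single y 1 - 1 : MonoidAlgebra ℚ G) = single y 1 - 1 := by
      simp [logTrunc, logSeries, Finset.sum_range_succ]
    rwa [h1] at this
  have h1 : conjBy (W.wt x) (b - (single y 1 - 1)) ∈ augIdeal G ^ (2 * k) := by
    have := conjBy_mem (r := 0) (θ := W.wt x) (by simp [Submodule.pow_zero, Ideal.one_eq_top]) hb
    rwa [zero_add] at this
  have h2 := prod_sub_one_sub_sum_mem hL.sign fun p hp => hL.mem hy hp
  rw [← two_mul] at h2
  set z := (L.map fun p => p.1 ^ p.2).prod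
  have h3 : (L.map fun p => (p.2 : ℚ) • (single p.1 1 - 1 : MonoidAlgebra ℚ G)).sum =
      conjBy (W.wt x) (single y 1 - 1) := by
    rw [map_sub, conjBy_one_right]
    have e1 : augmentation G (W.wt x) = augmentation G (conjBy (W.wt x) (single y 1)) := by
      rw [augmentation_conjBy, augmentation_single, mul_one]
    rw [e1, hL.sum]
    clear_value z
    clear h2 hL
    induction L with
    | nil => simp
    | cons p L ih =>
      rw [List.map_cons, List.sum_cons, List.map_cons, List.sum_cons, ih, map_add, add_smul,
        augmentation_single, smul_sub, smul_single, smul_eq_mul, mul_one]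
      abel
  have e : single x 1 + conjBy (W.wt x) b * single x 1 - single (z * x) 1 =
      (conjBy (W.wt x) (b - (single y 1 - 1)) -
        (single z 1 - 1 - conjBy (W.wt x) (single y 1 - 1))) * single x 1 := by
    have : (single (z * x) 1 : MonoidAlgebra ℚ G) = single z 1 * single x 1 := by
      rw [single_mul_single, one_mul]
    rw [this, map_sub (conjBy (W.wt x)) b]
    noncomm_ring
  rw [e]
  rw [h3] at h2
  exact Ideal.mul_mem_right _ _ (sub_mem h1 h2)

variable (hW : ∀ x, ∃ L, W.Represented x L)
include hW

/-- The generalized Dehn twist acts on `G / Γ_{2k}`. -/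
theorem exists_mulAut : ∃ τ : MulAut (G ⧸ Gam G (2 * k)),
    ActsOnNilpotentQuotient W.system.exp (2 * k) τ ∧ ∀ x L, W.Represented x L →
      τ (QuotientGroup.mk x) = QuotientGroup.mk ((L.map fun p => p.1 ^ p.2).prod * x) := by
  obtain ⟨t, ht⟩ := exists_hom hW hk hy
  refine ⟨MulEquiv.ofBijective _ (lift_bijective hW hk hy ht), ⟨W.malcevAut, W.malcevAut_coe,
    W.malcevQuotAut (2 * k), W.malcevQuotAut_mk (2 * k), fun x => ?_⟩, ht⟩
  obtain ⟨x, rfl⟩ := QuotientGroup.mk_surjective x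
  obtain ⟨L, hL⟩ := hW x
  change nilpotentToMalcev G (2 * k) (t x) = QuotientGroup.mk (W.malcevAut (toMalcev G x))
  rw [ht x L hL]
  change QuotientGroup.mk (toMalcev G _) = _
  -- Elements of the Malcev completion have the same class exactly when they agree in `ℚ[G] /
  -- I^(2k)`.
  rw [QuotientGroup.eq, malcevFiltration, MonoidHom.mem_ker, map_mul, map_inv, inv_mul_eq_one]
  refine Units.ext ?_
  exact (level_exp_single hk hy hθ hL).symm

end Estimate

end TwistWeights

/-! ### Fox derivations -/

section Fox

open MonoidAlgebra

open scoped commutatorElement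

variable {G : Type*} [Group G] {Θ : G → MonoidAlgebra ℚ G}
  (hΘ : ∀ y y', Θ (y * y') = Θ y + single y 1 * Θ y')

include hΘ

theorem fox_one : Θ 1 = 0 := by
  have h := hΘ 1 1
  rw [mul_one, ← one_def, one_mul] at h
  exact left_eq_add.1 h

theorem fox_inv (y : G) : Θ y⁻¹ = -(single y⁻¹ 1 * Θ y) := by
  have h := hΘ y⁻¹ y
  rw [inv_mul_cancel, fox_one hΘ] at h
  exact eq_neg_of_add_eq_zero_left h.symm

/-- Apply the Fox rule to both sides of `[a, b] b a = a b` and solve for the commutator. -/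
theorem fox_commutator (a b : G) : Θ ⁅a, b⁆ =
    (1 - single (⁅a, b⁆ * b) 1) * Θ a + ((single a 1 - 1) - (single ⁅a, b⁆ 1 - 1)) * Θ b := by
  have h1 : Θ (⁅a, b⁆ * b * a) = Θ (a * b) := by
    congr 1
    rw [commutatorElement_def]
    group
  rw [hΘ, hΘ, hΘ] at h1
  rw [← eq_sub_iff_add_eq, ← eq_sub_iff_add_eq] at h1
  rw [h1]
  noncomm_ring

/-- The values of a Fox derivation on the lower central series. -/
theorem fox_mem {k : ℕ} {y : G} (hy : y ∈ Gam G k) : Θ y ∈ augIdeal G ^ (k - 1) := by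
  let F : ℕ → Subgroup G := fun n =>
    { carrier := {g | Θ g ∈ augIdeal G ^ n}
      mul_mem' := fun {a b} ha hb => by
        change Θ (a * b) ∈ augIdeal G ^ n
        rw [hΘ]
        exact add_mem ha (Ideal.mul_mem_left _ _ hb)
      one_mem' := by
        change Θ 1 ∈ augIdeal G ^ n
        rw [fox_one hΘ]
        exact zero_mem _
      inv_mem' := fun {a} ha => by
        change Θ a⁻¹ ∈ augIdeal G ^ n
        rw [fox_inv hΘ]
        exact neg_mem (Ideal.mul_mem_left _ _ ha) }
  suffices h : ∀ n, (⊤ : Subgroup G).lowerCentralSeries n ≤ F n from h _ hy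
  intro n
  induction n with
  | zero =>
    intro g _
    change Θ g ∈ augIdeal G ^ 0
    rw [Submodule.pow_zero, Ideal.one_eq_top]
    exact Submodule.mem_top
  | succ n ih =>
    rw [Subgroup.lowerCentralSeries_succ, Subgroup.commutator_le]
    intro a ha b _
    have hc : ⁅a, b⁆ ∈ Gam G (n + 1) :=
      Gam_antitone (Nat.le_succ _) (commutator_mem_Gam (i := n + 1) (j := 1) (by omega) le_rfl le_rfl
        ha trivial)
    change Θ _ ∈ augIdeal G ^ (n + 1)
    rw [fox_commutator hΘ]
    -- The coefficient of `Θ a` lies in `I` and `Θ a ∈ I^n` by induction; the coefficient of `Θ b`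
    -- lies in `I^(n+1)`, as `a` and `[a, b]` belong to `Γ_{n+1}`.
    refine add_mem ?_ (Ideal.mul_mem_right _ _ (sub_mem (TwistWeights.single_sub_one_mem_pow ha)
      (TwistWeights.single_sub_one_mem_pow hc)))
    rw [Ideal.IsTwoSided.pow_succ, ← neg_sub]
    exact Ideal.mul_mem_mul (neg_mem (single_sub_one_mem _)) (ih ha)

/-- By the Fox rule `Θ(y^i)` is the sum of `y^l Θ(y)` over `l < i`, and conjugation by powers of `y`
does not move `b`. -/
theorem conjBy_fox_pow (y : G) (i : ℕ) {b : MonoidAlgebra ℚ G} (hb : Commute (single y 1) b) :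
    conjBy (Θ (y ^ i)) b = (i : ℚ) • conjBy (Θ y) b := by
  induction i with
  | zero => simp [fox_one hΘ]
  | succ i ih =>
    have e : single y⁻¹ 1 * b * single y 1 = b := by
      rw [mul_assoc, ← hb.eq, ← mul_assoc, single_mul_single, inv_mul_cancel, one_mul, ← one_def,
        one_mul]
    rw [pow_succ', hΘ, map_add, LinearMap.add_apply, conjBy_single_mul, e, ih, Nat.cast_succ,
      add_smul, one_smul, add_comm]

omit hΘ

/-- The weights are the values at `y` of the Fox derivations attached to `x`. The bracket sees them
only multiplied by `j`, so `j > 0` is divided out, whereas the cocycle identity for `j = 0` is the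
augmentation of the one for `y`. -/
theorem exists_twistWeights {br : G → G → MonoidAlgebra ℚ G}
    (hmul : ∀ x x' y, br (x * x') y = br x y + single x 1 * br x' y * single x⁻¹ 1)
    (hfox : ∀ x, ∃ Θ : G → MonoidAlgebra ℚ G,
      (∀ y y', Θ (y * y') = Θ y + single y 1 * Θ y') ∧
      ∀ y, br x y = mapDomain (fun u => u⁻¹ * y * u) (Θ y))
    (haug : ∀ y, augmentation G (br y y) = 0) (y : G) :
    ∃ W : TwistWeights y,
      (∀ (j : ℕ) x, br x (y ^ j) = (j : ℚ) • conjBy (W.wt x) (single y 1 ^ j)) ∧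
      ∀ k, y ∈ Gam G k → ∀ x, W.wt x ∈ augIdeal G ^ (k - 1) := by
  choose Θ h1 h2 using hfox
  have key : ∀ (j : ℕ) x, br x (y ^ j) = (j : ℚ) • conjBy (Θ x y) (single y 1 ^ j) := fun j x => by
    rw [h2, ← conjBy_single_right, ← conjBy_fox_pow (h1 x) y j ((Commute.refl _).pow_right j),
      single_pow, one_pow]
  have key1 : ∀ x, br x y = conjBy (Θ x y) (single y 1) := fun x => by
    simpa using key 1 x
  have aug : ∀ x, augmentation G (br x y) = augmentation G (Θ x y) := fun x => by
    rw [key1, augmentation_conjBy, augmentation_single, mul_one]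
  refine ⟨⟨fun x => Θ x y, fun x x' j => ?_, ?_⟩, key, fun k hy x => fox_mem (h1 x) hy⟩
  · rcases Nat.eq_zero_or_pos j with rfl | hj
    · have h := congrArg (augmentation G) (hmul x x' y)
      rw [map_add, map_mul, map_mul, augmentation_single, augmentation_single, one_mul, mul_one,
        aug, aug, aug] at h
      rw [pow_zero, conjBy_one_right, conjBy_one_right, conjBy_one_right, h, add_smul, mul_smul_comm,
        smul_mul_assoc, mul_one, single_mul_single, mul_inv_cancel, mul_one, ← one_def]
    · have hj' : (j : ℚ) ≠ 0 := by exact_mod_cast hj.ne'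
      have h := hmul x x' (y ^ j)
      rw [key, key, key, mul_smul_comm, smul_mul_assoc, ← smul_add] at h
      exact smul_right_injective _ hj' h
  · rw [← aug, haug]

end Fox

/-! ### Classes of powers and of based versions of a closed curve. -/

section Twist

open MonoidAlgebra

variable {M : Type*} [TopologicalSpace M] [PathConnectedSpace M] {x₀ : M}

theorem hol_curvePow (γ : C(UnitAddCircle, M)) (j : ℕ) :
    hol x₀ (per (curvePow γ j)) 0 1 = hol x₀ (per γ) 0 1 ^ j := by
  have h : per (curvePow γ j) = (per γ).comp ⟨fun t => j * t, by fun_prop⟩ := by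
    ext t
    change γ (j • (t : UnitAddCircle)) = γ ((j * t : ℝ) : UnitAddCircle)
    rw [← nsmul_eq_mul, AddCircle.coe_nsmul]
  rw [h, hol_comp]
  simpa using hol_per_add_nat x₀ γ 0 j

theorem hol_per_shift (γ : C(UnitAddCircle, M)) (t : ℝ) : hol x₀ (per γ) t (t + 1) =
    (hol x₀ (per γ) 0 t)⁻¹ * hol x₀ (per γ) 0 1 * hol x₀ (per γ) 0 t := by
  have e : hol x₀ (per γ) 1 (t + 1) = hol x₀ (per γ) 0 t := by
    simpa using hol_per_add_int x₀ γ 0 t 1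
  nth_rewrite 2 [← e]
  rw [mul_assoc, hol_trans, eq_inv_mul_iff_mul_eq, hol_trans]

theorem hol_basedAt (γ : C(UnitAddCircle, M)) (c : Path x₀ (γ 0)) :
    hol x₀ (per γ) 0 1 = (el x₀ (Path.Homotopic.Quotient.mk c))⁻¹ *
      loopClass (Path.Homotopic.Quotient.mk ((c.trans (basedAt γ 0)).trans c.symm)) *
      el x₀ (Path.Homotopic.Quotient.mk c) := by
  have h : hol x₀ (per γ) 0 1 = el x₀ (Path.Homotopic.Quotient.mk (basedAt γ 0)) := by
    refine el_eq_of_forall x₀ _ _ fun u => ?_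
    change γ ((0 + u * (1 - 0) : ℝ) : UnitAddCircle) = γ (0 + ((u : ℝ) : UnitAddCircle))
    simp
  rw [h, ← el_loop, Path.Homotopic.Quotient.mk_trans, Path.Homotopic.Quotient.mk_trans,
    Path.Homotopic.Quotient.mk_symm, el_trans, el_trans, el_symm]
  group

/-- Moving the starting point of the closed curve and joining it to the basepoint along `ℓ` both act
by conjugation. -/
theorem Crossing.lasso_conj {ℓ : Path x₀ x₀} {γ : C(UnitAddCircle, M)} (c : Crossing ℓ γ)
    {y : LoopGroup x₀} (hy : ∃ g, hol x₀ (per γ) 0 1 = g⁻¹ * y * g) :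
    ∃ u, c.lasso = u⁻¹ * y * u := by
  obtain ⟨g, hg⟩ := hy
  obtain ⟨t, ht⟩ := QuotientAddGroup.mk_surjective c.param
  refine ⟨g * hol x₀ (per γ) 0 t * (hol x₀ (ext ℓ) 0 c.time)⁻¹, ?_⟩
  rw [Crossing.lasso, c.el_loop_eq_hol ht, hol_per_shift, hg]
  group

end Twist

/-! ### Conclusion for metric surfaces. -/

section Main

open MonoidAlgebra

variable {M : Type*} [MetricSpace M] [CompactSpace M] [ChartedSpace (EuclideanHalfSpace 2) M]
  [PathConnectedSpace M] [IsManifold (𝓡∂ 2) ∞ M] {x₀ : M} {S : Scale x₀} {ℓ : Path x₀ x₀}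
  {γ : C(UnitAddCircle, M)} {y : LoopGroup x₀} {W : TwistWeights y}

/-- The weights only enter through `b(x, y)`, which a loop in general position expresses as the
signed sum of its lassos; the right factor `x` is a unit and cancels. -/
theorem represented_crossings (hor : OrientedAtlas M) (hx₀ : x₀ ∈ (𝓡∂ 2).boundary M)
    (hW : ∀ x, S.brk x y = conjBy (W.wt x) (single y 1)) (gp : GeneralPosition ℓ γ)
    (hy : ∃ g, hol x₀ (per γ) 0 1 = g⁻¹ * y * g) {cs : List (Crossing ℓ γ)} (h1 : cs.Nodup)
    (h2 : ∀ c, c ∈ cs) :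
    W.Represented (loopClass (Path.Homotopic.Quotient.mk ℓ))
      (cs.map fun c => (c.lasso, (c.sign : ℤ))) := by
  classical
  have h := Scale.intersectionSum_eq_brk hor hx₀ S gp hy
  refine ⟨fun p hp => ?_, fun p hp => ?_, ?_⟩
  · obtain ⟨c, -, rfl⟩ := List.mem_map.1 hp
    have hc := (gp.2.2 c).2.2
    rcases lt_or_gt_of_ne hc with h | h
    · exact Or.inr (by simp [Crossing.sign, sign_neg h])
    · exact Or.inl (by simp [Crossing.sign, sign_pos h])
  · obtain ⟨c, -, rfl⟩ := List.mem_map.1 hp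
    exact c.lasso_conj hy
  · have e : intersectionSum ℓ γ = (cs.map fun c => single c.lasso ((c.sign : ℤ) : ℚ)).sum *
        single (loopClass (Path.Homotopic.Quotient.mk ℓ)) 1 := by
      rw [intersectionSum, finsum_eq_sum_of_support_subset (s := cs.toFinset) _
        (fun c _ => by simpa using h2 c), List.sum_toFinset _ h1, ← List.sum_map_mul_right]
      simp only [Crossing.insertOnce_eq, single_mul_single, mul_one]
    have hu : IsUnit (single (loopClass (Path.Homotopic.Quotient.mk ℓ)) 1 :
        MonoidAlgebra ℚ (LoopGroup x₀)) :=
      (Group.isUnit (loopClass (Path.Homotopic.Quotient.mk ℓ))).map (of ℚ (LoopGroup x₀))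
    rw [List.map_map, ← hW]
    exact hu.mul_right_cancel (h.symm.trans e)

omit [CompactSpace M] [IsManifold (𝓡∂ 2) ∞ M] in
theorem insertAll_eq_prod (gp : GeneralPosition ℓ γ) (cs : List (Crossing ℓ γ)) :
    insertAll cs = ((cs.map fun c => (c.lasso, (c.sign : ℤ))).map fun p => p.1 ^ p.2).prod *
      loopClass (Path.Homotopic.Quotient.mk ℓ) := by
  rw [Crossing.insertAll_eq, List.map_map]
  congr 3
  funext c
  have hc := (gp.2.2 c).2.2
  rcases lt_or_gt_of_ne hc with h | h
  · simp [Crossing.signedLasso, Crossing.sign, sign_neg h]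
  · simp [Crossing.signedLasso, Crossing.sign, sign_pos h]

/-- The three properties of the bracket feed the algebra through `exists_twistWeights`. Loops in
general position serve twice: they represent every class, as the construction of the automorphism
requires, and any given one supplies the formula, its ordered crossings being an admissible list. -/
theorem twist_of_metric (hor : OrientedAtlas M) (hx₀ : x₀ ∈ (𝓡∂ 2).boundary M) {k : ℕ}
    (hk : 1 ≤ k) (hγ : ∀ s, γ s ∈ (𝓡∂ 2).interior M) (hγk : NilpotencyClassGE x₀ γ k) :
    (∃! T : CompletedAlgebra (LoopGroup x₀) ≃ₐ[ℚ] CompletedAlgebra (LoopGroup x₀),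
      IsGeneralizedDehnTwist x₀ γ T) ∧
    ∀ T : CompletedAlgebra (LoopGroup x₀) ≃ₐ[ℚ] CompletedAlgebra (LoopGroup x₀),
      IsGeneralizedDehnTwist x₀ γ T →
      ∃ τ : MulAut (LoopGroup x₀ ⧸ Gam (LoopGroup x₀) (2 * k)),
        ActsOnNilpotentQuotient T (2 * k) τ ∧
        ∀ (ℓ : Path x₀ x₀) (n : ℕ) (p : Fin n → Crossing ℓ γ), GeneralPosition ℓ γ →
          StrictMono (fun i => (p i).time) → Function.Surjective p →
          τ (QuotientGroup.mk (loopClass (Path.Homotopic.Quotient.mk ℓ))) =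
            QuotientGroup.mk (insertAll (List.ofFn p)) := by
  obtain ⟨S⟩ := exists_scale hor x₀
  obtain ⟨c, hc⟩ := hγk
  obtain ⟨y, hy⟩ : ∃ y, y = loopClass
    (Path.Homotopic.Quotient.mk ((c.trans (basedAt γ 0)).trans c.symm)) := ⟨_, rfl⟩
  rw [← hy] at hc
  have hconj : ∃ g, hol x₀ (per γ) 0 1 = g⁻¹ * y * g := ⟨_, hy ▸ hol_basedAt γ c⟩
  obtain ⟨W, hW, hθ⟩ := exists_twistWeights (S.brk_mul hx₀) (Scale.exists_fox hx₀ S)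
    (S.augmentation_brk_self hx₀) y
  have hW1 : ∀ x, S.brk x y = conjBy (W.wt x) (single y 1) := fun x => by simpa using hW 1 x
  have hact : ∀ (j : ℕ) x, loopAction (curvePow γ j) x =
      (j : ℚ) • (conjBy (W.wt x) (single y 1 ^ j) * single x 1) := fun j x => by
    obtain ⟨g, hg⟩ := hconj
    have h := conj_pow (i := j) (a := g⁻¹) (b := y)
    rw [inv_inv, ← hg, ← hol_curvePow] at h
    rw [loopAction_eq hor S hx₀ (curvePow γ j) (hγ _) x ⟨g, h⟩, hW, smul_mul_assoc]
  have hrep : ∀ x, ∃ L, W.Represented x L := fun x => by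
    obtain ⟨r, rfl, h2, h3⟩ := exists_represents hor S hx₀ γ (hγ 0) x
    obtain ⟨g, hg⟩ := hconj
    obtain ⟨g', hg'⟩ := hol_conj_of_homotopic x₀ h2.symm
    have := h3.2.1
    have := Fintype.ofFinite (Crossing r.1 r.2)
    exact ⟨_, represented_crossings hor hx₀ hW1 h3 ⟨g * g', by rw [hg', hg]; group⟩
      (Finset.nodup_toList _) fun c => Finset.mem_toList.2 (Finset.mem_univ c)⟩
  obtain ⟨τ, h1, h2⟩ := TwistWeights.exists_mulAut hk hc (hθ k hc) hrep
  refine ⟨⟨_, (isGeneralizedDehnTwist_iff W hact).2 rfl,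
    fun T hT => (isGeneralizedDehnTwist_iff W hact).1 hT⟩, fun T hT => ?_⟩
  rw [(isGeneralizedDehnTwist_iff W hact).1 hT]
  refine ⟨τ, h1, fun ℓ n p gp hp hs => ?_⟩
  have hinj : Function.Injective p := fun i j e => hp.injective (congrArg Crossing.time e)
  rw [h2 _ _ (represented_crossings hor hx₀ hW1 gp hconj (List.nodup_ofFn.2 hinj)
    fun c => List.mem_ofFn.2 (hs c)), insertAll_eq_prod gp]

end Main

end GenDehn

end

theorem mainTheorem2 {M : Type*} [TopologicalSpace M] [T2Space M] [CompactSpace M]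
    [ConnectedSpace M] [ChartedSpace (EuclideanHalfSpace 2) M] [IsManifold (𝓡∂ 2) ∞ M]
    (hor : OrientedAtlas M) (hbd : IsConnected ((𝓡∂ 2).boundary M))
    (x₀ : M) (hx₀ : x₀ ∈ (𝓡∂ 2).boundary M)
    (k : ℕ) (hk : 1 ≤ k) (γ : C(UnitAddCircle, M)) (hγ : ∀ s, γ s ∈ (𝓡∂ 2).interior M)
    (hγk : NilpotencyClassGE x₀ γ k) :
    (∃! T : CompletedAlgebra (LoopGroup x₀) ≃ₐ[ℚ] CompletedAlgebra (LoopGroup x₀),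
      IsGeneralizedDehnTwist x₀ γ T) ∧
    ∀ T : CompletedAlgebra (LoopGroup x₀) ≃ₐ[ℚ] CompletedAlgebra (LoopGroup x₀),
      IsGeneralizedDehnTwist x₀ γ T →
      ∃ τ : MulAut (LoopGroup x₀ ⧸ Gam (LoopGroup x₀) (2 * k)),
        ActsOnNilpotentQuotient T (2 * k) τ ∧
        ∀ (ℓ : Path x₀ x₀) (n : ℕ) (p : Fin n → Crossing ℓ γ), GeneralPosition ℓ γ →
          StrictMono (fun i => (p i).time) → Function.Surjective p →
          τ (QuotientGroup.mk (loopClass (Path.Homotopic.Quotient.mk ℓ))) =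
            QuotientGroup.mk (insertAll (List.ofFn p)) := by
  -- A compact Hausdorff surface is metrizable, and a connected one is path connected. The metric is
  -- an auxiliary choice on which neither the hypotheses nor the conclusion depend.
  have : SecondCountableTopology (EuclideanHalfSpace 2) :=
    inferInstanceAs (SecondCountableTopology {x : EuclideanSpace ℝ (Fin 2) // 0 ≤ x 0})
  have : LocallyPathConnectedSpace (EuclideanHalfSpace 2) :=
    EuclideanHalfSpace.convex.locallyPathConnectedSpace
  have : SecondCountableTopology M :=
    ChartedSpace.secondCountable_of_sigmaCompact (EuclideanHalfSpace 2) M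
  have := TopologicalSpace.metrizableSpace_of_t3_secondCountable M
  let _ := TopologicalSpace.metrizableSpaceMetric M
  have := ChartedSpace.locallyPathConnectedSpace (EuclideanHalfSpace 2) M
  have : PathConnectedSpace M := pathConnectedSpace_iff_connectedSpace.2 inferInstance
  exact twist_of_metric hor hx₀ hk hγ hγk
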